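/- Let $k$ be an algebraically closed field of characteristic $p$, where $p=0$ or $p\ge 7$, and let $\mathcal A_5=\langle x_2,x_3,x_5\mid x_2^2=x_3^3=x_5^5=x_2x_3x_5=1\rangle$ (the alternating group on five letters). Let $\iota$ be an automorphism of order $2$ of $\mathcal A_5$ such that $\iota(x_2),\iota(x_3),\iota(x_5)$ are conjugate to $x_2,x_3,x_5^2$ respectively, and let $SL_2(\mathbf F_5)\to\mathcal A_5$ be a surjective homomorphism with kernel $\{\pm1\}$ (such $\iota$ and such double covers exist; the statements below hold for any choice of them). For $m\ge 2$ let $G=PGL_m(k)$. A homomorphism $\psi:\mathcal A_5\to G$ is *regular* if $Z_G(\psi(\mathcal A_5))/Z_G$ is finite. Homomorphisms are classified up to conjugation by $G$. A *$_{235}$-triple* of $G$ is a triple $(C_2,C_3,C_5)$ of conjugacy classes of $G$ such that $g^n=1$ for all $g\in C_n$, $n=2,3,5$. For a connected reductive group $H$ let $\nu(H)$ be half the number of roots of $H$ and let $r(H)$ be the dimension of a maximal torus of $H$; let $Z_G^0(g)$ be the identity component of the centralizer of $g$ in $G$. The triple is *regular* if $\nu(G)-\sum_{n=2,3,5}\nu(Z^0_G(g_n))=r(G)$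 where $g_n\in C_n$, and its *type* is $(X_2,X_3,X_5)$, where $X_n$ is the type of the root system of $Z_G^0(g_n)$. Finally $\iota$ acts on triples by $(C_2,C_3,C_5)\mapsto(C_2,C_3,\{g^2: g\in C_5\})$ and on homomorphisms by $\psi\mapsto\psi\circ\iota$. 1. If $m\in\{2,3\}$, then $G$ has exactly two regular $_{235}$-triples, interchanged by $\iota$, and there are exactly two regular homomorphisms $\mathcal A_5\to G$ up to conjugacy, interchanged by $\iota$. 2. If $m=4$, then $G$ has exactly one regular $_{235}$-triple, and there are exactly two regular homomorphisms $\mathcal A_5\to G$ up to conjugacy. 3. If $m\in\{5,6\}$, then $G$ has exactly one regular $_{235}$-triple, and there is exactly one regular homomorphism $\mathcal A_5\to G$ up to conjugacy. 4. If $m\ge 7$, then $G$ has no regular $_{235}$-triple and there is no regular homomorphism $\mathcal A_5\to G$. 5. The type of any regular $_{235}$-triple is $(\emptyset,\emptyset,\emptyset)$ if $m=2$, $(A_1,\emptyset,\emptyset)$ if $m=3$, $(A_1^2,A_1,\emptyset)$ if $m=4$, $(A_2A_1,A_1^2,\emptyset)$ if $m=5$, and $(A_2^2,A_1^3,A_1)$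 if $m=6$. 6. If $m\in\{3,5\}$, every regular homomorphism $\mathcal A_5\to G$ is induced by an irreducible $m$-dimensional representation of $\mathcal A_5$ over $k$. If $m\in\{2,6\}$, every regular homomorphism $\mathcal A_5\to G$ comes from an irreducible $m$-dimensional representation over $k$ of the double cover $SL_2(\mathbf F_5)$, not factoring through $\mathcal A_5$ and regarded as a projective representation of $\mathcal A_5$. If $m=4$, one of the two classes of regular homomorphisms comes from an irreducible $4$-dimensional representation of $\mathcal A_5$, and the other comes from an irreducible $4$-dimensional representation of $SL_2(\mathbf F_5)$ which does not factor through $\mathcal A_5$. -/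

import Mathlib

open scoped MatrixGroups

/-! ### The group `𝒜₅`, presented by generators and relations -/

/-- The three generators `x₂`, `x₃`, `x₅` of `𝒜₅`. -/
inductive A5Gen : Type
  | x2 | x3 | x5

/-- The relators `x₂²`, `x₃³`, `x₅⁵`, `x₂x₃x₅`. -/
def a5Rels : Set (FreeGroup A5Gen) :=
  {FreeGroup.of A5Gen.x2 ^ 2, FreeGroup.of A5Gen.x3 ^ 3, FreeGroup.of A5Gen.x5 ^ 5,
    FreeGroup.of A5Gen.x2 * FreeGroup.of A5Gen.x3 * FreeGroup.of A5Gen.x5}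

/-- The group `𝒜₅ = ⟨x₂, x₃, x₅ | x₂² = x₃³ = x₅⁵ = x₂x₃x₅ = 1⟩`. -/
abbrev A5 : Type := PresentedGroup a5Rels

namespace A5

/-- The generator `x₂`. -/
def x2 : A5 := PresentedGroup.of A5Gen.x2
/-- The generator `x₃`. -/
def x3 : A5 := PresentedGroup.of A5Gen.x3
/-- The generator `x₅`. -/
def x5 : A5 := PresentedGroup.of A5Gen.x5

/-- `ι` is an automorphism of order `2` with `ι(x₂) ~ x₂`, `ι(x₃) ~ x₃`, `ι(x₅) ~ x₅²`. -/
def IsIota (ι : MulAut A5) : Prop :=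
  orderOf ι = 2 ∧ IsConj (ι x2) x2 ∧ IsConj (ι x3) x3 ∧ IsConj (ι x5) (x5 ^ 2)

/-- `pr : SL₂(𝔽₅) → 𝒜₅` exhibits `SL₂(𝔽₅)` as the double cover of `𝒜₅`. -/
def IsDoubleCover (pr : SL(2, ZMod 5) →* A5) : Prop :=
  Function.Surjective pr ∧ ∀ s, pr s = 1 ↔ s = 1 ∨ s = -1

end A5

/-! ### Homomorphisms up to conjugacy, regular homomorphisms -/

section Homs

variable {Γ G : Type*} [Group Γ] [Group G]

/-- Two homomorphisms `Γ → G` are conjugate if they differ by an inner automorphism of `G`. -/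
def HomConj (φ ψ : Γ →* G) : Prop := ∃ g : G, ∀ x, ψ x = g * φ x * g⁻¹

variable (Γ G) in
/-- Conjugacy under `G` as an equivalence relation on `Hom(Γ, G)`. -/
def homConjSetoid : Setoid (Γ →* G) where
  r := HomConj
  iseqv :=
    { refl := fun φ => ⟨1, fun x => by simp⟩
      symm := fun {φ ψ} ⟨g, h⟩ => ⟨g⁻¹, fun x => by rw [h]; group⟩
      trans := fun {φ ψ χ} ⟨g, h⟩ ⟨g', h'⟩ => ⟨g' * g, fun x => by rw [h', h]; group⟩ }

/-- `ψ` is regular if `Z_G(ψ(Γ)) / Z_G` is finite. -/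
def IsRegularHom (ψ : Γ →* G) : Prop :=
  Finite (Subgroup.centralizer (ψ.range : Set G) ⧸
    (Subgroup.center G).subgroupOf (Subgroup.centralizer (ψ.range : Set G)))

variable (Γ G) in
/-- The set of conjugacy classes of regular homomorphisms `Γ → G`. -/
def regularHomClasses : Set (Quotient (homConjSetoid Γ G)) :=
  {c | ∃ ψ : Γ →* G, IsRegularHom ψ ∧ Quotient.mk (homConjSetoid Γ G) ψ = c}

end Homs

/-! ### `PGL_m(k)` as an algebraic group over an algebraically closed field `k` -/

/-- Pull-back of functions along a map. -/
def pullback (k : Type*) [Field k] {X Y : Type*} (φ : X → Y) : (Y → k) →ₐ[k] (X → k) where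
  toFun f := f ∘ φ
  map_one' := rfl
  map_mul' _ _ := rfl
  map_zero' := rfl
  map_add' _ _ := rfl
  commutes' _ := rfl

/-- The algebra `k[GL_m]` of regular functions on `GL_m`, generated by the entries of a matrix and
those of its inverse. -/
def coordGL (m : ℕ) (k : Type*) [Field k] : Subalgebra k (GL (Fin m) k → k) :=
  Algebra.adjoin k
    ({f | ∃ i j, f = fun g : GL (Fin m) k => (g : Matrix (Fin m) (Fin m) k) i j} ∪
      {f | ∃ i j, f = fun g : GL (Fin m) k => ((g⁻¹ : GL (Fin m) k) : Matrix (Fin m) (Fin m) k) i j})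

/-- The algebra `k[PGL_m]`: a function on `PGL_m` is regular iff its pull-back to `GL_m` is. -/
def coordPGL (m : ℕ) (k : Type*) [Field k] : Subalgebra k (PGL(m, k) → k) :=
  (coordGL m k).comap (pullback k (Matrix.ProjGenLinGroup.mk : GL (Fin m) k → PGL(m, k)))

/-- The algebra of regular functions on `(kˣ)ⁿ`: Laurent polynomials in the coordinates. -/
def coordTorus (n : ℕ) (k : Type*) [Field k] : Subalgebra k ((Fin n → kˣ) → k) :=
  Algebra.adjoin k
    ({f | ∃ i, f = fun t => ((t i : kˣ) : k)} ∪ {f | ∃ i, f = fun t => (((t i)⁻¹ : kˣ) : k)})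

section AlgebraicGroup

variable {m : ℕ} {k : Type*} [Field k]

theorem coordGL_translate (a b : GL (Fin m) k) {f : GL (Fin m) k → k} (hf : f ∈ coordGL m k) :
    (fun x => f (a * x * b)) ∈ coordGL m k := by
  let P := pullback k (fun x : GL (Fin m) k => a * x * b)
  suffices coordGL m k ≤ (coordGL m k).comap P from this hf
  refine Algebra.adjoin_le ?_
  rintro _ (⟨i, j, rfl⟩ | ⟨i, j, rfl⟩)
  · change (fun x : GL (Fin m) k => ((a * x * b : GL (Fin m) k) : Matrix _ _ k) i j) ∈ coordGL m k
    have : (fun x : GL (Fin m) k => ((a * x * b : GL (Fin m) k) : Matrix _ _ k) i j) =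
        ∑ q, ∑ p, (a.1 i p * b.1 q j) • (fun x : GL (Fin m) k => x.1 p q) := by
      funext x
      simp [Matrix.mul_apply, Finset.sum_mul, Finset.sum_apply, mul_right_comm]
    rw [this]
    exact Subalgebra.sum_mem _ fun q _ => Subalgebra.sum_mem _ fun p _ => Subalgebra.smul_mem _
      (by exact Algebra.subset_adjoin (Or.inl ⟨p, q, rfl⟩)) _
  · change (fun x : GL (Fin m) k =>
      (((a * x * b)⁻¹ : GL (Fin m) k) : Matrix _ _ k) i j) ∈ coordGL m k
    have : (fun x : GL (Fin m) k => (((a * x * b)⁻¹ : GL (Fin m) k) : Matrix _ _ k) i j) =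
        ∑ q, ∑ p, ((b⁻¹).1 i q * (a⁻¹).1 p j) •
          (fun x : GL (Fin m) k => (x⁻¹).1 q p) := by
      funext x
      rw [show (a * x * b)⁻¹ = b⁻¹ * x⁻¹ * a⁻¹ by group, Finset.sum_comm]
      simp only [Units.val_mul, Matrix.mul_apply, Finset.sum_mul, Finset.sum_apply,
        Pi.smul_apply, smul_eq_mul]
      exact Finset.sum_congr rfl fun p _ => Finset.sum_congr rfl fun q _ => by ring
    rw [this]
    exact Subalgebra.sum_mem _ fun q _ => Subalgebra.sum_mem _ fun p _ => Subalgebra.smul_mem _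
      (by exact Algebra.subset_adjoin (Or.inr ⟨q, p, rfl⟩)) _

theorem coordGL_inv {f : GL (Fin m) k → k} (hf : f ∈ coordGL m k) :
    (fun x => f x⁻¹) ∈ coordGL m k := by
  let P := pullback k (fun x : GL (Fin m) k => x⁻¹)
  suffices coordGL m k ≤ (coordGL m k).comap P from this hf
  refine Algebra.adjoin_le ?_
  rintro _ (⟨i, j, rfl⟩ | ⟨i, j, rfl⟩)
  · exact Algebra.subset_adjoin (Or.inr ⟨i, j, rfl⟩)
  · refine Algebra.subset_adjoin (Or.inl ⟨i, j, ?_⟩)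
    funext x
    change ((x⁻¹)⁻¹ : GL (Fin m) k).1 i j = x.1 i j
    rw [inv_inv]

theorem coordPGL_translate (a b : PGL(m, k)) {f : PGL(m, k) → k} (hf : f ∈ coordPGL m k) :
    (fun x => f (a * x * b)) ∈ coordPGL m k := by
  obtain ⟨a, rfl⟩ := Matrix.ProjGenLinGroup.mk_surjective a
  obtain ⟨b, rfl⟩ := Matrix.ProjGenLinGroup.mk_surjective b
  have := coordGL_translate a b (f := f ∘ Matrix.ProjGenLinGroup.mk) hf
  change (fun x => f (_ * Matrix.ProjGenLinGroup.mk x * _)) ∈ coordGL m k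
  simpa using this

theorem coordPGL_inv {f : PGL(m, k) → k} (hf : f ∈ coordPGL m k) :
    (fun x => f x⁻¹) ∈ coordPGL m k := by
  have := coordGL_inv (f := f ∘ Matrix.ProjGenLinGroup.mk) hf
  change (fun x => f (Matrix.ProjGenLinGroup.mk x)⁻¹) ∈ coordGL m k
  simpa using this

variable (m k) in
/-- The Zariski topology on `PGL_m(k)`: the sets `{f ≠ 0}`, `f` regular, form a basis. -/
@[reducible] def zariski : TopologicalSpace (PGL(m, k)) :=
  TopologicalSpace.generateFrom {U | ∃ f ∈ coordPGL m k, U = {x | f x ≠ 0}}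

theorem zariski_continuous_translate (a b : PGL(m, k)) :
    @Continuous _ _ (zariski m k) (zariski m k) (fun x => a * x * b) := by
  let := zariski m k
  refine continuous_generateFrom_iff.2 ?_
  rintro _ ⟨f, hf, rfl⟩
  exact TopologicalSpace.isOpen_generateFrom_of_mem ⟨_, coordPGL_translate a b hf, rfl⟩

theorem zariski_continuous_inv :
    @Continuous _ _ (zariski m k) (zariski m k) (fun x => x⁻¹) := by
  let := zariski m k
  refine continuous_generateFrom_iff.2 ?_
  rintro _ ⟨f, hf, rfl⟩
  exact TopologicalSpace.isOpen_generateFrom_of_mem ⟨_, coordPGL_inv hf, rfl⟩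

/-- The identity component `H⁰` of a subgroup `H` of `PGL_m(k)`: the connected component of `1` in
`H` for the Zariski topology. -/
def identityComponent (H : Subgroup (PGL(m, k))) : Subgroup (PGL(m, k)) :=
  let := zariski m k
  { carrier := connectedComponentIn (H : Set (PGL(m, k))) 1
    one_mem' := mem_connectedComponentIn H.one_mem
    mul_mem' := by
      intro a b ha hb
      have haH : a ∈ H := connectedComponentIn_subset _ _ ha
      have hc : Continuous (fun x : PGL(m, k) => a * x) := by
        simpa using zariski_continuous_translate a 1
      have h := hc.continuousOn.image_connectedComponentIn_subset (s := (H : Set (PGL(m, k))))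
        H.one_mem
      have himg : (fun x => a * x) '' (H : Set (PGL(m, k))) = H := by
        ext x
        constructor
        · rintro ⟨y, hy, rfl⟩
          exact H.mul_mem haH hy
        · exact fun hx => ⟨a⁻¹ * x, H.mul_mem (H.inv_mem haH) hx, by simp⟩
      simp only [himg, mul_one] at h
      rw [connectedComponentIn_eq ha]
      exact h ⟨b, hb, rfl⟩
    inv_mem' := by
      intro a ha
      have h := (zariski_continuous_inv (m := m) (k := k)).continuousOn.image_connectedComponentIn_subset
        (s := (H : Set (PGL(m, k)))) H.one_mem
      have himg : (fun x => x⁻¹) '' (H : Set (PGL(m, k))) = H := by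
        ext x
        constructor
        · rintro ⟨y, hy, rfl⟩
          exact H.inv_mem hy
        · exact fun hx => ⟨x⁻¹, H.inv_mem hx, by simp⟩
      simp only [himg, inv_one] at h
      exact h ⟨a, ha, rfl⟩ }

/-- The algebra `k[H]` of regular functions on a closed subgroup `H` of `PGL_m`: the restrictions
to `H` of the regular functions on `PGL_m`. -/
def coordSubgroup (H : Subgroup (PGL(m, k))) : Subalgebra k (H → k) :=
  (coordPGL m k).map (pullback k (Subtype.val : H → PGL(m, k)))

/-- `T` is a torus of dimension `n`: a closed subgroup isomorphic, as an algebraic group, to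
`(kˣ)ⁿ`. -/
def IsTorus (T : Subgroup (PGL(m, k))) (n : ℕ) : Prop :=
  @IsClosed _ (zariski m k) (T : Set (PGL(m, k))) ∧
    ∃ e : T ≃* (Fin n → kˣ), ∀ f : (Fin n → kˣ) → k, f ∈ coordTorus n k ↔ f ∘ e ∈ coordSubgroup T

/-- `T` is a maximal torus of `H`, of dimension `n`. -/
def IsMaximalTorus (H T : Subgroup (PGL(m, k))) (n : ℕ) : Prop :=
  T ≤ H ∧ IsTorus T n ∧ ∀ (T' : Subgroup (PGL(m, k))) (n' : ℕ), IsTorus T' n' → T' ≤ H → T ≤ T' →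
    T' = T

/-- The pull-back `f ↦ (x ↦ f(gxg⁻¹))` on `k[PGL_m]`. -/
def conjPullback (g : PGL(m, k)) : coordPGL m k →ₗ[k] coordPGL m k where
  toFun f := ⟨fun x => f.1 (g * x * g⁻¹), coordPGL_translate g g⁻¹ f.2⟩
  map_add' _ _ := rfl
  map_smul' _ _ := rfl

/-- The Lie algebra of a closed subgroup `H` of `PGL_m`, as tangent space at `1`: the point
derivations of `k[PGL_m]` at `1` which kill the ideal of `H`. -/
def lieAlg (H : Subgroup (PGL(m, k))) : Submodule k (Module.Dual k (coordPGL m k)) where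
  carrier := {D | (∀ f g : coordPGL m k, D (f * g) = f.1 1 * D g + g.1 1 * D f) ∧
    ∀ f : coordPGL m k, (∀ h ∈ H, f.1 h = 0) → D f = 0}
  zero_mem' := by simp
  add_mem' := by
    rintro D E ⟨hD, hD'⟩ ⟨hE, hE'⟩
    refine ⟨fun f g => ?_, fun f hf => ?_⟩
    · simp only [LinearMap.add_apply, hD, hE]
      ring
    · simp [hD' f hf, hE' f hf]
  smul_mem' := by
    rintro c D ⟨hD, hD'⟩
    refine ⟨fun f g => ?_, fun f hf => ?_⟩
    · simp only [LinearMap.smul_apply, hD, smul_eq_mul]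
      ring
    · simp [hD' f hf]

/-- The roots of `H` with respect to a torus `T` of `H`: the nontrivial characters `α` of the
algebraic group `T` for which there is a nonzero `D` in the Lie algebra of `H` with
`Ad(t) D = α(t) D` for all `t` in `T`. -/
def roots (H T : Subgroup (PGL(m, k))) : Set (T →* kˣ) :=
  {α | (fun t => (α t : k)) ∈ coordSubgroup T ∧ α ≠ 1 ∧
    ∃ D ∈ lieAlg H, D ≠ 0 ∧ ∀ t : T, D ∘ₗ conjPullback t.1 = (α t : k) • D}

/-- `ν(H) = N`: half the number of roots of `H` is `N`. -/
def HasNu (H : Subgroup (PGL(m, k))) (N : ℕ) : Prop :=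
  ∃ T n, IsMaximalTorus H T n ∧ (roots H T).encard = 2 * N

/-- `r(H) = r`: the dimension of a maximal torus of `H` is `r`. -/
def HasRank (H : Subgroup (PGL(m, k))) (r : ℕ) : Prop := ∃ T, IsMaximalTorus H T r

end AlgebraicGroup

/-! ### Types of root systems -/

/-- The standard root system of type `A_{n₁} × A_{n₂} × ⋯` for `l = [n₁, n₂, …]`: the vectors
`e_{i,a} - e_{i,b}`, where `i` runs over the components and `a ≠ b` over `{0, …, nᵢ}`. -/
def stdRootsA (l : List ℕ) : Set ((Σ i : Fin l.length, Fin (l.get i + 1)) → ℤ) :=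
  {v | ∃ (i : Fin l.length) (a b : Fin (l.get i + 1)), a ≠ b ∧
    v = Pi.single ⟨i, a⟩ 1 - Pi.single ⟨i, b⟩ 1}

/-- A set `Φ` of roots in a (multiplicatively written) character group is a root system of type
`A_{n₁} × A_{n₂} × ⋯`: some isomorphism from the lattice generated by `Φ` to the one generated by
the standard root system carries `Φ` onto the standard root system. -/
def HasTypeA {X : Type*} [CommGroup X] (Φ : Set X) (l : List ℕ) : Prop :=
  ∃ e : Additive (Subgroup.closure Φ) ≃+ AddSubgroup.closure (stdRootsA l),
    ∀ x : Subgroup.closure Φ, (x : X) ∈ Φ ↔ (e (Additive.ofMul x)).1 ∈ stdRootsA l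

/-! ### `₂₃₅`-triples -/

section Triples

/-- A `₂₃₅`-triple: conjugacy classes `C₂, C₃, C₅` with `gⁿ = 1` for all `g` in `Cₙ`. -/
def IsTriple235 {G : Type*} [Group G] (C : ConjClasses G × ConjClasses G × ConjClasses G) : Prop :=
  (∀ g ∈ C.1.carrier, g ^ 2 = 1) ∧ (∀ g ∈ C.2.1.carrier, g ^ 3 = 1) ∧
    ∀ g ∈ C.2.2.carrier, g ^ 5 = 1

/-- `{g² ; g ∈ C}`, for a conjugacy class `C`. -/
def sqClass {G : Type*} [Group G] (C : ConjClasses G) : ConjClasses G :=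
  Quotient.map (fun g : G => g ^ 2) (fun _ _ h => IsConj.pow 2 h) C

/-- The action `(C₂, C₃, C₅) ↦ (C₂, C₃, C₅')` of `ι` on triples, `C₅' = {g² ; g ∈ C₅}`. -/
def iotaTriple {G : Type*} [Group G] (C : ConjClasses G × ConjClasses G × ConjClasses G) :
    ConjClasses G × ConjClasses G × ConjClasses G :=
  (C.1, C.2.1, sqClass C.2.2)

variable {m : ℕ} {k : Type*} [Field k]

/-- The group `Z_G⁰(g)`, for `G = PGL_m`. -/
def centralizerComponent (g : PGL(m, k)) : Subgroup (PGL(m, k)) :=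
  identityComponent (Subgroup.centralizer {g})

/-- The triple is regular: `ν(G) - ∑ₙ ν(Z_G⁰(gₙ)) = r(G_ad)` for `gₙ ∈ Cₙ`. Here `G = PGL_m` is
adjoint, so `G_ad = G`. -/
def IsRegularTriple
    (C : ConjClasses (PGL(m, k)) × ConjClasses (PGL(m, k)) × ConjClasses (PGL(m, k))) : Prop :=
  IsTriple235 C ∧ ∃ ν ν₂ ν₃ ν₅ r : ℕ, HasNu (⊤ : Subgroup (PGL(m, k))) ν ∧
    (∀ g ∈ C.1.carrier, HasNu (centralizerComponent g) ν₂) ∧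
    (∀ g ∈ C.2.1.carrier, HasNu (centralizerComponent g) ν₃) ∧
    (∀ g ∈ C.2.2.carrier, HasNu (centralizerComponent g) ν₅) ∧
    HasRank (⊤ : Subgroup (PGL(m, k))) r ∧
    (ν : ℤ) - (ν₂ + ν₃ + ν₅) = r

variable (m k) in
/-- The set of regular `₂₃₅`-triples of `PGL_m(k)`. -/
def regularTriples : Set (ConjClasses (PGL(m, k)) × ConjClasses (PGL(m, k)) ×
    ConjClasses (PGL(m, k))) :=
  {C | IsRegularTriple C}

/-- The root system of `H`, with respect to a maximal torus, has type
`A_{n₁} × A_{n₂} × ⋯`, `l = [n₁, n₂, …]`. -/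
def RootSystemHasType (H : Subgroup (PGL(m, k))) (l : List ℕ) : Prop :=
  ∃ T n, IsMaximalTorus H T n ∧ HasTypeA (roots H T) l

/-- The triple has type `(X₂, X₃, X₅)`, where `Xₙ` is the type of the root system of `Z_G⁰(gₙ)`,
`gₙ ∈ Cₙ`, written as the list of the ranks of its (type `A`) components. -/
def TripleHasType
    (C : ConjClasses (PGL(m, k)) × ConjClasses (PGL(m, k)) × ConjClasses (PGL(m, k)))
    (l₂ l₃ l₅ : List ℕ) : Prop :=
  (∀ g ∈ C.1.carrier, RootSystemHasType (centralizerComponent g) l₂) ∧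
    (∀ g ∈ C.2.1.carrier, RootSystemHasType (centralizerComponent g) l₃) ∧
    ∀ g ∈ C.2.2.carrier, RootSystemHasType (centralizerComponent g) l₅

end Triples

/-! ### Homomorphisms to `PGL_m` coming from representations -/

section Representations

variable {m : ℕ} {k : Type*} [Field k] {Γ : Type*} [Group Γ]

/-- `φ : Γ → PGL_m(k)` is induced by the `m`-dimensional representation `ρ` of `Γ`. -/
def InducedBy (φ : Γ →* PGL(m, k)) (ρ : Representation k Γ (Fin m → k)) : Prop :=
  ∀ x, ∃ g : GL (Fin m) k, Matrix.toLin' (g : Matrix (Fin m) (Fin m) k) = ρ x ∧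
    φ x = Matrix.ProjGenLinGroup.mk g

/-- `ψ` comes from an irreducible `m`-dimensional representation of `𝒜₅`. -/
def ComesFromA5 (ψ : A5 →* PGL(m, k)) : Prop :=
  ∃ ρ : Representation k A5 (Fin m → k), ρ.IsIrreducible ∧ InducedBy ψ ρ

/-- `ψ` comes from an irreducible `m`-dimensional representation of the double cover
`pr : SL₂(𝔽₅) → 𝒜₅` which does not factor through `𝒜₅`. -/
def ComesFromSL2 (pr : SL(2, ZMod 5) →* A5) (ψ : A5 →* PGL(m, k)) : Prop :=
  ∃ ρ : Representation k SL(2, ZMod 5) (Fin m → k), ρ.IsIrreducible ∧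
    (¬ ∃ ρ' : Representation k A5 (Fin m → k), ρ = ρ'.comp pr) ∧ InducedBy (ψ.comp pr) ρ

end Representations

/-!
Both halves of the classification, that of the triples and that of the homomorphisms, come down to
one inequality between sums of squares of eigenvalue multiplicities.

For triples, everything is computed inside `k[PGL_m]`, the algebra generated by the functions
`[g] ↦ g_{ij} (g⁻¹)_{pq}`. An element of finite order prime to the characteristic is conjugate to a
diagonal one. The identity component of its centralizer consists of the classes of the matrices that
commute with a lift `a` of finite order (`centralizerComponent_mk`). The maximal tori of this
component are the diagonal tori with respect to the bases diagonalizing `a`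
(`isMaximalTorus_diagTorus`, `exists_diagTorus_of_isMaximalTorus`), and the roots are the characters
`tᵢ / tⱼ` with `i ≠ j` and `dᵢ = dⱼ`, where `d` lists the eigenvalues of `a` (`roots_commutantPGL`).
So `2 ν + m` is the sum of the squares of the multiplicities, written `eqPairs`, and a triple is
regular iff the three sums of squares, for partitions of `m` into `2`, `3` and `5` multiplicities,
add up to `m ^ 2 + 2`. A sum of squares is least for balanced multiplicities (`eqPairs_ge`). For
`2 ≤ m ≤ 6` the three minima add up to exactly `m ^ 2 + 2`, so that all multiplicities are balanced
(`regularTriples_eq_image`), and for `m ≥ 7` they add up to more (`eqPairs_sum_gt`). In `PGL_m` the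
eigenvalues count up to a common factor only; what remains of the choice of a balanced configuration
is nothing at all for the elements of order `2` and `3`, and for those of order `5` it is the orbit
of `ι`, which has two elements if `m ≤ 3` and one if `m ≥ 4`.

A homomorphism `𝒜₅ → PGL_m` lifts to a representation of the binary icosahedral group
`⟨x₂, x₃, x₅ | x₂² = x₃³ = x₅⁵ = x₂x₃x₅⟩` (`exists_isLift`), uniquely since this group is perfect
(`IsLift.unique`), and the central element `z = x₂²` acts as `1` or `-1`. The group is the double
cover `SL₂(𝔽₅)` of `𝒜₅` (`A5.IsDoubleCover.exists_mulEquiv`), its order is invertible in `k`, and by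
Maschke's theorem and Schur's lemma a homomorphism is regular iff its lift is irreducible
(`isRegularHom_iff`). Scott's inequality for the conjugation action on matrices
(`crossPairs_sum_le`) says that for an irreducible representation the three sums of squares of
multiplicities add up to at most `m ^ 2 + 2`. Hence `m ≤ 6` and the multiplicities are the balanced
ones again; since the generators have determinant `1`, they and the sign of `z` are almost determined
(`hasExponents_of_isIrreducible`): the sign is free for `m = 4` only, and there are two possibilities
for `x₅` for `m = 2` and `m = 3` only. The same inequality, applied to the matrices intertwining two
irreducible representations, shows that there are nonzero ones as soon as the multiplicities agree,
because `m ^ 2 + 2 > m ^ 2` (`exists_conj_of_hasExponents`).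

The representations exist: the symmetric powers of degree `1`, `3`, `5` and `2`, `4` of a
two-dimensional representation, realized on binary forms (`exists_isIrreducible_neg`,
`exists_isIrreducible_symPow`), and the permutation representation on the vectors in `k⁵` with
coordinate sum `0` (`exists_isIrreducible_perm`). Their irreducibility follows from the restrictions
just found on the dimensions and eigenvalues of possible constituents.
-/

/-! ### Regular functions on `PGL_m` -/

section Coordinates

open Matrix

variable {m : ℕ} {k : Type*} [Field k]

/-- Two matrices have the same class in `PGL_m` iff they are proportional. -/
theorem pgl_mk_eq_mk {g h : GL (Fin m) k} :
    (ProjGenLinGroup.mk g : PGL(m, k)) = ProjGenLinGroup.mk h ↔ ∃ u : kˣ, h.1 = u.1 • g.1 := by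
  rw [ProjGenLinGroup.mk_eq_mk_iff]
  refine exists_congr fun u => ?_
  rw [Units.ext_iff, eq_comm]
  simp [← Matrix.smul_eq_mul_diagonal, Matrix.scalar_apply]

/-- The regular function `[g] ↦ g_{ij} (g⁻¹)_{pq}` on `PGL_m`. -/
noncomputable def adCoord (i j p q : Fin m) (x : PGL(m, k)) : k :=
  (Function.surjInv ProjGenLinGroup.mk_surjective x).1 i j *
    (Function.surjInv ProjGenLinGroup.mk_surjective x)⁻¹.1 p q

theorem inv_val_of_smul {g h : GL (Fin m) k} {u : kˣ} (e : h.1 = u.1 • g.1) :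
    (h⁻¹).1 = (u⁻¹).1 • (g⁻¹).1 := by
  have h1 : h * (h⁻¹) = 1 := mul_inv_cancel h
  have : h.1 * ((u⁻¹).1 • (g⁻¹).1) = 1 := by
    rw [e, smul_mul_smul_comm, ← Units.val_mul, ← Units.val_mul]; simp
  calc (h⁻¹).1 = (h⁻¹).1 * (h.1 * ((u⁻¹).1 • (g⁻¹).1)) := by rw [this, mul_one]
    _ = _ := by rw [← mul_assoc, ← Units.val_mul]; simp

@[simp]
theorem adCoord_mk (i j p q : Fin m) (g : GL (Fin m) k) :
    adCoord i j p q (ProjGenLinGroup.mk g) = g.1 i j * (g⁻¹).1 p q := by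
  have h := Function.surjInv_eq (ProjGenLinGroup.mk_surjective (n := Fin m) (R := k))
    (ProjGenLinGroup.mk g)
  obtain ⟨u, hu⟩ := pgl_mk_eq_mk.1 h
  rw [adCoord, hu, inv_val_of_smul hu]
  simp only [Matrix.smul_apply, smul_eq_mul]
  have : (u : k) * (u⁻¹ : kˣ) = 1 := by simp
  linear_combination (-1 : k) * (Function.surjInv ProjGenLinGroup.mk_surjective
    (ProjGenLinGroup.mk g)).1 i j * (Function.surjInv ProjGenLinGroup.mk_surjective
    (ProjGenLinGroup.mk g))⁻¹.1 p q * this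

theorem coe_mem_coordGL (i j : Fin m) : (fun g : GL (Fin m) k => g.1 i j) ∈ coordGL m k :=
  Algebra.subset_adjoin (Or.inl ⟨i, j, rfl⟩)

theorem inv_mem_coordGL (i j : Fin m) : (fun g : GL (Fin m) k => (g⁻¹).1 i j) ∈ coordGL m k :=
  Algebra.subset_adjoin (Or.inr ⟨i, j, rfl⟩)

theorem adCoord_mem (i j p q : Fin m) : (adCoord i j p q : PGL(m, k) → k) ∈ coordPGL m k := by
  change (adCoord i j p q) ∘ _ ∈ coordGL m k
  have : (adCoord i j p q) ∘ (ProjGenLinGroup.mk : GL (Fin m) k → PGL(m, k)) =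
      (fun g : GL (Fin m) k => g.1 i j) * (fun g : GL (Fin m) k => (g⁻¹).1 p q) := by
    funext g; simp
  rw [this]
  exact mul_mem (coe_mem_coordGL i j) (inv_mem_coordGL p q)

variable (m k) in
/-- The algebra generated by the functions `adCoord`; it is all of `k[PGL_m]`. -/
def adAlgebra : Subalgebra k (PGL(m, k) → k) :=
  Algebra.adjoin k {f | ∃ i j p q, f = adCoord i j p q}

variable (m k) in
/-- The functions on `GL_m` pulled back from `adAlgebra`. -/
def adAlgebraGL : Subalgebra k (GL (Fin m) k → k) :=
  (adAlgebra m k).map (pullback k ProjGenLinGroup.mk)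

theorem coe_mul_inv_mem_adAlgebraGL (i j p q : Fin m) :
    (fun g : GL (Fin m) k => g.1 i j) * (fun g : GL (Fin m) k => (g⁻¹).1 p q) ∈
      adAlgebraGL m k := by
  refine ⟨adCoord i j p q, Algebra.subset_adjoin ⟨i, j, p, q, rfl⟩, ?_⟩
  funext g
  exact adCoord_mk i j p q g

/-- The product of the matrix entries at the positions listed in `L`. -/
def entryProd (L : List (Fin m × Fin m)) : GL (Fin m) k → k :=
  (L.map fun s (g : GL (Fin m) k) => g.1 s.1 s.2).prod

/-- The product of the entries of the inverse matrix at the positions listed in `L`. -/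
def invEntryProd (L : List (Fin m × Fin m)) : GL (Fin m) k → k :=
  (L.map fun s (g : GL (Fin m) k) => (g⁻¹).1 s.1 s.2).prod

theorem entryProd_smul (L : List (Fin m × Fin m)) {g h : GL (Fin m) k} {u : kˣ}
    (e : h.1 = u.1 • g.1) : entryProd L h = u.1 ^ L.length * entryProd L g := by
  induction L with
  | nil => simp [entryProd]
  | cons a L ih =>
    simp only [entryProd, List.map_cons, List.prod_cons, Pi.mul_apply, List.length_cons] at ih ⊢
    rw [ih, e]
    simp only [Matrix.smul_apply, smul_eq_mul]
    ring

theorem invEntryProd_smul (L : List (Fin m × Fin m)) {g h : GL (Fin m) k} {u : kˣ}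
    (e : h.1 = u.1 • g.1) : u.1 ^ L.length * invEntryProd L h = invEntryProd L g := by
  induction L with
  | nil => simp [invEntryProd]
  | cons a L ih =>
    simp only [invEntryProd, List.map_cons, List.prod_cons, Pi.mul_apply, List.length_cons] at ih ⊢
    rw [← ih, inv_val_of_smul e]
    simp only [Matrix.smul_apply, smul_eq_mul]
    have : (u : k) * (u⁻¹ : kˣ) = 1 := by simp
    linear_combination (u.1 ^ L.length * (g⁻¹).1 a.1 a.2 *
      (L.map fun s (g : GL (Fin m) k) => (g⁻¹).1 s.1 s.2).prod h) * this

/-- A monomial in the entries of `g` and `g⁻¹` is, after pairing off entries of `g` with entries of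
`g⁻¹`, a function on `PGL_m` times a monomial in one of the two kinds of entries only. -/
theorem monomial_normal_form {f : GL (Fin m) k → k}
    (hf : f ∈ Submonoid.closure
      ({f | ∃ i j, f = fun g : GL (Fin m) k => (g : Matrix (Fin m) (Fin m) k) i j} ∪
      {f | ∃ i j, f = fun g : GL (Fin m) k =>
        ((g⁻¹ : GL (Fin m) k) : Matrix (Fin m) (Fin m) k) i j})) :
    ∃ a ∈ adAlgebraGL m k, ∃ L : List (Fin m × Fin m),
      f = a * entryProd L ∨ f = a * invEntryProd L := by
  induction hf using Submonoid.closure_induction_left with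
  | one => exact ⟨1, one_mem _, [], Or.inl (by simp [entryProd])⟩
  | mul_left x hx y hy ih =>
    obtain ⟨a, ha, L, h⟩ := ih
    rcases hx with ⟨i, j, rfl⟩ | ⟨i, j, rfl⟩
    · rcases h with rfl | rfl
      · refine ⟨a, ha, (i, j) :: L, Or.inl ?_⟩
        simp only [entryProd, List.map_cons, List.prod_cons]
        ring
      · cases L with
        | nil => exact ⟨a, ha, [(i, j)], Or.inl (by
            simp only [entryProd, invEntryProd, List.map_cons, List.prod_cons, List.map_nil,
              List.prod_nil]; ring)⟩
        | cons b L =>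
          refine ⟨_, mul_mem (coe_mul_inv_mem_adAlgebraGL i j b.1 b.2) ha, L, Or.inr ?_⟩
          simp only [invEntryProd, List.map_cons, List.prod_cons]
          ring
    · rcases h with rfl | rfl
      · cases L with
        | nil => exact ⟨a, ha, [(i, j)], Or.inr (by
            simp only [entryProd, invEntryProd, List.map_cons, List.prod_cons, List.map_nil,
              List.prod_nil]; ring)⟩
        | cons b L =>
          refine ⟨_, mul_mem (coe_mul_inv_mem_adAlgebraGL b.1 b.2 i j) ha, L, Or.inl ?_⟩
          simp only [entryProd, List.map_cons, List.prod_cons]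
          ring
      · refine ⟨a, ha, (i, j) :: L, Or.inr ?_⟩
        simp only [invEntryProd, List.map_cons, List.prod_cons]
        ring

theorem adAlgebraGL_smul {f : GL (Fin m) k → k} (hf : f ∈ adAlgebraGL m k) {g h : GL (Fin m) k}
    {u : kˣ} (e : h.1 = u.1 • g.1) : f h = f g := by
  obtain ⟨f, -, rfl⟩ := hf
  exact congrArg f (pgl_mk_eq_mk.2 ⟨u, e⟩).symm

open Polynomial in
/-- Along the scalars, a regular function on `GL_m` is a Laurent polynomial, whose constant term
comes from `adAlgebra`. -/
theorem coordGL_expansion {f : GL (Fin m) k → k} (hf : f ∈ coordGL m k) :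
    ∃ (N : ℕ) (P : Polynomial (GL (Fin m) k → k)), P.coeff N ∈ adAlgebraGL m k ∧
      ∀ (g h : GL (Fin m) k) (u : kˣ), h.1 = u.1 • g.1 →
        u.1 ^ N * f h = (P.map (Pi.evalRingHom _ g)).eval u.1 := by
  rw [coordGL, ← Subalgebra.mem_toSubmodule, Algebra.adjoin_eq_span] at hf
  induction hf using Submodule.span_induction with
  | mem f hf =>
    obtain ⟨a, ha, L, rfl | rfl⟩ := monomial_normal_form hf
    · refine ⟨0, monomial L.length (a * entryProd L), ?_, fun g h u e => ?_⟩
      · cases L with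
        | nil => simpa [entryProd] using ha
        | cons b L => simp
      · simp [adAlgebraGL_smul ha e, entryProd_smul L e]
        ring
    · refine ⟨L.length, C (a * invEntryProd L), ?_, fun g h u e => ?_⟩
      · cases L with
        | nil => simpa [invEntryProd] using ha
        | cons b L => simp
      · simp [adAlgebraGL_smul ha e, ← invEntryProd_smul L e]
        ring
  | zero => exact ⟨0, 0, by simp, by simp⟩
  | add f f' _ _ h h' =>
    obtain ⟨N, P, h1, h2⟩ := h
    obtain ⟨N', P', h1', h2'⟩ := h'
    refine ⟨N + N', P * X ^ N' + P' * X ^ N, ?_, fun g h u e => ?_⟩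
    · rw [coeff_add, coeff_mul_X_pow, add_comm N N', coeff_mul_X_pow]
      exact add_mem h1 h1'
    · have e1 := h2 g h u e
      have e2 := h2' g h u e
      simp only [Pi.add_apply, Polynomial.map_add, Polynomial.map_mul, Polynomial.map_pow, map_X,
        eval_add, eval_mul, eval_pow, eval_X, ← e1, ← e2]
      ring
  | smul c f _ h =>
    obtain ⟨N, P, h1, h2⟩ := h
    refine ⟨N, C (fun _ => c) * P, ?_, fun g h u e => ?_⟩
    · rw [coeff_C_mul]
      exact Subalgebra.smul_mem _ h1 c
    · have e1 := h2 g h u e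
      simp only [Pi.smul_apply, smul_eq_mul, Polynomial.map_mul, map_C, eval_mul, eval_C, ← e1,
        Pi.evalRingHom_apply]
      ring

/-- `k[PGL_m]` is generated by the functions `[g] ↦ g_{ij} (g⁻¹)_{pq}`. -/
theorem coordPGL_eq_adAlgebra [Infinite k] : coordPGL m k = adAlgebra m k := by
  refine le_antisymm (fun f hf => ?_) (Algebra.adjoin_le ?_)
  · obtain ⟨N, P, h1, h2⟩ := coordGL_expansion hf
    have key : P.coeff N = f ∘ ProjGenLinGroup.mk := by
      funext g
      have : P.map (Pi.evalRingHom _ g) =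
          Polynomial.C (f (ProjGenLinGroup.mk g)) * Polynomial.X ^ N := by
        refine Polynomial.eq_of_infinite_eval_eq _ _
          ((Set.Finite.infinite_compl (Set.finite_singleton (0 : k))).mono fun u hu => ?_)
        have hu : u ≠ 0 := hu
        let h : GL (Fin m) k := GeneralLinearGroup.scalar (Fin m) (Units.mk0 u hu) * g
        have e : h.1 = (Units.mk0 u hu).1 • g.1 := by
          ext i j
          simp [h, Matrix.scalar_apply, Matrix.diagonal_mul]
        have e2 := h2 g h _ e
        have e3 := (pgl_mk_eq_mk.2 ⟨_, e⟩).symm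
        change u ^ N * f (ProjGenLinGroup.mk h) = _ at e2
        rw [e3] at e2
        change Polynomial.eval u _ = _
        rw [← show (Units.mk0 u hu).1 = u from rfl, ← e2]
        simp only [Polynomial.eval_mul, Polynomial.eval_C, Polynomial.eval_pow, Polynomial.eval_X]
        exact mul_comm _ _
      have := congrArg (fun Q => Polynomial.coeff Q N) this
      simpa using this
    rw [key] at h1
    obtain ⟨f', hf', e⟩ := h1
    have : f' = f := by
      funext x
      obtain ⟨g, rfl⟩ := ProjGenLinGroup.mk_surjective x
      exact congrFun e g
    exact this ▸ hf'
  · rintro _ ⟨i, j, p, q, rfl⟩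
    exact adCoord_mem i j p q

theorem isOpen_basic {f : PGL(m, k) → k} (hf : f ∈ coordPGL m k) :
    @IsOpen _ (zariski m k) {x | f x ≠ 0} := by
  let := zariski m k
  exact TopologicalSpace.isOpen_generateFrom_of_mem ⟨f, hf, rfl⟩

theorem isClosed_zeros {f : PGL(m, k) → k} (hf : f ∈ coordPGL m k) :
    @IsClosed _ (zariski m k) {x | f x = 0} := by
  let := zariski m k
  refine ⟨?_⟩
  exact isOpen_basic hf

variable (m k) in
theorem zariski_isTopologicalBasis :
    @TopologicalSpace.IsTopologicalBasis _ (zariski m k)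
      {U | ∃ f ∈ coordPGL m k, U = {x | f x ≠ 0}} := by
  let := zariski m k
  refine ⟨?_, ?_, rfl⟩
  · rintro _ ⟨f, hf, rfl⟩ _ ⟨g, hg, rfl⟩ x hx
    refine ⟨_, ⟨f * g, mul_mem hf hg, rfl⟩, ?_, ?_⟩
    · exact mul_ne_zero hx.1 hx.2
    · intro y hy
      exact ⟨left_ne_zero_of_mul hy, right_ne_zero_of_mul hy⟩
  · refine Set.eq_univ_of_univ_subset fun x _ => ⟨_, ⟨1, one_mem _, rfl⟩, ?_⟩
    exact one_ne_zero

end Coordinates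

/-! ### Identity components of centralizers -/

section Components

open Matrix

variable {m : ℕ} {k : Type*} [Field k]

/-- The invertible matrices commuting with a given matrix `a`. -/
def commutantGL (a : Matrix (Fin m) (Fin m) k) : Subgroup (GL (Fin m) k) where
  carrier := {g | g.1 * a = a * g.1}
  one_mem' := by simp
  mul_mem' := by
    intro g h hg hh
    change g.1 * h.1 * a = a * (g.1 * h.1)
    rw [mul_assoc, show h.1 * a = a * h.1 from hh, ← mul_assoc, show g.1 * a = a * g.1 from hg,
      mul_assoc]
  inv_mem' := by
    intro g hg
    change g.1 * a = a * g.1 at hg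
    change (g⁻¹).1 * a = a * (g⁻¹).1
    calc (g⁻¹).1 * a = (g⁻¹).1 * (a * g.1) * (g⁻¹).1 := by
          rw [mul_assoc, mul_assoc a, ← Units.val_mul]; simp
      _ = _ := by rw [← hg, ← mul_assoc, ← Units.val_mul]; simp

/-- The image in `PGL_m` of the invertible matrices commuting with `a`. -/
def commutantPGL (a : Matrix (Fin m) (Fin m) k) : Subgroup (PGL(m, k)) :=
  (commutantGL a).map ProjGenLinGroup.mk

theorem commutantPGL_one : commutantPGL (1 : Matrix (Fin m) (Fin m) k) = ⊤ := by
  refine eq_top_iff.2 fun x _ => ?_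
  obtain ⟨g, rfl⟩ := ProjGenLinGroup.mk_surjective x
  exact ⟨g, by change g.1 * 1 = 1 * g.1; simp, rfl⟩

theorem mk_mem_commutantPGL {a : Matrix (Fin m) (Fin m) k} {g : GL (Fin m) k} :
    ProjGenLinGroup.mk g ∈ commutantPGL a ↔ g.1 * a = a * g.1 := by
  refine ⟨?_, fun h => ⟨g, h, rfl⟩⟩
  rintro ⟨h, hh, e⟩
  obtain ⟨u, hu⟩ := pgl_mk_eq_mk.1 e
  change h.1 * a = a * h.1 at hh
  rw [hu, smul_mul_assoc, hh, mul_smul_comm]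

/-- The point of `PGL_m`, if it exists, given by the matrix `(1 - s) + s h`. -/
def projLine (h : Matrix (Fin m) (Fin m) k) : Set (PGL(m, k)) :=
  {x | ∃ (s : k) (g : GL (Fin m) k), g.1 = (1 - s) • 1 + s • h ∧ x = ProjGenLinGroup.mk g}

open Polynomial in
/-- The line through `1` and `h`, with polynomial coefficients. -/
noncomputable def polyLine (h : Matrix (Fin m) (Fin m) k) : Matrix (Fin m) (Fin m) k[X] :=
  fun i j => (1 - X) * C ((1 : Matrix (Fin m) (Fin m) k) i j) + X * C (h i j)

theorem polyLine_eval (h : Matrix (Fin m) (Fin m) k) (s : k) :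
    (Polynomial.evalRingHom s).mapMatrix (polyLine h) = (1 - s) • 1 + s • h := by
  ext i j
  simp only [polyLine, RingHom.mapMatrix_apply, Matrix.map_apply, Polynomial.coe_evalRingHom,
    Polynomial.eval_add, Polynomial.eval_mul, Polynomial.eval_sub, Polynomial.eval_one,
    Polynomial.eval_X, Polynomial.eval_C, Matrix.add_apply, Matrix.smul_apply, smul_eq_mul]

/-- A regular function on `GL_m` restricts to the line through `1` and `h` as a rational function
whose denominator is a power of the determinant. -/
theorem coordGL_line (h : Matrix (Fin m) (Fin m) k) {f : GL (Fin m) k → k}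
    (hf : f ∈ coordGL m k) : ∃ (N : ℕ) (P : Polynomial k), ∀ (s : k) (g : GL (Fin m) k),
      g.1 = (1 - s) • 1 + s • h → f g * g.1.det ^ N = P.eval s := by
  have hdet (s : k) (g : GL (Fin m) k) (e : g.1 = (1 - s) • 1 + s • h) :
      (polyLine h).det.eval s = g.1.det := by
    rw [e, ← polyLine_eval, ← RingHom.map_det, Polynomial.coe_evalRingHom]
  induction hf using Algebra.adjoin_induction with
  | mem f hf =>
    rcases hf with ⟨i, j, rfl⟩ | ⟨i, j, rfl⟩
    · refine ⟨0, polyLine h i j, fun s g e => ?_⟩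
      simpa using congrFun (congrFun (e.trans (polyLine_eval h s).symm) i) j
    · refine ⟨1, (polyLine h).adjugate i j, fun s g e => ?_⟩
      have h1 : (Polynomial.evalRingHom s).mapMatrix (polyLine h).adjugate = g.1.adjugate := by
        rw [RingHom.map_adjugate, polyLine_eval, e]
      have h2 : g.1.adjugate = g.1.det • (g⁻¹).1 := by
        calc g.1.adjugate = (g.1.adjugate * g.1) * (g⁻¹).1 := by
              rw [mul_assoc, ← Units.val_mul]; simp
          _ = _ := by rw [Matrix.adjugate_mul]; simp
      have h3 := congrFun (congrFun (h1.trans h2) i) j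
      simp only [RingHom.mapMatrix_apply, Matrix.map_apply, Polynomial.coe_evalRingHom,
        Matrix.smul_apply, smul_eq_mul] at h3
      rw [h3, pow_one, mul_comm]
  | algebraMap c => exact ⟨0, Polynomial.C c, fun s g e => by simp⟩
  | add f f' _ _ h1 h2 =>
    obtain ⟨N, P, hP⟩ := h1
    obtain ⟨N', P', hP'⟩ := h2
    refine ⟨N + N', P * (polyLine h).det ^ N' + P' * (polyLine h).det ^ N, fun s g e => ?_⟩
    simp only [Pi.add_apply, Polynomial.eval_add, Polynomial.eval_mul, Polynomial.eval_pow,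
      ← hP s g e, ← hP' s g e, hdet s g e]
    ring
  | mul f f' _ _ h1 h2 =>
    obtain ⟨N, P, hP⟩ := h1
    obtain ⟨N', P', hP'⟩ := h2
    refine ⟨N + N', P * P', fun s g e => ?_⟩
    simp only [Pi.mul_apply, Polynomial.eval_mul, ← hP s g e, ← hP' s g e]
    ring

/-- The classes of the invertible matrices on the line through `1` and `h` form an irreducible set:
regular functions become polynomials in one variable up to powers of the determinant, so that two
of them and the determinant have a common point of nonvanishing. -/
theorem isPreconnected_projLine [Infinite k] (h : Matrix (Fin m) (Fin m) k) :
    @IsPreconnected _ (zariski m k) (projLine h) := by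
  let := zariski m k
  refine IsPreirreducible.isPreconnected ?_
  rintro u v hu hv ⟨x, hx, hxu⟩ ⟨y, hy, hyv⟩
  obtain ⟨_, ⟨f, hf, rfl⟩, hfx, hfu⟩ :=
    (zariski_isTopologicalBasis m k).exists_subset_of_mem_open hxu hu
  obtain ⟨_, ⟨f', hf', rfl⟩, hfy, hfv⟩ :=
    (zariski_isTopologicalBasis m k).exists_subset_of_mem_open hyv hv
  obtain ⟨N, P, hP⟩ := coordGL_line h hf
  obtain ⟨N', P', hP'⟩ := coordGL_line h hf'
  obtain ⟨s, g, e, rfl⟩ := hx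
  obtain ⟨s', g', e', rfl⟩ := hy
  have hdet (g : GL (Fin m) k) : g.1.det ≠ 0 := (Matrix.isUnit_iff_isUnit_det _).1 g.isUnit |>.ne_zero
  have h1 : P ≠ 0 := by
    rintro rfl
    have := hP s g e
    simp only [Polynomial.eval_zero, mul_eq_zero] at this
    exact this.elim hfx (pow_ne_zero _ (hdet g))
  have h2 : P' ≠ 0 := by
    rintro rfl
    have := hP' s' g' e'
    simp only [Polynomial.eval_zero, mul_eq_zero] at this
    exact this.elim hfy (pow_ne_zero _ (hdet g'))
  have heval (s : k) : (polyLine h).det.eval s = ((1 - s) • 1 + s • h).det := by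
    rw [← polyLine_eval, ← RingHom.map_det, Polynomial.coe_evalRingHom]
  have h3 : (polyLine h).det ≠ 0 := by
    intro h0
    have := heval 0
    rw [h0] at this
    simp at this
  obtain ⟨t, ht⟩ := Polynomial.exists_eval_ne_zero_of_natDegree_lt_card
    (P * P' * (polyLine h).det) (mul_ne_zero (mul_ne_zero h1 h2) h3)
    ((Cardinal.natCast_lt_aleph0).trans_le (Cardinal.aleph0_le_mk k))
  simp only [Polynomial.eval_mul, heval] at ht
  have ht3 := right_ne_zero_of_mul ht
  have ht1 := left_ne_zero_of_mul (left_ne_zero_of_mul ht)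
  have ht2 := right_ne_zero_of_mul (left_ne_zero_of_mul ht)
  let γ : GL (Fin m) k := GeneralLinearGroup.mkOfDetNeZero _ ht3
  have eγ : γ.1 = (1 - t) • 1 + t • h := rfl
  refine ⟨ProjGenLinGroup.mk γ, ⟨t, γ, eγ, rfl⟩, hfu ?_, hfv ?_⟩
  · intro h0
    apply ht1
    rw [← hP t γ eγ]
    exact mul_eq_zero_of_left h0 _
  · intro h0
    apply ht2
    rw [← hP' t γ eγ]
    exact mul_eq_zero_of_left h0 _

/-- The function `[h] ↦ (h a h⁻¹ b)_{ij}` is regular. -/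
theorem conj_entry_mem (a b : Matrix (Fin m) (Fin m) k) (i j : Fin m) :
    ∃ f ∈ coordPGL m k, ∀ h : GL (Fin m) k,
      f (ProjGenLinGroup.mk h) = (h.1 * a * (h⁻¹).1 * b) i j := by
  refine ⟨∑ q, ∑ p, ∑ r, (a r p * b q j) • adCoord i r p q, ?_, fun h => ?_⟩
  · exact sum_mem fun q _ => sum_mem fun p _ => sum_mem fun r _ =>
      Subalgebra.smul_mem _ (adCoord_mem _ _ _ _) _
  · simp only [Finset.sum_apply, Pi.smul_apply, adCoord_mk, smul_eq_mul, Matrix.mul_apply,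
      Finset.sum_mul]
    exact Finset.sum_congr rfl fun q _ => Finset.sum_congr rfl fun p _ =>
      Finset.sum_congr rfl fun r _ => by ring

theorem mk_mem_centralizer {a h : GL (Fin m) k} :
    ProjGenLinGroup.mk h ∈ Subgroup.centralizer {(ProjGenLinGroup.mk a : PGL(m, k))} ↔
      ∃ c : kˣ, h.1 * a.1 = c.1 • (a.1 * h.1) := by
  rw [Subgroup.mem_centralizer_singleton_iff, eq_comm, ← map_mul, ← map_mul, eq_comm,
    eq_comm (b := ProjGenLinGroup.mk (a * h)), pgl_mk_eq_mk]
  rfl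

/-- The identity component of the centralizer of the class of a matrix `a` of finite order consists
of the classes of the invertible matrices commuting with `a`: an element `h` of the centralizer
satisfies `h a h⁻¹ = c a` with `c` a root of unity, and `c = 1` is an open and closed condition. -/
theorem centralizerComponent_mk [Infinite k] [NeZero m] {n : ℕ} (hn : (n : k) ≠ 0)
    {a : GL (Fin m) k} (ha : a ^ n = 1) :
    centralizerComponent (ProjGenLinGroup.mk a : PGL(m, k)) = commutantPGL a.1 := by
  let := zariski m k
  refine le_antisymm ?_ ?_
  · intro x hx
    set C : Subgroup (PGL(m, k)) := Subgroup.centralizer {ProjGenLinGroup.mk a} with hC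
    have hx : x ∈ connectedComponentIn (C : Set (PGL(m, k))) 1 := hx
    obtain ⟨f, hf, hfe⟩ := conj_entry_mem (a.1) (a⁻¹).1 (0 : Fin m) 0
    have hval (h : GL (Fin m) k) (c : kˣ) (e : h.1 * a.1 = c.1 • (a.1 * h.1)) :
        f (ProjGenLinGroup.mk h) = c := by
      rw [hfe, e, smul_mul_assoc, mul_assoc a.1, ← Units.val_mul h, mul_inv_cancel, Units.val_one,
        mul_one, smul_mul_assoc, ← Units.val_mul, mul_inv_cancel]
      simp
    have hroot (h : GL (Fin m) k) (c : kˣ) (e : h.1 * a.1 = c.1 • (a.1 * h.1)) : c.1 ^ n = 1 := by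
      have h1 (j : ℕ) : h.1 * a.1 ^ j = c.1 ^ j • (a.1 ^ j * h.1) := by
        induction j with
        | zero => simp
        | succ j ih =>
          rw [pow_succ, ← mul_assoc, ih, smul_mul_assoc, mul_assoc, e, mul_smul_comm, smul_smul,
            ← mul_assoc, pow_succ]
      have h2 := h1 n
      rw [← Units.val_pow_eq_pow_val, ha, Units.val_one, mul_one, one_mul] at h2
      have h3 := congrArg (fun M => (M * (h⁻¹).1) 0 0) h2
      simp only [smul_mul_assoc, ← Units.val_mul, mul_inv_cancel] at h3
      simpa using h3.symm
    have hq : (∑ i ∈ Finset.range n, f ^ i) ∈ coordPGL m k := sum_mem fun i _ => pow_mem hf i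
    have hU := isOpen_basic (sub_mem hf (one_mem _))
    have hV := isOpen_basic hq
    have hsub := connectedComponentIn_subset (C : Set (PGL(m, k))) 1
    -- a function `f` whose value at `h` is the scalar `c` splits the centralizer: `f - 1` and
    -- `1 + f + ⋯ + f ^ (n - 1)` have product `0` on it and no common zero
    have hfC (y) (hy : y ∈ C) : (f y - 1) * (∑ i ∈ Finset.range n, f ^ i) y = 0 := by
      obtain ⟨h, rfl⟩ := ProjGenLinGroup.mk_surjective y
      obtain ⟨c, e⟩ := mk_mem_centralizer.1 hy
      simp only [Finset.sum_apply, Pi.pow_apply]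
      rw [mul_comm, geom_sum_mul, hval h c e, hroot h c e, sub_self]
    have hf1 (y) (h : f y = 1) : (∑ i ∈ Finset.range n, f ^ i) y ≠ 0 := by
      simpa [Finset.sum_apply, h] using hn
    have hcon := isPreconnected_connectedComponentIn (F := (C : Set (PGL(m, k)))) (x := 1)
    have hone : f 1 = 1 := by
      have := hval 1 1 (by simp)
      simpa using this
    have hfx : f x = 1 := by
      by_contra hne
      obtain ⟨y, hy, hyU, hyV⟩ := hcon _ _ hU hV
        (fun y _ => (em (f y = 1)).elim (fun h => Or.inr (hf1 y h)) fun h => Or.inl (sub_ne_zero.2 h))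
        ⟨x, hx, sub_ne_zero.2 hne⟩ ⟨1, mem_connectedComponentIn C.one_mem, hf1 1 hone⟩
      exact mul_ne_zero hyU hyV (hfC y (hsub hy))
    have hxC := hsub hx
    obtain ⟨h, rfl⟩ := ProjGenLinGroup.mk_surjective x
    obtain ⟨c, e⟩ := mk_mem_centralizer.1 hxC
    rw [hval h c e] at hfx
    rw [mk_mem_commutantPGL, e, hfx, one_smul]
  · intro x hx
    obtain ⟨h, rfl⟩ := ProjGenLinGroup.mk_surjective x
    rw [mk_mem_commutantPGL] at hx
    -- the line through `1` and `h` consists of matrices commuting with `a`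
    refine (isPreconnected_projLine h.1).subset_connectedComponentIn (x := 1)
      ⟨0, 1, by simp, by simp⟩ ?_ ⟨1, h, by simp, rfl⟩
    rintro _ ⟨s, g, e, rfl⟩
    refine mk_mem_centralizer.2 ⟨1, ?_⟩
    rw [e, Units.val_one, one_smul, add_mul, mul_add, smul_mul_assoc, smul_mul_assoc, hx,
      mul_smul_comm, mul_smul_comm, one_mul, mul_one]

end Components

/-! ### Tori in `PGL_m` -/

section Tori

open Matrix

variable {m : ℕ} {k : Type*} [Field k]

/-- Commuting diagonalizable matrices are simultaneously diagonalizable. -/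
theorem exists_simultaneous_diagonalization [IsAlgClosed k]
    (S : Set (Matrix (Fin m) (Fin m) k)) (hcomm : ∀ a ∈ S, ∀ b ∈ S, a * b = b * a)
    (hss : ∀ a ∈ S, ∃ p : Polynomial k, Squarefree p ∧ Polynomial.aeval a p = 0) :
    ∃ P : GL (Fin m) k, ∀ a ∈ S, ∃ d : Fin m → k, a * P.1 = P.1 * diagonal d := by
  have hsem (a : S) : Module.End.IsSemisimple (Matrix.toLin' a.1) := by
    obtain ⟨p, hp, h0⟩ := hss a.1 a.2
    refine Module.End.isSemisimple_of_squarefree_aeval_eq_zero hp ?_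
    have : Polynomial.aeval (Matrix.toLinAlgEquiv' a.1) p = Matrix.toLinAlgEquiv' (Polynomial.aeval a.1 p) :=
      Polynomial.aeval_algHom_apply (Matrix.toLinAlgEquiv' (R := k) (n := Fin m)).toAlgHom a.1 p
    rw [h0, map_zero] at this
    exact this
  have htop := Module.End.iSup_iInf_maxGenEigenspace_eq_top_of_iSup_maxGenEigenspace_eq_top_of_commute
    (fun a : S => Matrix.toLin' a.1)
    (fun a b _ => by
      change Matrix.toLin' a.1 ∘ₗ Matrix.toLin' b.1 = Matrix.toLin' b.1 ∘ₗ Matrix.toLin' a.1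
      rw [← Matrix.toLin'_mul, ← Matrix.toLin'_mul, hcomm a.1 a.2 b.1 b.2])
    (fun a => Module.End.iSup_maxGenEigenspace_eq_top _)
  simp only [fun a : S => (hsem a).isFinitelySemisimple.maxGenEigenspace_eq_eigenspace] at htop
  let s : Set (Fin m → k) := {v | ∀ a : S, ∃ μ : k, a.1 *ᵥ v = μ • v}
  have hs : ⊤ ≤ Submodule.span k s := by
    rw [← htop, iSup_le_iff]
    refine fun χ v hv => Submodule.subset_span fun a => ⟨χ a, ?_⟩
    have := (Submodule.mem_iInf _).1 hv a
    simpa using Module.End.mem_eigenspace_iff.1 this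
  let b₀ := Module.Basis.ofSpan hs
  have : Fintype (LinearIndepOn.extend (linearIndepOn_empty k id) (Set.empty_subset s) : Set (Fin m → k)) :=
    FiniteDimensional.fintypeBasisIndex b₀
  have hcard := (Module.finrank_eq_card_basis b₀).symm
  rw [Module.finrank_fin_fun] at hcard
  let b := b₀.reindex (Fintype.equivFinOfCardEq hcard)
  have hb (j : Fin m) : b j ∈ s := by
    rw [Module.Basis.reindex_apply]
    exact Module.Basis.ofSpan_subset hs ⟨_, rfl⟩
  let := (Pi.basisFun k (Fin m)).invertibleToMatrix b
  have hP (i j) : (Pi.basisFun k (Fin m)).toMatrix b i j = b j i := by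
    simp [Module.Basis.toMatrix_apply]
  refine ⟨unitOfInvertible ((Pi.basisFun k (Fin m)).toMatrix b), fun a ha => ?_⟩
  choose d hd using fun j => hb j ⟨a, ha⟩
  refine ⟨d, ?_⟩
  ext i j
  have := congrFun (hd j) i
  simp only [Matrix.mulVec, dotProduct, Pi.smul_apply, smul_eq_mul] at this
  rw [val_unitOfInvertible, Matrix.mul_diagonal, hP, Matrix.mul_apply]
  simp only [hP]
  rw [this, mul_comm]

theorem exists_squarefree_of_pow_eq {a : Matrix (Fin m) (Fin m) k} {n : ℕ} (hn : (n : k) ≠ 0)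
    {c : k} (hc : c ≠ 0) (ha : a ^ n = c • 1) :
    ∃ p : Polynomial k, Squarefree p ∧ Polynomial.aeval a p = 0 := by
  refine ⟨_, (Polynomial.separable_X_pow_sub_C c hn hc).squarefree, ?_⟩
  simp [ha, Algebra.algebraMap_eq_smul_one]

theorem exists_diagonalization [IsAlgClosed k] {a : Matrix (Fin m) (Fin m) k} {n : ℕ}
    (hn : (n : k) ≠ 0) {c : k} (hc : c ≠ 0) (ha : a ^ n = c • 1) :
    ∃ (P : GL (Fin m) k) (d : Fin m → k), a * P.1 = P.1 * diagonal d := by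
  obtain ⟨P, hP⟩ := exists_simultaneous_diagonalization {a} (by simp)
    (by rintro _ rfl; exact exists_squarefree_of_pow_eq hn hc ha)
  exact ⟨P, hP a rfl⟩

variable (m k) in
/-- The diagonal matrix with given invertible entries. -/
def diagGL : (Fin m → kˣ) →* GL (Fin m) k where
  toFun t := ⟨diagonal fun i => (t i).1, diagonal fun i => (t i)⁻¹.1, by simp, by simp⟩
  map_one' := by ext; simp [Matrix.one_apply, diagonal_apply]
  map_mul' s t := by
    ext1
    exact (diagonal_mul_diagonal _ _).symm

@[simp]
theorem diagGL_val (t : Fin m → kˣ) : (diagGL m k t).1 = diagonal fun i => (t i).1 := rfl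

@[simp]
theorem diagGL_inv_val (t : Fin m → kˣ) : (diagGL m k t)⁻¹.1 = diagonal fun i => ((t i)⁻¹).1 := rfl

/-- The homomorphism `t ↦ [P diag(t) P⁻¹]`. -/
def diagTorusHom (P : GL (Fin m) k) : (Fin m → kˣ) →* PGL(m, k) :=
  ProjGenLinGroup.mk.comp ((MulAut.conj P).toMonoidHom.comp (diagGL m k))

theorem diagTorusHom_apply (P : GL (Fin m) k) (t : Fin m → kˣ) :
    diagTorusHom P t = ProjGenLinGroup.mk (P * diagGL m k t * P⁻¹) := rfl

/-- The torus of the classes of the matrices `P diag(t) P⁻¹`. -/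
def diagTorus (P : GL (Fin m) k) : Subgroup (PGL(m, k)) := (diagTorusHom P).range

theorem coordPGL_conj {f : PGL(m, k) → k} (hf : f ∈ coordPGL m k) (P : GL (Fin m) k) :
    (fun x => f (ProjGenLinGroup.mk P⁻¹ * x * ProjGenLinGroup.mk P)) ∈ coordPGL m k :=
  coordPGL_translate _ _ hf

theorem exists_inv_entry_ne_zero [NeZero m] (h : GL (Fin m) k) : ∃ p q, (h⁻¹).1 p q ≠ 0 := by
  by_contra! h0
  have : (h⁻¹).1 = 0 := by ext p q; exact h0 p q
  have h1 : h.1 * (h⁻¹).1 = 1 := by rw [← Units.val_mul]; simp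
  rw [this, mul_zero] at h1
  have := congrFun (congrFun h1 0) 0
  simp at this

theorem mk_mem_diagTorus_iff {P g : GL (Fin m) k} :
    ProjGenLinGroup.mk g ∈ diagTorus P ↔ ∃ d, g.1 * P.1 = P.1 * diagonal d := by
  constructor
  · rintro ⟨t, ht⟩
    rw [diagTorusHom_apply] at ht
    obtain ⟨u, hu⟩ := pgl_mk_eq_mk.1 ht
    refine ⟨u.1 • fun i => (t i).1, ?_⟩
    rw [hu, diagonal_smul, smul_mul_assoc, mul_smul_comm, ← Units.val_mul, inv_mul_cancel_right]
    rfl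
  · rintro ⟨d, hd⟩
    have h1 : (P⁻¹ * g * P).1 = diagonal d := by
      rw [mul_assoc, Units.val_mul, Units.val_mul, hd, ← mul_assoc, ← Units.val_mul]
      simp
    have hdet : (diagonal d).det ≠ 0 := by
      rw [← h1]
      exact ((Matrix.isUnit_iff_isUnit_det _).1 (P⁻¹ * g * P).isUnit).ne_zero
    rw [det_diagonal, Finset.prod_ne_zero_iff] at hdet
    refine ⟨fun i => Units.mk0 (d i) (hdet i (Finset.mem_univ i)), ?_⟩
    rw [diagTorusHom_apply]
    congr 1
    have : diagGL m k (fun i => Units.mk0 (d i) (hdet i (Finset.mem_univ i))) = P⁻¹ * g * P := by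
      ext1
      rw [h1]
      rfl
    rw [this]
    group

theorem mem_diagTorus_of_adCoord [NeZero m] {P : GL (Fin m) k} {x : PGL(m, k)}
    (h : ∀ i j p q, i ≠ j →
      adCoord i j p q (ProjGenLinGroup.mk P⁻¹ * x * ProjGenLinGroup.mk P) = 0) :
    x ∈ diagTorus P := by
  obtain ⟨g, rfl⟩ := ProjGenLinGroup.mk_surjective x
  obtain ⟨p, q, hpq⟩ := exists_inv_entry_ne_zero (P⁻¹ * g * P)
  have h1 : (P⁻¹ * g * P).1 = diagonal fun i => (P⁻¹ * g * P).1 i i := by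
    ext i j
    rcases eq_or_ne i j with rfl | hij
    · simp
    · rw [diagonal_apply_ne _ hij]
      have := h i j p q hij
      rw [← map_mul, ← map_mul, adCoord_mk] at this
      exact (mul_eq_zero.1 this).resolve_right hpq
  refine mk_mem_diagTorus_iff.2 ⟨fun i => (P⁻¹ * g * P).1 i i, ?_⟩
  rw [← h1, ← Units.val_mul, ← Units.val_mul]
  group

theorem adCoord_diagTorusHom (P : GL (Fin m) k) (t : Fin m → kˣ) (i j p q : Fin m) :
    adCoord i j p q (ProjGenLinGroup.mk P⁻¹ * diagTorusHom P t * ProjGenLinGroup.mk P) =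
      diagonal (fun a => (t a).1) i j * diagonal (fun a => ((t a)⁻¹).1) p q := by
  rw [diagTorusHom_apply, ← map_mul, ← map_mul, adCoord_mk]
  rw [show P⁻¹ * (P * diagGL m k t * P⁻¹) * P = diagGL m k t by group]
  rfl

theorem isClosed_diagTorus [NeZero m] (P : GL (Fin m) k) :
    @IsClosed _ (zariski m k) (diagTorus P : Set (PGL(m, k))) := by
  let := zariski m k
  have : (diagTorus P : Set (PGL(m, k))) = ⋂ (i) (j) (p) (q) (_ : i ≠ j),
      {x | adCoord i j p q (ProjGenLinGroup.mk P⁻¹ * x * ProjGenLinGroup.mk P) = 0} := by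
    ext x
    simp only [Set.mem_iInter, Set.mem_ofPred_eq]
    refine ⟨?_, mem_diagTorus_of_adCoord⟩
    rintro ⟨t, rfl⟩ i j p q hij
    rw [adCoord_diagTorusHom, diagonal_apply_ne _ hij, zero_mul]
  rw [this]
  exact isClosed_iInter fun i => isClosed_iInter fun j => isClosed_iInter fun p =>
    isClosed_iInter fun q => isClosed_iInter fun _ =>
      isClosed_zeros (coordPGL_conj (adCoord_mem i j p q) P)

theorem coordTorus_coord {n : ℕ} (i : Fin n) :
    (fun t : Fin n → kˣ => (t i).1) ∈ coordTorus n k :=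
  Algebra.subset_adjoin (Or.inl ⟨i, rfl⟩)

theorem coordTorus_coord_inv {n : ℕ} (i : Fin n) :
    (fun t : Fin n → kˣ => ((t i)⁻¹).1) ∈ coordTorus n k :=
  Algebra.subset_adjoin (Or.inr ⟨i, rfl⟩)

/-- A diagonal torus of `PGL_{n+1}` is a torus of dimension `n`: its elements have unique
representatives whose first coordinate is `1`, and the other coordinates are those of `(kˣ)ⁿ`. -/
theorem diagTorus_isTorus [Infinite k] {n : ℕ} (P : GL (Fin (n + 1)) k) :
    IsTorus (diagTorus P) n := by
  refine ⟨isClosed_diagTorus P, ?_⟩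
  let φ : (Fin n → kˣ) →* diagTorus P :=
    { toFun := fun s => ⟨diagTorusHom P (Fin.cons 1 s), ⟨_, rfl⟩⟩
      map_one' := by
        refine Subtype.ext ?_
        change diagTorusHom P _ = 1
        convert map_one (diagTorusHom P)
        ext i
        refine Fin.cases ?_ (fun i => ?_) i <;> simp
      map_mul' := fun s t => by
        refine Subtype.ext ?_
        change diagTorusHom P _ = diagTorusHom P _ * diagTorusHom P _
        rw [← map_mul]
        congr 1
        ext i
        refine Fin.cases ?_ (fun i => ?_) i <;> simp }
  have hval (s : Fin n → kˣ) (i j p q : Fin (n + 1)) :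
      adCoord i j p q (ProjGenLinGroup.mk P⁻¹ * (φ s).1 * ProjGenLinGroup.mk P) =
        diagonal (fun a => ((Fin.cons 1 s : Fin (n + 1) → kˣ) a).1) i j *
          diagonal (fun a => (((Fin.cons 1 s : Fin (n + 1) → kˣ) a)⁻¹).1) p q :=
    adCoord_diagTorusHom P _ i j p q
  have hinj : Function.Injective φ := by
    intro s t h
    ext i
    have h1 := hval s i.succ i.succ 0 0
    rw [h, hval] at h1
    simpa using h1.symm
  have hsurj : Function.Surjective φ := by
    rintro ⟨_, t, rfl⟩
    refine ⟨fun i => t i.succ * (t 0)⁻¹, Subtype.ext ?_⟩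
    change diagTorusHom P _ = diagTorusHom P t
    rw [diagTorusHom_apply, diagTorusHom_apply, pgl_mk_eq_mk]
    refine ⟨t 0, ?_⟩
    have : (diagGL (n + 1) k t).1 = (t 0).1 • (diagGL (n + 1) k
        (Fin.cons 1 fun i => t i.succ * (t 0)⁻¹)).1 := by
      rw [diagGL_val, diagGL_val, ← diagonal_smul]
      congr 1
      funext i
      refine Fin.cases ?_ (fun i => ?_) i
      · simp
      · simp [mul_left_comm]
    rw [Units.val_mul, Units.val_mul, this, mul_smul_comm, smul_mul_assoc]
    rfl
  let e := (MulEquiv.ofBijective φ ⟨hinj, hsurj⟩).symm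
  refine ⟨e, fun f => ?_⟩
  constructor
  · intro hf
    change f ∈ (coordSubgroup (diagTorus P)).comap (pullback k e)
    refine (show coordTorus n k ≤ _ from Algebra.adjoin_le ?_) hf
    rintro _ (⟨i, rfl⟩ | ⟨i, rfl⟩)
    · refine ⟨_, coordPGL_conj (adCoord_mem i.succ i.succ 0 0) P, ?_⟩
      funext x
      obtain ⟨s, rfl⟩ := hsurj x
      refine (hval s _ _ _ _).trans ?_
      change _ = (e (MulEquiv.ofBijective φ ⟨hinj, hsurj⟩ s) i).1
      simp [e]
    · refine ⟨_, coordPGL_conj (adCoord_mem 0 0 i.succ i.succ) P, ?_⟩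
      funext x
      obtain ⟨s, rfl⟩ := hsurj x
      refine (hval s _ _ _ _).trans ?_
      change _ = ((e (MulEquiv.ofBijective φ ⟨hinj, hsurj⟩ s) i)⁻¹).1
      simp [e]
  · rintro ⟨F, hF, hFe⟩
    have hfe : f = fun s => F (φ s).1 := by
      funext s
      have := congrFun hFe (φ s)
      change F (φ s).1 = f (e (MulEquiv.ofBijective φ ⟨hinj, hsurj⟩ s)) at this
      rw [this, MulEquiv.symm_apply_apply]
    rw [hfe]
    have hF : F ∈ adAlgebra (n + 1) k := coordPGL_eq_adAlgebra (m := n + 1) (k := k) ▸ hF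
    change F ∈ (coordTorus n k).comap (pullback k fun s => (φ s).1)
    refine (show adAlgebra (n + 1) k ≤ _ from Algebra.adjoin_le ?_) hF
    rintro _ ⟨i, j, p, q, rfl⟩
    have h1 (a : Fin (n + 1)) :
        (fun s : Fin n → kˣ => ((Fin.cons 1 s : Fin (n + 1) → kˣ) a).1) ∈ coordTorus n k := by
      refine Fin.cases ?_ (fun a => ?_) a
      · exact one_mem (coordTorus n k)
      · exact coordTorus_coord a
    have h2 (a : Fin (n + 1)) :
        (fun s : Fin n → kˣ => (((Fin.cons 1 s : Fin (n + 1) → kˣ) a)⁻¹).1) ∈ coordTorus n k := by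
      refine Fin.cases ?_ (fun a => ?_) a
      · exact one_mem (coordTorus n k)
      · exact coordTorus_coord_inv a
    have : (pullback k (fun s => (φ s).1) (adCoord i j p q) : (Fin n → kˣ) → k) =
        ∑ a, ∑ b, (P.1 i a * (P⁻¹).1 a j * P.1 p b * (P⁻¹).1 b q) •
          ((fun s : Fin n → kˣ => ((Fin.cons 1 s : Fin (n + 1) → kˣ) a).1) *
            (fun s : Fin n → kˣ => (((Fin.cons 1 s : Fin (n + 1) → kˣ) b)⁻¹).1)) := by
      funext s
      change adCoord i j p q (diagTorusHom P (Fin.cons 1 s)) = _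
      rw [diagTorusHom_apply, adCoord_mk]
      rw [show (P * diagGL (n + 1) k (Fin.cons 1 s) * P⁻¹)⁻¹ =
        P * (diagGL (n + 1) k (Fin.cons 1 s))⁻¹ * P⁻¹ by group]
      simp only [Units.val_mul, diagGL_val, diagGL_inv_val, Matrix.mul_apply (N := (P⁻¹).1),
        Matrix.mul_diagonal, Finset.sum_mul_sum, Finset.sum_apply, Pi.smul_apply, Pi.mul_apply,
        smul_eq_mul]
      exact Finset.sum_congr rfl fun a _ => Finset.sum_congr rfl fun b _ => by ring
    change pullback k (fun s => (φ s).1) (adCoord i j p q) ∈ coordTorus n k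
    rw [this]
    exact sum_mem fun a _ => sum_mem fun b _ => Subalgebra.smul_mem _ (mul_mem (h1 a) (h2 b)) _

theorem infinite_two_power_roots [IsAlgClosed k] (h2 : (2 : k) ≠ 0) :
    {x : k | ∃ b : ℕ, x ^ 2 ^ b = 1}.Infinite := by
  intro hfin
  set c := hfin.toFinset.card with hc
  have : NeZero ((2 ^ c : ℕ) : k) := ⟨by push_cast; exact pow_ne_zero _ h2⟩
  obtain ⟨ζ, hζ⟩ := HasEnoughRootsOfUnity.exists_primitiveRoot k (2 ^ c)
  have h1 : Polynomial.nthRootsFinset (2 ^ c) (1 : k) ⊆ hfin.toFinset := by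
    intro x hx
    rw [Polynomial.mem_nthRootsFinset (by positivity)] at hx
    simpa using ⟨c, hx⟩
  have h3 := Finset.card_le_card h1
  rw [hζ.card_nthRootsFinset] at h3
  exact absurd h3 (not_le.2 Nat.lt_two_pow_self)

/-- A regular function on `(kˣ)ⁿ` is a polynomial divided by a monomial. -/
theorem coordTorus_polynomial {n : ℕ} {f : (Fin n → kˣ) → k} (hf : f ∈ coordTorus n k) :
    ∃ (N : ℕ) (p : MvPolynomial (Fin n) k), ∀ t : Fin n → kˣ,
      f t * (∏ i, (t i).1) ^ N = MvPolynomial.eval (fun i => (t i).1) p := by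
  induction hf using Algebra.adjoin_induction with
  | mem f hf =>
    rcases hf with ⟨i, rfl⟩ | ⟨i, rfl⟩
    · exact ⟨0, MvPolynomial.X i, fun t => by simp⟩
    · refine ⟨1, ∏ j ∈ Finset.univ.erase i, MvPolynomial.X j, fun t => ?_⟩
      rw [pow_one, ← Finset.mul_prod_erase _ _ (Finset.mem_univ i), ← mul_assoc, ← Units.val_mul]
      simp
  | algebraMap c => exact ⟨0, MvPolynomial.C c, fun t => by simp⟩
  | add f f' _ _ h1 h2 =>
    obtain ⟨N, P, hP⟩ := h1
    obtain ⟨N', P', hP'⟩ := h2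
    refine ⟨N + N', P * (∏ i, MvPolynomial.X i) ^ N' + P' * (∏ i, MvPolynomial.X i) ^ N,
      fun t => ?_⟩
    simp only [Pi.add_apply, map_add, map_mul, map_pow, map_prod, MvPolynomial.eval_X, ← hP, ← hP']
    ring
  | mul f f' _ _ h1 h2 =>
    obtain ⟨N, P, hP⟩ := h1
    obtain ⟨N', P', hP'⟩ := h2
    refine ⟨N + N', P * P', fun t => ?_⟩
    simp only [Pi.mul_apply, map_mul, ← hP, ← hP']
    ring

/-- The `2`-power torsion is Zariski dense in `(kˣ)ⁿ`. -/
theorem coordTorus_eq_zero [IsAlgClosed k] (h2 : (2 : k) ≠ 0) {n : ℕ} {f : (Fin n → kˣ) → k}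
    (hf : f ∈ coordTorus n k) (h0 : ∀ t : Fin n → kˣ, (∃ b : ℕ, t ^ 2 ^ b = 1) → f t = 0) :
    f = 0 := by
  obtain ⟨N, p, hp⟩ := coordTorus_polynomial hf
  have : p = 0 := by
    refine MvPolynomial.funext_set (fun _ => {x : k | ∃ b : ℕ, x ^ 2 ^ b = 1})
      (fun _ => infinite_two_power_roots h2) fun x hx => ?_
    choose b hb using fun i => hx i (Set.mem_univ i)
    have hx0 (i) : x i ≠ 0 := by
      intro h
      have := hb i
      rw [h, zero_pow (by positivity)] at this
      exact zero_ne_one this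
    have h1 := hp fun i => Units.mk0 (x i) (hx0 i)
    rw [h0 _ ⟨∑ i, b i, ?_⟩] at h1
    · simpa using h1.symm
    · funext i
      ext
      obtain ⟨c, hc⟩ : 2 ^ b i ∣ 2 ^ ∑ i, b i := pow_dvd_pow 2
        (Finset.single_le_sum (f := b) (fun _ _ => Nat.zero_le _) (Finset.mem_univ i))
      simp only [Pi.pow_apply, Units.val_pow_eq_pow_val, Units.val_mk0, Pi.one_apply, Units.val_one]
      rw [hc, pow_mul, hb, one_pow]
  funext t
  have h1 := hp t
  rw [this, map_zero] at h1
  exact (mul_eq_zero.1 h1).resolve_right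
    (pow_ne_zero _ (Finset.prod_ne_zero_iff.2 fun i _ => (t i).ne_zero))

/-- The preimage in `GL_m` of a torus of `PGL_m` is commutative: commutators are scalars `c` with
`c ^ m = 1`, bimultiplicative in the two entries, and a torus is divisible. -/
theorem commute_of_mem_torus [IsAlgClosed k] [NeZero m] {T : Subgroup (PGL(m, k))} {n : ℕ}
    (e : T ≃* (Fin n → kˣ)) {g h : GL (Fin m) k} (hg : ProjGenLinGroup.mk g ∈ T)
    (hh : ProjGenLinGroup.mk h ∈ T) : g * h = h * g := by
  have hroot (c : kˣ) : ∃ d : kˣ, d ^ m = c := by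
    obtain ⟨d, hd⟩ := IsAlgClosed.exists_pow_nat_eq c.1 (NeZero.pos m)
    have hd0 : d ≠ 0 := by
      rintro rfl
      rw [zero_pow (NeZero.ne m)] at hd
      exact c.ne_zero hd.symm
    exact ⟨Units.mk0 d hd0, by ext; simpa using hd⟩
  choose r hr using hroot
  obtain ⟨u, hu⟩ : ∃ u : T, u ^ m = ⟨_, hg⟩ := by
    refine ⟨e.symm fun i => r (e ⟨_, hg⟩ i), e.injective ?_⟩
    rw [map_pow, e.apply_symm_apply]
    funext i
    exact hr _
  obtain ⟨g', hg'⟩ := ProjGenLinGroup.mk_surjective u.1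
  have hcomm : ProjGenLinGroup.mk (h * g') = ProjGenLinGroup.mk (g' * h) := by
    rw [map_mul, map_mul, hg']
    have : (⟨_, hh⟩ : T) * u = u * ⟨_, hh⟩ := e.injective (by rw [map_mul, map_mul, mul_comm])
    exact congrArg Subtype.val this
  obtain ⟨c, hc⟩ := pgl_mk_eq_mk.1 hcomm
  have hpow : ProjGenLinGroup.mk (g' ^ m) = ProjGenLinGroup.mk g := by
    rw [map_pow, hg']
    exact congrArg Subtype.val hu
  obtain ⟨l, hl⟩ := pgl_mk_eq_mk.1 hpow
  have hcm : c.1 ^ m = 1 := by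
    have h1 := congrArg Matrix.det hc
    rw [det_smul, Units.val_mul, Units.val_mul, det_mul, det_mul, Fintype.card_fin,
      mul_comm h.1.det] at h1
    have h2 : g'.1.det * h.1.det ≠ 0 := by
      rw [← det_mul, ← Units.val_mul]
      exact ((Matrix.isUnit_iff_isUnit_det _).1 (g' * h).isUnit).ne_zero
    exact mul_right_cancel₀ h2 (by rw [one_mul, ← h1])
  have hj (j : ℕ) : g'.1 ^ j * h.1 = c.1 ^ j • (h.1 * g'.1 ^ j) := by
    induction j with
    | zero => simp
    | succ j ih =>
      rw [pow_succ, mul_assoc, ← Units.val_mul, hc, mul_smul_comm, Units.val_mul, ← mul_assoc, ih,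
        smul_mul_assoc, smul_smul, mul_assoc, pow_succ, mul_comm (c.1 ^ j)]
  ext1
  rw [Units.val_mul, Units.val_mul, hl, Units.val_pow_eq_pow_val, smul_mul_assoc, hj, hcm, one_smul,
    mul_smul_comm]

/-- A torus of `PGL_m` all of whose elements lift to matrices commuting with a given diagonalizable
matrix `a` can be diagonalized together with `a`. -/
theorem torus_le_diagTorus [IsAlgClosed k] [NeZero m] (h2 : (2 : k) ≠ 0)
    {T : Subgroup (PGL(m, k))} {n : ℕ} (hT : IsTorus T n) {a : Matrix (Fin m) (Fin m) k}
    (ha : ∃ p : Polynomial k, Squarefree p ∧ Polynomial.aeval a p = 0) (hTa : T ≤ commutantPGL a) :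
    ∃ (P : GL (Fin m) k) (d : Fin m → k), a * P.1 = P.1 * diagonal d ∧ T ≤ diagTorus P := by
  obtain ⟨-, e, he⟩ := hT
  -- the lifts of the `2`-power torsion of `T` are diagonalizable since `2 ≠ 0`, and commute; what is
  -- diagonal on the torsion is diagonal on `T` by density
  let S₀ : Set (Matrix (Fin m) (Fin m) k) := {M | ∃ g : GL (Fin m) k, M = g.1 ∧
    ProjGenLinGroup.mk g ∈ T ∧ ∃ b : ℕ, (ProjGenLinGroup.mk g) ^ 2 ^ b = 1}
  have hS₀ : ∀ M ∈ S₀, M * a = a * M := by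
    rintro _ ⟨g, rfl, hg, -⟩
    exact mk_mem_commutantPGL.1 (hTa hg)
  obtain ⟨P, hP⟩ := exists_simultaneous_diagonalization (insert a S₀) (by
      rintro x (rfl | hx) y (rfl | hy)
      · rfl
      · exact (hS₀ y hy).symm
      · exact hS₀ x hx
      · obtain ⟨g, rfl, hg, -⟩ := hx
        obtain ⟨h, rfl, hh, -⟩ := hy
        exact congrArg Units.val (commute_of_mem_torus e hg hh)) (by
      rintro x (rfl | ⟨g, rfl, hg, b, hb⟩)
      · exact ha
      · rw [← map_pow, ← map_one ProjGenLinGroup.mk, eq_comm, pgl_mk_eq_mk] at hb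
        obtain ⟨u, hu⟩ := hb
        exact exists_squarefree_of_pow_eq (n := 2 ^ b) (by push_cast; exact pow_ne_zero _ h2)
          u.ne_zero (by rw [← Units.val_pow_eq_pow_val, hu, Units.val_one]))
  obtain ⟨d, hd⟩ := hP a (Set.mem_insert _ _)
  refine ⟨P, d, hd, fun x hx => mem_diagTorus_of_adCoord fun i j p q hij => ?_⟩
  let F : PGL(m, k) → k := fun x =>
    adCoord i j p q (ProjGenLinGroup.mk P⁻¹ * x * ProjGenLinGroup.mk P)
  have hF : F ∈ coordPGL m k := coordPGL_conj (adCoord_mem i j p q) P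
  have hf : (fun s => F (e.symm s).1) ∈ coordTorus n k := by
    rw [he]
    refine ⟨F, hF, ?_⟩
    funext x
    change F x.1 = F (e.symm (e x)).1
    rw [e.symm_apply_apply]
  have h0 := coordTorus_eq_zero h2 hf (by
    rintro s ⟨b, hb⟩
    obtain ⟨g, hg⟩ := ProjGenLinGroup.mk_surjective (e.symm s).1
    have hgS : g.1 ∈ S₀ := by
      refine ⟨g, rfl, hg ▸ (e.symm s).2, b, ?_⟩
      rw [hg]
      have : (e.symm s) ^ 2 ^ b = 1 := by rw [← map_pow, hb, map_one]
      exact congrArg Subtype.val this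
    have h1 : ProjGenLinGroup.mk g ∈ diagTorus P :=
      mk_mem_diagTorus_iff.2 (hP g.1 (Set.mem_insert_of_mem _ hgS))
    rw [hg] at h1
    obtain ⟨t, ht⟩ := h1
    change adCoord i j p q (ProjGenLinGroup.mk P⁻¹ * (e.symm s).1 * ProjGenLinGroup.mk P) = 0
    rw [← ht, adCoord_diagTorusHom, diagonal_apply_ne _ hij, zero_mul])
  have h1 := congrFun h0 (e ⟨x, hx⟩)
  simpa [F] using h1

theorem diagTorus_le_commutantPGL {P : GL (Fin m) k} {a : Matrix (Fin m) (Fin m) k} {d : Fin m → k}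
    (h : a * P.1 = P.1 * diagonal d) : diagTorus P ≤ commutantPGL a := by
  rintro _ ⟨t, rfl⟩
  rw [diagTorusHom_apply, mk_mem_commutantPGL]
  have ha : a = P.1 * diagonal d * (P⁻¹).1 := by
    rw [← h, mul_assoc, ← Units.val_mul]; simp
  have h1 : (P⁻¹).1 * P.1 = 1 := by rw [← Units.val_mul]; simp
  rw [Units.val_mul, Units.val_mul, ha, diagGL_val]
  calc P.1 * diagonal (fun i => (t i).1) * (P⁻¹).1 * (P.1 * diagonal d * (P⁻¹).1)
      = P.1 * diagonal (fun i => (t i).1) * ((P⁻¹).1 * P.1) * diagonal d * (P⁻¹).1 := by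
        simp only [mul_assoc]
    _ = P.1 * diagonal d * ((P⁻¹).1 * P.1) * diagonal (fun i => (t i).1) * (P⁻¹).1 := by
        rw [h1, mul_one, mul_one, mul_assoc P.1, mul_assoc P.1 (diagonal d),
          diagonal_mul_diagonal, diagonal_mul_diagonal]
        simp only [mul_comm]
    _ = _ := by simp only [mul_assoc]

/-- A torus containing a diagonal torus is equal to it. -/
theorem torus_eq_diagTorus [IsAlgClosed k] [NeZero m] {T : Subgroup (PGL(m, k))} {n : ℕ}
    (hT : IsTorus T n) {P : GL (Fin m) k} (h : diagTorus P ≤ T) : T = diagTorus P := by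
  refine le_antisymm (fun x hx => ?_) h
  obtain ⟨-, e, -⟩ := hT
  obtain ⟨g, rfl⟩ := ProjGenLinGroup.mk_surjective x
  obtain ⟨t, ht⟩ : ∃ t : Fin m → kˣ, Function.Injective t := by
    have := IsAlgClosed.instInfinite (K := k)
    have φ := (Set.finite_singleton (0 : k)).infinite_compl.natEmbedding
    refine ⟨fun i => Units.mk0 (φ i).1 (φ i).2, fun i j h => Fin.ext (φ.injective (Subtype.ext ?_))⟩
    exact congrArg Units.val h
  -- a matrix commuting with a diagonal matrix with distinct entries is diagonal
  have h1 := commute_of_mem_torus e hx (h ⟨t, rfl⟩)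
  have h2 : (P⁻¹ * g * P) * diagGL m k t = diagGL m k t * (P⁻¹ * g * P) := by
    calc (P⁻¹ * g * P) * diagGL m k t = P⁻¹ * (g * (P * diagGL m k t * P⁻¹)) * P := by group
      _ = P⁻¹ * ((P * diagGL m k t * P⁻¹) * g) * P := by
        exact congrArg (fun y => P⁻¹ * y * P) h1
      _ = _ := by group
  refine mk_mem_diagTorus_iff.2 ⟨fun i => (P⁻¹ * g * P).1 i i, ?_⟩
  have h3 : (P⁻¹ * g * P).1 = diagonal fun i => (P⁻¹ * g * P).1 i i := by
    ext i j
    rcases eq_or_ne i j with rfl | hij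
    · simp
    · rw [diagonal_apply_ne _ hij]
      have h4 : (P⁻¹ * g * P).1 * (diagonal fun i => (t i).1) =
          (diagonal fun i => (t i).1) * (P⁻¹ * g * P).1 := congrArg Units.val h2
      replace h4 := congrFun (congrFun h4 i) j
      rw [mul_diagonal, diagonal_mul] at h4
      have h5 : (t j).1 - (t i).1 ≠ 0 := sub_ne_zero.2 fun h => hij (ht (Units.ext h)).symm
      refine (mul_eq_zero.1 (?_ : (P⁻¹ * g * P).1 i j * ((t j).1 - (t i).1) = 0)).resolve_right h5
      rw [mul_sub, h4]
      ring
  rw [← h3, ← Units.val_mul, ← Units.val_mul]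
  group

/-- The diagonal tori with respect to the bases diagonalizing `a` are maximal tori of the centralizer
of `a`. -/
theorem isMaximalTorus_diagTorus [IsAlgClosed k] {n : ℕ}
    {a : Matrix (Fin (n + 1)) (Fin (n + 1)) k} {P : GL (Fin (n + 1)) k} {d : Fin (n + 1) → k}
    (h : a * P.1 = P.1 * diagonal d) : IsMaximalTorus (commutantPGL a) (diagTorus P) n :=
  ⟨diagTorus_le_commutantPGL h, have := IsAlgClosed.instInfinite (K := k); diagTorus_isTorus P,
    fun _ _ hT _ hle => torus_eq_diagTorus hT hle⟩

/-- Every maximal torus of the centralizer of a diagonalizable matrix `a` is the diagonal torus with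
respect to a basis diagonalizing `a`. -/
theorem exists_diagTorus_of_isMaximalTorus [IsAlgClosed k] (h2 : (2 : k) ≠ 0) {n r : ℕ}
    {a : Matrix (Fin (n + 1)) (Fin (n + 1)) k}
    (ha : ∃ p : Polynomial k, Squarefree p ∧ Polynomial.aeval a p = 0)
    {T : Subgroup (PGL(Fin (n + 1), k))} (hT : IsMaximalTorus (commutantPGL a) T r) :
    ∃ (P : GL (Fin (n + 1)) k) (d : Fin (n + 1) → k),
      a * P.1 = P.1 * diagonal d ∧ T = diagTorus P ∧ r = n := by
  have := IsAlgClosed.instInfinite (K := k)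
  obtain ⟨P, d, hd, hle⟩ := torus_le_diagTorus h2 hT.2.1 ha hT.1
  have hTP := hT.2.2 _ n (diagTorus_isTorus P) (diagTorus_le_commutantPGL hd) hle
  refine ⟨P, d, hd, hTP.symm, ?_⟩
  obtain ⟨-, e, -⟩ := hT.2.1
  obtain ⟨-, e', -⟩ := diagTorus_isTorus P
  subst hTP
  -- the dimension is determined by the number of elements of order dividing `2`
  have hcount (r : ℕ) : Nat.card {t : Fin r → kˣ // t ^ 2 = 1} = 2 ^ r := by
    have : Nat.card {u : kˣ // u ^ 2 = 1} = 2 := by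
      have h11 : (1 : kˣ) ≠ -1 := by
        intro h
        have := congrArg Units.val h
        rw [Units.val_one, Units.val_neg, Units.val_one] at this
        apply h2
        linear_combination this
      have : {u : kˣ | u ^ 2 = 1} = {1, -1} := by
        ext u
        simp only [Set.mem_ofPred_eq, Set.mem_insert_iff, Set.mem_singleton_iff, Units.ext_iff,
          Units.val_mul, Units.val_neg, Units.val_one, pow_two, mul_self_eq_one_iff]
      change Nat.card {u : kˣ | u ^ 2 = 1} = 2
      rw [this, Nat.card_coe_set_eq, Set.ncard_pair h11]
    let E : {t : Fin r → kˣ // t ^ 2 = 1} ≃ (Fin r → {u : kˣ // u ^ 2 = 1}) :=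
      { toFun := fun t i => ⟨t.1 i, congrFun t.2 i⟩
        invFun := fun t => ⟨fun i => (t i).1, funext fun i => (t i).2⟩
        left_inv := fun _ => rfl
        right_inv := fun _ => rfl }
    rw [Nat.card_congr E, Nat.card_fun, this, Nat.card_fin]
  have h3 := Nat.card_congr ((e.symm.trans e').toEquiv.subtypeEquiv
    (p := fun t => t ^ 2 = 1) (q := fun t => t ^ 2 = 1) fun t => by
      change _ ↔ (e.symm.trans e') t ^ 2 = 1
      rw [← map_pow, map_eq_one_iff _ (e.symm.trans e').injective])
  rw [hcount, hcount] at h3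
  exact Nat.pow_right_injective le_rfl h3

end Tori

/-! ### Lie algebras and roots of centralizers -/

section Roots

open Matrix

variable {m : ℕ} {k : Type*} [Field k]

/-- The unipotent matrix `1 + s X`, for `X` of square zero. -/
def unipotentGL (X : Matrix (Fin m) (Fin m) k) (hX : X * X = 0) (s : k) : GL (Fin m) k where
  val := 1 + s • X
  inv := 1 - s • X
  val_inv := by simp [add_mul, mul_sub, hX]
  inv_val := by simp [sub_mul, mul_add, hX]

/-- A regular function on `PGL_m` is polynomial along a unipotent one-parameter group. -/
theorem exists_polynomial_unipotent [Infinite k] (X : Matrix (Fin m) (Fin m) k) (hX : X * X = 0)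
    {f : PGL(m, k) → k} (hf : f ∈ coordPGL m k) :
    ∃ p : Polynomial k, ∀ s, f (ProjGenLinGroup.mk (unipotentGL X hX s)) = p.eval s := by
  rw [coordPGL_eq_adAlgebra] at hf
  induction hf using Algebra.adjoin_induction with
  | mem f hf =>
    obtain ⟨i, j, p, q, rfl⟩ := hf
    refine ⟨(Polynomial.C ((1 : Matrix (Fin m) (Fin m) k) i j) + Polynomial.X * Polynomial.C (X i j)) *
      (Polynomial.C ((1 : Matrix (Fin m) (Fin m) k) p q) - Polynomial.X * Polynomial.C (X p q)),
      fun s => ?_⟩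
    rw [adCoord_mk]
    simp only [Polynomial.eval_mul, Polynomial.eval_add, Polynomial.eval_sub, Polynomial.eval_C,
      Polynomial.eval_X]
    rfl
  | algebraMap c => exact ⟨Polynomial.C c, fun s => by simp⟩
  | add f f' _ _ h1 h2 =>
    obtain ⟨P, hP⟩ := h1
    obtain ⟨P', hP'⟩ := h2
    exact ⟨P + P', fun s => by simp [hP, hP']⟩
  | mul f f' _ _ h1 h2 =>
    obtain ⟨P, hP⟩ := h1
    obtain ⟨P', hP'⟩ := h2
    exact ⟨P * P', fun s => by simp [hP, hP']⟩

/-- The restriction of a regular function to the one-parameter group `s ↦ [1 + s X]`. -/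
noncomputable def unipotentPoly [Infinite k] (X : Matrix (Fin m) (Fin m) k) (hX : X * X = 0)
    (f : coordPGL m k) : Polynomial k :=
  (exists_polynomial_unipotent X hX f.2).choose

theorem unipotentPoly_eq [Infinite k] (X : Matrix (Fin m) (Fin m) k) (hX : X * X = 0)
    (f : coordPGL m k) {p : Polynomial k}
    (hp : ∀ s, f.1 (ProjGenLinGroup.mk (unipotentGL X hX s)) = p.eval s) :
    unipotentPoly X hX f = p :=
  Polynomial.funext fun s =>
    ((exists_polynomial_unipotent X hX f.2).choose_spec s).symm.trans (hp s)

theorem unipotentPoly_eval [Infinite k] (X : Matrix (Fin m) (Fin m) k) (hX : X * X = 0)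
    (f : coordPGL m k) (s : k) :
    (unipotentPoly X hX f).eval s = f.1 (ProjGenLinGroup.mk (unipotentGL X hX s)) :=
  ((exists_polynomial_unipotent X hX f.2).choose_spec s).symm

theorem unipotentPoly_coeff_zero [Infinite k] (X : Matrix (Fin m) (Fin m) k) (hX : X * X = 0)
    (f : coordPGL m k) : (unipotentPoly X hX f).coeff 0 = f.1 1 := by
  rw [Polynomial.coeff_zero_eq_eval_zero, unipotentPoly_eval]
  have : unipotentGL X hX 0 = 1 := by ext1; simp [unipotentGL]
  rw [this, map_one]

/-- The tangent vector at `1` to the one-parameter group `s ↦ [1 + s X]`, as a functional on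
`k[PGL_m]`. -/
noncomputable def unipotentDeriv [Infinite k] (X : Matrix (Fin m) (Fin m) k) (hX : X * X = 0) :
    Module.Dual k (coordPGL m k) where
  toFun f := (unipotentPoly X hX f).coeff 1
  map_add' f g := by
    rw [unipotentPoly_eq X hX (f + g) (p := unipotentPoly X hX f + unipotentPoly X hX g) fun s => by
      rw [Polynomial.eval_add, unipotentPoly_eval, unipotentPoly_eval]; rfl, Polynomial.coeff_add]
  map_smul' c f := by
    rw [unipotentPoly_eq X hX (c • f) (p := c • unipotentPoly X hX f) fun s => by
      rw [Polynomial.eval_smul, unipotentPoly_eval]; rfl, Polynomial.coeff_smul]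
    rfl

theorem unipotentDeriv_mem_lieAlg [Infinite k] {X : Matrix (Fin m) (Fin m) k} (hX : X * X = 0)
    {a : Matrix (Fin m) (Fin m) k} (ha : X * a = a * X) :
    unipotentDeriv X hX ∈ lieAlg (commutantPGL a) := by
  refine ⟨fun f g => ?_, fun f hf => ?_⟩
  · change (unipotentPoly X hX (f * g)).coeff 1 = _ * (unipotentPoly X hX g).coeff 1 +
      _ * (unipotentPoly X hX f).coeff 1
    rw [unipotentPoly_eq X hX (f * g) (p := unipotentPoly X hX f * unipotentPoly X hX g) fun s => by
      rw [Polynomial.eval_mul, unipotentPoly_eval, unipotentPoly_eval]; rfl, Polynomial.coeff_mul,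
      Finset.Nat.sum_antidiagonal_eq_sum_range_succ_mk]
    simp [Finset.sum_range_succ, unipotentPoly_coeff_zero]
    ring
  · change (unipotentPoly X hX f).coeff 1 = 0
    rw [unipotentPoly_eq X hX f (p := 0), Polynomial.coeff_zero]
    intro s
    rw [Polynomial.eval_zero]
    refine hf _ (mk_mem_commutantPGL.2 ?_)
    change (1 + s • X) * a = a * (1 + s • X)
    rw [add_mul, mul_add, smul_mul_assoc, mul_smul_comm, ha, one_mul, mul_one]

theorem unipotentDeriv_conj [Infinite k] {X : Matrix (Fin m) (Fin m) k} (hX : X * X = 0)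
    {g : GL (Fin m) k} {c : k} (hg : g.1 * X = c • (X * g.1)) :
    unipotentDeriv X hX ∘ₗ conjPullback (ProjGenLinGroup.mk g) = c • unipotentDeriv X hX := by
  refine LinearMap.ext fun f => ?_
  change (unipotentPoly X hX (conjPullback (ProjGenLinGroup.mk g) f)).coeff 1 =
    c • (unipotentPoly X hX f).coeff 1
  rw [unipotentPoly_eq X hX (conjPullback (ProjGenLinGroup.mk g) f)
    (p := (unipotentPoly X hX f).comp (Polynomial.C c * Polynomial.X)) fun s => ?_,
    Polynomial.comp_C_mul_X_coeff, pow_one, smul_eq_mul, mul_comm]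
  rw [Polynomial.eval_comp, unipotentPoly_eval]
  simp only [Polynomial.eval_mul, Polynomial.eval_C, Polynomial.eval_X]
  change f.1 (_ * _ * _) = _
  rw [← map_inv, ← map_mul, ← map_mul]
  refine congrArg (fun y => f.1 (ProjGenLinGroup.mk y)) (Units.ext ?_)
  change g.1 * (1 + s • X) * (g⁻¹).1 = 1 + (c * s) • X
  rw [mul_add, mul_smul_comm, hg, add_mul, mul_one, ← Units.val_mul, mul_inv_cancel, Units.val_one,
    smul_smul, smul_mul_assoc, mul_assoc, ← Units.val_mul, mul_inv_cancel, Units.val_one, mul_one,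
    mul_comm s]

/-- `adCoord` as an element of `k[PGL_m]`. -/
noncomputable def adElt (i j p q : Fin m) : coordPGL m k := ⟨adCoord i j p q, adCoord_mem i j p q⟩

theorem unipotentDeriv_adElt [Infinite k] {X : Matrix (Fin m) (Fin m) k} (hX : X * X = 0)
    (i j p q : Fin m) : unipotentDeriv X hX (adElt i j p q) =
      (1 : Matrix (Fin m) (Fin m) k) p q * X i j - (1 : Matrix (Fin m) (Fin m) k) i j * X p q := by
  change (unipotentPoly X hX (adElt i j p q)).coeff 1 = _
  rw [unipotentPoly_eq X hX (adElt i j p q)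
    (p := (Polynomial.C ((1 : Matrix (Fin m) (Fin m) k) i j) + Polynomial.C (X i j) * Polynomial.X) *
      (Polynomial.C ((1 : Matrix (Fin m) (Fin m) k) p q) - Polynomial.C (X p q) * Polynomial.X))
    fun s => ?_]
  · rw [Polynomial.coeff_mul, Finset.Nat.sum_antidiagonal_eq_sum_range_succ_mk]
    simp only [Finset.sum_range_succ, Finset.sum_range_zero, zero_add, Nat.sub_zero, Nat.sub_self,
      Polynomial.coeff_add, Polynomial.coeff_sub, Polynomial.coeff_C_mul, Polynomial.coeff_C_zero,
      Polynomial.coeff_X_zero, Polynomial.coeff_X_one, Polynomial.coeff_C_succ, mul_zero, mul_one,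
      add_zero, sub_zero]
    ring
  · change adCoord i j p q _ = _
    rw [adCoord_mk]
    simp only [Polynomial.eval_mul, Polynomial.eval_add, Polynomial.eval_sub, Polynomial.eval_C,
      Polynomial.eval_X]
    change (1 + s • X) i j * (1 - s • X) p q = _
    simp only [Matrix.add_apply, Matrix.sub_apply, Matrix.smul_apply, smul_eq_mul]
    ring

/-- The Leibniz rule at `1`. -/
def IsPointDerivation (D : Module.Dual k (coordPGL m k)) : Prop :=
  ∀ f g : coordPGL m k, D (f * g) = f.1 1 * D g + g.1 1 * D f

theorem adElt_one (i j p q : Fin m) : (adElt i j p q : coordPGL m k).1 1 =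
    (1 : Matrix (Fin m) (Fin m) k) i j * (1 : Matrix (Fin m) (Fin m) k) p q := by
  change adCoord i j p q 1 = _
  rw [← map_one ProjGenLinGroup.mk, adCoord_mk]
  simp

theorem IsPointDerivation.apply_one {D : Module.Dual k (coordPGL m k)} (hD : IsPointDerivation D) :
    D 1 = 0 := by
  have h := hD 1 1
  rw [mul_one] at h
  have h1 : (1 : coordPGL m k).1 1 = 1 := rfl
  rw [h1] at h
  linear_combination -h

/-- A point derivation vanishing on the generators of `k[PGL_m]` is zero. -/
theorem IsPointDerivation.eq_zero [Infinite k] {D : Module.Dual k (coordPGL m k)}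
    (hD : IsPointDerivation D) (h : ∀ i j p q, D (adElt i j p q) = 0) : D = 0 := by
  suffices key : ∀ f ∈ adAlgebra m k, ∃ hf : f ∈ coordPGL m k, D ⟨f, hf⟩ = 0 by
    refine LinearMap.ext fun f => ?_
    exact (key f.1 (coordPGL_eq_adAlgebra (m := m) (k := k) ▸ f.2)).2
  intro f hf
  induction hf using Algebra.adjoin_induction with
  | mem f hf =>
    obtain ⟨i, j, p, q, rfl⟩ := hf
    exact ⟨_, h i j p q⟩
  | algebraMap c =>
    refine ⟨Subalgebra.algebraMap_mem _ c, ?_⟩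
    have : (⟨algebraMap k _ c, Subalgebra.algebraMap_mem _ c⟩ : coordPGL m k) = c • 1 := by
      refine Subtype.ext ?_
      exact Algebra.algebraMap_eq_smul_one c
    rw [this, map_smul, hD.apply_one, smul_zero]
  | add f g _ _ h1 h2 =>
    obtain ⟨hf, h1⟩ := h1
    obtain ⟨hg, h2⟩ := h2
    refine ⟨add_mem hf hg, ?_⟩
    have := map_add D ⟨f, hf⟩ ⟨g, hg⟩
    rw [h1, h2, add_zero] at this
    exact this
  | mul f g _ _ h1 h2 =>
    obtain ⟨hf, h1⟩ := h1
    obtain ⟨hg, h2⟩ := h2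
    refine ⟨mul_mem hf hg, ?_⟩
    have := hD ⟨f, hf⟩ ⟨g, hg⟩
    rw [h1, h2, mul_zero, mul_zero, add_zero] at this
    exact this

theorem sum_one_mul (i : Fin m) (f : Fin m → k) :
    ∑ j, (1 : Matrix (Fin m) (Fin m) k) i j * f j = f i := by
  simp [Matrix.one_apply]

theorem sum_one_mul' (i : Fin m) (f : Fin m → k) :
    ∑ j, (1 : Matrix (Fin m) (Fin m) k) j i * f j = f i := by
  simp [Matrix.one_apply]

/-- Every point derivation of `k[PGL_m]` is, on the generators, the derivative in the direction of
some matrix `X`: this is the vanishing of the first cohomology of a matrix algebra. -/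
theorem IsPointDerivation.exists_matrix [NeZero m] {D : Module.Dual k (coordPGL m k)}
    (hD : IsPointDerivation D) : ∃ X : Matrix (Fin m) (Fin m) k, ∀ i j p q,
      D (adElt i j p q) =
        (1 : Matrix (Fin m) (Fin m) k) p q * X i j - (1 : Matrix (Fin m) (Fin m) k) i j * X p q := by
  -- two relations between the generators, which `D` is applied to: the exchange relation, and
  -- `g g⁻¹ = 1`
  have h1 (i j p q : Fin m) : (adElt i j p q * adElt 0 0 0 0 : coordPGL m k) =
      adElt i j 0 0 * adElt 0 0 p q := by
    refine Subtype.ext (funext fun x => ?_)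
    obtain ⟨g, rfl⟩ := ProjGenLinGroup.mk_surjective x
    change adCoord i j p q (ProjGenLinGroup.mk g) * adCoord 0 0 0 0 (ProjGenLinGroup.mk g) =
      adCoord i j 0 0 (ProjGenLinGroup.mk g) * adCoord 0 0 p q (ProjGenLinGroup.mk g)
    simp only [adCoord_mk]
    ring
  have h2 (i j p q : Fin m) := congrArg D (h1 i j p q)
  simp only [hD (adElt _ _ _ _), adElt_one, Matrix.one_apply_eq (0 : Fin m), one_mul, mul_one] at h2
  have h3 (i l : Fin m) : ∑ j, adElt i j j l = (1 : Matrix (Fin m) (Fin m) k) i l • (1 : coordPGL m k) := by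
    refine Subtype.ext (funext fun x => ?_)
    obtain ⟨g, rfl⟩ := ProjGenLinGroup.mk_surjective x
    rw [AddSubmonoidClass.coe_finsetSum, Finset.sum_apply]
    change ∑ j, adCoord i j j l _ = (1 : Matrix (Fin m) (Fin m) k) i l • (1 : k)
    simp only [adCoord_mk]
    rw [← Matrix.mul_apply, ← Units.val_mul, mul_inv_cancel]
    simp
  have h4 (i l : Fin m) := congrArg D (h3 i l)
  simp only [map_sum, map_smul, hD.apply_one, smul_zero] at h4
  have h5 (i l : Fin m) : D (adElt 0 0 i l) = (1 : Matrix (Fin m) (Fin m) k) i l * D (adElt 0 0 0 0) -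
      D (adElt i l 0 0) := by
    have h6 := h4 i l
    have h7 (j : Fin m) : D (adElt i j j l) = (1 : Matrix (Fin m) (Fin m) k) i j * D (adElt 0 0 j l) +
        (1 : Matrix (Fin m) (Fin m) k) j l * D (adElt i j 0 0) -
        (1 : Matrix (Fin m) (Fin m) k) i j * ((1 : Matrix (Fin m) (Fin m) k) j l *
          D (adElt 0 0 0 0)) := by
      linear_combination h2 i j j l
    simp only [h7, Finset.sum_add_distrib, Finset.sum_sub_distrib, sum_one_mul, sum_one_mul'] at h6
    linear_combination h6
  -- to first order, the functions `g_{ij} (g⁻¹)_{00}` are the entries of `g`, up to adding a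
  -- scalar matrix
  refine ⟨fun i j => D (adElt i j 0 0), fun i j p q => ?_⟩
  linear_combination h2 i j p q + (1 : Matrix (Fin m) (Fin m) k) i j * h5 p q

theorem eq_smul_one_of_forall [NeZero m] {Z : Matrix (Fin m) (Fin m) k}
    (h : ∀ i j p q, (1 : Matrix (Fin m) (Fin m) k) p q * Z i j -
      (1 : Matrix (Fin m) (Fin m) k) i j * Z p q = 0) : Z = Z 0 0 • 1 := by
  ext i j
  have := h i j 0 0
  rw [Matrix.one_apply_eq] at this
  rw [Matrix.smul_apply, smul_eq_mul]
  linear_combination this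

/-- A tangent vector of the centralizer of `a` is given by a matrix commuting with `a`. -/
theorem commute_of_mem_lieAlg {a X : Matrix (Fin m) (Fin m) k} {D : Module.Dual k (coordPGL m k)}
    (hD : D ∈ lieAlg (commutantPGL a)) (hX : ∀ i j p q, D (adElt i j p q) =
      (1 : Matrix (Fin m) (Fin m) k) p q * X i j - (1 : Matrix (Fin m) (Fin m) k) i j * X p q) :
    X * a = a * X := by
  ext i l
  have h := hD.2 (∑ p, ∑ j, a j p • adElt i j p l - a i l • 1) fun h hh => by
    obtain ⟨g, hg, rfl⟩ := hh
    change g.1 * a = a * g.1 at hg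
    have h1 : g.1 * a * (g⁻¹).1 = a := by
      rw [hg, mul_assoc, ← Units.val_mul, mul_inv_cancel, Units.val_one, mul_one]
    have h2 := congrFun (congrFun h1 i) l
    rw [AddSubgroupClass.coe_sub, AddSubmonoidClass.coe_finsetSum, Pi.sub_apply, Finset.sum_apply]
    simp only [AddSubmonoidClass.coe_finsetSum, Finset.sum_apply]
    change ∑ p, ∑ j, a j p • adCoord i j p l _ - a i l • (1 : k) = 0
    simp only [adCoord_mk, smul_eq_mul, mul_one]
    rw [← h2, Matrix.mul_apply]
    simp only [Matrix.mul_apply, Finset.sum_mul]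
    rw [sub_eq_zero]
    exact Finset.sum_congr rfl fun p _ => Finset.sum_congr rfl fun j _ => by ring
  have h1 : D 1 = 0 := IsPointDerivation.apply_one hD.1
  simp only [map_sub, map_sum, map_smul, hX, h1, smul_eq_mul, mul_zero, sub_zero, mul_sub,
    Finset.sum_sub_distrib] at h
  rw [Finset.sum_comm] at h
  have h2 : ∑ j, ∑ p, a j p * ((1 : Matrix (Fin m) (Fin m) k) p l * X i j) = (X * a) i l := by
    rw [Matrix.mul_apply]
    refine Finset.sum_congr rfl fun j _ => ?_
    rw [← sum_one_mul' l (fun p => a j p), Finset.mul_sum]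
    exact Finset.sum_congr rfl fun p _ => by ring
  have h3 : ∑ p, ∑ j, a j p * ((1 : Matrix (Fin m) (Fin m) k) i j * X p l) = (a * X) i l := by
    rw [Matrix.mul_apply]
    refine Finset.sum_congr rfl fun p _ => ?_
    rw [← sum_one_mul i (fun j => a j p), Finset.sum_mul]
    exact Finset.sum_congr rfl fun j _ => by ring
  rw [h2, h3] at h
  exact sub_eq_zero.1 h

theorem mul_mul_apply_mul (g g' M N : Matrix (Fin m) (Fin m) k) (i j p q : Fin m) :
    (g * M * g') i j * (g * N * g') p q = ∑ a, ∑ b, ∑ c, ∑ d,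
      (g i a * g' b j * g p c * g' d q) * (M a b * N c d) := by
  have h (M : Matrix (Fin m) (Fin m) k) (i j : Fin m) :
      (g * M * g') i j = ∑ a, ∑ b, (g i a * g' b j) * M a b := by
    simp only [Matrix.mul_apply, Finset.sum_mul]
    rw [Finset.sum_comm]
    exact Finset.sum_congr rfl fun a _ => Finset.sum_congr rfl fun b _ => by ring
  rw [h, h, Finset.sum_mul]
  refine Finset.sum_congr rfl fun a _ => ?_
  rw [Finset.sum_mul]
  refine Finset.sum_congr rfl fun b _ => ?_
  rw [Finset.mul_sum]
  refine Finset.sum_congr rfl fun c _ => ?_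
  rw [Finset.mul_sum]
  exact Finset.sum_congr rfl fun d _ => by ring

theorem conjPullback_adElt (g : GL (Fin m) k) (i j p q : Fin m) :
    conjPullback (ProjGenLinGroup.mk g) (adElt i j p q) = ∑ a, ∑ b, ∑ c, ∑ d,
      (g.1 i a * (g⁻¹).1 b j * g.1 p c * (g⁻¹).1 d q) • adElt a b c d := by
  refine Subtype.ext (funext fun x => ?_)
  obtain ⟨h, rfl⟩ := ProjGenLinGroup.mk_surjective x
  simp only [AddSubmonoidClass.coe_finsetSum, Finset.sum_apply]
  change adCoord i j p q (_ * _ * _) = ∑ a, ∑ b, ∑ c, ∑ d,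
    (g.1 i a * (g⁻¹).1 b j * g.1 p c * (g⁻¹).1 d q) * adCoord a b c d _
  rw [← map_inv, ← map_mul, ← map_mul, adCoord_mk,
    show (g * h * g⁻¹)⁻¹ = g * h⁻¹ * g⁻¹ by group]
  simp only [adCoord_mk]
  exact mul_mul_apply_mul _ _ _ _ _ _ _ _

/-- `Ad(g)` acts on tangent vectors by conjugation of matrices. -/
theorem conjPullback_deriv {X : Matrix (Fin m) (Fin m) k} {D : Module.Dual k (coordPGL m k)}
    (hX : ∀ i j p q, D (adElt i j p q) =
      (1 : Matrix (Fin m) (Fin m) k) p q * X i j - (1 : Matrix (Fin m) (Fin m) k) i j * X p q)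
    (g : GL (Fin m) k) (i j p q : Fin m) :
    D (conjPullback (ProjGenLinGroup.mk g) (adElt i j p q)) =
      (1 : Matrix (Fin m) (Fin m) k) p q * (g.1 * X * (g⁻¹).1) i j -
        (1 : Matrix (Fin m) (Fin m) k) i j * (g.1 * X * (g⁻¹).1) p q := by
  have e (i j : Fin m) : (1 : Matrix (Fin m) (Fin m) k) i j =
      (g.1 * 1 * (g⁻¹).1 : Matrix (Fin m) (Fin m) k) i j := by
    rw [mul_one, ← Units.val_mul, mul_inv_cancel, Units.val_one]
  rw [mul_comm ((1 : Matrix (Fin m) (Fin m) k) p q), e p q, e i j, mul_mul_apply_mul,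
    mul_mul_apply_mul, conjPullback_adElt]
  simp only [map_sum, map_smul, hX, smul_eq_mul, ← Finset.sum_sub_distrib]
  exact Finset.sum_congr rfl fun a _ => Finset.sum_congr rfl fun b _ =>
      Finset.sum_congr rfl fun c _ => Finset.sum_congr rfl fun d _ => by ring

end Roots

section RootCount

open Matrix

variable {m : ℕ} {k : Type*} [Field k]

theorem adCoord_diagTorusHom_diag (P : GL (Fin m) k) (t : Fin m → kˣ) (i j : Fin m) :
    adCoord i i j j (ProjGenLinGroup.mk P⁻¹ * diagTorusHom P t * ProjGenLinGroup.mk P) =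
      (t i / t j : kˣ) := by
  rw [adCoord_diagTorusHom, diagonal_apply_eq, diagonal_apply_eq, ← Units.val_mul, div_eq_mul_inv]

/-- The character `[P diag(t) P⁻¹] ↦ tᵢ / tⱼ` of a diagonal torus. -/
noncomputable def rootChar (P : GL (Fin m) k) (i j : Fin m) : diagTorus P →* kˣ where
  toFun x := Units.mk0 (adCoord i i j j (ProjGenLinGroup.mk P⁻¹ * x.1 * ProjGenLinGroup.mk P)) (by
    obtain ⟨_, t, rfl⟩ := x
    rw [adCoord_diagTorusHom_diag]
    exact Units.ne_zero _)
  map_one' := by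
    ext
    have := adCoord_diagTorusHom_diag P 1 i j
    simpa using this
  map_mul' := by
    rintro ⟨_, s, rfl⟩ ⟨_, t, rfl⟩
    ext
    have := adCoord_diagTorusHom_diag P (s * t) i j
    rw [map_mul] at this
    change adCoord i i j j (ProjGenLinGroup.mk P⁻¹ * (diagTorusHom P s * diagTorusHom P t) *
      ProjGenLinGroup.mk P) = adCoord i i j j _ * adCoord i i j j _
    rw [this, adCoord_diagTorusHom_diag, adCoord_diagTorusHom_diag, ← Units.val_mul, Pi.mul_apply,
      Pi.mul_apply, mul_div_mul_comm]

theorem rootChar_apply (P : GL (Fin m) k) (i j : Fin m) (t : Fin m → kˣ) :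
    rootChar P i j ⟨diagTorusHom P t, ⟨t, rfl⟩⟩ = t i / t j :=
  Units.ext (adCoord_diagTorusHom_diag P t i j)

theorem exists_unit_sq_ne_one [Infinite k] : ∃ u : kˣ, u ^ 2 ≠ 1 := by
  classical
  obtain ⟨x, hx⟩ := Infinite.exists_notMem_finset ({0, 1, -1} : Finset k)
  simp only [Finset.mem_insert, Finset.mem_singleton, not_or] at hx
  refine ⟨Units.mk0 x hx.1, fun h => ?_⟩
  have h1 : x * x = 1 := by
    have := congrArg Units.val h
    simpa [pow_two] using this
  rcases mul_self_eq_one_iff.1 h1 with h | h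
  exacts [hx.2.1 h, hx.2.2 h]

theorem rootChar_injective [Infinite k] (P : GL (Fin m) k) {i j i' j' : Fin m} (hij : i ≠ j)
    (h : rootChar P i j = rootChar P i' j') : i = i' ∧ j = j' := by
  obtain ⟨u, hu⟩ := exists_unit_sq_ne_one (k := k)
  have hu1 : u ≠ 1 := by rintro rfl; simp at hu
  have huinv : u ≠ u⁻¹ := by
    intro h
    apply hu
    rw [pow_two]
    nth_rw 2 [h]
    simp
  have key (t : Fin m → kˣ) : t i / t j = t i' / t j' := by
    rw [← rootChar_apply P, ← rootChar_apply P, h]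
  have h1 := key (Function.update 1 i u)
  have h2 := key (Function.update 1 j u)
  simp only [Function.update_apply, Pi.one_apply, if_true, if_neg hij, if_neg hij.symm] at h1 h2
  constructor
  · by_contra hne
    rw [if_neg (Ne.symm hne)] at h1
    split_ifs at h1
    · simp [div_eq_mul_inv] at h1
      exact huinv h1
    · simp at h1
      exact hu1 h1
  · by_contra hne
    rw [if_neg (Ne.symm hne)] at h2
    split_ifs at h2
    · simp [div_eq_mul_inv] at h2
      exact huinv h2.symm
    · simp at h2
      exact hu1 h2

/-- The roots of the centralizer of `a = P diag(d) P⁻¹` with respect to the diagonal torus are the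
characters `tᵢ / tⱼ` with `i ≠ j` and `dᵢ = dⱼ`. -/
theorem roots_commutantPGL [Infinite k] [NeZero m] {a : Matrix (Fin m) (Fin m) k}
    {P : GL (Fin m) k} {d : Fin m → k} (h : a * P.1 = P.1 * diagonal d) :
    roots (commutantPGL a) (diagTorus P) =
      {α | ∃ i j, i ≠ j ∧ d i = d j ∧ α = rootChar P i j} := by
  have hPP : (P⁻¹).1 * P.1 = 1 := by rw [← Units.val_mul, inv_mul_cancel, Units.val_one]
  have hPP' : P.1 * (P⁻¹).1 = 1 := by rw [← Units.val_mul, mul_inv_cancel, Units.val_one]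
  have hconj (t : Fin m → kˣ) : (P * diagGL m k t * P⁻¹).1 = P.1 * (diagGL m k t).1 * (P⁻¹).1 := rfl
  ext α
  constructor
  · rintro ⟨-, hα1, D, hD, hD0, hw⟩
    have hder : IsPointDerivation D := hD.1
    obtain ⟨X, hX⟩ := hder.exists_matrix
    have hXa := commute_of_mem_lieAlg hD hX
    set Y := (P⁻¹).1 * X * P.1 with hY
    have hXY : X = P.1 * Y * (P⁻¹).1 := by
      calc X = (P.1 * (P⁻¹).1) * X * (P.1 * (P⁻¹).1) := by rw [hPP', one_mul, mul_one]
        _ = _ := by rw [hY]; simp only [mul_assoc]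
    -- `t Y t⁻¹ - α(t) Y` is scalar
    have key (t : Fin m → kˣ) : ∃ z : k,
        (diagGL m k t).1 * Y * (diagGL m k t)⁻¹.1 - (α ⟨_, ⟨t, rfl⟩⟩).1 • Y = z • 1 := by
      set g := P * diagGL m k t * P⁻¹ with hg
      set c := (α ⟨_, ⟨t, rfl⟩⟩).1 with hc
      have h1 := hw ⟨_, ⟨t, rfl⟩⟩
      have h2 (i j p q : Fin m) : D (conjPullback (ProjGenLinGroup.mk g) (adElt i j p q)) =
          c * D (adElt i j p q) := congrArg (fun E => E (adElt i j p q)) h1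
      simp only [conjPullback_deriv hX, hX] at h2
      have h3 := eq_smul_one_of_forall (Z := g.1 * X * (g⁻¹).1 - c • X) fun i j p q => by
        simp only [Matrix.sub_apply, Matrix.smul_apply, smul_eq_mul]
        linear_combination h2 i j p q
      refine ⟨(g.1 * X * (g⁻¹).1 - c • X) 0 0, ?_⟩
      · have h4 : (P⁻¹).1 * (g.1 * X * (g⁻¹).1 - c • X) * P.1 =
            (diagGL m k t).1 * Y * (diagGL m k t)⁻¹.1 - c • Y := by
          rw [mul_sub, sub_mul, hY, mul_smul_comm, smul_mul_assoc]
          congr 1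
          have h5 : (P⁻¹).1 * g.1 = (diagGL m k t).1 * (P⁻¹).1 := by
            rw [← Units.val_mul, ← Units.val_mul, hg]; congr 1; group
          have h6 : (g⁻¹).1 * P.1 = P.1 * (diagGL m k t)⁻¹.1 := by
            rw [← Units.val_mul, ← Units.val_mul, hg]; congr 1; group
          calc (P⁻¹).1 * (g.1 * X * (g⁻¹).1) * P.1 = ((P⁻¹).1 * g.1) * X * ((g⁻¹).1 * P.1) := by
                simp only [mul_assoc]
            _ = _ := by rw [h5, h6]; simp only [mul_assoc]
        rw [← h4]
        nth_rw 1 [h3]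
        rw [mul_smul_comm, smul_mul_assoc, mul_one, hPP]
    -- if `Y` were diagonal, it would be a scalar matrix by `key`, and `D` would be `0`
    obtain ⟨i, j, hij, hYij⟩ : ∃ i j, i ≠ j ∧ Y i j ≠ 0 := by
      by_contra! hall
      obtain ⟨x, hx⟩ : ∃ x, α x ≠ 1 := by
        by_contra! h1
        exact hα1 (MonoidHom.ext h1)
      obtain ⟨_, t, rfl⟩ := x
      obtain ⟨z, hz⟩ := key t
      have h1 (i : Fin m) : (1 - (α ⟨_, ⟨t, rfl⟩⟩).1) * Y i i = z := by
        have := congrFun (congrFun hz i) i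
        rw [Matrix.sub_apply, diagGL_val, diagGL_inv_val, mul_diagonal, diagonal_mul] at this
        simp only [Matrix.smul_apply, smul_eq_mul, Matrix.one_apply_eq, mul_one] at this
        rw [← this, mul_right_comm, ← Units.val_mul, mul_inv_cancel, Units.val_one]
        ring
      have h2 : 1 - (α ⟨_, ⟨t, rfl⟩⟩).1 ≠ 0 := sub_ne_zero.2 fun h => hx (Units.ext h.symm)
      have h3 : Y = Y 0 0 • 1 := by
        ext i j
        rw [Matrix.smul_apply, smul_eq_mul]
        rcases eq_or_ne i j with rfl | hij
        · rw [Matrix.one_apply_eq, mul_one]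
          exact mul_left_cancel₀ h2 ((h1 i).trans (h1 0).symm)
        · rw [hall i j hij, Matrix.one_apply_ne hij, mul_zero]
      have h4 : X = Y 0 0 • 1 := by
        rw [hXY]
        nth_rw 1 [h3]
        rw [mul_smul_comm, smul_mul_assoc, mul_one, hPP']
      refine hD0 (hder.eq_zero fun i j p q => ?_)
      rw [hX, h4]
      simp only [Matrix.smul_apply, smul_eq_mul]
      ring
    refine ⟨i, j, hij, ?_, ?_⟩
    · have hYd : Y * diagonal d = diagonal d * Y := by
        have hd : diagonal d = (P⁻¹).1 * a * P.1 := by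
          rw [mul_assoc, h, ← mul_assoc, hPP, one_mul]
        rw [hd, hY]
        calc (P⁻¹).1 * X * P.1 * ((P⁻¹).1 * a * P.1) = (P⁻¹).1 * X * (P.1 * (P⁻¹).1) * a * P.1 := by
              simp only [mul_assoc]
          _ = (P⁻¹).1 * a * (P.1 * (P⁻¹).1) * X * P.1 := by
              rw [hPP', mul_one, mul_one, mul_assoc _ X a, hXa, ← mul_assoc]
          _ = _ := by simp only [mul_assoc]
      have := congrFun (congrFun hYd i) j
      rw [mul_diagonal, diagonal_mul, mul_comm] at this
      exact (mul_right_cancel₀ hYij this).symm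
    · ext ⟨_, t, rfl⟩
      obtain ⟨z, hz⟩ := key t
      have := congrFun (congrFun hz i) j
      rw [Matrix.sub_apply, diagGL_val, diagGL_inv_val, mul_diagonal, diagonal_mul] at this
      simp only [Matrix.smul_apply, smul_eq_mul, Matrix.one_apply_ne hij, mul_zero] at this
      rw [rootChar_apply, div_eq_mul_inv, Units.val_mul]
      refine mul_right_cancel₀ hYij ?_
      linear_combination -this
  · rintro ⟨i, j, hij, hd, rfl⟩
    refine ⟨⟨_, coordPGL_conj (adCoord_mem i i j j) P, rfl⟩, ?_, ?_⟩
    · intro h1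
      obtain ⟨u, hu⟩ := exists_unit_sq_ne_one (k := k)
      have := rootChar_apply P i j (Function.update 1 i u)
      rw [h1] at this
      simp [hij.symm] at this
      rw [← this] at hu
      simp at hu
    -- the root vector is the derivative along the conjugate of an elementary matrix
    · set E := Matrix.single i j (1 : k) with hE
      have hEE : E * E = 0 := by
        rw [hE, Matrix.single_mul_single_of_ne _ _ _ _ hij.symm]
      set X := P.1 * E * (P⁻¹).1 with hXdef
      have hX : X * X = 0 := by
        calc X * X = P.1 * E * ((P⁻¹).1 * P.1) * E * (P⁻¹).1 := by
              rw [hXdef]; simp only [mul_assoc]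
          _ = 0 := by rw [hPP, mul_one, mul_assoc P.1, hEE, mul_zero, zero_mul]
      have hXa : X * a = a * X := by
        have ha : a = P.1 * diagonal d * (P⁻¹).1 := by
          rw [← h, mul_assoc, hPP', mul_one]
        have hEd : E * diagonal d = diagonal d * E := by
          ext p q
          rw [mul_diagonal, diagonal_mul, hE, Matrix.single_apply]
          split_ifs with hpq
          · rw [← hpq.1, ← hpq.2, hd, mul_comm]
          · simp
        calc X * a = P.1 * E * ((P⁻¹).1 * P.1) * diagonal d * (P⁻¹).1 := by
              rw [hXdef, ha]; simp only [mul_assoc]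
          _ = P.1 * diagonal d * ((P⁻¹).1 * P.1) * E * (P⁻¹).1 := by
              rw [hPP, mul_one, mul_one, mul_assoc P.1, hEd, ← mul_assoc P.1]
          _ = _ := by rw [hXdef, ha]; simp only [mul_assoc]
      refine ⟨unipotentDeriv X hX, unipotentDeriv_mem_lieAlg hX hXa, ?_, ?_⟩
      · intro h0
        have h1 := eq_smul_one_of_forall (Z := X) fun i j p q => by
          rw [← unipotentDeriv_adElt hX, h0]; rfl
        have h2 : X 0 0 = 0 := by
          have h3 := hX
          rw [h1, smul_mul_smul_comm, mul_one] at h3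
          have := congrFun (congrFun h3 0) 0
          simpa using this
        rw [h2, zero_smul] at h1
        have h4 : E = 0 := by
          calc E = ((P⁻¹).1 * P.1) * E * ((P⁻¹).1 * P.1) := by rw [hPP, one_mul, mul_one]
            _ = (P⁻¹).1 * X * P.1 := by rw [hXdef]; simp only [mul_assoc]
            _ = 0 := by rw [h1, mul_zero, zero_mul]
        have := congrFun (congrFun h4 i) j
        simp [hE] at this
      · rintro ⟨_, t, rfl⟩
        rw [rootChar_apply]
        refine unipotentDeriv_conj hX ?_
        have h1 : (diagGL m k t).1 * E = (t i / t j : kˣ).1 • (E * (diagGL m k t).1) := by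
          ext p q
          rw [Matrix.smul_apply, diagGL_val, mul_diagonal, diagonal_mul, hE, Matrix.single_apply]
          split_ifs with hpq
          · rw [← hpq.1, ← hpq.2, smul_eq_mul, one_mul, mul_one, ← Units.val_mul, div_mul_cancel]
          · simp
        change (P * diagGL m k t * P⁻¹).1 * X = _ • (X * (P * diagGL m k t * P⁻¹).1)
        rw [hconj, hXdef]
        calc P.1 * (diagGL m k t).1 * (P⁻¹).1 * (P.1 * E * (P⁻¹).1)
            = P.1 * ((diagGL m k t).1 * ((P⁻¹).1 * P.1) * E) * (P⁻¹).1 := by simp only [mul_assoc]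
          _ = (t i / t j : kˣ).1 • (P.1 * E * ((P⁻¹).1 * P.1) * (diagGL m k t).1 * (P⁻¹).1) := by
            rw [hPP, mul_one, mul_one, h1, mul_smul_comm, smul_mul_assoc]; simp only [mul_assoc]
          _ = _ := by simp only [mul_assoc]

/-- The number of pairs `(i, j)`, possibly equal, with `dᵢ = dⱼ`. -/
noncomputable def eqPairs {X : Type*} (d : Fin m → X) : ℕ := Nat.card {p : Fin m × Fin m // d p.1 = d p.2}

/-- The `m` pairs `(i, i)` are counted by `eqPairs` but do not give roots. -/
theorem roots_encard [Infinite k] [NeZero m] {a : Matrix (Fin m) (Fin m) k}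
    {P : GL (Fin m) k} {d : Fin m → k} (h : a * P.1 = P.1 * diagonal d) :
    (roots (commutantPGL a) (diagTorus P)).encard + m = eqPairs d := by
  classical
  rw [roots_commutantPGL h]
  let S : Finset (Fin m × Fin m) := Finset.univ.filter fun p => p.1 ≠ p.2 ∧ d p.1 = d p.2
  have h1 : {α | ∃ i j, i ≠ j ∧ d i = d j ∧ α = rootChar P i j} =
      (fun p : Fin m × Fin m => rootChar P p.1 p.2) '' (S : Set (Fin m × Fin m)) := by
    ext α
    constructor
    · rintro ⟨i, j, hij, hd, rfl⟩
      exact ⟨(i, j), by simp [S, hij, hd], rfl⟩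
    · rintro ⟨⟨i, j⟩, hp, rfl⟩
      simp only [S, Finset.coe_filter, Finset.mem_univ, true_and] at hp
      exact ⟨i, j, hp.1, hp.2, rfl⟩
  have h2 : Set.InjOn (fun p : Fin m × Fin m => rootChar P p.1 p.2) (S : Set (Fin m × Fin m)) := by
    rintro ⟨i, j⟩ hp ⟨i', j'⟩ _ he
    simp only [S, Finset.coe_filter, Finset.mem_univ, true_and] at hp
    have := rootChar_injective P hp.1 he
    exact Prod.ext this.1 this.2
  rw [h1, h2.encard_image, Set.encard_coe_eq_coe_finsetCard]
  norm_cast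
  have h3 : eqPairs d = (Finset.univ.filter fun p : Fin m × Fin m => d p.1 = d p.2).card := by
    rw [eqPairs, Nat.card_eq_fintype_card, Fintype.card_subtype]
  have h4 : (Finset.univ.filter fun p : Fin m × Fin m => d p.1 = d p.2) =
      S ∪ Finset.univ.image fun i => (i, i) := by
    ext ⟨i, j⟩
    simp only [S, Finset.mem_filter, Finset.mem_univ, true_and, Finset.mem_union, Finset.mem_image,
      Prod.mk.injEq, exists_eq_left]
    rcases eq_or_ne i j with rfl | hij
    · simp
    · simp [hij]
  rw [h3, h4, Finset.card_union_of_disjoint, Finset.card_image_of_injective, Finset.card_univ,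
    Fintype.card_fin]
  · intro i j h
    exact congrArg Prod.fst h
  · rw [Finset.disjoint_left]
    rintro ⟨i, j⟩ hp hq
    simp only [S, Finset.mem_filter, Finset.mem_image, Prod.mk.injEq] at hp hq
    obtain ⟨l, -, rfl, rfl⟩ := hq
    exact hp.2.1 rfl

theorem exists_perm_of_card_eq {X : Type*} {d d' : Fin m → X}
    (h : ∀ x, Nat.card {i // d i = x} = Nat.card {i // d' i = x}) :
    ∃ σ : Equiv.Perm (Fin m), ∀ i, d' (σ i) = d i := by
  classical
  let e (x : X) : {i // d i = x} ≃ {i // d' i = x} := Fintype.equivOfCardEq (by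
    rw [← Nat.card_eq_fintype_card, ← Nat.card_eq_fintype_card, h x])
  refine ⟨(Equiv.sigmaFiberEquiv d).symm.trans ((Equiv.sigmaCongrRight e).trans
    (Equiv.sigmaFiberEquiv d')), fun i => ?_⟩
  exact (e (d i) ⟨i, rfl⟩).2

/-- The eigenvalues of a diagonalizable matrix are unique up to order. -/
theorem exists_perm_of_diagonalizations {a : Matrix (Fin m) (Fin m) k}
    {P P' : GL (Fin m) k} {d d' : Fin m → k} (h : a * P.1 = P.1 * diagonal d)
    (h' : a * P'.1 = P'.1 * diagonal d') : ∃ σ : Equiv.Perm (Fin m), ∀ i, d' (σ i) = d i := by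
  classical
  have key {P : GL (Fin m) k} {d : Fin m → k} (h : a * P.1 = P.1 * diagonal d) :
      a.charpoly.roots = Finset.univ.val.map d := by
    have h1 : a = P.1 * diagonal d * (P⁻¹).1 := by
      rw [← h, mul_assoc, ← Units.val_mul, mul_inv_cancel, Units.val_one, mul_one]
    rw [h1, Matrix.coe_units_inv, Matrix.charpoly_units_conj, Matrix.charpoly_diagonal]
    have h2 : ∏ i, (Polynomial.X - Polynomial.C (d i)) =
        ((Finset.univ.val.map d).map fun x => Polynomial.X - Polynomial.C x).prod := by
      rw [Multiset.map_map]; rfl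
    rw [h2, Polynomial.roots_multiset_prod_X_sub_C]
  refine exists_perm_of_card_eq fun x => ?_
  have h1 (d : Fin m → k) : Nat.card {i // d i = x} = (Finset.univ.val.map d).count x := by
    rw [Nat.card_eq_fintype_card, Fintype.card_subtype, Multiset.count_map]
    simp only [eq_comm (a := x)]
    rfl
  rw [h1, h1, ← key h, ← key h']

theorem eqPairs_perm {X : Type*} {d d' : Fin m → X} (σ : Equiv.Perm (Fin m))
    (h : ∀ i, d' (σ i) = d i) : eqPairs d = eqPairs d' :=
  Nat.card_congr ((Equiv.prodCongr σ σ).subtypeEquiv fun p => by simp [h])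

/-- The value of `ν` does not depend on the choice of the maximal torus, since the eigenvalues of `a`
are unique up to order. -/
theorem hasNu_commutantPGL_iff [IsAlgClosed k] (h2 : (2 : k) ≠ 0) {n : ℕ}
    {a : Matrix (Fin (n + 1)) (Fin (n + 1)) k}
    (ha : ∃ p : Polynomial k, Squarefree p ∧ Polynomial.aeval a p = 0)
    {P : GL (Fin (n + 1)) k} {d : Fin (n + 1) → k} (h : a * P.1 = P.1 * diagonal d) (N : ℕ) :
    HasNu (commutantPGL a) N ↔ 2 * N + (n + 1) = eqPairs d := by
  have := IsAlgClosed.instInfinite (K := k)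
  have hcount {P : GL (Fin (n + 1)) k} {d : Fin (n + 1) → k} (h : a * P.1 = P.1 * diagonal d) :
      (roots (commutantPGL a) (diagTorus P)).encard = 2 * N ↔ 2 * N + (n + 1) = eqPairs d := by
    have h1 := roots_encard h
    have h2 : (roots (commutantPGL a) (diagTorus P)).Finite := by
      rw [← Set.encard_lt_top_iff]
      refine lt_of_le_of_lt (le_self_add (b := ((n + 1 : ℕ) : ℕ∞))) ?_
      rw [h1]
      exact ENat.natCast_lt_top _
    rw [h2.encard_eq_coe_toFinset_card] at h1 ⊢
    norm_cast at h1 ⊢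
    omega
  constructor
  · rintro ⟨T, r, hT, hc⟩
    obtain ⟨P', d', h', rfl, rfl⟩ := exists_diagTorus_of_isMaximalTorus h2 ha hT
    obtain ⟨σ, hσ⟩ := exists_perm_of_diagonalizations h h'
    rw [eqPairs_perm σ hσ]
    exact (hcount h').1 hc
  · intro hN
    exact ⟨_, _, isMaximalTorus_diagTorus h, (hcount h).2 hN⟩

theorem hasNu_top_iff [IsAlgClosed k] (h2 : (2 : k) ≠ 0) {n N : ℕ} :
    HasNu (⊤ : Subgroup (PGL(Fin (n + 1), k))) N ↔ 2 * N + (n + 1) = (n + 1) ^ 2 := by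
  rw [← commutantPGL_one, hasNu_commutantPGL_iff h2 (P := 1) (d := fun _ => 1)]
  · have : eqPairs (fun _ : Fin (n + 1) => (1 : k)) = (n + 1) ^ 2 := by
      rw [eqPairs, Nat.card_congr (Equiv.subtypeUnivEquiv fun _ => rfl)]
      simp [pow_two]
    rw [this]
  · exact ⟨Polynomial.X - Polynomial.C 1, (Polynomial.irreducible_X_sub_C 1).squarefree, by simp⟩
  · simp

theorem hasRank_top_iff [IsAlgClosed k] (h2 : (2 : k) ≠ 0) {n r : ℕ} :
    HasRank (⊤ : Subgroup (PGL(Fin (n + 1), k))) r ↔ r = n := by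
  rw [← commutantPGL_one]
  constructor
  · rintro ⟨T, hT⟩
    obtain ⟨-, -, -, -, h⟩ := exists_diagTorus_of_isMaximalTorus h2
      ⟨Polynomial.X - Polynomial.C 1, (Polynomial.irreducible_X_sub_C 1).squarefree, by simp⟩ hT
    exact h
  · rintro rfl
    exact ⟨_, isMaximalTorus_diagTorus (P := 1) (d := fun _ => 1) (by simp)⟩

end RootCount

/-! ### The type of the root system of a centralizer -/

section Types

open Matrix

variable {m : ℕ} {k : Type*} [Field k]

/-- The character `t ↦ ∏ₓ t_{σ x} ^ vₓ`. -/
noncomputable def weightChar (k : Type*) [Field k] {I : Type*} [Fintype I] (σ : I → Fin m) :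
    (I → ℤ) →+ Additive ((Fin m → kˣ) →* kˣ) where
  toFun v := Additive.ofMul
    { toFun := fun t => ∏ x, t (σ x) ^ v x
      map_one' := by simp
      map_mul' := fun s t => by simp [mul_zpow, Finset.prod_mul_distrib] }
  map_zero' := by
    refine congrArg Additive.ofMul (MonoidHom.ext fun t => ?_)
    simp
  map_add' v w := by
    rw [← ofMul_mul]
    refine congrArg Additive.ofMul (MonoidHom.ext fun t => ?_)
    simp [_root_.zpow_add, Finset.prod_mul_distrib]

theorem weightChar_apply {I : Type*} [Fintype I] (σ : I → Fin m) (v : I → ℤ) (t : Fin m → kˣ) :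
    (weightChar k σ v).toMul t = ∏ x, t (σ x) ^ v x := rfl

theorem weightChar_injective [Infinite k] {I : Type*} [Fintype I] [DecidableEq I] {σ : I → Fin m}
    (hσ : Function.Injective σ) : Function.Injective (weightChar k σ) := by
  rw [injective_iff_map_eq_zero]
  intro v hv
  funext x
  by_contra hx
  have h1 (u : kˣ) : u ^ (v x).natAbs = 1 := by
    rw [pow_natAbs_eq_one]
    have := DFunLike.congr_fun (congrArg Additive.toMul hv) (Function.update (1 : Fin m → kˣ) (σ x) u)
    rw [weightChar_apply, Finset.prod_eq_single x] at this
    · simpa using this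
    · intro y _ hy
      rw [Function.update_of_ne (fun h => hy (hσ h))]
      simp
    · simp
  have hpos : 0 < (v x).natAbs := Int.natAbs_pos.2 hx
  refine Polynomial.X_pow_sub_C_ne_zero hpos (1 : k) (Polynomial.eq_zero_of_infinite_isRoot _
    ((Set.finite_singleton (0 : k)).infinite_compl.mono fun u hu => ?_))
  have := congrArg Units.val (h1 (Units.mk0 u hu))
  change u ^ (v x).natAbs = 1 at this
  simp [Polynomial.IsRoot, this]

/-- Pull-back of characters of a diagonal torus along `t ↦ [P diag(t) P⁻¹]`. -/
def torusCharPullback (P : GL (Fin m) k) : (diagTorus P →* kˣ) →* ((Fin m → kˣ) →* kˣ) where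
  toFun χ := χ.comp (diagTorusHom P).rangeRestrict
  map_one' := rfl
  map_mul' _ _ := rfl

theorem torusCharPullback_injective (P : GL (Fin m) k) :
    Function.Injective (torusCharPullback P) := by
  intro χ χ' h
  ext ⟨_, t, rfl⟩
  exact congrArg Units.val (DFunLike.congr_fun h t)

/-- The root system is of type `A_{l₁} × A_{l₂} × ⋯` if the sets of at least two indices with equal
eigenvalues, enumerated by `σ`, have sizes `lᵢ + 1`. The root lattice and the standard one are both
embedded into the characters of `(kˣ)ᵐ`, where they have the same image. -/
theorem hasTypeA_roots [Infinite k] [NeZero m] {a : Matrix (Fin m) (Fin m) k}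
    {P : GL (Fin m) k} {d : Fin m → k} (h : a * P.1 = P.1 * diagonal d) {l : List ℕ}
    (σ : (Σ i : Fin l.length, Fin (l.get i + 1)) → Fin m) (hσ : Function.Injective σ)
    (h1 : ∀ i a b, d (σ ⟨i, a⟩) = d (σ ⟨i, b⟩))
    (h2 : ∀ i j, i ≠ j → d i = d j → ∃ x a b, i = σ ⟨x, a⟩ ∧ j = σ ⟨x, b⟩) :
    HasTypeA (roots (commutantPGL a) (diagTorus P)) l := by
  classical
  rw [roots_commutantPGL h]
  set Φ : Set (diagTorus P →* kˣ) := {α | ∃ i j, i ≠ j ∧ d i = d j ∧ α = rootChar P i j} with hΦ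
  let f : AddSubgroup.closure (stdRootsA l) →+ Additive ((Fin m → kˣ) →* kˣ) :=
    (weightChar k σ).comp (AddSubgroup.subtype _)
  let g : Additive (Subgroup.closure Φ) →+ Additive ((Fin m → kˣ) →* kˣ) :=
    MonoidHom.toAdditive ((torusCharPullback P).comp (Subgroup.subtype _))
  have hf : Function.Injective f := (weightChar_injective hσ).comp Subtype.val_injective
  have hg : Function.Injective g := (torusCharPullback_injective P).comp Subtype.val_injective
  have hroot (x : Fin l.length) (a b : Fin (l.get x + 1)) :
      weightChar k σ (Pi.single ⟨x, a⟩ 1 - Pi.single ⟨x, b⟩ 1) =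
        Additive.ofMul (torusCharPullback P (rootChar P (σ ⟨x, a⟩) (σ ⟨x, b⟩))) := by
    refine Additive.toMul.injective (MonoidHom.ext fun t => ?_)
    have h3 (y) : (weightChar k σ (Pi.single y 1)).toMul t = t (σ y) := by
      rw [weightChar_apply, Finset.prod_eq_single y]
      · simp
      · intro z _ hz
        simp [hz]
      · simp
    rw [map_sub]
    change (weightChar k σ (Pi.single ⟨x, a⟩ 1)).toMul t / (weightChar k σ (Pi.single ⟨x, b⟩ 1)).toMul t
      = rootChar P _ _ ⟨diagTorusHom P t, ⟨t, rfl⟩⟩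
    rw [h3, h3, rootChar_apply]
  have hrange : AddMonoidHom.range (N := Additive ((Fin m → kˣ) →* kˣ)) g =
      AddMonoidHom.range (N := Additive ((Fin m → kˣ) →* kˣ)) f := by
    refine le_antisymm ?_ ?_
    · rintro _ ⟨x, rfl⟩
      obtain ⟨x, hx⟩ := x
      change ∃ y, f y = Additive.ofMul (torusCharPullback P x)
      induction hx using Subgroup.closure_induction with
      | mem x hx =>
        obtain ⟨i, j, hij, hd, rfl⟩ := hx
        obtain ⟨x, a, b, rfl, rfl⟩ := h2 i j hij hd
        exact ⟨⟨_, AddSubgroup.subset_closure ⟨x, a, b, fun h => hij (by rw [h]), rfl⟩⟩, hroot x a b⟩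
      | one => exact ⟨0, by rw [map_zero, map_one]; rfl⟩
      | mul x y _ _ hx hy =>
        obtain ⟨v, hv⟩ := hx
        obtain ⟨w, hw⟩ := hy
        exact ⟨v + w, by rw [map_add, hv, hw, map_mul]; rfl⟩
      | inv x _ hx =>
        obtain ⟨v, hv⟩ := hx
        exact ⟨-v, by rw [map_neg, hv, map_inv]; rfl⟩
    · rintro _ ⟨x, rfl⟩
      obtain ⟨v, hv⟩ := x
      change ∃ y, g y = weightChar k σ v
      induction hv using AddSubgroup.closure_induction with
      | mem v hv =>
        obtain ⟨x, a, b, hab, rfl⟩ := hv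
        exact ⟨Additive.ofMul ⟨_, Subgroup.subset_closure ⟨σ ⟨x, a⟩, σ ⟨x, b⟩,
          fun h => hab (by simpa using hσ h), h1 x a b, rfl⟩⟩, (hroot x a b).symm⟩
      | zero => exact ⟨0, by rw [map_zero, map_zero]⟩
      | add x y _ _ hx hy =>
        obtain ⟨v, hv⟩ := hx
        obtain ⟨w, hw⟩ := hy
        exact ⟨v + w, by rw [map_add, hv, hw, map_add]⟩
      | neg x _ hx =>
        obtain ⟨v, hv⟩ := hx
        exact ⟨-v, by rw [map_neg, hv, map_neg]⟩
  let e : Additive (Subgroup.closure Φ) ≃+ AddSubgroup.closure (stdRootsA l) :=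
    (AddMonoidHom.ofInjective hg).trans ((AddEquiv.addSubgroupCongr hrange).trans
      (AddMonoidHom.ofInjective hf).symm)
  have he (x) : f (e x) = g x := by
    have : AddMonoidHom.ofInjective hf (e x) =
        AddEquiv.addSubgroupCongr hrange (AddMonoidHom.ofInjective hg x) :=
      AddEquiv.apply_symm_apply _ _
    exact congrArg Subtype.val this
  refine ⟨e, fun x => ⟨?_, ?_⟩⟩
  · rintro ⟨i, j, hij, hd, hx⟩
    obtain ⟨y, a, b, rfl, rfl⟩ := h2 i j hij hd
    have hab : a ≠ b := fun h => hij (by rw [h])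
    refine ⟨y, a, b, hab, ?_⟩
    have h3 : e (Additive.ofMul x) =
        ⟨_, AddSubgroup.subset_closure ⟨y, a, b, hab, rfl⟩⟩ := hf (by
      rw [he]
      refine Eq.trans ?_ (hroot y a b).symm
      rw [← hx]
      rfl)
    rw [h3]
  · rintro ⟨y, a, b, hab, hx⟩
    refine ⟨σ ⟨y, a⟩, σ ⟨y, b⟩, fun h => hab (by simpa using hσ h), h1 y a b, ?_⟩
    refine torusCharPullback_injective P (Additive.ofMul.injective ?_)
    rw [← hroot, ← hx]
    exact (he (Additive.ofMul x)).symm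

end Types

/-! ### Classification of the regular triples -/

section TripleClassification

open Matrix

variable {m : ℕ} {k : Type*} [Field k]

/-- The class in `PGL_m` of `diag(ζ ^ e₁, ζ ^ e₂, …)`. -/
def rootDiag {N : ℕ} (ζ : kˣ) (e : Fin m → Fin N) : PGL(m, k) :=
  ProjGenLinGroup.mk (diagGL m k fun i => ζ ^ (e i).1)

theorem smul_one_of_mk_eq_one {g : GL (Fin m) k} (h : (ProjGenLinGroup.mk g : PGL(m, k)) = 1) :
    ∃ u : kˣ, g.1 = u.1 • 1 := by
  rw [← map_one ProjGenLinGroup.mk, eq_comm, pgl_mk_eq_mk] at h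
  exact h

theorem IsPrimitiveRoot.units_pow_injective {N : ℕ} {ζ : kˣ} (hζ : IsPrimitiveRoot ζ N) :
    Function.Injective fun i : Fin N => (ζ ^ i.1).1 := fun i j h =>
  Fin.ext (hζ.pow_inj i.2 j.2 (Units.ext h))

/-- An element of `PGL_m` of order dividing `N` is conjugate to a diagonal one. -/
theorem exists_isConj_rootDiag [IsAlgClosed k] {N : ℕ} (hN : (N : k) ≠ 0)
    {ζ : kˣ} (hζ : IsPrimitiveRoot ζ N) {x : PGL(m, k)} (hx : x ^ N = 1) :
    ∃ e : Fin m → Fin N, IsConj (rootDiag ζ e) x := by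
  have hN0 : N ≠ 0 := by rintro rfl; simp at hN
  obtain ⟨g, rfl⟩ := ProjGenLinGroup.mk_surjective x
  rw [← map_pow] at hx
  obtain ⟨u, hu⟩ := smul_one_of_mk_eq_one hx
  -- if `g ^ N = u`, the eigenvalues of `g` divided by an `N`-th root `v` of `u` are powers of `ζ`
  obtain ⟨v, hv⟩ := IsAlgClosed.exists_pow_nat_eq u.1 (Nat.pos_of_ne_zero hN0)
  have hv0 : v ≠ 0 := by
    rintro rfl
    rw [zero_pow hN0] at hv
    exact u.ne_zero hv.symm
  obtain ⟨P, d, hd⟩ := exists_diagonalization hN u.ne_zero hu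
  have hPP : (P⁻¹).1 * P.1 = 1 := by rw [← Units.val_mul, inv_mul_cancel, Units.val_one]
  have hPP' : P.1 * (P⁻¹).1 = 1 := by rw [← Units.val_mul, mul_inv_cancel, Units.val_one]
  have hpow (j : ℕ) : g.1 ^ j * P.1 = P.1 * diagonal d ^ j := by
    induction j with
    | zero => simp
    | succ j ih => rw [pow_succ, mul_assoc, hd, ← mul_assoc, ih, mul_assoc, pow_succ]
  have hdN (i : Fin m) : d i ^ N = u.1 := by
    have h1 := hpow N
    rw [← Units.val_pow_eq_pow_val, hu, smul_mul_assoc, one_mul, diagonal_pow] at h1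
    have h2 : diagonal (d ^ N) = u.1 • (1 : Matrix (Fin m) (Fin m) k) := by
      calc diagonal (d ^ N) = (P⁻¹).1 * (P.1 * diagonal (d ^ N)) := by
            rw [← mul_assoc, hPP, one_mul]
        _ = _ := by rw [← h1, mul_smul_comm, hPP]
    have := congrFun (congrFun h2 i) i
    simpa using this
  have hroot (i : Fin m) : ∃ j : Fin N, d i = v * (ζ ^ j.1).1 := by
    have h1 : (d i / v) ^ N = 1 := by
      rw [div_pow, hdN, hv, div_self u.ne_zero]
    have : NeZero N := ⟨hN0⟩
    have hζ' : IsPrimitiveRoot ζ.1 N := IsPrimitiveRoot.coe_units_iff.2 hζ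
    obtain ⟨j, hj, e⟩ := hζ'.eq_pow_of_pow_eq_one h1
    refine ⟨⟨j, hj⟩, ?_⟩
    rw [Units.val_pow_eq_pow_val]
    change d i = v * ζ.1 ^ j
    rw [e, mul_div_cancel₀ _ hv0]
  choose e he using hroot
  refine ⟨e, isConj_iff.2 ⟨ProjGenLinGroup.mk P, ?_⟩⟩
  rw [rootDiag, ← map_inv, ← map_mul, ← map_mul, pgl_mk_eq_mk]
  refine ⟨Units.mk0 v hv0, ?_⟩
  have h1 : diagonal d = v • (diagGL m k fun i => ζ ^ (e i).1).1 := by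
    rw [diagGL_val, ← diagonal_smul]
    congr 1
    funext i
    exact he i
  calc g.1 = g.1 * (P.1 * (P⁻¹).1) := by rw [hPP', mul_one]
    _ = P.1 * diagonal d * (P⁻¹).1 := by rw [← mul_assoc, hd]
    _ = _ := by rw [h1, mul_smul_comm, smul_mul_assoc]; rfl

/-- A conjugate of `rootDiag ζ e` lifts to a matrix of order dividing `N` with eigenvalues
`ζ ^ eᵢ`. -/
theorem exists_lift_of_isConj_rootDiag {N : ℕ} {ζ : kˣ} (hζ : ζ ^ N = 1) {e : Fin m → Fin N}
    {x : PGL(m, k)} (hx : IsConj (rootDiag ζ e) x) :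
    ∃ a P : GL (Fin m) k, x = ProjGenLinGroup.mk a ∧ a ^ N = 1 ∧
      a.1 * P.1 = P.1 * diagonal fun i => (ζ ^ (e i).1).1 := by
  obtain ⟨c, hc⟩ := isConj_iff.1 hx
  obtain ⟨P, rfl⟩ := ProjGenLinGroup.mk_surjective c
  refine ⟨P * diagGL m k (fun i => ζ ^ (e i).1) * P⁻¹, P, ?_, ?_, ?_⟩
  · rw [map_mul, map_mul, map_inv]
    exact hc.symm
  · rw [conj_pow, ← map_pow]
    have : (fun i => ζ ^ (e i).1) ^ N = 1 := by
      funext i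
      rw [Pi.pow_apply, ← pow_mul, mul_comm, pow_mul, hζ, one_pow, Pi.one_apply]
    rw [this, map_one, mul_one, mul_inv_cancel]
  · rw [← Units.val_mul, inv_mul_cancel_right]
    rfl

theorem eqPairs_comp {X Y : Type*} {f : X → Y} (hf : Function.Injective f) (e : Fin m → X) :
    eqPairs (fun i => f (e i)) = eqPairs e :=
  Nat.card_congr (Equiv.subtypeEquivRight fun _ => hf.eq_iff)

theorem hasNu_of_isConj_rootDiag [IsAlgClosed k] (h2 : (2 : k) ≠ 0) {n N : ℕ} (hN : (N : k) ≠ 0)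
    {ζ : kˣ} (hζ : IsPrimitiveRoot ζ N) {e : Fin (n + 1) → Fin N} {x : PGL(Fin (n + 1), k)}
    (hx : IsConj (rootDiag ζ e) x) (ν : ℕ) :
    HasNu (centralizerComponent x) ν ↔ 2 * ν + (n + 1) = eqPairs e := by
  have := IsAlgClosed.instInfinite (K := k)
  obtain ⟨a, P, rfl, ha, hP⟩ := exists_lift_of_isConj_rootDiag hζ.pow_eq_one hx
  rw [centralizerComponent_mk hN ha, hasNu_commutantPGL_iff h2 _ hP]
  · rw [← eqPairs_comp hζ.units_pow_injective e]
  · exact exists_squarefree_of_pow_eq hN one_ne_zero (by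
      rw [← Units.val_pow_eq_pow_val, ha, Units.val_one, one_smul])

theorem rootSystemHasType_of_isConj_rootDiag [IsAlgClosed k] {n N : ℕ} (hN : (N : k) ≠ 0)
    {ζ : kˣ} (hζ : IsPrimitiveRoot ζ N) {e : Fin (n + 1) → Fin N} {x : PGL(Fin (n + 1), k)}
    (hx : IsConj (rootDiag ζ e) x) {l : List ℕ}
    (σ : (Σ i : Fin l.length, Fin (l.get i + 1)) → Fin (n + 1)) (hσ : Function.Injective σ)
    (h1 : ∀ i a b, e (σ ⟨i, a⟩) = e (σ ⟨i, b⟩))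
    (h2 : ∀ i j, i ≠ j → e i = e j → ∃ x a b, i = σ ⟨x, a⟩ ∧ j = σ ⟨x, b⟩) :
    RootSystemHasType (centralizerComponent x) l := by
  have := IsAlgClosed.instInfinite (K := k)
  obtain ⟨a, P, rfl, ha, hP⟩ := exists_lift_of_isConj_rootDiag hζ.pow_eq_one hx
  rw [centralizerComponent_mk hN ha]
  exact ⟨_, _, isMaximalTorus_diagTorus hP, hasTypeA_roots hP σ hσ
    (fun i a b => by rw [h1 i a b]) fun i j hij h => h2 i j hij (hζ.units_pow_injective h)⟩

/-- The number of indices with a given exponent. -/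
def expMult {N : ℕ} (e : Fin m → Fin N) (i : Fin N) : ℕ :=
  (Finset.univ.filter fun j => e j = i).card

theorem eqPairs_eq_sum {N : ℕ} (e : Fin m → Fin N) : eqPairs e = ∑ i, expMult e i ^ 2 := by
  rw [eqPairs, Nat.card_eq_fintype_card, Fintype.card_subtype]
  have h : (Finset.univ.filter fun p : Fin m × Fin m => e p.1 = e p.2) =
      Finset.univ.biUnion fun i =>
        (Finset.univ.filter fun j => e j = i) ×ˢ (Finset.univ.filter fun j => e j = i) := by
    ext p
    simp
    exact eq_comm
  rw [h, Finset.card_biUnion]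
  · exact Finset.sum_congr rfl fun i _ => by rw [Finset.card_product, expMult, pow_two]
  · intro i _ j _ hij
    refine Finset.disjoint_left.2 fun p hp hq => ?_
    simp only [Finset.mem_product, Finset.mem_filter, Finset.mem_univ, true_and] at hp hq
    exact hij (hp.1.symm.trans hq.1)

theorem sum_expMult {N : ℕ} (e : Fin m → Fin N) : ∑ i, expMult e i = m := by
  have := Finset.card_eq_sum_card_fiberwise (f := e) (s := Finset.univ) (t := Finset.univ)
    (fun _ _ => Finset.mem_univ _)
  rw [Finset.card_univ, Fintype.card_fin] at this
  exact this.symm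

theorem mul_le_sq_add (c a : ℕ) : (2 * c + 1) * a ≤ a ^ 2 + c * (c + 1) := by
  rcases le_or_gt a c with h | h
  · obtain ⟨b, rfl⟩ := Nat.exists_eq_add_of_le h
    nlinarith [Nat.zero_le b]
  · obtain ⟨b, rfl⟩ := Nat.exists_eq_add_of_lt h
    nlinarith [Nat.zero_le b]

/-- For integers `aᵢ` with sum `m`, the inequality `∑ (aᵢ - c) (aᵢ - c - 1) ≥ 0`. -/
theorem eqPairs_ge {N : ℕ} (e : Fin m → Fin N) (c : ℕ) :
    (2 * c + 1) * m ≤ eqPairs e + N * (c * (c + 1)) := by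
  have h1 := Finset.sum_le_sum fun i (_ : i ∈ Finset.univ) => mul_le_sq_add c (expMult e i)
  rw [← Finset.mul_sum, sum_expMult, Finset.sum_add_distrib, ← eqPairs_eq_sum] at h1
  simpa using h1

theorem expMult_le_of_eqPairs_eq {N : ℕ} {e : Fin m → Fin N} {c : ℕ}
    (he : eqPairs e + N * (c * (c + 1)) ≤ (2 * c + 1) * m) (i : Fin N) : expMult e i < c + 2 := by
  by_contra! hi
  have h1 : ∑ i, (2 * c + 1) * expMult e i < ∑ i, (expMult e i ^ 2 + c * (c + 1)) := by
    refine Finset.sum_lt_sum (fun i _ => mul_le_sq_add c (expMult e i)) ⟨i, Finset.mem_univ i, ?_⟩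
    obtain ⟨b, hb⟩ := Nat.exists_eq_add_of_le hi
    rw [hb]
    nlinarith [Nat.zero_le b]
  rw [← Finset.mul_sum, sum_expMult, Finset.sum_add_distrib, ← eqPairs_eq_sum] at h1
  simp only [Finset.sum_const, Finset.card_univ, Fintype.card_fin, smul_eq_mul] at h1
  omega

theorem card_mul_eqPairs_ge {N : ℕ} (e : Fin m → Fin N) : m ^ 2 ≤ N * eqPairs e := by
  have := sq_sum_le_card_mul_sum_sq (s := Finset.univ) (f := expMult e)
  rwa [sum_expMult, ← eqPairs_eq_sum, Finset.card_univ, Fintype.card_fin] at this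

/-- For `m ≥ 7` even balanced multiplicities have too large a sum of squares. For `m ≥ 8` the
Cauchy–Schwarz inequality suffices, since `1/2 + 1/3 + 1/5 = 31/30`; for `m = 7` the least values are
`25`, `17` and `11`. -/
theorem eqPairs_sum_gt (hm : 7 ≤ m) (e₂ : Fin m → Fin 2) (e₃ : Fin m → Fin 3) (e₅ : Fin m → Fin 5) :
    m ^ 2 + 2 < eqPairs e₂ + eqPairs e₃ + eqPairs e₅ := by
  rcases hm.eq_or_lt with rfl | hm
  · have h2 := eqPairs_ge e₂ 3
    have h3 := eqPairs_ge e₃ 2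
    have h5 := eqPairs_ge e₅ 1
    omega
  · have h2 := card_mul_eqPairs_ge e₂
    have h3 := card_mul_eqPairs_ge e₃
    have h5 := card_mul_eqPairs_ge e₅
    have : 8 * 8 ≤ m ^ 2 := by rw [pow_two]; exact Nat.mul_le_mul hm hm
    omega

theorem pow_fin_add {N : ℕ} [NeZero N] {ζ : kˣ} (hζ : ζ ^ N = 1) (i j : Fin N) :
    ζ ^ (i + j).1 = ζ ^ i.1 * ζ ^ j.1 := by
  rw [Fin.val_add, ← pow_add, ← pow_eq_pow_mod _ hζ]

/-- Diagonal elements whose multiplicities agree up to a shift are conjugate in `PGL_m`. -/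
theorem isConj_rootDiag {N : ℕ} [NeZero N] {ζ : kˣ} (hζ : ζ ^ N = 1) {e e' : Fin m → Fin N}
    (s : Fin N) (h : ∀ i, expMult e i = expMult e' (i + s)) :
    IsConj (rootDiag ζ e : PGL(m, k)) (rootDiag ζ e') := by
  obtain ⟨σ, hσ⟩ := exists_perm_of_card_eq (d := fun j => e j + s) (d' := e') fun i => by
    have h1 := h (i - s)
    rw [sub_add_cancel] at h1
    rw [Nat.card_eq_fintype_card, Nat.card_eq_fintype_card, Fintype.card_subtype,
      Fintype.card_subtype]
    refine Eq.trans ?_ h1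
    simp only [expMult, eq_sub_iff_add_eq]
  let Q : GL (Fin m) k :=
    { val := (1 : Matrix (Fin m) (Fin m) k).submatrix σ.symm id
      inv := (1 : Matrix (Fin m) (Fin m) k).submatrix id σ.symm
      val_inv := by
        rw [← Matrix.submatrix_mul _ _ _ _ _ Function.bijective_id, one_mul,
          Matrix.submatrix_one_equiv]
      inv_val := by
        rw [← Matrix.submatrix_mul _ _ _ _ _ σ.symm.bijective, one_mul, Matrix.submatrix_id_id] }
  refine isConj_iff.2 ⟨ProjGenLinGroup.mk Q, ?_⟩
  rw [mul_inv_eq_iff_eq_mul, rootDiag, rootDiag, ← map_mul, ← map_mul, pgl_mk_eq_mk]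
  refine ⟨ζ ^ s.1, ?_⟩
  rw [Units.val_mul, Units.val_mul, diagGL_val, diagGL_val]
  ext i j
  rw [diagonal_mul, Matrix.smul_apply, mul_diagonal, smul_eq_mul]
  change _ * (1 : Matrix (Fin m) (Fin m) k) (σ.symm i) j =
    _ * ((1 : Matrix (Fin m) (Fin m) k) (σ.symm i) j * _)
  rcases eq_or_ne (σ.symm i) j with rfl | hij
  · have h2 := hσ (σ.symm i)
    rw [Equiv.apply_symm_apply] at h2
    rw [Matrix.one_apply_eq, mul_one, one_mul, h2, pow_fin_add hζ, Units.val_mul, mul_comm]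
  · rw [Matrix.one_apply_ne hij]
    simp

/-- Conjugate diagonal elements of `PGL_m` have the same multiplicities up to a shift. -/
theorem exists_shift_of_isConj {N : ℕ} [NeZero N] {ζ : kˣ} (hζ : IsPrimitiveRoot ζ N) (hm : m ≠ 0)
    {e e' : Fin m → Fin N} (h : IsConj (rootDiag ζ e : PGL(m, k)) (rootDiag ζ e')) :
    ∃ s : Fin N, ∀ i, expMult e i = expMult e' (i + s) := by
  obtain ⟨a, P, ha, haN, hP⟩ := exists_lift_of_isConj_rootDiag hζ.pow_eq_one h
  obtain ⟨u, hu⟩ := pgl_mk_eq_mk.1 ha.symm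
  -- two lifts with trivial `N`-th power differ by a power of `ζ`, which causes the shift
  have huN : u ^ N = 1 := by
    have h1 : (diagGL m k fun i => ζ ^ (e' i).1) ^ N = 1 := by
      rw [← map_pow]
      convert map_one (diagGL m k)
      funext i
      rw [Pi.pow_apply, ← pow_mul, mul_comm, pow_mul, hζ.pow_eq_one, one_pow, Pi.one_apply]
    have h2 := congrArg Units.val h1
    rw [Units.val_pow_eq_pow_val, hu, smul_pow, ← Units.val_pow_eq_pow_val a, haN] at h2
    have := congrFun (congrFun h2 ⟨0, Nat.pos_of_ne_zero hm⟩) ⟨0, Nat.pos_of_ne_zero hm⟩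
    exact Units.ext (by simpa using this)
  have hζ' : IsPrimitiveRoot ζ.1 N := IsPrimitiveRoot.coe_units_iff.2 hζ
  obtain ⟨s, hs, hsu⟩ := hζ'.eq_pow_of_pow_eq_one (ξ := u.1) (by
    rw [← Units.val_pow_eq_pow_val, huN, Units.val_one])
  have hsu : ζ ^ s = u := Units.ext (by rw [← hsu, Units.val_pow_eq_pow_val])
  obtain ⟨σ, hσ⟩ := exists_perm_of_diagonalizations (a := diagonal fun i => (ζ ^ (e' i).1).1)
    (P := P) (d := fun i => (ζ ^ (e i + ⟨s, hs⟩).1).1) (P' := 1)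
    (d' := fun i => (ζ ^ (e' i).1).1) (by
      change (diagGL m k fun i => ζ ^ (e' i).1).1 * P.1 = _
      rw [hu, smul_mul_assoc, hP, ← mul_smul_comm, ← diagonal_smul]
      congr 2
      funext i
      rw [pow_fin_add hζ.pow_eq_one, Units.val_mul, hsu, mul_comm]
      rfl) (by simp)
  refine ⟨⟨s, hs⟩, fun i => ?_⟩
  rw [expMult, expMult]
  refine Finset.card_bij (fun j _ => σ j) ?_ (fun _ _ _ _ h => σ.injective h) ?_
  · intro j hj
    simp only [Finset.mem_filter, Finset.mem_univ, true_and] at hj ⊢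
    rw [← hj]
    exact hζ.units_pow_injective (hσ j)
  · intro j hj
    simp only [Finset.mem_filter, Finset.mem_univ, true_and] at hj
    refine ⟨σ.symm j, ?_, σ.apply_symm_apply j⟩
    simp only [Finset.mem_filter, Finset.mem_univ, true_and]
    have h1 : e' (σ (σ.symm j)) = e (σ.symm j) + ⟨s, hs⟩ := hζ.units_pow_injective (hσ (σ.symm j))
    rw [σ.apply_symm_apply, hj] at h1
    exact (add_right_cancel h1).symm

theorem rootDiag_sq {N : ℕ} [NeZero N] {ζ : kˣ} (hζ : ζ ^ N = 1) (e : Fin m → Fin N) :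
    (rootDiag ζ e : PGL(m, k)) ^ 2 = rootDiag ζ fun j => e j + e j := by
  rw [rootDiag, ← map_pow, ← map_pow, rootDiag]
  congr 2
  funext i
  rw [pow_fin_add hζ, Pi.pow_apply, pow_two]

variable (m) in
/-- The exponents `0, u, 2u, …` modulo `N`. -/
def arithExp (N u : ℕ) [NeZero N] (j : Fin m) : Fin N := Fin.ofNat N (u * j.1)

/-- The exponents whose multiplicities are at most `c + 1` and have square sum `q` agree, up to order
and a shift, with `arithExp m N u` for some `u` in `U`. -/
def BalancedUnique (m N c q : ℕ) [NeZero N] (U : Finset ℕ) : Prop :=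
  ∀ a : Fin N → Fin (c + 2), ∑ i, (a i).1 = m → ∑ i, (a i).1 ^ 2 = q →
    ∃ s : Fin N, ∃ u ∈ U, ∀ i, (a i).1 = expMult (arithExp m N u) (i + s)

instance (m N c q : ℕ) [NeZero N] (U : Finset ℕ) : Decidable (BalancedUnique m N c q U) := by
  unfold BalancedUnique
  infer_instance

theorem BalancedUnique.exists_isConj {N c q : ℕ} [NeZero N] {U : Finset ℕ}
    (h : BalancedUnique m N c q U) (hq : q + N * (c * (c + 1)) = (2 * c + 1) * m)
    {e : Fin m → Fin N} (he : eqPairs e = q) {ζ : kˣ} (hζ : ζ ^ N = 1) :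
    ∃ u ∈ U, IsConj (rootDiag ζ e : PGL(m, k)) (rootDiag ζ (arithExp m N u)) := by
  have h1 := expMult_le_of_eqPairs_eq (e := e) (c := c) (by rw [he, hq])
  obtain ⟨s, u, hu, hs⟩ := h (fun i => ⟨expMult e i, h1 i⟩) (sum_expMult e)
    (by rw [← he, eqPairs_eq_sum])
  exact ⟨u, hu, isConj_rootDiag hζ s hs⟩

/-- The triple of the classes of `diag(1, ζ, ζ², …)`, for `ζ` a primitive root of unity of order
`2`, `3` and of `5`, in the last case with `ζ` replaced by `ζ ^ u`. -/
def balancedTriple (m : ℕ) (ζ₂ ζ₃ ζ₅ : kˣ) (u : ℕ) :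
    ConjClasses (PGL(m, k)) × ConjClasses (PGL(m, k)) × ConjClasses (PGL(m, k)) :=
  (ConjClasses.mk (rootDiag ζ₂ (arithExp m 2 1)), ConjClasses.mk (rootDiag ζ₃ (arithExp m 3 1)),
    ConjClasses.mk (rootDiag ζ₅ (arithExp m 5 u)))

theorem pow_eq_one_of_isConj_rootDiag {N : ℕ} {ζ : kˣ} (hζ : ζ ^ N = 1) {e : Fin m → Fin N}
    {x : PGL(m, k)} (hx : IsConj (rootDiag ζ e) x) : x ^ N = 1 := by
  obtain ⟨a, P, rfl, ha, -⟩ := exists_lift_of_isConj_rootDiag hζ hx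
  rw [← map_pow, ha, map_one]

/-- A regular triple consists of classes of diagonal elements with
`∑ eqPairs = m ^ 2 + 2`. -/
theorem exists_of_mem_regularTriples [IsAlgClosed k] (h2 : (2 : k) ≠ 0) (h3 : (3 : k) ≠ 0)
    (h5 : (5 : k) ≠ 0) {ζ₂ ζ₃ ζ₅ : kˣ} (hζ₂ : IsPrimitiveRoot ζ₂ 2) (hζ₃ : IsPrimitiveRoot ζ₃ 3)
    (hζ₅ : IsPrimitiveRoot ζ₅ 5) {n : ℕ} {C} (hC : C ∈ regularTriples (n + 1) k) :
    ∃ (e₂ : Fin (n + 1) → Fin 2) (e₃ : Fin (n + 1) → Fin 3) (e₅ : Fin (n + 1) → Fin 5),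
      C = (ConjClasses.mk (rootDiag ζ₂ e₂), ConjClasses.mk (rootDiag ζ₃ e₃),
        ConjClasses.mk (rootDiag ζ₅ e₅)) ∧
      eqPairs e₂ + eqPairs e₃ + eqPairs e₅ = (n + 1) ^ 2 + 2 := by
  have h2' : ((2 : ℕ) : k) ≠ 0 := by exact_mod_cast h2
  have h3' : ((3 : ℕ) : k) ≠ 0 := by exact_mod_cast h3
  have h5' : ((5 : ℕ) : k) ≠ 0 := by exact_mod_cast h5
  obtain ⟨C₂, C₃, C₅⟩ := C
  obtain ⟨⟨t2, t3, t5⟩, ν, ν₂, ν₃, ν₅, r, hν, hν₂, hν₃, hν₅, hr, heq⟩ := hC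
  obtain ⟨g₂, rfl⟩ := ConjClasses.mk_surjective C₂
  obtain ⟨g₃, rfl⟩ := ConjClasses.mk_surjective C₃
  obtain ⟨g₅, rfl⟩ := ConjClasses.mk_surjective C₅
  obtain ⟨e₂, he₂⟩ := exists_isConj_rootDiag h2' hζ₂ (t2 g₂ ConjClasses.mem_carrier_mk)
  obtain ⟨e₃, he₃⟩ := exists_isConj_rootDiag h3' hζ₃ (t3 g₃ ConjClasses.mem_carrier_mk)
  obtain ⟨e₅, he₅⟩ := exists_isConj_rootDiag h5' hζ₅ (t5 g₅ ConjClasses.mem_carrier_mk)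
  have n2 := (hasNu_of_isConj_rootDiag h2 h2' hζ₂ he₂ ν₂).1 (hν₂ g₂ ConjClasses.mem_carrier_mk)
  have n3 := (hasNu_of_isConj_rootDiag h2 h3' hζ₃ he₃ ν₃).1 (hν₃ g₃ ConjClasses.mem_carrier_mk)
  have n5 := (hasNu_of_isConj_rootDiag h2 h5' hζ₅ he₅ ν₅).1 (hν₅ g₅ ConjClasses.mem_carrier_mk)
  have nν := (hasNu_top_iff h2).1 hν
  have nr := (hasRank_top_iff h2).1 hr
  refine ⟨e₂, e₃, e₅, ?_, ?_⟩
  · rw [ConjClasses.mk_eq_mk_iff_isConj.2 he₂, ConjClasses.mk_eq_mk_iff_isConj.2 he₃,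
      ConjClasses.mk_eq_mk_iff_isConj.2 he₅]
  · have : ν = ν₂ + ν₃ + ν₅ + n := by omega
    omega

theorem mem_regularTriples [IsAlgClosed k] (h2 : (2 : k) ≠ 0) (h3 : (3 : k) ≠ 0)
    (h5 : (5 : k) ≠ 0) {ζ₂ ζ₃ ζ₅ : kˣ} (hζ₂ : IsPrimitiveRoot ζ₂ 2) (hζ₃ : IsPrimitiveRoot ζ₃ 3)
    (hζ₅ : IsPrimitiveRoot ζ₅ 5) {n : ℕ} (e₂ : Fin (n + 1) → Fin 2) (e₃ : Fin (n + 1) → Fin 3)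
    (e₅ : Fin (n + 1) → Fin 5) (ν₂ ν₃ ν₅ : ℕ) (n2 : 2 * ν₂ + (n + 1) = eqPairs e₂)
    (n3 : 2 * ν₃ + (n + 1) = eqPairs e₃) (n5 : 2 * ν₅ + (n + 1) = eqPairs e₅)
    (h : eqPairs e₂ + eqPairs e₃ + eqPairs e₅ = (n + 1) ^ 2 + 2) :
    (ConjClasses.mk (rootDiag ζ₂ e₂), ConjClasses.mk (rootDiag ζ₃ e₃),
      ConjClasses.mk (rootDiag ζ₅ e₅)) ∈ regularTriples (n + 1) k := by
  have h2' : ((2 : ℕ) : k) ≠ 0 := by exact_mod_cast h2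
  have h3' : ((3 : ℕ) : k) ≠ 0 := by exact_mod_cast h3
  have h5' : ((5 : ℕ) : k) ≠ 0 := by exact_mod_cast h5
  have hc {N : ℕ} {ζ : kˣ} {e : Fin (n + 1) → Fin N} {g : PGL(Fin (n + 1), k)}
      (hg : g ∈ (ConjClasses.mk (rootDiag ζ e)).carrier) : IsConj (rootDiag ζ e) g :=
    (ConjClasses.mk_eq_mk_iff_isConj.1 (ConjClasses.mem_carrier_iff_mk_eq.1 hg)).symm
  refine ⟨⟨fun g hg => pow_eq_one_of_isConj_rootDiag hζ₂.pow_eq_one (hc hg),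
    fun g hg => pow_eq_one_of_isConj_rootDiag hζ₃.pow_eq_one (hc hg),
    fun g hg => pow_eq_one_of_isConj_rootDiag hζ₅.pow_eq_one (hc hg)⟩,
    ν₂ + ν₃ + ν₅ + n, ν₂, ν₃, ν₅, n, (hasNu_top_iff h2).2 (by omega),
    fun g hg => (hasNu_of_isConj_rootDiag h2 h2' hζ₂ (hc hg) _).2 n2,
    fun g hg => (hasNu_of_isConj_rootDiag h2 h3' hζ₃ (hc hg) _).2 n3,
    fun g hg => (hasNu_of_isConj_rootDiag h2 h5' hζ₅ (hc hg) _).2 n5,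
    (hasRank_top_iff h2).2 rfl, by push_cast; ring⟩

/-- If the balanced multiplicities have square sums adding up to the required value, the regular
triples are the balanced ones. -/
theorem regularTriples_eq_image [IsAlgClosed k] (h2 : (2 : k) ≠ 0) (h3 : (3 : k) ≠ 0)
    (h5 : (5 : k) ≠ 0) {ζ₂ ζ₃ ζ₅ : kˣ} (hζ₂ : IsPrimitiveRoot ζ₂ 2) (hζ₃ : IsPrimitiveRoot ζ₃ 3)
    (hζ₅ : IsPrimitiveRoot ζ₅ 5) {n : ℕ} (c₂ c₃ c₅ ν₂ ν₃ ν₅ : ℕ) (U : Finset ℕ)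
    (hν : ν₂ + ν₃ + ν₅ + n = n * (n + 1) / 2)
    (hc₂ : 2 * ν₂ + (n + 1) + 2 * (c₂ * (c₂ + 1)) = (2 * c₂ + 1) * (n + 1))
    (hc₃ : 2 * ν₃ + (n + 1) + 3 * (c₃ * (c₃ + 1)) = (2 * c₃ + 1) * (n + 1))
    (hc₅ : 2 * ν₅ + (n + 1) + 5 * (c₅ * (c₅ + 1)) = (2 * c₅ + 1) * (n + 1))
    (b₂ : BalancedUnique (n + 1) 2 c₂ (2 * ν₂ + (n + 1)) {1})
    (b₃ : BalancedUnique (n + 1) 3 c₃ (2 * ν₃ + (n + 1)) {1})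
    (b₅ : BalancedUnique (n + 1) 5 c₅ (2 * ν₅ + (n + 1)) U)
    (n₂ : 2 * ν₂ + (n + 1) = ∑ i, expMult (arithExp (n + 1) 2 1) i ^ 2)
    (n₃ : 2 * ν₃ + (n + 1) = ∑ i, expMult (arithExp (n + 1) 3 1) i ^ 2)
    (n₅ : ∀ u ∈ U, 2 * ν₅ + (n + 1) = ∑ i, expMult (arithExp (n + 1) 5 u) i ^ 2) :
    regularTriples (n + 1) k = balancedTriple (n + 1) ζ₂ ζ₃ ζ₅ '' U := by
  have hsum : 2 * ν₂ + (n + 1) + (2 * ν₃ + (n + 1)) + (2 * ν₅ + (n + 1)) = (n + 1) ^ 2 + 2 := by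
    have h1 : 2 ∣ n * (n + 1) := (Nat.even_mul_succ_self n).two_dvd
    have h3 : (n + 1) ^ 2 = n * (n + 1) + (n + 1) := by ring
    omega
  ext C
  constructor
  · intro hC
    obtain ⟨e₂, e₃, e₅, rfl, h⟩ := exists_of_mem_regularTriples h2 h3 h5 hζ₂ hζ₃ hζ₅ hC
    have g₂ := eqPairs_ge e₂ c₂
    have g₃ := eqPairs_ge e₃ c₃
    have g₅ := eqPairs_ge e₅ c₅
    obtain ⟨u₂, hu₂, k₂⟩ := b₂.exists_isConj hc₂ (e := e₂) (by omega) hζ₂.pow_eq_one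
    obtain ⟨u₃, hu₃, k₃⟩ := b₃.exists_isConj hc₃ (e := e₃) (by omega) hζ₃.pow_eq_one
    obtain ⟨u, hu, k₅⟩ := b₅.exists_isConj hc₅ (e := e₅) (by omega) hζ₅.pow_eq_one
    rw [Finset.mem_singleton] at hu₂ hu₃
    subst hu₂ hu₃
    refine ⟨u, hu, ?_⟩
    rw [balancedTriple, ← ConjClasses.mk_eq_mk_iff_isConj.2 k₂,
      ← ConjClasses.mk_eq_mk_iff_isConj.2 k₃, ← ConjClasses.mk_eq_mk_iff_isConj.2 k₅]
  · rintro ⟨u, hu, rfl⟩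
    have n₅ := n₅ u hu
    rw [← eqPairs_eq_sum] at n₂ n₃ n₅
    refine mem_regularTriples h2 h3 h5 hζ₂ hζ₃ hζ₅ _ _ _ ν₂ ν₃ ν₅ n₂ n₃ n₅ ?_
    rw [← n₂, ← n₃, ← n₅, hsum]

/-- The position of the `a`-th element of the `i`-th block, for blocks consisting of the indices
congruent modulo `N`. -/
def blockIndex (m N : ℕ) [NeZero m] (l : List ℕ) (x : Σ i : Fin l.length, Fin (l.get i + 1)) :
    Fin m := Fin.ofNat m (x.1.1 + N * x.2.1)

/-- The blocks of equal exponents of size at least `2` have sizes `l + 1`. -/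
def HasBlocks {m N : ℕ} [NeZero m] (e : Fin m → Fin N) (l : List ℕ) : Prop :=
  (∀ x y, blockIndex m N l x = blockIndex m N l y → x = y) ∧
    (∀ i a b, e (blockIndex m N l ⟨i, a⟩) = e (blockIndex m N l ⟨i, b⟩)) ∧
    ∀ i j, i ≠ j → e i = e j →
      ∃ x a b, i = blockIndex m N l ⟨x, a⟩ ∧ j = blockIndex m N l ⟨x, b⟩

instance {m N : ℕ} [NeZero m] (e : Fin m → Fin N) (l : List ℕ) : Decidable (HasBlocks e l) := by
  unfold HasBlocks
  infer_instance

theorem tripleHasType_balancedTriple [IsAlgClosed k] (h2 : (2 : k) ≠ 0) (h3 : (3 : k) ≠ 0)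
    (h5 : (5 : k) ≠ 0) {ζ₂ ζ₃ ζ₅ : kˣ} (hζ₂ : IsPrimitiveRoot ζ₂ 2) (hζ₃ : IsPrimitiveRoot ζ₃ 3)
    (hζ₅ : IsPrimitiveRoot ζ₅ 5) {n u : ℕ} {l₂ l₃ l₅ : List ℕ}
    (b₂ : HasBlocks (arithExp (n + 1) 2 1) l₂) (b₃ : HasBlocks (arithExp (n + 1) 3 1) l₃)
    (b₅ : HasBlocks (arithExp (n + 1) 5 u) l₅) :
    TripleHasType (balancedTriple (n + 1) ζ₂ ζ₃ ζ₅ u) l₂ l₃ l₅ := by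
  have hc {N : ℕ} {ζ : kˣ} {e : Fin (n + 1) → Fin N} {g : PGL(Fin (n + 1), k)}
      (hg : g ∈ (ConjClasses.mk (rootDiag ζ e)).carrier) : IsConj (rootDiag ζ e) g :=
    (ConjClasses.mk_eq_mk_iff_isConj.1 (ConjClasses.mem_carrier_iff_mk_eq.1 hg)).symm
  refine ⟨fun g hg => ?_, fun g hg => ?_, fun g hg => ?_⟩
  · exact rootSystemHasType_of_isConj_rootDiag (by exact_mod_cast h2) hζ₂ (hc hg) _
      (fun x y => b₂.1 x y) b₂.2.1 b₂.2.2
  · exact rootSystemHasType_of_isConj_rootDiag (by exact_mod_cast h3) hζ₃ (hc hg) _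
      (fun x y => b₃.1 x y) b₃.2.1 b₃.2.2
  · exact rootSystemHasType_of_isConj_rootDiag (by exact_mod_cast h5) hζ₅ (hc hg) _
      (fun x y => b₅.1 x y) b₅.2.1 b₅.2.2

/-- Squaring multiplies the exponents of the third class by `2`. -/
theorem iotaTriple_balancedTriple {ζ₂ ζ₃ ζ₅ : kˣ} (hζ₅ : ζ₅ ^ 5 = 1) {u v : ℕ}
    (h : ∃ s, ∀ i, expMult (fun j => arithExp m 5 u j + arithExp m 5 u j) i =
      expMult (arithExp m 5 v) (i + s)) :
    iotaTriple (balancedTriple m ζ₂ ζ₃ ζ₅ u) = balancedTriple m ζ₂ ζ₃ ζ₅ v := by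
  obtain ⟨s, hs⟩ := h
  refine Prod.ext rfl (Prod.ext rfl ?_)
  change ConjClasses.mk (rootDiag ζ₅ (arithExp m 5 u) ^ 2) = ConjClasses.mk _
  rw [rootDiag_sq hζ₅]
  exact ConjClasses.mk_eq_mk_iff_isConj.2 (isConj_rootDiag hζ₅ s hs)

theorem balancedTriple_ne {ζ₂ ζ₃ ζ₅ : kˣ} (hζ₅ : IsPrimitiveRoot ζ₅ 5) (hm : m ≠ 0) {u v : ℕ}
    (h : ¬ ∃ s, ∀ i, expMult (arithExp m 5 u) i = expMult (arithExp m 5 v) (i + s)) :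
    balancedTriple m ζ₂ ζ₃ ζ₅ u ≠ balancedTriple m ζ₂ ζ₃ ζ₅ v := fun he =>
  h (exists_shift_of_isConj hζ₅ hm
    (ConjClasses.mk_eq_mk_iff_isConj.1 (congrArg (fun C => C.2.2) he)))

end TripleClassification

/-! ### The regular triples for each `m` -/

section TripleResults

variable {k : Type*} [Field k] [IsAlgClosed k]

theorem exists_units_isPrimitiveRoot {n : ℕ} (hn : (n : k) ≠ 0) :
    ∃ ζ : kˣ, IsPrimitiveRoot ζ n := by
  have : NeZero (n : k) := ⟨hn⟩
  have hn0 : NeZero n := ⟨by rintro rfl; simp at hn⟩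
  obtain ⟨ζ, hζ⟩ := HasEnoughRootsOfUnity.exists_primitiveRoot k n
  exact ⟨(hζ.isUnit hn0.out).unit, IsPrimitiveRoot.coe_units_iff.1 hζ⟩

set_option maxRecDepth 20000

theorem regularTriples_eq_empty (h2 : (2 : k) ≠ 0) (h3 : (3 : k) ≠ 0) (h5 : (5 : k) ≠ 0) {m : ℕ}
    (hm : 7 ≤ m) : regularTriples m k = ∅ := by
  obtain ⟨ζ₂, hζ₂⟩ := exists_units_isPrimitiveRoot (k := k) (n := 2) (by exact_mod_cast h2)
  obtain ⟨ζ₃, hζ₃⟩ := exists_units_isPrimitiveRoot (k := k) (n := 3) (by exact_mod_cast h3)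
  obtain ⟨ζ₅, hζ₅⟩ := exists_units_isPrimitiveRoot (k := k) (n := 5) (by exact_mod_cast h5)
  obtain ⟨n, rfl⟩ := Nat.exists_eq_add_of_lt (show 0 < m by omega)
  rw [zero_add] at *
  refine Set.eq_empty_iff_forall_notMem.2 fun C hC => ?_
  obtain ⟨e₂, e₃, e₅, -, h⟩ := exists_of_mem_regularTriples h2 h3 h5 hζ₂ hζ₃ hζ₅ hC
  have := eqPairs_sum_gt hm e₂ e₃ e₅
  omega

variable {ζ₂ ζ₃ ζ₅ : kˣ}

theorem regularTriples_two (h2 : (2 : k) ≠ 0) (h3 : (3 : k) ≠ 0) (h5 : (5 : k) ≠ 0)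
    (hζ₂ : IsPrimitiveRoot ζ₂ 2) (hζ₃ : IsPrimitiveRoot ζ₃ 3) (hζ₅ : IsPrimitiveRoot ζ₅ 5) :
    regularTriples 2 k = balancedTriple 2 ζ₂ ζ₃ ζ₅ '' ({1, 2} : Finset ℕ) :=
  regularTriples_eq_image h2 h3 h5 hζ₂ hζ₃ hζ₅ (n := 1) 0 0 0 0 0 0 _ (by decide) (by decide)
    (by decide) (by decide) (by decide) (by decide) (by decide) (by decide) (by decide) (by decide)

theorem regularTriples_three (h2 : (2 : k) ≠ 0) (h3 : (3 : k) ≠ 0) (h5 : (5 : k) ≠ 0)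
    (hζ₂ : IsPrimitiveRoot ζ₂ 2) (hζ₃ : IsPrimitiveRoot ζ₃ 3) (hζ₅ : IsPrimitiveRoot ζ₅ 5) :
    regularTriples 3 k = balancedTriple 3 ζ₂ ζ₃ ζ₅ '' ({1, 2} : Finset ℕ) :=
  regularTriples_eq_image h2 h3 h5 hζ₂ hζ₃ hζ₅ (n := 2) 1 0 0 1 0 0 _ (by decide) (by decide)
    (by decide) (by decide) (by decide) (by decide) (by decide) (by decide) (by decide) (by decide)

theorem regularTriples_four (h2 : (2 : k) ≠ 0) (h3 : (3 : k) ≠ 0) (h5 : (5 : k) ≠ 0)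
    (hζ₂ : IsPrimitiveRoot ζ₂ 2) (hζ₃ : IsPrimitiveRoot ζ₃ 3) (hζ₅ : IsPrimitiveRoot ζ₅ 5) :
    regularTriples 4 k = balancedTriple 4 ζ₂ ζ₃ ζ₅ '' ({1} : Finset ℕ) :=
  regularTriples_eq_image h2 h3 h5 hζ₂ hζ₃ hζ₅ (n := 3) 1 1 0 2 1 0 _ (by decide) (by decide)
    (by decide) (by decide) (by decide) (by decide) (by decide) (by decide) (by decide) (by decide)

theorem regularTriples_five (h2 : (2 : k) ≠ 0) (h3 : (3 : k) ≠ 0) (h5 : (5 : k) ≠ 0)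
    (hζ₂ : IsPrimitiveRoot ζ₂ 2) (hζ₃ : IsPrimitiveRoot ζ₃ 3) (hζ₅ : IsPrimitiveRoot ζ₅ 5) :
    regularTriples 5 k = balancedTriple 5 ζ₂ ζ₃ ζ₅ '' ({1} : Finset ℕ) :=
  regularTriples_eq_image h2 h3 h5 hζ₂ hζ₃ hζ₅ (n := 4) 2 1 0 4 2 0 _ (by decide) (by decide)
    (by decide) (by decide) (by decide) (by decide) (by decide) (by decide) (by decide) (by decide)

theorem regularTriples_six (h2 : (2 : k) ≠ 0) (h3 : (3 : k) ≠ 0) (h5 : (5 : k) ≠ 0)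
    (hζ₂ : IsPrimitiveRoot ζ₂ 2) (hζ₃ : IsPrimitiveRoot ζ₃ 3) (hζ₅ : IsPrimitiveRoot ζ₅ 5) :
    regularTriples 6 k = balancedTriple 6 ζ₂ ζ₃ ζ₅ '' ({1} : Finset ℕ) :=
  regularTriples_eq_image h2 h3 h5 hζ₂ hζ₃ hζ₅ (n := 5) 2 1 1 6 3 1 _ (by decide) (by decide)
    (by decide) (by decide) (by decide) (by decide) (by decide) (by decide) (by decide) (by decide)

/-- For `m = 2, 3` the two choices of the class of order `5` are distinct and interchanged by
squaring. -/
theorem ncard_regularTriples_eq_two (h2 : (2 : k) ≠ 0) (h3 : (3 : k) ≠ 0) (h5 : (5 : k) ≠ 0)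
    {m : ℕ} (hm : m = 2 ∨ m = 3) :
    (regularTriples m k).ncard = 2 ∧
      ∀ C ∈ regularTriples m k, iotaTriple C ∈ regularTriples m k ∧ iotaTriple C ≠ C := by
  obtain ⟨ζ₂, hζ₂⟩ := exists_units_isPrimitiveRoot (k := k) (n := 2) (by exact_mod_cast h2)
  obtain ⟨ζ₃, hζ₃⟩ := exists_units_isPrimitiveRoot (k := k) (n := 3) (by exact_mod_cast h3)
  obtain ⟨ζ₅, hζ₅⟩ := exists_units_isPrimitiveRoot (k := k) (n := 5) (by exact_mod_cast h5)
  have hm0 : m ≠ 0 := by omega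
  have hU : regularTriples m k = balancedTriple m ζ₂ ζ₃ ζ₅ '' ({1, 2} : Finset ℕ) := by
    rcases hm with rfl | rfl
    · exact regularTriples_two h2 h3 h5 hζ₂ hζ₃ hζ₅
    · exact regularTriples_three h2 h3 h5 hζ₂ hζ₃ hζ₅
  have hne : balancedTriple m ζ₂ ζ₃ ζ₅ 1 ≠ balancedTriple m ζ₂ ζ₃ ζ₅ 2 :=
    balancedTriple_ne hζ₅ hm0 (by rcases hm with rfl | rfl <;> decide)
  have h12 : iotaTriple (balancedTriple m ζ₂ ζ₃ ζ₅ 1) = balancedTriple m ζ₂ ζ₃ ζ₅ 2 :=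
    iotaTriple_balancedTriple hζ₅.pow_eq_one (by rcases hm with rfl | rfl <;> decide)
  have h21 : iotaTriple (balancedTriple m ζ₂ ζ₃ ζ₅ 2) = balancedTriple m ζ₂ ζ₃ ζ₅ 1 :=
    iotaTriple_balancedTriple hζ₅.pow_eq_one (by rcases hm with rfl | rfl <;> decide)
  rw [Finset.coe_pair, Set.image_pair] at hU
  rw [hU]
  refine ⟨Set.ncard_pair hne, ?_⟩
  rintro C (rfl | rfl)
  · rw [h12]
    exact ⟨Or.inr rfl, hne.symm⟩
  · rw [h21]
    exact ⟨Or.inl rfl, hne⟩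

theorem ncard_regularTriples_eq_one (h2 : (2 : k) ≠ 0) (h3 : (3 : k) ≠ 0) (h5 : (5 : k) ≠ 0)
    {m : ℕ} (hm : m = 4 ∨ m = 5 ∨ m = 6) : (regularTriples m k).ncard = 1 := by
  obtain ⟨ζ₂, hζ₂⟩ := exists_units_isPrimitiveRoot (k := k) (n := 2) (by exact_mod_cast h2)
  obtain ⟨ζ₃, hζ₃⟩ := exists_units_isPrimitiveRoot (k := k) (n := 3) (by exact_mod_cast h3)
  obtain ⟨ζ₅, hζ₅⟩ := exists_units_isPrimitiveRoot (k := k) (n := 5) (by exact_mod_cast h5)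
  have hU : regularTriples m k = balancedTriple m ζ₂ ζ₃ ζ₅ '' ({1} : Finset ℕ) := by
    rcases hm with rfl | rfl | rfl
    · exact regularTriples_four h2 h3 h5 hζ₂ hζ₃ hζ₅
    · exact regularTriples_five h2 h3 h5 hζ₂ hζ₃ hζ₅
    · exact regularTriples_six h2 h3 h5 hζ₂ hζ₃ hζ₅
  rw [hU, Finset.coe_singleton, Set.image_singleton, Set.ncard_singleton]

theorem tripleHasType_of_mem_regularTriples (h2 : (2 : k) ≠ 0) (h3 : (3 : k) ≠ 0)
    (h5 : (5 : k) ≠ 0) :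
    (∀ C ∈ regularTriples 2 k, TripleHasType C [] [] []) ∧
    (∀ C ∈ regularTriples 3 k, TripleHasType C [1] [] []) ∧
    (∀ C ∈ regularTriples 4 k, TripleHasType C [1, 1] [1] []) ∧
    (∀ C ∈ regularTriples 5 k, TripleHasType C [2, 1] [1, 1] []) ∧
    (∀ C ∈ regularTriples 6 k, TripleHasType C [2, 2] [1, 1, 1] [1]) := by
  obtain ⟨ζ₂, hζ₂⟩ := exists_units_isPrimitiveRoot (k := k) (n := 2) (by exact_mod_cast h2)
  obtain ⟨ζ₃, hζ₃⟩ := exists_units_isPrimitiveRoot (k := k) (n := 3) (by exact_mod_cast h3)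
  obtain ⟨ζ₅, hζ₅⟩ := exists_units_isPrimitiveRoot (k := k) (n := 5) (by exact_mod_cast h5)
  rw [regularTriples_two h2 h3 h5 hζ₂ hζ₃ hζ₅, regularTriples_three h2 h3 h5 hζ₂ hζ₃ hζ₅,
    regularTriples_four h2 h3 h5 hζ₂ hζ₃ hζ₅, regularTriples_five h2 h3 h5 hζ₂ hζ₃ hζ₅,
    regularTriples_six h2 h3 h5 hζ₂ hζ₃ hζ₅]
  simp only [Finset.coe_pair, Finset.coe_singleton, Set.image_pair, Set.image_singleton]
  refine ⟨?_, ?_, ?_, ?_, ?_⟩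
  · rintro C (rfl | rfl)
    · exact tripleHasType_balancedTriple h2 h3 h5 hζ₂ hζ₃ hζ₅ (n := 1) (by decide) (by decide)
        (by decide)
    · exact tripleHasType_balancedTriple h2 h3 h5 hζ₂ hζ₃ hζ₅ (n := 1) (by decide) (by decide)
        (by decide)
  · rintro C (rfl | rfl)
    · exact tripleHasType_balancedTriple h2 h3 h5 hζ₂ hζ₃ hζ₅ (n := 2) (by decide) (by decide)
        (by decide)
    · exact tripleHasType_balancedTriple h2 h3 h5 hζ₂ hζ₃ hζ₅ (n := 2) (by decide) (by decide)
        (by decide)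
  · rintro C rfl
    exact tripleHasType_balancedTriple h2 h3 h5 hζ₂ hζ₃ hζ₅ (n := 3) (by decide) (by decide)
      (by decide)
  · rintro C rfl
    exact tripleHasType_balancedTriple h2 h3 h5 hζ₂ hζ₃ hζ₅ (n := 4) (by decide) (by decide)
      (by decide)
  · rintro C rfl
    exact tripleHasType_balancedTriple h2 h3 h5 hζ₂ hζ₃ hζ₅ (n := 5) (by decide) (by decide)
      (by decide)

end TripleResults

/-! ### The group `𝒜₅`: normal forms, the automorphism `ι` and the double cover -/

section CentralRelations

variable {E : Type*} [Group E] {r t z : E}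

/-- The relation `(r t⁻¹)³ = z`, rewritten as a rule for moving `t⁻¹` past `r`. -/
theorem mul_inv_mul_of_relation (hr : r * r = z) (hz : ∀ x, z * x = x * z)
    (hs : (r * t⁻¹) ^ 3 = z) : r * t⁻¹ * r = t * r * t := by
  have h : r * t⁻¹ * r * (t⁻¹ * r * t⁻¹) = r * r := by
    rw [hr, ← hs, pow_succ, pow_two]
    group
  have h2 : r * t⁻¹ * r = r * r * (t * r⁻¹ * t) := by
    rw [← h]
    group
  rw [h2, hr, ← mul_assoc, ← mul_assoc, hz t, mul_assoc t z, ← hr]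
  group

theorem mul_mul_of_relation (hr : r * r = z) (hz : ∀ x, z * x = x * z)
    (hs : (r * t⁻¹) ^ 3 = z) : r * t * r = z * t⁻¹ * r * t⁻¹ := by
  have h := mul_inv_mul_of_relation hr hz hs
  have h1 : r * (r * t⁻¹ * r) * r * r⁻¹ * t⁻¹ = r * (t * r * t) * t⁻¹ := by
    rw [h]
    group
  have h2 : r * (r * t⁻¹ * r) * r * r⁻¹ * t⁻¹ = r * r * t⁻¹ * r * t⁻¹ := by group
  rw [h2, hr] at h1
  rw [h1]
  group

variable (r t) in
/-- In `𝒜₅`, the involution `r t² r t⁻² r` normalizes the subgroup generated by `t = x₅`. -/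
def normalizingWord : E := r * t ^ 2 * r * (t ^ 2)⁻¹ * r

theorem normalizingWord_mul (hr : r * r = z) (hz : ∀ x, z * x = x * z)
    (hs : (r * t⁻¹) ^ 3 = z) (ht : t ^ 5 = z) :
    t * normalizingWord r t * t = normalizingWord r t := by
  have ha := mul_inv_mul_of_relation hr hz hs
  have hb := mul_mul_of_relation hr hz hs
  have h3 : (t ^ 3)⁻¹ = z⁻¹ * t ^ 2 := by
    rw [← ht]
    group
  -- the element `r t⁻² r t² r`, which equals both `t w` and `w t⁻¹`
  have hu : t * normalizingWord r t = r * (t ^ 2)⁻¹ * r * t ^ 2 * r := by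
    calc t * normalizingWord r t = (t * r * t) * t * r * (t ^ 2)⁻¹ * r := by
          rw [normalizingWord, pow_two]
          group
      _ = r * t⁻¹ * (r * t * r) * (t ^ 2)⁻¹ * r := by
          rw [← ha]
          group
      _ = r * (t⁻¹ * z) * t⁻¹ * r * (t ^ 3)⁻¹ * r := by
          rw [hb]
          group
      _ = r * z * (t ^ 2)⁻¹ * r * (z⁻¹ * t ^ 2) * r := by
          rw [h3, ← hz t⁻¹]
          group
      _ = r * (z * ((t ^ 2)⁻¹ * r)) * z⁻¹ * t ^ 2 * r := by group
      _ = _ := by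
          rw [hz]
          group
  rw [hu]
  calc r * (t ^ 2)⁻¹ * r * t ^ 2 * r * t = r * (t ^ 2)⁻¹ * r * t * (t * r * t) := by
        simp only [pow_two, mul_assoc]
    _ = r * (t ^ 2)⁻¹ * (r * t * r) * t⁻¹ * r := by
        rw [← ha]
        group
    _ = r * ((t ^ 2)⁻¹ * z) * t⁻¹ * r * (t ^ 2)⁻¹ * r := by
        rw [hb]
        group
    _ = r * z * (t ^ 3)⁻¹ * r * (t ^ 2)⁻¹ * r := by
        rw [← hz (t ^ 2)⁻¹]
        group
    _ = r * (z * z⁻¹) * t ^ 2 * r * (t ^ 2)⁻¹ * r := by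
        rw [h3]
        group
    _ = normalizingWord r t := by
        rw [normalizingWord]
        group

/-- In the binary icosahedral group the central element has order dividing `2`, because
`t = x₅` is conjugate to its inverse. -/
theorem sq_eq_one_of_relations {a b c : E} (h2 : a ^ 2 = z) (h3 : b ^ 3 = z) (h5 : c ^ 5 = z)
    (h : a * b * c = z) : z ^ 2 = 1 := by
  have hb : b = a * c⁻¹ := by
    have : a⁻¹ * (a * b * c) * c⁻¹ = a⁻¹ * (a ^ 2) * c⁻¹ := by rw [h, h2]
    calc b = a⁻¹ * (a * b * c) * c⁻¹ := by group
      _ = a * c⁻¹ := by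
        rw [this]
        group
  have hza : a * z = z * a := by rw [← h2]; group
  have hzc : c * z = z * c := by rw [← h5]; group
  -- `z` commutes with `a` and `c`; the lemmas above apply in the subgroup generated by them
  let K : Subgroup E := Subgroup.closure {a, c}
  have ha : a ∈ K := Subgroup.subset_closure (by simp)
  have hc : c ∈ K := Subgroup.subset_closure (by simp)
  have hzK : z ∈ K := h2 ▸ K.pow_mem ha 2
  have hcent : ∀ x : K, (⟨z, hzK⟩ : K) * x = x * ⟨z, hzK⟩ := by
    have : K ≤ Subgroup.centralizer {z} := by
      rw [Subgroup.closure_le]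
      rintro x (rfl | rfl)
      · exact Subgroup.mem_centralizer_singleton_iff.2 hza
      · exact Subgroup.mem_centralizer_singleton_iff.2 hzc
    exact fun x => Subtype.ext (Subgroup.mem_centralizer_singleton_iff.1 (this x.2)).symm
  have key := normalizingWord_mul (r := (⟨a, ha⟩ : K)) (t := ⟨c, hc⟩) (z := ⟨z, hzK⟩)
    (Subtype.ext (by simpa [pow_two] using h2)) hcent
    (Subtype.ext (by simpa [← hb] using h3)) (Subtype.ext (by simpa using h5))
  set w := normalizingWord (⟨a, ha⟩ : K) ⟨c, hc⟩
  set t : K := ⟨c, hc⟩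
  have hinv : w * t * w⁻¹ = t⁻¹ := by
    calc w * t * w⁻¹ = t⁻¹ * (t * w * t) * w⁻¹ := by group
      _ = t⁻¹ := by
        rw [key]
        group
  have h5' : t ^ 5 = ⟨z, hzK⟩ := Subtype.ext (by simpa [t] using h5)
  have hz2 : (⟨z, hzK⟩ : K) = (⟨z, hzK⟩ : K)⁻¹ := by
    calc (⟨z, hzK⟩ : K) = w * ⟨z, hzK⟩ * w⁻¹ := by rw [← hcent]; group
      _ = (w * t * w⁻¹) ^ 5 := by rw [conj_pow, h5']
      _ = _ := by rw [hinv, inv_pow, h5']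
  have hz3 := congrArg Subtype.val hz2
  simp only [Subgroup.coe_inv] at hz3
  rw [pow_two]
  nth_rewrite 2 [hz3]
  exact mul_inv_cancel z

/-- The binary icosahedral group is perfect. -/
theorem eq_one_of_relations {M : Type*} [CommGroup M] {a b c z : M} (h2 : a ^ 2 = z)
    (h3 : b ^ 3 = z) (h5 : c ^ 5 = z) (h : a * b * c = z) : a = 1 ∧ b = 1 ∧ c = 1 := by
  have ha : a = b * c := by
    rw [← h2, pow_two, mul_assoc] at h
    exact (mul_left_cancel h).symm
  have hb : b = c ^ 2 := by
    have : b * (b * c) * c = b ^ 3 := by rw [h3, ← h, ha]; simp only [mul_comm, mul_left_comm]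
    have h4 : b ^ 2 * c ^ 2 = b ^ 2 * b := by
      rw [← pow_succ, ← this]
      simp only [pow_two, mul_comm, mul_left_comm]
    exact (mul_left_cancel h4).symm
  have hc : c = 1 := by
    have h6 : (c ^ 2) ^ 3 = c ^ 5 := by rw [← hb, h3, h5]
    rw [← pow_mul] at h6
    have h7 : c ^ 5 * c = c ^ 5 * 1 := by rw [← pow_succ, mul_one]; exact h6
    exact mul_left_cancel h7
  rw [hc, one_pow] at hb
  rw [hb, hc, one_mul] at ha
  exact ⟨ha, hb, hc⟩

end CentralRelations

namespace A5

set_option maxRecDepth 10000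

theorem x2_sq : x2 ^ 2 = 1 :=
  PresentedGroup.one_of_mem (rels := a5Rels) (x := FreeGroup.of A5Gen.x2 ^ 2) (by simp [a5Rels])

theorem x3_pow : x3 ^ 3 = 1 :=
  PresentedGroup.one_of_mem (rels := a5Rels) (x := FreeGroup.of A5Gen.x3 ^ 3) (by simp [a5Rels])

theorem x5_pow : x5 ^ 5 = 1 :=
  PresentedGroup.one_of_mem (rels := a5Rels) (x := FreeGroup.of A5Gen.x5 ^ 5) (by simp [a5Rels])

theorem x2_mul_x3_mul_x5 : x2 * x3 * x5 = 1 :=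
  PresentedGroup.one_of_mem (rels := a5Rels)
    (x := FreeGroup.of A5Gen.x2 * FreeGroup.of A5Gen.x3 * FreeGroup.of A5Gen.x5)
    (by simp [a5Rels])

section Lift

variable {G : Type*} [Group G]

/-- The homomorphism from `𝒜₅` defined by the images of the generators. -/
def lift (a b c : G) (h2 : a ^ 2 = 1) (h3 : b ^ 3 = 1) (h5 : c ^ 5 = 1) (h : a * b * c = 1) :
    A5 →* G :=
  PresentedGroup.toGroup (f := fun i => A5Gen.casesOn i a b c) (rels := a5Rels) (by
    rintro x (rfl | rfl | rfl | rfl) <;> simpa)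

variable {a b c : G} {h2 : a ^ 2 = 1} {h3 : b ^ 3 = 1} {h5 : c ^ 5 = 1} {h : a * b * c = 1}

@[simp] theorem lift_x2 : lift a b c h2 h3 h5 h x2 = a := PresentedGroup.toGroup.of _
@[simp] theorem lift_x3 : lift a b c h2 h3 h5 h x3 = b := PresentedGroup.toGroup.of _
@[simp] theorem lift_x5 : lift a b c h2 h3 h5 h x5 = c := PresentedGroup.toGroup.of _

theorem hom_ext {φ ψ : A5 →* G} (h2 : φ x2 = ψ x2) (h3 : φ x3 = ψ x3) (h5 : φ x5 = ψ x5) :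
    φ = ψ :=
  PresentedGroup.ext fun i => by cases i <;> assumption

end Lift

theorem x3_eq : x3 = x2 * x5⁻¹ := by
  have h := x2_mul_x3_mul_x5
  have h2 : x2⁻¹ = x2 := inv_eq_of_mul_eq_one_right (by rw [← pow_two, x2_sq])
  rw [mul_assoc, mul_eq_one_iff_inv_eq, h2] at h
  rw [h, mul_inv_cancel_right]

theorem closure_x2_x5 : Subgroup.closure {x2, x5} = ⊤ := by
  rw [eq_top_iff, ← PresentedGroup.closure_range_of a5Rels, Subgroup.closure_le]
  have h2 : x2 ∈ Subgroup.closure {x2, x5} := Subgroup.subset_closure (by simp)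
  have h5 : x5 ∈ Subgroup.closure {x2, x5} := Subgroup.subset_closure (by simp)
  rintro _ ⟨i, rfl⟩
  cases i
  · exact h2
  · change x3 ∈ _
    rw [x3_eq]
    exact mul_mem h2 (inv_mem h5)
  · exact h5

/-- The `60` normal forms of the elements of `𝒜₅`: a power of `x₅` times one of the representatives
`1`, `x₂ x₅ᵇ`, `x₂ x₅² x₂ x₅ᵇ` and the normalizing word of the right cosets of `⟨x₅⟩`. -/
abbrev NormalForm : Type := Fin 5 × (Unit ⊕ Fin 5 ⊕ Fin 5 ⊕ Unit)

/-- The value of a normal form in a group with elements `r`, `t`. -/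
def NormalForm.eval {G : Type*} [Group G] (r t : G) : NormalForm → G
  | (a, .inl _) => t ^ a.1
  | (a, .inr (.inl b)) => t ^ a.1 * r * t ^ b.1
  | (a, .inr (.inr (.inl b))) => t ^ a.1 * r * t ^ 2 * r * t ^ b.1
  | (a, .inr (.inr (.inr _))) => t ^ a.1 * normalizingWord r t

theorem NormalForm.map_eval {G H : Type*} [Group G] [Group H] (f : G →* H) (r t : G)
    (n : NormalForm) : f (n.eval r t) = n.eval (f r) (f t) := by
  rcases n with ⟨a, _ | b | b | _⟩ <;> simp [eval, normalizingWord]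

theorem exists_zpow_eq_pow_fin (n : ℤ) : ∃ a : Fin 5, x5 ^ n = x5 ^ a.1 := by
  refine ⟨⟨(n % 5).toNat, by omega⟩, ?_⟩
  rw [← zpow_natCast, Int.toNat_of_nonneg (by omega)]
  conv_lhs => rw [← Int.mul_ediv_add_emod n 5]
  rw [zpow_add, zpow_mul, show x5 ^ (5 : ℤ) = 1 by exact_mod_cast x5_pow, one_zpow, one_mul]

theorem exists_normalForm_of_zpow {r t : A5} (ht : x5 = t) {x : A5} (h : (∃ a : ℤ, x = t ^ a) ∨
    (∃ a b : ℤ, x = t ^ a * r * t ^ b) ∨ (∃ a b : ℤ, x = t ^ a * r * t ^ 2 * r * t ^ b) ∨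
    ∃ a : ℤ, x = t ^ a * normalizingWord r t) : ∃ n : NormalForm, n.eval r t = x := by
  subst ht
  rcases h with ⟨a, rfl⟩ | ⟨a, b, rfl⟩ | ⟨a, b, rfl⟩ | ⟨a, rfl⟩
  · obtain ⟨a', ha⟩ := exists_zpow_eq_pow_fin a
    exact ⟨(a', .inl ()), by rw [ha]; rfl⟩
  · obtain ⟨a', ha⟩ := exists_zpow_eq_pow_fin a
    obtain ⟨b', hb⟩ := exists_zpow_eq_pow_fin b
    exact ⟨(a', .inr (.inl b')), by rw [ha, hb]; rfl⟩
  · obtain ⟨a', ha⟩ := exists_zpow_eq_pow_fin a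
    obtain ⟨b', hb⟩ := exists_zpow_eq_pow_fin b
    exact ⟨(a', .inr (.inr (.inl b'))), by rw [ha, hb]; rfl⟩
  · obtain ⟨a', ha⟩ := exists_zpow_eq_pow_fin a
    exact ⟨(a', .inr (.inr (.inr ()))), by rw [ha]; rfl⟩

/-- Every element of `𝒜₅` has a normal form: the set of normal forms is stable under right
multiplication by the generators. -/
theorem exists_normalForm (x : A5) : ∃ n : NormalForm, n.eval x2 x5 = x := by
  have hr : x2 * x2 = 1 := by rw [← pow_two, x2_sq]
  have hz : ∀ x : A5, 1 * x = x * 1 := by simp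
  have hs : (x2 * x5⁻¹) ^ 3 = 1 := by rw [← x3_eq, x3_pow]
  have h1 := mul_inv_mul_of_relation hr hz hs
  have h2 := mul_mul_of_relation hr hz hs
  rw [one_mul] at h2
  have hw := normalizingWord_mul hr hz hs x5_pow
  have h5 := x5_pow
  have hx : x ∈ Subgroup.closure {x2, x5} := by rw [closure_x2_x5]; trivial
  generalize x2 = r at *
  generalize ht : x5 = t at *
  have hn : (t ^ 2)⁻¹ = t ^ 3 := inv_eq_of_mul_eq_one_right (by rw [← pow_add]; exact h5)
  have hn3 : (t ^ 3)⁻¹ = t ^ 2 := by rw [← hn, inv_inv]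
  have hn4 : t⁻¹ = t ^ 4 := inv_eq_of_mul_eq_one_right (by rw [← pow_succ']; exact h5)
  -- rewriting rules for `r tᵇ r`
  have h3 : r * t ^ 2 * r = t⁻¹ * r * t ^ 3 * r * t⁻¹ := by
    calc r * t ^ 2 * r = r * t * (r * r) * t * r := by rw [hr]; simp only [pow_two, mul_assoc, mul_one]
      _ = (r * t * r) * (r * t * r) := by group
      _ = t⁻¹ * r * (t ^ 2)⁻¹ * r * t⁻¹ := by rw [h2]; group
      _ = _ := by rw [hn]
  have h4 : r * t ^ 3 * r = t * r * t ^ 2 * r * t := by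
    calc r * t ^ 3 * r = t * (t⁻¹ * r * t ^ 3 * r * t⁻¹) * t := by group
      _ = _ := by rw [← h3]; group
  have h6 : r * t ^ 2 * r * t ^ 2 * r = t⁻¹ * r * t ^ 2 * r * t⁻¹ := by
    calc r * t ^ 2 * r * t ^ 2 * r = t⁻¹ * r * (t ^ 2)⁻¹ * (r * t * r) := by
          rw [h3, hn]; group
      _ = t⁻¹ * r * (t ^ 3)⁻¹ * r * t⁻¹ := by rw [h2]; group
      _ = _ := by rw [hn3]
  have hwt : normalizingWord r t * t = t⁻¹ * normalizingWord r t := by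
    nth_rewrite 2 [← hw]
    group
  have hwr : normalizingWord r t = r * t ^ 2 * r * t ^ 3 * r := by rw [normalizingWord, hn]
  have hmulr : ∀ x : A5, (∃ n : NormalForm, n.eval r t = x) →
      ∃ n : NormalForm, n.eval r t = x * r := by
    rintro _ ⟨⟨a, _ | b | b | _⟩, rfl⟩
    · refine exists_normalForm_of_zpow ht (Or.inr (Or.inl ⟨a, 0, ?_⟩))
      simp [NormalForm.eval]
    · fin_cases b
      · refine exists_normalForm_of_zpow ht (Or.inl ⟨a, ?_⟩)
        simp [NormalForm.eval, mul_assoc, hr]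
      · refine exists_normalForm_of_zpow ht (Or.inr (Or.inl ⟨a - 1, -1, ?_⟩))
        calc t ^ a.1 * r * t ^ 1 * r = t ^ a.1 * (r * t * r) := by group
          _ = _ := by rw [h2]; group
      · refine exists_normalForm_of_zpow ht (Or.inr (Or.inr (Or.inl ⟨a, 0, ?_⟩)))
        simp [NormalForm.eval]
      · refine exists_normalForm_of_zpow ht (Or.inr (Or.inr (Or.inl ⟨a + 1, 1, ?_⟩)))
        calc t ^ a.1 * r * t ^ 3 * r = t ^ a.1 * (r * t ^ 3 * r) := by group
          _ = _ := by rw [h4]; group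
      · refine exists_normalForm_of_zpow ht (Or.inr (Or.inl ⟨a + 1, 1, ?_⟩))
        calc t ^ a.1 * r * t ^ 4 * r = t ^ a.1 * (r * t⁻¹ * r) := by rw [hn4]; group
          _ = _ := by rw [h1]; group
    · fin_cases b
      · refine exists_normalForm_of_zpow ht (Or.inr (Or.inl ⟨a, 2, ?_⟩))
        calc t ^ a.1 * r * t ^ 2 * r * t ^ 0 * r = t ^ a.1 * r * t ^ 2 * (r * r) := by group
          _ = _ := by rw [hr]; group
      · refine exists_normalForm_of_zpow ht (Or.inr (Or.inl ⟨a - 1, -2, ?_⟩))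
        calc t ^ a.1 * r * t ^ 2 * r * t ^ 1 * r = t ^ a.1 * r * t ^ 2 * (r * t * r) := by group
          _ = t ^ a.1 * r * t * (t * t⁻¹) * r * t⁻¹ := by
              rw [h2]
              simp only [pow_two, mul_assoc]
          _ = t ^ a.1 * (r * t * r) * t⁻¹ := by group
          _ = _ := by rw [h2]; group
      · refine exists_normalForm_of_zpow ht (Or.inr (Or.inr (Or.inl ⟨a - 1, -1, ?_⟩)))
        calc t ^ a.1 * r * t ^ 2 * r * t ^ 2 * r = t ^ a.1 * (r * t ^ 2 * r * t ^ 2 * r) := by group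
          _ = _ := by rw [h6]; group
      · refine exists_normalForm_of_zpow ht (Or.inr (Or.inr (Or.inr ⟨a, ?_⟩)))
        calc t ^ a.1 * r * t ^ 2 * r * t ^ 3 * r = t ^ a.1 * (r * t ^ 2 * r * t ^ 3 * r) := by group
          _ = _ := by rw [← hwr]; group
      · refine exists_normalForm_of_zpow ht (Or.inr (Or.inr (Or.inl ⟨a + 1, 1 + 1, ?_⟩)))
        calc t ^ a.1 * r * t ^ 2 * r * t ^ 4 * r = t ^ a.1 * r * t ^ 2 * (r * t⁻¹ * r) := by
              rw [hn4]; group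
          _ = t ^ a.1 * (r * t ^ 3 * r) * t := by rw [h1]; group
          _ = _ := by simp only [h4, zpow_add, zpow_one, zpow_natCast, mul_assoc]
    · refine exists_normalForm_of_zpow ht (Or.inr (Or.inr (Or.inl ⟨a, 3, ?_⟩)))
      calc t ^ a.1 * normalizingWord r t * r = t ^ a.1 * r * t ^ 2 * r * t ^ 3 * (r * r) := by
            rw [hwr]; group
        _ = _ := by rw [hr]; group
  have hmult : ∀ (x : A5) (c : ℤ), c = 1 ∨ c = -1 → (∃ n : NormalForm, n.eval r t = x) →
      ∃ n : NormalForm, n.eval r t = x * t ^ c := by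
    rintro _ c hc ⟨⟨a, _ | b | b | _⟩, rfl⟩
    · refine exists_normalForm_of_zpow ht (Or.inl ⟨a + c, ?_⟩)
      rw [zpow_add]; rfl
    · refine exists_normalForm_of_zpow ht (Or.inr (Or.inl ⟨a, b + c, ?_⟩))
      rw [zpow_add, ← mul_assoc]; rfl
    · refine exists_normalForm_of_zpow ht (Or.inr (Or.inr (Or.inl ⟨a, b + c, ?_⟩)))
      rw [zpow_add, ← mul_assoc]; rfl
    · refine exists_normalForm_of_zpow ht (Or.inr (Or.inr (Or.inr ⟨a - c, ?_⟩)))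
      rw [NormalForm.eval, zpow_sub, mul_assoc, mul_assoc, zpow_natCast]
      congr 1
      rcases hc with rfl | rfl
      · rw [zpow_one, hwt]
      · rw [zpow_neg_one, inv_inv, mul_inv_eq_iff_eq_mul, mul_assoc, hwt, mul_inv_cancel_left]
  induction hx using Subgroup.closure_induction_right with
  | one => exact ⟨(0, .inl ()), pow_zero _⟩
  | mul_right x hx y hy ih =>
    rcases hy with rfl | rfl
    · exact hmulr x ih
    · simpa using hmult x 1 (Or.inl rfl) ih
  | mul_inv_cancel x hx y hy ih =>
    rcases hy with rfl | rfl
    · rw [inv_eq_of_mul_eq_one_right hr]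
      exact hmulr x ih
    · simpa using hmult x (-1) (Or.inr rfl) ih

/-- A homomorphism from `𝒜₅` is injective if no nontrivial normal form is in its kernel. -/
theorem injective_of_normalForm {G : Type*} [Group G] (f : A5 →* G)
    (h : ∀ n : NormalForm, n.eval (f x2) (f x5) = 1 → n = (0, .inl ())) :
    Function.Injective f := by
  refine (injective_iff_map_eq_one f).2 fun x hx => ?_
  obtain ⟨n, rfl⟩ := exists_normalForm x
  rw [NormalForm.map_eval] at hx
  rw [h n hx]
  exact pow_zero _

/-- The embedding of `𝒜₅` into the symmetric group on five letters. -/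
def toPerm : A5 →* Equiv.Perm (Fin 5) :=
  lift (Equiv.swap 1 2 * Equiv.swap 3 4)
    (Equiv.swap 1 2 * Equiv.swap 3 4 * (Equiv.addRight (1 : Fin 5))⁻¹) (Equiv.addRight (1 : Fin 5))
    (by decide) (by decide) (by decide) (by decide)

theorem toPerm_x2 : toPerm x2 = Equiv.swap 1 2 * Equiv.swap 3 4 := lift_x2
theorem toPerm_x5 : toPerm x5 = Equiv.addRight (1 : Fin 5) := lift_x5

theorem toPerm_injective : Function.Injective toPerm := by
  refine injective_of_normalForm _ ?_
  rw [toPerm_x2, toPerm_x5]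
  decide

theorem x2_ne_one : x2 ≠ 1 := fun h => by
  have := congrArg toPerm h
  rw [toPerm_x2, map_one] at this
  exact absurd this (by decide)

theorem x5_ne_sq_conj : (x5⁻¹ * x2) * x5 ^ 2 * (x5⁻¹ * x2)⁻¹ ≠ x5 := fun h => by
  have := congrArg toPerm h
  simp only [map_mul, map_inv, map_pow, toPerm_x2, toPerm_x5] at this
  exact absurd this (by decide)

/-- The endomorphism of `𝒜₅` given by conjugation with the transposition `(1 2)`. -/
def iotaHom : A5 →* A5 :=
  lift x2 (x5 ^ 2 * x3 * (x5 ^ 2)⁻¹) ((x5⁻¹ * x2) * x5 ^ 2 * (x5⁻¹ * x2)⁻¹) x2_sq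
    (by rw [conj_pow, x3_pow, mul_one, mul_inv_cancel])
    (by rw [conj_pow, ← pow_mul, mul_comm 2 5, pow_mul, x5_pow, one_pow, mul_one, mul_inv_cancel])
    (toPerm_injective (by
      simp only [map_mul, map_inv, map_pow, x3_eq, toPerm_x2, toPerm_x5, map_one]
      decide))

theorem iotaHom_iotaHom (x : A5) : iotaHom (iotaHom x) = x := by
  have h2 : iotaHom x2 = x2 := lift_x2
  have h5 : iotaHom x5 = (x5⁻¹ * x2) * x5 ^ 2 * (x5⁻¹ * x2)⁻¹ := lift_x5
  have h55 : iotaHom (iotaHom x5) = x5 := toPerm_injective (by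
    rw [h5]
    simp only [map_mul, map_inv, map_pow, h2, h5, toPerm_x2, toPerm_x5]
    decide)
  have h22 : iotaHom (iotaHom x2) = x2 := by rw [h2, h2]
  exact DFunLike.congr_fun (hom_ext (φ := iotaHom.comp iotaHom) (ψ := MonoidHom.id A5) h22
    (by simp [x3_eq, h22, h55]) h55) x

theorem exists_isIota : ∃ ι, IsIota ι := by
  let ι : MulAut A5 :=
    { toFun := iotaHom
      invFun := iotaHom
      left_inv := iotaHom_iotaHom
      right_inv := iotaHom_iotaHom
      map_mul' := map_mul iotaHom }
  have h5 : ι x5 = (x5⁻¹ * x2) * x5 ^ 2 * (x5⁻¹ * x2)⁻¹ := (lift_x5 : iotaHom x5 = _)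
  refine ⟨ι, orderOf_eq_prime (MulEquiv.ext iotaHom_iotaHom) fun h => ?_, ?_, ?_, ?_⟩
  · rw [h] at h5
    exact x5_ne_sq_conj h5.symm
  · exact (lift_x2 : iotaHom x2 = x2) ▸ IsConj.refl x2
  · exact (isConj_iff.2 ⟨x5 ^ 2, (lift_x3 : iotaHom x3 = _).symm⟩).symm
  · exact (isConj_iff.2 ⟨x5⁻¹ * x2, h5.symm⟩).symm

end A5

/-! ### The binary icosahedral group and `SL₂(𝔽₅)` -/

/-- The relators `x₂² = x₃³ = x₅⁵ = x₂x₃x₅` of the binary icosahedral group. -/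
def binRels : Set (FreeGroup A5Gen) :=
  {FreeGroup.of A5Gen.x2 ^ 2 *
      (FreeGroup.of A5Gen.x2 * FreeGroup.of A5Gen.x3 * FreeGroup.of A5Gen.x5)⁻¹,
    FreeGroup.of A5Gen.x3 ^ 3 *
      (FreeGroup.of A5Gen.x2 * FreeGroup.of A5Gen.x3 * FreeGroup.of A5Gen.x5)⁻¹,
    FreeGroup.of A5Gen.x5 ^ 5 *
      (FreeGroup.of A5Gen.x2 * FreeGroup.of A5Gen.x3 * FreeGroup.of A5Gen.x5)⁻¹}

/-- The binary icosahedral group `⟨x₂, x₃, x₅ | x₂² = x₃³ = x₅⁵ = x₂x₃x₅⟩`. -/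
abbrev BinIcos : Type := PresentedGroup binRels

namespace BinIcos

/-- The generator `x₂`. -/
def x2 : BinIcos := PresentedGroup.of A5Gen.x2
/-- The generator `x₃`. -/
def x3 : BinIcos := PresentedGroup.of A5Gen.x3
/-- The generator `x₅`. -/
def x5 : BinIcos := PresentedGroup.of A5Gen.x5
/-- The central element `x₂x₃x₅`. -/
def z : BinIcos := x2 * x3 * x5

theorem x2_sq : x2 ^ 2 = z := mul_inv_eq_one.1
  (PresentedGroup.one_of_mem (rels := binRels) (x := FreeGroup.of A5Gen.x2 ^ 2 * _) (Or.inl rfl))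

theorem x3_pow : x3 ^ 3 = z := mul_inv_eq_one.1
  (PresentedGroup.one_of_mem (rels := binRels) (x := FreeGroup.of A5Gen.x3 ^ 3 * _)
    (Or.inr (Or.inl rfl)))

theorem x5_pow : x5 ^ 5 = z := mul_inv_eq_one.1
  (PresentedGroup.one_of_mem (rels := binRels) (x := FreeGroup.of A5Gen.x5 ^ 5 * _)
    (Or.inr (Or.inr rfl)))

theorem z_sq : z ^ 2 = 1 := sq_eq_one_of_relations x2_sq x3_pow x5_pow rfl

section Lift

variable {G : Type*} [Group G]

/-- The homomorphism from the binary icosahedral group defined by the images of the generators. -/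
def lift (a b c : G) (h2 : a ^ 2 = a * b * c) (h3 : b ^ 3 = a * b * c) (h5 : c ^ 5 = a * b * c) :
    BinIcos →* G :=
  PresentedGroup.toGroup (f := fun i => A5Gen.casesOn i a b c) (rels := binRels) (by
    rintro x (rfl | rfl | rfl)
    · simpa using mul_inv_eq_one.2 h2
    · simpa using mul_inv_eq_one.2 h3
    · simpa using mul_inv_eq_one.2 h5)

variable {a b c : G} {h2 : a ^ 2 = a * b * c} {h3 : b ^ 3 = a * b * c} {h5 : c ^ 5 = a * b * c}

@[simp] theorem lift_x2 : lift a b c h2 h3 h5 x2 = a := PresentedGroup.toGroup.of _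
@[simp] theorem lift_x3 : lift a b c h2 h3 h5 x3 = b := PresentedGroup.toGroup.of _
@[simp] theorem lift_x5 : lift a b c h2 h3 h5 x5 = c := PresentedGroup.toGroup.of _
@[simp] theorem lift_z : lift a b c h2 h3 h5 z = a * b * c := by simp [z]

theorem hom_ext {φ ψ : BinIcos →* G} (h2 : φ x2 = ψ x2) (h3 : φ x3 = ψ x3) (h5 : φ x5 = ψ x5) :
    φ = ψ :=
  PresentedGroup.ext fun i => by cases i <;> assumption

end Lift

theorem z_mul (x : BinIcos) : z * x = x * z := by
  have h : (⊤ : Subgroup BinIcos) ≤ Subgroup.centralizer {z} := by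
    rw [← PresentedGroup.closure_range_of binRels, Subgroup.closure_le]
    rintro _ ⟨i, rfl⟩
    refine Subgroup.mem_centralizer_singleton_iff.2 ?_
    cases i
    · change x2 * z = z * x2
      rw [← x2_sq]; group
    · change x3 * z = z * x3
      rw [← x3_pow]; group
    · change x5 * z = z * x5
      rw [← x5_pow]; group
  exact (Subgroup.mem_centralizer_singleton_iff.1 (h (Subgroup.mem_top x))).symm

/-- The projection onto `𝒜₅`. -/
def toA5 : BinIcos →* A5 :=
  lift A5.x2 A5.x3 A5.x5 (by rw [A5.x2_sq, A5.x2_mul_x3_mul_x5])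
    (by rw [A5.x3_pow, A5.x2_mul_x3_mul_x5]) (by rw [A5.x5_pow, A5.x2_mul_x3_mul_x5])

@[simp] theorem toA5_x2 : toA5 x2 = A5.x2 := lift_x2
@[simp] theorem toA5_x3 : toA5 x3 = A5.x3 := lift_x3
@[simp] theorem toA5_x5 : toA5 x5 = A5.x5 := lift_x5
@[simp] theorem toA5_z : toA5 z = 1 := by simp [z, A5.x2_mul_x3_mul_x5]

theorem toA5_surjective : Function.Surjective toA5 := fun x => by
  obtain ⟨n, rfl⟩ := A5.exists_normalForm x
  exact ⟨n.eval x2 x5, by rw [A5.NormalForm.map_eval, toA5_x2, toA5_x5]⟩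

/-- The quotient by `z` satisfies the relations of `𝒜₅`. -/
theorem eq_one_or_eq_z_of_toA5 {x : BinIcos} (hx : toA5 x = 1) : x = 1 ∨ x = z := by
  let K := Subgroup.zpowers z
  have : K.Normal := ⟨fun n hn g => by
    obtain ⟨i, rfl⟩ := Subgroup.mem_zpowers_iff.1 hn
    have h : Commute z g := z_mul g
    rwa [← (h.zpow_left i).eq, mul_inv_cancel_right]⟩
  have hz : (QuotientGroup.mk' K) z = 1 := (QuotientGroup.eq_one_iff z).2 (Subgroup.mem_zpowers z)
  let g : A5 →* BinIcos ⧸ K :=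
    A5.lift (QuotientGroup.mk' K x2) (QuotientGroup.mk' K x3) (QuotientGroup.mk' K x5)
      (by rw [← map_pow, x2_sq, hz]) (by rw [← map_pow, x3_pow, hz]) (by rw [← map_pow, x5_pow, hz])
      (by rw [← map_mul, ← map_mul]; exact hz)
  have hg : g.comp toA5 = QuotientGroup.mk' K :=
    hom_ext (by simp [g]) (by simp [g]) (by simp [g])
  have h := DFunLike.congr_fun hg x
  rw [MonoidHom.comp_apply, hx, map_one] at h
  obtain ⟨i, rfl⟩ := Subgroup.mem_zpowers_iff.1 ((QuotientGroup.eq_one_iff x).1 h.symm)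
  rcases Int.even_or_odd' i with ⟨j, rfl | rfl⟩
  · left
    rw [zpow_mul, zpow_ofNat, z_sq, one_zpow]
  · right
    rw [zpow_add, zpow_mul, zpow_ofNat, z_sq, one_zpow, one_mul, zpow_one]

end BinIcos

section SL2

open Matrix

theorem SL2.neg_one_ne_one : (-1 : SL(2, ZMod 5)) ≠ 1 := by decide

/-- The only involution in `SL₂(𝔽₅)` is `-1`. -/
theorem SL2.eq_one_or_eq_neg_one_of_sq {s : SL(2, ZMod 5)} (h : s ^ 2 = 1) : s = 1 ∨ s = -1 := by
  have hs : s = s⁻¹ := eq_inv_of_mul_eq_one_left (by rw [← pow_two, h])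
  have h1 : s.1 = adjugate s.1 := congrArg Subtype.val hs
  rw [adjugate_fin_two] at h1
  have h00 := congrFun (congrFun h1 0) 0
  have h01 := congrFun (congrFun h1 0) 1
  have h10 := congrFun (congrFun h1 1) 0
  simp only [of_apply, cons_val', cons_val_zero, cons_val_one, cons_val_fin_one] at h00 h01 h10
  have hz : ∀ x : ZMod 5, x = -x → x = 0 := by decide
  have hd := s.2
  rw [det_fin_two, hz _ h01, h00] at hd
  have hpm : ∀ x : ZMod 5, x * x - 0 * s.1 1 0 = 1 → x = 1 ∨ x = -1 := by
    intro x hx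
    rw [zero_mul, sub_zero] at hx
    revert x
    decide
  rcases hpm _ hd with h | h
  · left
    refine Subtype.ext (Matrix.ext fun i j => ?_)
    fin_cases i <;> fin_cases j
    · exact h00.trans h
    · exact hz _ h01
    · exact hz _ h10
    · exact h
  · right
    refine Subtype.ext (Matrix.ext fun i j => ?_)
    fin_cases i <;> fin_cases j
    · exact h00.trans h
    · exact (hz _ h01).trans (by simp)
    · exact (hz _ h10).trans (by simp)
    · exact h

/-- The image `(0 -1; 1 0)` of `x₂` in `SL₂(𝔽₅)`. -/
def SL2.r : SL(2, ZMod 5) := ⟨!![0, -1; 1, 0], by decide⟩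
/-- The image `-(1 1; 0 1)` of `x₅` in `SL₂(𝔽₅)`. -/
def SL2.t : SL(2, ZMod 5) := ⟨!![-1, -1; 0, -1], by decide⟩

/-- The upper unitriangular matrix `(1 x; 0 1)`. -/
def SL2.upper (x : ZMod 5) : SL(2, ZMod 5) := ⟨!![1, x; 0, 1], by simp⟩
/-- The lower unitriangular matrix `(1 0; x 1)`. -/
def SL2.lower (x : ZMod 5) : SL(2, ZMod 5) := ⟨!![1, 0; x, 1], by simp⟩

/-- `SL₂(𝔽₅)` is generated by unitriangular matrices: a matrix with lower left entry `c ≠ 0` is a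
product `upper x * lower c * upper y`. -/
theorem SL2.mem_of_elementary {H : Subgroup SL(2, ZMod 5)} (hU : upper 1 ∈ H) (hL : lower 1 ∈ H)
    (s : SL(2, ZMod 5)) : s ∈ H := by
  have hU' : ∀ x : ZMod 5, upper x ∈ H := fun x => by
    have : upper x = upper 1 ^ x.val := by
      revert x
      decide
    exact this ▸ H.pow_mem hU x.val
  have hL' : ∀ x : ZMod 5, lower x ∈ H := fun x => by
    have : lower x = lower 1 ^ x.val := by
      revert x
      decide
    exact this ▸ H.pow_mem hL x.val
  have key : ∀ s : SL(2, ZMod 5), s.1 1 0 ≠ 0 → s ∈ H := fun s hs => by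
    have h : s = upper ((s.1 0 0 - 1) * (s.1 1 0)⁻¹) * lower (s.1 1 0) *
        upper ((s.1 1 1 - 1) * (s.1 1 0)⁻¹) := by
      have := Fact.mk (show Nat.Prime 5 by norm_num)
      have hd := s.2
      rw [det_fin_two] at hd
      have hc : (s.1 1 0)⁻¹ * s.1 1 0 = 1 := inv_mul_cancel₀ hs
      refine Subtype.ext ?_
      change s.1 = !![1, _; 0, 1] * !![1, 0; _, 1] * !![1, _; 0, 1]
      rw [Matrix.mul_fin_two, Matrix.mul_fin_two]
      refine (Matrix.eta_fin_two s.1).trans ?_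
      congr 3
      · linear_combination (1 - s.1 0 0) * hc
      · congr 1
        linear_combination
          -((s.1 0 0 - 1) * (s.1 1 1 - 1) * (s.1 1 0)⁻¹ + s.1 0 1) * hc - (s.1 1 0)⁻¹ * hd
      · congr 1
        · ring
        · congr 1
          linear_combination (1 - s.1 1 1) * hc
    rw [h]
    exact H.mul_mem (H.mul_mem (hU' _) (hL' _)) (hU' _)
  by_cases h : s.1 1 0 = 0
  · have h1 : s * lower 1 ∈ H := key _ (by
      have hd := s.2
      rw [det_fin_two, h, mul_zero, sub_zero] at hd
      change (s.1 * !![1, 0; 1, 1] : Matrix (Fin 2) (Fin 2) (ZMod 5)) 1 0 ≠ 0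
      intro h11
      rw [Matrix.mul_apply, Fin.sum_univ_two, h] at h11
      simp at h11
      rw [h11, mul_zero] at hd
      exact absurd hd (by decide))
    simpa using H.mul_mem h1 (H.inv_mem hL)
  · exact key s h

/-- The isomorphism of the binary icosahedral group with `SL₂(𝔽₅)`, as a homomorphism. -/
def SL2.ofBinIcos : BinIcos →* SL(2, ZMod 5) :=
  BinIcos.lift SL2.r (SL2.r * SL2.t⁻¹) SL2.t (by decide) (by decide) (by decide)

theorem SL2.ofBinIcos_x2 : ofBinIcos BinIcos.x2 = r := BinIcos.lift_x2
theorem SL2.ofBinIcos_x5 : ofBinIcos BinIcos.x5 = t := BinIcos.lift_x5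
theorem SL2.ofBinIcos_z : ofBinIcos BinIcos.z = -1 := by
  rw [← BinIcos.x2_sq, map_pow, ofBinIcos_x2]
  decide

set_option maxRecDepth 10000 in
theorem SL2.eval_normalForm (n : A5.NormalForm) :
    n.eval r t = 1 ∨ n.eval r t = -1 → n = (0, .inl ()) := by
  revert n
  decide

theorem SL2.ofBinIcos_bijective : Function.Bijective ofBinIcos := by
  constructor
  · refine (injective_iff_map_eq_one _).2 fun x hx => ?_
    obtain ⟨n, hn⟩ := A5.exists_normalForm (BinIcos.toA5 x)
    have h1 : BinIcos.toA5 (x * (n.eval BinIcos.x2 BinIcos.x5)⁻¹) = 1 := by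
      rw [map_mul, map_inv, A5.NormalForm.map_eval, BinIcos.toA5_x2, BinIcos.toA5_x5, hn,
        mul_inv_cancel]
    have h2 : ofBinIcos (n.eval BinIcos.x2 BinIcos.x5) = n.eval r t := by
      rw [A5.NormalForm.map_eval, ofBinIcos_x2, ofBinIcos_x5]
    have h3 : n = (0, .inl ()) := eval_normalForm n (by
      rcases BinIcos.eq_one_or_eq_z_of_toA5 h1 with h | h
      · left
        rw [← h2, ← mul_inv_eq_one.1 h, hx]
      · right
        have h4 := congrArg ofBinIcos (mul_inv_eq_iff_eq_mul.1 h)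
        rw [map_mul, ofBinIcos_z, h2, hx, neg_one_mul] at h4
        rw [h4, neg_neg])
    rw [h3] at hn
    rcases BinIcos.eq_one_or_eq_z_of_toA5 (hn.symm.trans (pow_zero _)) with h | h
    · exact h
    · rw [h, ofBinIcos_z] at hx
      exact absurd hx neg_one_ne_one
  · intro s
    refine mem_of_elementary (H := ofBinIcos.range) ⟨BinIcos.z * BinIcos.x5, ?_⟩
      ⟨BinIcos.x2 * (BinIcos.z * BinIcos.x5)⁻¹ * BinIcos.x2⁻¹, ?_⟩ s
    · rw [map_mul, ofBinIcos_z, ofBinIcos_x5]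
      decide
    · rw [map_mul, map_mul, map_inv, map_inv, map_mul, ofBinIcos_z, ofBinIcos_x5, ofBinIcos_x2]
      decide

theorem A5.exists_isDoubleCover : ∃ pr, A5.IsDoubleCover pr := by
  let e := MulEquiv.ofBijective SL2.ofBinIcos SL2.ofBinIcos_bijective
  refine ⟨BinIcos.toA5.comp e.symm.toMonoidHom, BinIcos.toA5_surjective.comp e.symm.surjective,
    fun s => ?_⟩
  obtain ⟨x, rfl⟩ := e.surjective s
  have hz : e BinIcos.z = -1 := SL2.ofBinIcos_z
  rw [← hz, ← map_one e, e.injective.eq_iff, e.injective.eq_iff]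
  change BinIcos.toA5 (e.symm (e x)) = 1 ↔ _
  rw [e.symm_apply_apply]
  refine ⟨BinIcos.eq_one_or_eq_z_of_toA5, ?_⟩
  rintro (rfl | rfl)
  · exact map_one _
  · exact BinIcos.toA5_z

/-- Every double cover `SL₂(𝔽₅) → 𝒜₅` is isomorphic to the binary icosahedral group over `𝒜₅`: the
generators have lifts `sₙ` to `SL₂(𝔽₅)` with `s₂² = s₃³ = s₅⁵ = s₂s₃s₅ = -1`. -/
theorem A5.IsDoubleCover.exists_mulEquiv {pr : SL(2, ZMod 5) →* A5} (h : A5.IsDoubleCover pr) :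
    ∃ e : BinIcos ≃* SL(2, ZMod 5), e BinIcos.z = -1 ∧ ∀ x, pr (e x) = BinIcos.toA5 x := by
  have hneg : ∀ s, pr (-s) = pr s := fun s => by
    rw [← neg_one_mul, map_mul, (h.2 (-1)).2 (Or.inr rfl), one_mul]
  -- a lift of an element of odd order `n`, corrected by a sign
  have hodd : ∀ (x : A5) (n : ℕ), Odd n → x ^ n = 1 → ∃ s, pr s = x ∧ s ^ n = -1 := by
    intro x n hn hx
    obtain ⟨s, rfl⟩ := h.1 x
    rw [← map_pow] at hx
    rcases (h.2 _).1 hx with h1 | h1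
    · exact ⟨-s, hneg s, by rw [hn.neg_pow, h1]⟩
    · exact ⟨s, rfl, h1⟩
  obtain ⟨s3, p3, h3⟩ := hodd A5.x3 3 (by decide) A5.x3_pow
  obtain ⟨s5, p5, h5⟩ := hodd A5.x5 5 (by decide) A5.x5_pow
  obtain ⟨s2, p2, h235⟩ : ∃ s2, pr s2 = A5.x2 ∧ s2 * s3 * s5 = -1 := by
    obtain ⟨s, hs⟩ := h.1 A5.x2
    have h1 : pr (s * s3 * s5) = 1 := by
      rw [map_mul, map_mul, hs, p3, p5, A5.x2_mul_x3_mul_x5]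
    rcases (h.2 _).1 h1 with h1 | h1
    · exact ⟨-s, by rw [hneg, hs], by rw [neg_mul, neg_mul, h1]⟩
    · exact ⟨s, hs, h1⟩
  have h2 : s2 ^ 2 = -1 := by
    have h1 : pr (s2 ^ 2) = 1 := by rw [map_pow, p2, A5.x2_sq]
    refine ((h.2 _).1 h1).resolve_left fun hs => A5.x2_ne_one ?_
    rw [← p2]
    exact (h.2 _).2 (SL2.eq_one_or_eq_neg_one_of_sq hs)
  let f : BinIcos →* SL(2, ZMod 5) :=
    BinIcos.lift s2 s3 s5 (h2.trans h235.symm) (h3.trans h235.symm) (h5.trans h235.symm)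
  have hz : f BinIcos.z = -1 := BinIcos.lift_z.trans h235
  have hf : pr.comp f = BinIcos.toA5 :=
    BinIcos.hom_ext (by simp [f, p2]) (by simp [f, p3]) (by simp [f, p5])
  have hf' : ∀ x, pr (f x) = BinIcos.toA5 x := fun x => DFunLike.congr_fun hf x
  refine ⟨MulEquiv.ofBijective f ⟨(injective_iff_map_eq_one _).2 fun x hx => ?_, fun s => ?_⟩, hz,
    hf'⟩
  · refine (BinIcos.eq_one_or_eq_z_of_toA5 (x := x) ?_).resolve_right ?_
    · rw [← hf', hx, map_one]
    · rintro rfl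
      exact SL2.neg_one_ne_one (hz.symm.trans hx)
  · obtain ⟨x, hx⟩ := BinIcos.toA5_surjective (pr s)
    have h1 : pr (s * (f x)⁻¹) = 1 := by rw [map_mul, map_inv, hf', hx, mul_inv_cancel]
    rcases (h.2 _).1 h1 with h1 | h1
    · exact ⟨x, (mul_inv_eq_one.1 h1).symm⟩
    · refine ⟨BinIcos.z * x, ?_⟩
      rw [map_mul, hz, ← h1, inv_mul_cancel_right]

end SL2

/-! ### Matrix representations -/

section MatrixRepresentations

open Matrix

variable {m : ℕ} {k : Type*} [Field k] {Γ : Type*} [Group Γ]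

/-- The representation on column vectors given by a homomorphism to `GL_m`. -/
def matRep (ρ : Γ →* GL (Fin m) k) : Representation k Γ (Fin m → k) :=
  (Matrix.toLinAlgEquiv' : Matrix (Fin m) (Fin m) k ≃ₐ[k] _).toMonoidHom.comp
    ((Units.coeHom _).comp ρ)

theorem matRep_eq (ρ : Γ →* GL (Fin m) k) (g : Γ) : matRep ρ g = Matrix.toLin' (ρ g).1 := rfl

@[simp]
theorem matRep_apply (ρ : Γ →* GL (Fin m) k) (g : Γ) (v : Fin m → k) :
    matRep ρ g v = (ρ g).1 *ᵥ v := rfl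

section General

variable {V : Type*} [AddCommGroup V] [Module k V]

theorem isIrreducible_iff_submodule (R : Representation k Γ V) :
    R.IsIrreducible ↔ Nontrivial V ∧
      ∀ W : Submodule k V, (∀ g, ∀ v ∈ W, R g v ∈ W) → W = ⊥ ∨ W = ⊤ := by
  constructor
  · intro h
    constructor
    · by_contra hV
      rw [not_nontrivial_iff_subsingleton] at hV
      obtain ⟨x, y, hxy⟩ := h.exists_pair_ne
      exact hxy (Subrepresentation.ext (Subsingleton.elim _ _))
    · intro W hW
      rcases h.eq_bot_or_eq_top ⟨W, fun g v hv => hW g v hv⟩ with h | h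
      · exact Or.inl (congrArg Subrepresentation.toSubmodule h)
      · exact Or.inr (congrArg Subrepresentation.toSubmodule h)
  · rintro ⟨hV, h⟩
    exact
      { exists_pair_ne := ⟨⊥, ⊤, fun e =>
          bot_ne_top (congrArg Subrepresentation.toSubmodule e : (⊥ : Submodule k V) = ⊤)⟩
        eq_bot_or_eq_top := fun W => by
          rcases h W.toSubmodule fun g v hv => W.apply_mem_toSubmodule g hv with h | h
          · exact Or.inl (Subrepresentation.ext h)
          · exact Or.inr (Subrepresentation.ext h) }

theorem exists_isCompl_invariant [Finite Γ] (hΓ : (Nat.card Γ : k) ≠ 0) (R : Representation k Γ V)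
    {W : Submodule k V} (hW : ∀ g, ∀ v ∈ W, R g v ∈ W) :
    ∃ W' : Submodule k V, (∀ g, ∀ v ∈ W', R g v ∈ W') ∧ IsCompl W W' := by
  have : NeZero (Nat.card Γ : k) := ⟨hΓ⟩
  obtain ⟨W', h⟩ := exists_isCompl (⟨W, fun g v hv => hW g v hv⟩ : Subrepresentation R)
  refine ⟨W'.toSubmodule, fun g v hv => W'.apply_mem_toSubmodule g hv, ?_, ?_⟩
  · exact disjoint_iff.2 (congrArg Subrepresentation.toSubmodule h.inf_eq_bot)
  · exact codisjoint_iff.2 (congrArg Subrepresentation.toSubmodule h.sup_eq_top)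

/-- A finite dimensional representation in coordinates. -/
theorem exists_matRep [FiniteDimensional k V] (R : Representation k Γ V)
    (hm : Module.finrank k V = m) :
    ∃ (ρ : Γ →* GL (Fin m) k) (e : V ≃ₗ[k] (Fin m → k)), ∀ g v, e (R g v) = (ρ g).1 *ᵥ e v := by
  let b := Module.finBasisOfFinrankEq k V hm
  let f : Γ →* Matrix (Fin m) (Fin m) k := (LinearMap.toMatrixAlgEquiv b).toMonoidHom.comp R
  refine ⟨f.toHomUnits, b.equivFun, fun g v => ?_⟩
  exact (LinearMap.toMatrix_mulVec_repr b b (R g) v).symm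

/-- The representation on a finite dimensional invariant subspace, in coordinates. -/
theorem exists_matRep_of_invariant (R : Representation k Γ V)
    {W : Submodule k V} [hfin : FiniteDimensional k W] (hW : ∀ g, ∀ v ∈ W, R g v ∈ W)
    (hm : Module.finrank k W = m) :
    ∃ (ρ : Γ →* GL (Fin m) k) (e : (Fin m → k) →ₗ[k] V), Function.Injective e ∧ e.range = W ∧
      ∀ g v, e ((ρ g).1 *ᵥ v) = R g (e v) := by
  have : FiniteDimensional k (⟨W, fun g v hv => hW g v hv⟩ : Subrepresentation R).toSubmodule := hfin
  obtain ⟨ρ, e, he⟩ := exists_matRep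
    (Subrepresentation.toRepresentation (ρ := R) ⟨W, fun g v hv => hW g v hv⟩) hm
  refine ⟨ρ, W.subtype ∘ₗ e.symm.toLinearMap, ?_, ?_, fun g v => ?_⟩
  · exact (Subtype.val_injective).comp e.symm.injective
  · rw [LinearMap.range_comp, LinearEquiv.range, Submodule.map_top, Submodule.range_subtype]
  · have h := he g (e.symm v)
    rw [e.apply_symm_apply] at h
    rw [LinearMap.comp_apply, ← h]
    change W.subtype (e.symm (e _)) = _
    rw [e.symm_apply_apply]
    rfl

end General

/-- Schur's lemma: a matrix commuting with an irreducible representation is scalar. -/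
theorem exists_eq_smul_one_of_commute [IsAlgClosed k] {ρ : Γ →* GL (Fin m) k}
    (hρ : (matRep ρ).IsIrreducible) {X : Matrix (Fin m) (Fin m) k}
    (hX : ∀ g, X * (ρ g).1 = (ρ g).1 * X) : ∃ c : k, X = c • 1 := by
  obtain ⟨hV, hW⟩ := (isIrreducible_iff_submodule _).1 hρ
  obtain ⟨c, hc⟩ := Module.End.exists_eigenvalue (Matrix.toLin' X)
  refine ⟨c, ?_⟩
  have h : Module.End.eigenspace (Matrix.toLin' X) c = ⊤ := by
    refine (hW _ fun g v hv => ?_).resolve_left hc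
    rw [Module.End.mem_eigenspace_iff, Matrix.toLin'_apply] at hv ⊢
    rw [matRep_apply, mulVec_mulVec, hX, ← mulVec_mulVec, hv, mulVec_smul]
  refine Matrix.toLin'.injective (LinearMap.ext fun v => ?_)
  have hv : v ∈ Module.End.eigenspace (Matrix.toLin' X) c := h ▸ Submodule.mem_top
  rw [Module.End.mem_eigenspace_iff] at hv
  rw [hv, Matrix.toLin'_apply, smul_mulVec, one_mulVec]

/-- Schur's lemma: a nonzero intertwining matrix between irreducible representations of the same
dimension is invertible. -/
theorem exists_conj_of_intertwining {ρ ρ' : Γ →* GL (Fin m) k} (hρ : (matRep ρ).IsIrreducible)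
    {X : Matrix (Fin m) (Fin m) k} (hX0 : X ≠ 0) (hX : ∀ g, X * (ρ g).1 = (ρ' g).1 * X) :
    ∃ P : GL (Fin m) k, ∀ g, ρ' g = P * ρ g * P⁻¹ := by
  obtain ⟨hV, hW⟩ := (isIrreducible_iff_submodule _).1 hρ
  have hker : (Matrix.toLin' X).ker = ⊥ := by
    refine (hW _ fun g v hv => ?_).resolve_right fun h => hX0 ?_
    · rw [LinearMap.mem_ker, Matrix.toLin'_apply] at hv ⊢
      rw [matRep_apply, mulVec_mulVec, hX, ← mulVec_mulVec, hv, mulVec_zero]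
    · exact Matrix.toLin'.injective (by rw [LinearMap.ker_eq_top.1 h, map_zero])
  have hunit : IsUnit X := by
    rw [← Matrix.mulVec_injective_iff_isUnit]
    exact LinearMap.ker_eq_bot.1 hker
  obtain ⟨P, rfl⟩ := hunit
  refine ⟨P, fun g => ?_⟩
  rw [eq_mul_inv_iff_mul_eq]
  exact Units.ext (hX g).symm

/-- `PGL_m` has trivial centre: if `h` commutes with a transvection `1 + E` up to the factor `c`,
then both `1 + E` and `c (1 + E)` are unipotent, hence `c = 1`. -/
theorem eq_smul_one_of_mk_mem_center {h : GL (Fin m) k}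
    (hh : (ProjGenLinGroup.mk h : PGL(m, k)) ∈ Subgroup.center (PGL(m, k))) :
    (ProjGenLinGroup.mk h : PGL(m, k)) = 1 := by
  rw [ProjGenLinGroup.mk_eq_one, GeneralLinearGroup.mem_center_iff_val_mem_range_scalar,
    mem_range_scalar_iff_commute_single]
  intro i j hij
  set E : Matrix (Fin m) (Fin m) k := single i j 1
  have hE : E * E = 0 := by simp [E, hij.symm]
  let g : GL (Fin m) k := ⟨1 + E, 1 - E, by noncomm_ring [hE], by noncomm_ring [hE]⟩
  have h1 := (Subgroup.mem_center_iff.1 hh) (ProjGenLinGroup.mk g)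
  rw [← map_mul, ← map_mul, pgl_mk_eq_mk] at h1
  obtain ⟨c, hc⟩ := h1
  -- `h (1 + E) = c (1 + E) h`
  have hc' : h.1 * (1 + E) = c.1 • ((1 + E) * h.1) := hc
  have hsq : (c.1 • (1 + E) - 1) * (c.1 • (1 + E) - 1) = 0 := by
    have h2 : (c.1 • (1 + E) - 1) * h.1 = h.1 * E := by
      rw [sub_mul, smul_mul_assoc, ← hc', mul_add, mul_one, one_mul, add_sub_cancel_left]
    have h3 : (c.1 • (1 + E) - 1) * (c.1 • (1 + E) - 1) * h.1 = 0 := by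
      rw [mul_assoc, h2, ← mul_assoc, h2, mul_assoc, hE, mul_zero]
    have h4 := congrArg (· * (h⁻¹).1) h3
    simpa [mul_assoc] using h4
  have hc1 : (c.1 - 1) * (c.1 - 1) = 0 := by
    have h5 : (c.1 • (1 + E) - 1) * (c.1 • (1 + E) - 1) =
        ((c.1 - 1) * (c.1 - 1)) • (1 : Matrix (Fin m) (Fin m) k) +
          (2 * (c.1 - 1) * c.1) • E + (c.1 * c.1) • (E * E) := by
      have : c.1 • (1 + E) - 1 = (c.1 - 1) • (1 : Matrix (Fin m) (Fin m) k) + c.1 • E := by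
        module
      rw [this]
      simp only [add_mul, mul_add, smul_mul_assoc, mul_smul_comm, one_mul, mul_one]
      module
    rw [h5, hE] at hsq
    have := congrFun (congrFun hsq i) i
    simpa [E, hij.symm, single_apply_of_col_ne] using this
  have hc2 : c.1 = 1 := by
    rcases mul_self_eq_zero.1 hc1 with h6
    linear_combination h6
  rw [hc2, one_smul, mul_add, add_mul, mul_one, one_mul] at hc'
  exact (add_left_cancel hc').symm

end MatrixRepresentations

/-! ### Lifting projective representations of `𝒜₅` to the binary icosahedral group -/

section Lifting

open Matrix

variable {m : ℕ} {k : Type*} [Field k]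

theorem BinIcos.hom_eq_one {M : Type*} [CommGroup M] (f : BinIcos →* M) (x : BinIcos) :
    f x = 1 := by
  obtain ⟨h2, h3, h5⟩ := eq_one_of_relations (a := f x2) (b := f x3) (c := f x5) (z := f z)
    (by rw [← map_pow, x2_sq]) (by rw [← map_pow, x3_pow]) (by rw [← map_pow, x5_pow])
    (by rw [← map_mul, ← map_mul]; rfl)
  exact DFunLike.congr_fun (hom_ext (ψ := 1) h2 h3 h5) x

instance : Finite BinIcos := Finite.of_injective _ SL2.ofBinIcos_bijective.1

theorem A5.card_dvd : Nat.card A5 ∣ 120 := by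
  have h := Subgroup.card_subgroup_dvd_card A5.toPerm.range
  rw [Nat.card_congr (MonoidHom.ofInjective A5.toPerm_injective).toEquiv.symm] at h
  simpa [Nat.card_eq_fintype_card, Fintype.card_perm, Nat.factorial] using h

theorem BinIcos.card_dvd : Nat.card BinIcos ∣ 240 := by
  rw [Subgroup.card_eq_card_quotient_mul_card_subgroup toA5.ker,
    Nat.card_congr (QuotientGroup.quotientKerEquivOfSurjective toA5 toA5_surjective).toEquiv]
  have h : toA5.ker = Subgroup.zpowers z := by
    refine le_antisymm (fun x hx => ?_) ?_
    · rcases eq_one_or_eq_z_of_toA5 hx with rfl | rfl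
      · exact one_mem _
      · exact Subgroup.mem_zpowers z
    · rw [Subgroup.zpowers_le]
      exact toA5_z
  rw [h, Nat.card_zpowers]
  exact mul_dvd_mul A5.card_dvd (orderOf_dvd_of_pow_eq_one z_sq : _ ∣ 2)

theorem BinIcos.card_ne_zero (h2 : (2 : k) ≠ 0) (h3 : (3 : k) ≠ 0) (h5 : (5 : k) ≠ 0) :
    (Nat.card BinIcos : k) ≠ 0 := fun h => by
  obtain ⟨c, hc⟩ := BinIcos.card_dvd
  have : ((240 : ℕ) : k) = 0 := by rw [hc, Nat.cast_mul, h, zero_mul]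
  have h240 : ((240 : ℕ) : k) = 2 ^ 4 * 3 * 5 := by norm_num
  rw [h240] at this
  exact mul_ne_zero (mul_ne_zero (pow_ne_zero _ h2) h3) h5 this

/-- `ρ` is a linear lift of `ψ` to the binary icosahedral group. -/
def IsLift (ψ : A5 →* PGL(m, k)) (ρ : BinIcos →* GL (Fin m) k) : Prop :=
  ∀ x, ProjGenLinGroup.mk (ρ x) = ψ (BinIcos.toA5 x)

theorem exists_scalar_of_mk_eq_one {g : GL (Fin m) k}
    (h : (ProjGenLinGroup.mk g : PGL(m, k)) = 1) :
    ∃ u : kˣ, GeneralLinearGroup.scalar (Fin m) u = g := by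
  rwa [ProjGenLinGroup.mk_eq_one, GeneralLinearGroup.center_eq_range_scalar] at h

theorem commute_scalar (u : kˣ) (g : GL (Fin m) k) :
    Commute (GeneralLinearGroup.scalar (Fin m) u) g := by
  have h : GeneralLinearGroup.scalar (Fin m) u ∈ Subgroup.center (GL (Fin m) k) := by
    rw [GeneralLinearGroup.center_eq_range_scalar]
    exact ⟨u, rfl⟩
  exact (Subgroup.mem_center_iff.1 h g).symm

theorem mk_scalar_mul (u : kˣ) (g : GL (Fin m) k) :
    (ProjGenLinGroup.mk (GeneralLinearGroup.scalar (Fin m) u * g) : PGL(m, k)) =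
      ProjGenLinGroup.mk g := by
  have h : (ProjGenLinGroup.mk (GeneralLinearGroup.scalar (Fin m) u) : PGL(m, k)) = 1 := by
    rw [ProjGenLinGroup.mk_eq_one, GeneralLinearGroup.center_eq_range_scalar]
    exact ⟨u, rfl⟩
  rw [map_mul, h, one_mul]

theorem scalar_val (u : kˣ) :
    (GeneralLinearGroup.scalar (Fin m) u).1 = u.1 • (1 : Matrix (Fin m) (Fin m) k) := by
  rw [Matrix.smul_one_eq_diagonal]
  rfl

theorem scalar_injective (hm : 0 < m) :
    Function.Injective (GeneralLinearGroup.scalar (Fin m) : kˣ →* GL (Fin m) k) := fun u v h => by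
  have h1 := congrArg (fun g : GL (Fin m) k => g.1 ⟨0, hm⟩ ⟨0, hm⟩) h
  simp only [scalar_val] at h1
  exact Units.ext (by simpa using h1)

theorem exists_units_pow_eq [IsAlgClosed k] (u : kˣ) {n : ℕ} (hn : n ≠ 0) : ∃ v : kˣ, v ^ n = u := by
  obtain ⟨v, hv⟩ := IsAlgClosed.exists_pow_nat_eq u.1 (Nat.pos_of_ne_zero hn)
  have hv0 : v ≠ 0 := by
    rintro rfl
    rw [zero_pow hn] at hv
    exact u.ne_zero hv.symm
  exact ⟨Units.mk0 v hv0, Units.ext hv⟩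

/-- Arbitrary lifts of the generators can be rescaled so that the relations of the binary
icosahedral group hold: after making the powers of the generators equal to `1`, their product is a
scalar `w⁻¹`, and the factors `w¹⁵`, `w¹⁰`, `w⁶` do it since `15 + 10 + 6 = 30 + 1`. -/
theorem exists_isLift [IsAlgClosed k] (ψ : A5 →* PGL(m, k)) : ∃ ρ, IsLift ψ ρ := by
  obtain ⟨a, ha⟩ := ProjGenLinGroup.mk_surjective (ψ A5.x2)
  obtain ⟨b, hb⟩ := ProjGenLinGroup.mk_surjective (ψ A5.x3)
  obtain ⟨c, hc⟩ := ProjGenLinGroup.mk_surjective (ψ A5.x5)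
  obtain ⟨α, hα⟩ := exists_scalar_of_mk_eq_one (g := a ^ 2)
    (by rw [map_pow, ha, ← map_pow, A5.x2_sq, map_one])
  obtain ⟨β, hβ⟩ := exists_scalar_of_mk_eq_one (g := b ^ 3)
    (by rw [map_pow, hb, ← map_pow, A5.x3_pow, map_one])
  obtain ⟨γ, hγ⟩ := exists_scalar_of_mk_eq_one (g := c ^ 5)
    (by rw [map_pow, hc, ← map_pow, A5.x5_pow, map_one])
  obtain ⟨δ, hδ⟩ := exists_scalar_of_mk_eq_one (g := a * b * c)
    (by rw [map_mul, map_mul, ha, hb, hc, ← map_mul, ← map_mul, A5.x2_mul_x3_mul_x5, map_one])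
  obtain ⟨α₀, hα₀⟩ := exists_units_pow_eq α⁻¹ (n := 2) (by norm_num)
  obtain ⟨β₀, hβ₀⟩ := exists_units_pow_eq β⁻¹ (n := 3) (by norm_num)
  obtain ⟨γ₀, hγ₀⟩ := exists_units_pow_eq γ⁻¹ (n := 5) (by norm_num)
  set S := (GeneralLinearGroup.scalar (Fin m) : kˣ →* GL (Fin m) k)
  obtain ⟨w, hw⟩ : ∃ w : kˣ, w * (δ * α₀ * β₀ * γ₀) = 1 := ⟨_, inv_mul_cancel _⟩
  have hprod : S (w ^ 15 * α₀) * a * (S (w ^ 10 * β₀) * b) * (S (w ^ 6 * γ₀) * c) = S (w ^ 30) := by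
    have h1 : S (w ^ 15 * α₀) * a * (S (w ^ 10 * β₀) * b) * (S (w ^ 6 * γ₀) * c) =
        S (w ^ 15 * α₀) * (S (w ^ 10 * β₀) * (S (w ^ 6 * γ₀) * (a * b * c))) := by
      have c1 : S _ * a = a * S _ := (commute_scalar (w ^ 10 * β₀) a).eq
      have c2 : S _ * (a * b) = a * b * S _ := (commute_scalar (w ^ 6 * γ₀) (a * b)).eq
      calc _ = S (w ^ 15 * α₀) * (a * S (w ^ 10 * β₀)) * b * S (w ^ 6 * γ₀) * c := by group
        _ = S (w ^ 15 * α₀) * S (w ^ 10 * β₀) * ((a * b) * S (w ^ 6 * γ₀)) * c := by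
          rw [← c1]; group
        _ = _ := by rw [← c2]; group
    rw [h1, ← hδ, ← map_mul, ← map_mul, ← map_mul]
    congr 1
    calc w ^ 15 * α₀ * (w ^ 10 * β₀ * (w ^ 6 * γ₀ * δ))
        = w ^ 30 * (w * (δ * α₀ * β₀ * γ₀)) := by
          rw [← Units.val_inj]
          push_cast
          ring
      _ = w ^ 30 := by rw [hw, mul_one]
  let ρ : BinIcos →* GL (Fin m) k := BinIcos.lift (S (w ^ 15 * α₀) * a) (S (w ^ 10 * β₀) * b)
    (S (w ^ 6 * γ₀) * c)
    (by rw [hprod, (commute_scalar _ a).mul_pow, ← hα, ← map_pow, ← map_mul, mul_pow, hα₀,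
          inv_mul_cancel_right, ← pow_mul])
    (by rw [hprod, (commute_scalar _ b).mul_pow, ← hβ, ← map_pow, ← map_mul, mul_pow, hβ₀,
          inv_mul_cancel_right, ← pow_mul])
    (by rw [hprod, (commute_scalar _ c).mul_pow, ← hγ, ← map_pow, ← map_mul, mul_pow, hγ₀,
          inv_mul_cancel_right, ← pow_mul])
  refine ⟨ρ, fun x => DFunLike.congr_fun (f := ProjGenLinGroup.mk.comp ρ)
    (g := ψ.comp BinIcos.toA5) (BinIcos.hom_ext ?_ ?_ ?_) x⟩
  · simp only [MonoidHom.comp_apply, ρ, BinIcos.lift_x2, BinIcos.toA5_x2, S, mk_scalar_mul, ha]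
  · simp only [MonoidHom.comp_apply, ρ, BinIcos.lift_x3, BinIcos.toA5_x3, S, mk_scalar_mul, hb]
  · simp only [MonoidHom.comp_apply, ρ, BinIcos.lift_x5, BinIcos.toA5_x5, S, mk_scalar_mul, hc]

/-- The lift is unique, since the binary icosahedral group is perfect. -/
theorem IsLift.unique (hm : 0 < m) {ψ : A5 →* PGL(m, k)} {ρ ρ' : BinIcos →* GL (Fin m) k}
    (h : IsLift ψ ρ) (h' : IsLift ψ ρ') : ρ = ρ' := by
  have hex : ∀ x, ∃ u : kˣ, ρ' x = GeneralLinearGroup.scalar (Fin m) u * ρ x := fun x => by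
    obtain ⟨u, hu⟩ := exists_scalar_of_mk_eq_one (g := ρ' x * (ρ x)⁻¹)
      (by rw [map_mul, map_inv, h x, h' x, mul_inv_cancel])
    exact ⟨u, by rw [hu, inv_mul_cancel_right]⟩
  choose c hc using hex
  let χ : BinIcos →* kˣ := MonoidHom.mk' c fun x y => scalar_injective hm (by
    have h1 := hc (x * y)
    rw [map_mul, map_mul, hc x, hc y] at h1
    have h2 : GeneralLinearGroup.scalar (Fin m) (c x) * ρ x *
        (GeneralLinearGroup.scalar (Fin m) (c y) * ρ y) =
        GeneralLinearGroup.scalar (Fin m) (c x * c y) * (ρ x * ρ y) := by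
      rw [map_mul, mul_assoc, ← mul_assoc (ρ x), ← (commute_scalar (c y) (ρ x)).eq]
      group
    rw [h2] at h1
    exact (mul_right_cancel h1).symm)
  refine MonoidHom.ext fun x => ?_
  have h1 : c x = 1 := BinIcos.hom_eq_one χ x
  rw [hc x, h1, map_one, one_mul]

theorem IsLift.conj {ψ : A5 →* PGL(m, k)} {ρ : BinIcos →* GL (Fin m) k} (h : IsLift ψ ρ)
    {ψ' : A5 →* PGL(m, k)} {P : GL (Fin m) k}
    (hP : ∀ x, ψ' x = ProjGenLinGroup.mk P * ψ x * (ProjGenLinGroup.mk P)⁻¹) :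
    IsLift ψ' ((MulAut.conj P).toMonoidHom.comp ρ) := fun x => by
  rw [hP, ← h]
  simp

theorem homConj_iff_of_isLift (hm : 0 < m) {ψ ψ' : A5 →* PGL(m, k)}
    {ρ ρ' : BinIcos →* GL (Fin m) k} (h : IsLift ψ ρ) (h' : IsLift ψ' ρ') :
    HomConj ψ ψ' ↔ ∃ P : GL (Fin m) k, ∀ x, ρ' x = P * ρ x * P⁻¹ := by
  constructor
  · rintro ⟨g, hg⟩
    obtain ⟨P, rfl⟩ := ProjGenLinGroup.mk_surjective g
    refine ⟨P, fun x => ?_⟩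
    rw [h'.unique hm (h.conj hg)]
    rfl
  · rintro ⟨P, hP⟩
    refine ⟨ProjGenLinGroup.mk P, fun x => ?_⟩
    obtain ⟨x, rfl⟩ := BinIcos.toA5_surjective x
    rw [← h, ← h', hP, map_mul, map_mul, map_inv]

theorem exists_isLift_of_scalar {ρ : BinIcos →* GL (Fin m) k}
    (hz : (ProjGenLinGroup.mk (ρ BinIcos.z) : PGL(m, k)) = 1) : ∃ ψ, IsLift ψ ρ := by
  let f : BinIcos →* PGL(m, k) := ProjGenLinGroup.mk.comp ρ
  have hz : f BinIcos.z = 1 := hz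
  let ψ : A5 →* PGL(m, k) := A5.lift (f BinIcos.x2) (f BinIcos.x3) (f BinIcos.x5)
    (by rw [← map_pow, BinIcos.x2_sq, hz]) (by rw [← map_pow, BinIcos.x3_pow, hz])
    (by rw [← map_pow, BinIcos.x5_pow, hz]) (by rw [← map_mul, ← map_mul]; exact hz)
  exact ⟨ψ, fun x => DFunLike.congr_fun (f := f) (g := ψ.comp BinIcos.toA5)
    (BinIcos.hom_ext (by simp [ψ]) (by simp [ψ]) (by simp [ψ])) x⟩

theorem IsLift.z_eq (hm : 0 < m) {ψ : A5 →* PGL(m, k)} {ρ : BinIcos →* GL (Fin m) k}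
    (h : IsLift ψ ρ) : ρ BinIcos.z = 1 ∨ ρ BinIcos.z = -1 := by
  obtain ⟨u, hu⟩ := exists_scalar_of_mk_eq_one (g := ρ BinIcos.z)
    (by rw [h, BinIcos.toA5_z, map_one])
  have h1 : u ^ 2 = 1 := scalar_injective hm (by
    rw [map_pow, hu, ← map_pow, BinIcos.z_sq, map_one, map_one])
  have h2 : u.1 = 1 ∨ u.1 = -1 := sq_eq_sq_iff_eq_or_eq_neg.1 (by
    rw [one_pow, ← Units.val_pow_eq_pow_val, h1, Units.val_one])
  rw [← hu]
  refine h2.imp (fun h => Units.ext ?_) (fun h => Units.ext ?_)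
  · rw [scalar_val, h, one_smul]; rfl
  · rw [scalar_val, h, neg_smul, one_smul]; rfl

theorem infinite_units (K : Type*) [Field K] [Infinite K] : Infinite Kˣ := by
  have : Infinite {a : K // a ≠ 0} :=
    Set.infinite_coe_iff.2 (Set.finite_singleton (0 : K)).infinite_compl
  exact Infinite.of_injective _ (unitsEquivNeZero (G₀ := K)).symm.injective

/-- A homomorphism `𝒜₅ → PGL_m` is regular iff its linear lift is irreducible. If there is an
invariant projection `π`, the elements `1 + (s - 1) π` centralize the image; if there is none, the
centralizer is trivial by Schur's lemma. -/
theorem isRegularHom_iff [IsAlgClosed k] (hk : (Nat.card BinIcos : k) ≠ 0) (hm : 0 < m)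
    {ψ : A5 →* PGL(m, k)} {ρ : BinIcos →* GL (Fin m) k} (h : IsLift ψ ρ) :
    IsRegularHom ψ ↔ (matRep ρ).IsIrreducible := by
  constructor
  · intro hfin
    have hm' : Nonempty (Fin m) := ⟨⟨0, hm⟩⟩
    refine (isIrreducible_iff_submodule _).2 ⟨inferInstance, fun W hW => ?_⟩
    obtain ⟨W', hW', hc⟩ := exists_isCompl_invariant hk (matRep ρ) hW
    set p : (Fin m → k) →ₗ[k] (Fin m → k) := W.projection W' hc
    set π : Matrix (Fin m) (Fin m) k := LinearMap.toMatrix' p with hπ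
    have hππ : π * π = π := by
      rw [hπ, ← LinearMap.toMatrix'_comp]
      congr 1
      refine LinearMap.ext fun v => ?_
      exact Submodule.projection_apply_of_mem_left hc (Submodule.projection_apply_mem hc v)
    have hcomm : ∀ x, π * (ρ x).1 = (ρ x).1 * π := fun x => by
      have h1 : p ∘ₗ matRep ρ x = matRep ρ x ∘ₗ p := LinearMap.ext fun v => by
        obtain ⟨w, hw, w', hw', rfl⟩ : ∃ w ∈ W, ∃ w' ∈ W', w + w' = v :=
          Submodule.mem_sup.1 (hc.sup_eq_top ▸ Submodule.mem_top)
        simp only [LinearMap.comp_apply, map_add, p]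
        rw [Submodule.projection_apply_of_mem_left hc (hW x w hw),
          Submodule.projection_apply_of_mem_left hc hw,
          Submodule.projection_apply_of_mem_right hc (hW' x w' hw'),
          Submodule.projection_apply_of_mem_right hc hw', map_zero]
      have h2 := congrArg LinearMap.toMatrix' h1
      rwa [LinearMap.toMatrix'_comp, LinearMap.toMatrix'_comp, matRep_eq,
        LinearMap.toMatrix'_toLin'] at h2
    have hmul : ∀ s t : k, (1 + (s - 1) • π) * (1 + (t - 1) • π) = 1 + (s * t - 1) • π := by
      intro s t
      simp only [mul_add, add_mul, one_mul, mul_one, smul_mul_assoc, mul_smul_comm, hππ]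
      module
    let f : kˣ →* Matrix (Fin m) (Fin m) k :=
      { toFun := fun s => 1 + (s.1 - 1) • π
        map_one' := by simp
        map_mul' := fun s t => by rw [hmul, Units.val_mul] }
    have hf : ∀ s, (f.toHomUnits s).1 = 1 + (s.1 - 1) • π := fun s => rfl
    let F : kˣ → Subgroup.centralizer (ψ.range : Set (PGL(m, k))) := fun s =>
      ⟨ProjGenLinGroup.mk (f.toHomUnits s), by
        rintro _ ⟨x, rfl⟩
        obtain ⟨x, rfl⟩ := BinIcos.toA5_surjective x
        rw [← h, ← map_mul, ← map_mul]
        congr 1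
        refine Units.ext ?_
        rw [Units.val_mul, Units.val_mul, hf, mul_add, add_mul, mul_one, one_mul, mul_smul_comm,
          smul_mul_assoc, hcomm]⟩
    have : Infinite k := IsAlgClosed.instInfinite
    have : Infinite kˣ := infinite_units k
    have hfin' := hfin
    rw [IsRegularHom] at hfin'
    obtain ⟨s, t, hst, he⟩ := Finite.exists_ne_map_eq_of_infinite fun s => (QuotientGroup.mk (F s) :
      _ ⧸ (Subgroup.center (PGL(m, k))).subgroupOf (Subgroup.centralizer (ψ.range : Set _)))
    rw [QuotientGroup.eq, Subgroup.mem_subgroupOf] at he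
    have he' : (ProjGenLinGroup.mk (f.toHomUnits (s⁻¹ * t)) : PGL(m, k)) ∈ Subgroup.center _ := by
      rw [map_mul, map_inv, map_mul, map_inv]
      exact he
    obtain ⟨u, hu⟩ := exists_scalar_of_mk_eq_one (eq_smul_one_of_mk_mem_center he')
    have hu' := congrArg Units.val hu
    rw [scalar_val, hf] at hu'
    have hne : ((s⁻¹ * t : kˣ) : k) - 1 ≠ 0 := by
      rw [sub_ne_zero, ← Units.val_one, Units.val_injective.ne_iff, ne_eq, inv_mul_eq_one]
      exact hst
    -- `π` is an idempotent scalar matrix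
    obtain ⟨d, hd⟩ : ∃ d : k, π = d • 1 := by
      refine ⟨(((s⁻¹ * t : kˣ) : k) - 1)⁻¹ * (u.1 - 1), ?_⟩
      have h3 : (((s⁻¹ * t : kˣ) : k) - 1) • π = (u.1 - 1) • 1 := by
        rw [sub_smul u.1, hu', one_smul, add_sub_cancel_left]
      rw [mul_smul, ← h3, smul_smul, inv_mul_cancel₀ hne, one_smul]
    have hp : ∀ v, p v = d • v := fun v => by
      have : p = Matrix.toLin' π := (Matrix.toLin'_toMatrix' p).symm
      rw [this, hd, Matrix.toLin'_apply, smul_mulVec, one_mulVec]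
    by_cases hd0 : d = 0
    · left
      rw [Submodule.eq_bot_iff]
      intro v hv
      rw [← Submodule.projection_apply_of_mem_left hc hv]
      exact (hp v).trans (by rw [hd0, zero_smul])
    · right
      rw [Submodule.eq_top_iff']
      intro v
      have : d • v ∈ W := hp v ▸ Submodule.projection_apply_mem hc v
      exact (Submodule.smul_mem_iff _ hd0).1 this
  · intro hirr
    have : Subsingleton (Subgroup.centralizer (ψ.range : Set (PGL(m, k)))) := by
      refine subsingleton_of_forall_eq 1 fun ⟨g, hg⟩ => Subtype.ext ?_
      obtain ⟨P, rfl⟩ := ProjGenLinGroup.mk_surjective g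
      change ProjGenLinGroup.mk P = 1
      have h1 : IsLift ψ ((MulAut.conj P).toMonoidHom.comp ρ) := h.conj fun x => by
        rw [eq_mul_inv_iff_mul_eq]
        exact hg _ ⟨x, rfl⟩
      have h2 := h.unique hm h1
      obtain ⟨c, hc⟩ := exists_eq_smul_one_of_commute hirr (X := P.1) fun x => by
        have h3 : ρ x = P * ρ x * P⁻¹ := DFunLike.congr_fun h2 x
        rw [eq_mul_inv_iff_mul_eq] at h3
        exact (congrArg Units.val h3).symm
      rw [ProjGenLinGroup.mk_eq_one, GeneralLinearGroup.mem_center_iff_val_mem_range_scalar]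
      exact ⟨c, by rw [hc, Matrix.smul_one_eq_diagonal]; rfl⟩
    exact Finite.of_surjective _ (QuotientGroup.mk_surjective)

theorem isIrreducible_comp {Γ Γ' : Type*} [Group Γ] [Group Γ'] {f : Γ' →* Γ}
    (hf : Function.Surjective f) (ρ : Γ →* GL (Fin m) k) :
    (matRep (ρ.comp f)).IsIrreducible ↔ (matRep ρ).IsIrreducible := by
  rw [isIrreducible_iff_submodule, isIrreducible_iff_submodule]
  refine and_congr_right fun _ => forall_congr' fun W => imp_congr_left ?_
  exact ⟨fun h g => by obtain ⟨g, rfl⟩ := hf g; exact h g, fun h g => h (f g)⟩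

theorem comesFromA5_of_isLift {ψ : A5 →* PGL(m, k)} {ρ : BinIcos →* GL (Fin m) k}
    (h : IsLift ψ ρ) (hirr : (matRep ρ).IsIrreducible) (hz : ρ BinIcos.z = 1) : ComesFromA5 ψ := by
  let σ : A5 →* GL (Fin m) k := A5.lift (ρ BinIcos.x2) (ρ BinIcos.x3) (ρ BinIcos.x5)
    (by rw [← map_pow, BinIcos.x2_sq, hz]) (by rw [← map_pow, BinIcos.x3_pow, hz])
    (by rw [← map_pow, BinIcos.x5_pow, hz]) (by rw [← map_mul, ← map_mul]; exact hz)
  have hσ : σ.comp BinIcos.toA5 = ρ :=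
    BinIcos.hom_ext (by simp [σ]) (by simp [σ]) (by simp [σ])
  rw [← hσ, isIrreducible_comp BinIcos.toA5_surjective] at hirr
  refine ⟨matRep σ, hirr, fun x => ⟨σ x, rfl, ?_⟩⟩
  obtain ⟨x, rfl⟩ := BinIcos.toA5_surjective x
  rw [← h, ← hσ]
  rfl

theorem comesFromSL2_of_isLift {ψ : A5 →* PGL(m, k)} {ρ : BinIcos →* GL (Fin m) k}
    (h : IsLift ψ ρ) (hirr : (matRep ρ).IsIrreducible) (hz : ρ BinIcos.z ≠ 1)
    {pr : SL(2, ZMod 5) →* A5} (hpr : A5.IsDoubleCover pr) : ComesFromSL2 pr ψ := by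
  obtain ⟨e, hez, he⟩ := hpr.exists_mulEquiv
  refine ⟨matRep (ρ.comp e.symm.toMonoidHom), ?_, ?_, fun s => ⟨ρ (e.symm s), rfl, ?_⟩⟩
  · exact (isIrreducible_comp e.symm.surjective ρ).2 hirr
  · rintro ⟨σ, hσ⟩
    refine hz ?_
    have h1 := DFunLike.congr_fun hσ (-1)
    rw [MonoidHom.comp_apply, (hpr.2 (-1)).2 (Or.inr rfl), map_one, ← hez] at h1
    have h2 : Matrix.toLin' (ρ (e.symm (e BinIcos.z))).1 = Matrix.toLin' 1 := by
      rw [Matrix.toLin'_one]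
      exact h1
    rw [e.symm_apply_apply] at h2
    exact Units.ext (Matrix.toLin'.injective h2)
  · rw [MonoidHom.comp_apply, h, ← he, e.apply_symm_apply]

end Lifting

/-! ### Scott's inequality -/

section Scott

open Matrix

/-- Scott's inequality for three endomorphisms with product `1`: the composite
`v ↦ ((1 - A) v, (1 - B) v, (1 - C) v)`, `(x, y, z) ↦ x + A y + A B z` is zero. -/
theorem scott_inequality {k M : Type*} [Field k] [AddCommGroup M] [Module k M]
    [FiniteDimensional k M] (A B C : M →ₗ[k] M) (h : ∀ v, A (B (C v)) = v) :
    Module.finrank k (LinearMap.id - A).ker + Module.finrank k (LinearMap.id - B).ker +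
        Module.finrank k (LinearMap.id - C).ker +
        Module.finrank k ((LinearMap.id - A).range ⊔ (LinearMap.id - B).range ⊔
          (LinearMap.id - C).range : Submodule k M) ≤
      2 * Module.finrank k M + Module.finrank k
        ((LinearMap.id - A).ker ⊓ (LinearMap.id - B).ker ⊓ (LinearMap.id - C).ker :
          Submodule k M) := by
  set a := LinearMap.id - A with ha
  set b := LinearMap.id - B with hb
  set c := LinearMap.id - C with hc
  have ha' : ∀ v, a v = v - A v := fun v => rfl
  have hb' : ∀ v, b v = v - B v := fun v => rfl
  have hc' : ∀ v, c v = v - C v := fun v => rfl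
  let β : M →ₗ[k] (a.range × b.range × c.range) :=
    a.rangeRestrict.prod (b.rangeRestrict.prod c.rangeRestrict)
  let δ : (a.range × b.range × c.range) →ₗ[k] M :=
    a.range.subtype.coprod ((A ∘ₗ b.range.subtype).coprod (A ∘ₗ B ∘ₗ c.range.subtype))
  have hδ : ∀ x y z, δ (x, y, z) = x.1 + (A y.1 + A (B z.1)) := fun x y z => rfl
  have hβ : β.ker = a.ker ⊓ b.ker ⊓ c.ker := by
    ext v
    simp only [β, LinearMap.ker_prod, LinearMap.ker_rangeRestrict, inf_assoc]
  have h1 : β.range ≤ δ.ker := by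
    rintro _ ⟨v, rfl⟩
    rw [LinearMap.mem_ker]
    change a v + (A (b v) + A (B (c v))) = 0
    rw [ha', hb', hc', map_sub, map_sub, map_sub, h]
    abel
  have h2 : a.range ⊔ b.range ⊔ c.range ≤ δ.range := by
    refine sup_le (sup_le ?_ ?_) ?_
    · intro x hx
      exact ⟨(⟨x, hx⟩, 0, 0), by simp [hδ]⟩
    · intro y hy
      exact ⟨(⟨a y, y, rfl⟩, ⟨y, hy⟩, 0), by simp [hδ, ha']⟩
    · intro z hz
      exact ⟨(⟨a z, z, rfl⟩, ⟨b z, z, rfl⟩, ⟨z, hz⟩), by simp [hδ, ha', hb']⟩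
  have e1 := β.finrank_range_add_finrank_ker
  have e2 := δ.finrank_range_add_finrank_ker
  have e3 := Submodule.finrank_mono h1
  have e4 := Submodule.finrank_mono h2
  have ea := a.finrank_range_add_finrank_ker
  have eb := b.finrank_range_add_finrank_ker
  have ec := c.finrank_range_add_finrank_ker
  rw [Module.finrank_prod, Module.finrank_prod] at e2
  rw [hβ] at e1
  omega

variable {m : ℕ} {k : Type*} [Field k] {Γ : Type*} [Group Γ]

/-- The space of matrices intertwining `ρ` and `ρ'`. -/
def intertwiners (ρ ρ' : Γ →* GL (Fin m) k) : Submodule k (Matrix (Fin m) (Fin m) k) where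
  carrier := {X | ∀ g, X * (ρ g).1 = (ρ' g).1 * X}
  zero_mem' := by simp
  add_mem' {X Y} hX hY g := by rw [add_mul, mul_add, hX g, hY g]
  smul_mem' c X hX g := by rw [smul_mul_assoc, mul_smul_comm, hX g]

/-- The action `X ↦ ρ'(g) X ρ(g)⁻¹` on matrices. -/
def conjAction (ρ ρ' : Γ →* GL (Fin m) k) (g : Γ) :
    Matrix (Fin m) (Fin m) k →ₗ[k] Matrix (Fin m) (Fin m) k :=
  LinearMap.mulLeft k (ρ' g).1 ∘ₗ LinearMap.mulRight k ((ρ g)⁻¹).1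

theorem conjAction_apply (ρ ρ' : Γ →* GL (Fin m) k) (g : Γ) (X : Matrix (Fin m) (Fin m) k) :
    conjAction ρ ρ' g X = (ρ' g).1 * (X * ((ρ g)⁻¹).1) := rfl

theorem mem_ker_id_sub_conjAction {ρ ρ' : Γ →* GL (Fin m) k} {g : Γ}
    {X : Matrix (Fin m) (Fin m) k} :
    X ∈ (LinearMap.id - conjAction ρ ρ' g).ker ↔ X * (ρ g).1 = (ρ' g).1 * X := by
  rw [LinearMap.mem_ker, LinearMap.sub_apply, LinearMap.id_apply, sub_eq_zero, conjAction_apply,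
    ← mul_assoc]
  constructor
  · intro h
    nth_rewrite 1 [h]
    rw [mul_assoc, ← Units.val_mul, inv_mul_cancel, Units.val_one, mul_one]
  · intro h
    rw [← h, mul_assoc, ← Units.val_mul, mul_inv_cancel, Units.val_one, mul_one]

/-- The number of pairs `(i, j)` with `d'ᵢ = dⱼ`. -/
noncomputable def crossPairs {X : Type*} (d' d : Fin m → X) : ℕ :=
  Nat.card {p : Fin m × Fin m // d' p.1 = d p.2}

/-- The fixed space of `X ↦ ρ'(g) X ρ(g)⁻¹` contains the matrices `P' Y P⁻¹` such that `Y` has nonzero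
entries only at the pairs `(i, j)` with `d'ᵢ = dⱼ`. -/
theorem crossPairs_le_finrank {ρ ρ' : Γ →* GL (Fin m) k} {g : Γ} {P P' : GL (Fin m) k}
    {d d' : Fin m → k} (h : (ρ g).1 * P.1 = P.1 * diagonal d)
    (h' : (ρ' g).1 * P'.1 = P'.1 * diagonal d') :
    crossPairs d' d ≤ Module.finrank k (LinearMap.id - conjAction ρ ρ' g).ker := by
  classical
  let Y : ({p : Fin m × Fin m // d' p.1 = d p.2} → k) →ₗ[k] Matrix (Fin m) (Fin m) k :=
    { toFun := fun f => Matrix.of fun i j => if hij : d' i = d j then f ⟨(i, j), hij⟩ else 0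
      map_add' := fun f g => by
        ext i j
        by_cases hij : d' i = d j <;> simp [hij]
      map_smul' := fun c f => by
        ext i j
        by_cases hij : d' i = d j <;> simp [hij] }
  have hY : ∀ f, diagonal d' * Y f = Y f * diagonal d := fun f => by
    ext i j
    rw [diagonal_mul, mul_diagonal]
    by_cases hij : d' i = d j
    · rw [hij, mul_comm]
    · simp [Y, hij]
  let F : ({p : Fin m × Fin m // d' p.1 = d p.2} → k) →ₗ[k] Matrix (Fin m) (Fin m) k :=
    LinearMap.mulLeft k P'.1 ∘ₗ LinearMap.mulRight k (P⁻¹).1 ∘ₗ Y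
  have hF : ∀ f, F f = P'.1 * (Y f * (P⁻¹).1) := fun f => rfl
  have hFm : ∀ f, F f ∈ (LinearMap.id - conjAction ρ ρ' g).ker := fun f => by
    have hP : (P⁻¹).1 * (ρ g).1 = diagonal d * (P⁻¹).1 := by
      calc (P⁻¹).1 * (ρ g).1 = (P⁻¹).1 * ((ρ g).1 * P.1) * (P⁻¹).1 := by
            rw [mul_assoc, mul_assoc, ← Units.val_mul P, mul_inv_cancel, Units.val_one, mul_one]
        _ = diagonal d * (P⁻¹).1 := by
            rw [h, ← mul_assoc, ← Units.val_mul, inv_mul_cancel, Units.val_one, one_mul]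
    rw [mem_ker_id_sub_conjAction, hF, mul_assoc, mul_assoc, hP, ← mul_assoc (Y f), ← hY,
      ← mul_assoc (ρ' g).1, h']
    simp only [mul_assoc]
  have hinj : Function.Injective F := by
    intro f f' hff
    rw [hF, hF, Units.mul_right_inj, Units.mul_left_inj] at hff
    funext ⟨⟨i, j⟩, hij⟩
    have := congrFun (congrFun hff i) j
    simpa [Y, show d' i = d j from hij] using this
  have h1 := LinearMap.finrank_le_finrank_of_injective
    (f := F.codRestrict _ hFm) fun x y hxy => hinj (congrArg Subtype.val hxy)
  rwa [Module.finrank_fintype_fun_eq_card, ← Nat.card_eq_fintype_card] at h1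

theorem BinIcos.mem_intertwiners {ρ ρ' : BinIcos →* GL (Fin m) k} {X : Matrix (Fin m) (Fin m) k}
    (h2 : X * (ρ x2).1 = (ρ' x2).1 * X) (h3 : X * (ρ x3).1 = (ρ' x3).1 * X)
    (h5 : X * (ρ x5).1 = (ρ' x5).1 * X) : X ∈ intertwiners ρ ρ' := by
  let H : Subgroup BinIcos :=
    { carrier := {g | X * (ρ g).1 = (ρ' g).1 * X}
      one_mem' := by simp
      mul_mem' := fun {a b} ha hb => by
        change X * (ρ a).1 = (ρ' a).1 * X at ha
        change X * (ρ b).1 = (ρ' b).1 * X at hb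
        change X * (ρ (a * b)).1 = (ρ' (a * b)).1 * X
        rw [map_mul, map_mul, Units.val_mul, Units.val_mul, ← mul_assoc, ha, mul_assoc, hb,
          mul_assoc]
      inv_mem' := fun {a} ha => by
        change X * (ρ a).1 = (ρ' a).1 * X at ha
        change X * (ρ a⁻¹).1 = (ρ' a⁻¹).1 * X
        rw [map_inv, map_inv, Units.eq_inv_mul_iff_mul_eq, ← mul_assoc, ← ha, mul_assoc,
          ← Units.val_mul, mul_inv_cancel, Units.val_one, mul_one] }
  intro g
  exact PresentedGroup.generated_by binRels H (fun i => by cases i <;> assumption) g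

/-- The annihilator of the sum of the images of `1 - g` in the dual of the matrix space consists
of the functionals `X ↦ tr (Z X)` with `Z` intertwining in the opposite direction. -/
theorem finrank_dualAnnihilator_le {ρ ρ' : BinIcos →* GL (Fin m) k}
    (R : Submodule k (Matrix (Fin m) (Fin m) k))
    (h2 : (LinearMap.id - conjAction ρ ρ' BinIcos.x2).range ≤ R)
    (h3 : (LinearMap.id - conjAction ρ ρ' BinIcos.x3).range ≤ R)
    (h5 : (LinearMap.id - conjAction ρ ρ' BinIcos.x5).range ≤ R) :
    Module.finrank k R.dualAnnihilator ≤ Module.finrank k (intertwiners ρ' ρ) := by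
  let F : Module.Dual k (Matrix (Fin m) (Fin m) k) →ₗ[k] Matrix (Fin m) (Fin m) k :=
    { toFun := fun φ => Matrix.of fun j i => φ (single i j 1)
      map_add' := fun _ _ => rfl
      map_smul' := fun _ _ => rfl }
  have hF : ∀ φ X, trace (F φ * X) = φ X := fun φ X => by
    have hX : φ X = ∑ i, ∑ j, X i j * φ (single i j 1) := by
      conv_lhs => rw [matrix_eq_sum_single X]
      simp only [map_sum]
      refine Finset.sum_congr rfl fun i _ => Finset.sum_congr rfl fun j _ => ?_
      rw [← mul_one (X i j), ← smul_eq_mul, ← smul_single, map_smul, smul_eq_mul, smul_eq_mul,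
        mul_one]
    rw [hX, Finset.sum_comm]
    simp only [trace, diag_apply, mul_apply]
    exact Finset.sum_congr rfl fun j _ => Finset.sum_congr rfl fun i _ => mul_comm _ _
  have hinj : Function.Injective F := fun φ ψ h => LinearMap.ext fun X => by rw [← hF, h, hF]
  have hint : ∀ φ ∈ R.dualAnnihilator, ∀ g, (LinearMap.id - conjAction ρ ρ' g).range ≤ R →
      F φ * (ρ' g).1 = (ρ g).1 * F φ := by
    intro φ hφ g hg
    have h1 : ((ρ g)⁻¹).1 * F φ * (ρ' g).1 = F φ := by
      rw [ext_iff_trace_mul_right]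
      intro X
      have h4 := (Submodule.mem_dualAnnihilator φ).1 hφ _ (hg ⟨X, rfl⟩)
      rw [LinearMap.sub_apply, LinearMap.id_apply, map_sub, sub_eq_zero, conjAction_apply, ← hF,
        ← hF] at h4
      rw [h4, mul_assoc, mul_assoc, trace_mul_comm, mul_assoc]
      simp only [mul_assoc]
    have h5 : (ρ g).1 * (((ρ g)⁻¹).1 * F φ * (ρ' g).1) = F φ * (ρ' g).1 := by
      rw [← mul_assoc, ← mul_assoc, ← Units.val_mul, mul_inv_cancel, Units.val_one, one_mul]
    rw [← h5, h1]
  refine LinearMap.finrank_le_finrank_of_injective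
    (f := (F ∘ₗ R.dualAnnihilator.subtype).codRestrict (intertwiners ρ' ρ) fun φ => ?_) ?_
  · exact BinIcos.mem_intertwiners (hint φ.1 φ.2 _ h2) (hint φ.1 φ.2 _ h3) (hint φ.1 φ.2 _ h5)
  · exact fun x y hxy => Subtype.ext (hinj (congrArg Subtype.val hxy))

/-- Scott's inequality for the conjugation action on matrices. -/
theorem crossPairs_sum_le {ρ ρ' : BinIcos →* GL (Fin m) k}
    (hz : ∀ X : Matrix (Fin m) (Fin m) k, X * (ρ BinIcos.z).1 = (ρ' BinIcos.z).1 * X)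
    {P₂ P₂' P₃ P₃' P₅ P₅' : GL (Fin m) k} {d₂ d₂' d₃ d₃' d₅ d₅' : Fin m → k}
    (h2 : (ρ BinIcos.x2).1 * P₂.1 = P₂.1 * diagonal d₂)
    (h2' : (ρ' BinIcos.x2).1 * P₂'.1 = P₂'.1 * diagonal d₂')
    (h3 : (ρ BinIcos.x3).1 * P₃.1 = P₃.1 * diagonal d₃)
    (h3' : (ρ' BinIcos.x3).1 * P₃'.1 = P₃'.1 * diagonal d₃')
    (h5 : (ρ BinIcos.x5).1 * P₅.1 = P₅.1 * diagonal d₅)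
    (h5' : (ρ' BinIcos.x5).1 * P₅'.1 = P₅'.1 * diagonal d₅') :
    crossPairs d₂' d₂ + crossPairs d₃' d₃ + crossPairs d₅' d₅ ≤
      m ^ 2 + Module.finrank k (intertwiners ρ ρ') + Module.finrank k (intertwiners ρ' ρ) := by
  have hmul : ∀ v, conjAction ρ ρ' BinIcos.x2 (conjAction ρ ρ' BinIcos.x3
      (conjAction ρ ρ' BinIcos.x5 v)) = v := fun v => by
    have h1 := mem_ker_id_sub_conjAction.2 (hz v)
    rw [LinearMap.mem_ker, LinearMap.sub_apply, LinearMap.id_apply, sub_eq_zero] at h1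
    nth_rewrite 2 [h1]
    simp only [conjAction_apply, BinIcos.z, map_mul, _root_.mul_inv_rev, Units.val_mul, mul_assoc]
  have hs := scott_inequality _ _ _ hmul
  have c2 := crossPairs_le_finrank h2 h2'
  have c3 := crossPairs_le_finrank h3 h3'
  have c5 := crossPairs_le_finrank h5 h5'
  have hK : ((LinearMap.id - conjAction ρ ρ' BinIcos.x2).ker ⊓
      (LinearMap.id - conjAction ρ ρ' BinIcos.x3).ker ⊓
      (LinearMap.id - conjAction ρ ρ' BinIcos.x5).ker) ≤ intertwiners ρ ρ' := fun X hX =>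
    BinIcos.mem_intertwiners (mem_ker_id_sub_conjAction.1 hX.1.1)
      (mem_ker_id_sub_conjAction.1 hX.1.2) (mem_ker_id_sub_conjAction.1 hX.2)
  have hK' := Submodule.finrank_mono hK
  set R := (LinearMap.id - conjAction ρ ρ' BinIcos.x2).range ⊔
      (LinearMap.id - conjAction ρ ρ' BinIcos.x3).range ⊔
      (LinearMap.id - conjAction ρ ρ' BinIcos.x5).range
  have hR := finrank_dualAnnihilator_le (ρ := ρ) (ρ' := ρ') R (le_sup_left.trans le_sup_left)
    (le_sup_right.trans le_sup_left) le_sup_right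
  have hR' := Subspace.finrank_add_finrank_dualAnnihilator_eq R
  rw [Module.finrank_matrix, Module.finrank_self, Fintype.card_fin] at hR' hs
  have : m ^ 2 = m * m := pow_two m
  omega

theorem finrank_intertwiners_self [IsAlgClosed k] {ρ : Γ →* GL (Fin m) k}
    (hρ : (matRep ρ).IsIrreducible) : Module.finrank k (intertwiners ρ ρ) ≤ 1 := by
  have h : intertwiners ρ ρ ≤ Submodule.span k {(1 : Matrix (Fin m) (Fin m) k)} := fun X hX => by
    obtain ⟨c, rfl⟩ := exists_eq_smul_one_of_commute hρ hX
    exact Submodule.smul_mem _ _ (Submodule.mem_span_singleton_self _)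
  exact (Submodule.finrank_mono h).trans ((finrank_span_le_card _).trans (by simp))

theorem intertwiners_eq_bot {ρ ρ' : Γ →* GL (Fin m) k} (hρ : (matRep ρ).IsIrreducible)
    (h : ¬ ∃ P : GL (Fin m) k, ∀ g, ρ' g = P * ρ g * P⁻¹) : intertwiners ρ ρ' = ⊥ := by
  rw [Submodule.eq_bot_iff]
  intro X hX
  by_contra hX0
  exact h (exists_conj_of_intertwining hρ hX0 hX)

end Scott

/-! ### Eigenvalue multiplicities of irreducible representations, and rigidity -/

section Rigidity

open Matrix

variable {m : ℕ} {k : Type*} [Field k]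

/-- The matrix `a` is diagonalizable with eigenvalues `σ ζⁱ` of multiplicity `μ i`. -/
def HasExponents {N : ℕ} (a : GL (Fin m) k) (σ ζ : kˣ) (μ : Fin N → ℕ) : Prop :=
  ∃ (P : GL (Fin m) k) (e : Fin m → Fin N),
    a.1 * P.1 = P.1 * diagonal (fun i => (σ * ζ ^ (e i).1).1) ∧ ∀ i, expMult e i = μ i

theorem exists_exponents [IsAlgClosed k] {N : ℕ} (hN : (N : k) ≠ 0) {ζ : kˣ}
    (hζ : IsPrimitiveRoot ζ N) {a : GL (Fin m) k} {σ : kˣ}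
    (ha : a ^ N = GeneralLinearGroup.scalar (Fin m) (σ ^ N)) :
    ∃ (P : GL (Fin m) k) (e : Fin m → Fin N),
      a.1 * P.1 = P.1 * diagonal (fun i => (σ * ζ ^ (e i).1).1) := by
  have hN0 : N ≠ 0 := by rintro rfl; simp at hN
  have ha' : a.1 ^ N = (σ ^ N).1 • 1 := by
    rw [← Units.val_pow_eq_pow_val, ha, scalar_val]
  obtain ⟨P, d, hd⟩ := exists_diagonalization hN (σ ^ N).ne_zero ha'
  have hpow : ∀ n : ℕ, a.1 ^ n * P.1 = P.1 * diagonal d ^ n := fun n => by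
    induction n with
    | zero => simp
    | succ n ih => rw [pow_succ, mul_assoc, hd, ← mul_assoc, ih, mul_assoc, pow_succ]
  have hdN : ∀ i, d i ^ N = σ.1 ^ N := fun i => by
    have h1 := hpow N
    rw [ha', smul_mul_assoc, one_mul, diagonal_pow] at h1
    have h2 : (σ ^ N).1 • (1 : Matrix (Fin m) (Fin m) k) = diagonal (d ^ N) := by
      have h3 : P.1 * ((σ ^ N).1 • (1 : Matrix (Fin m) (Fin m) k)) = P.1 * diagonal (d ^ N) := by
        rw [mul_smul_comm, mul_one, h1]
      exact (Units.mul_right_inj P).1 h3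
    have h4 := congrFun (congrFun h2 i) i
    simpa using h4.symm
  have hex : ∀ i, ∃ j : Fin N, d i = (σ * ζ ^ j.1).1 := fun i => by
    have h1 : (d i * σ.1⁻¹) ^ N = 1 := by
      rw [mul_pow, inv_pow, hdN, mul_inv_cancel₀ (pow_ne_zero N σ.ne_zero)]
    have : NeZero N := ⟨hN0⟩
    obtain ⟨j, hj, hj'⟩ := (IsPrimitiveRoot.coe_units_iff.2 hζ).eq_pow_of_pow_eq_one h1
    refine ⟨⟨j, hj⟩, ?_⟩
    rw [Units.val_mul, Units.val_pow_eq_pow_val, hj', mul_comm, inv_mul_cancel_right₀ σ.ne_zero]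
  choose e he using hex
  exact ⟨P, e, by rw [hd]; congr 2; funext i; exact he i⟩

theorem sum_val_eq {N : ℕ} (e : Fin m → Fin N) : ∑ j, (e j).1 = ∑ i, i.1 * expMult e i := by
  have h : ∀ j, (e j).1 = ∑ i : Fin N, if e j = i then i.1 else 0 := fun j => by simp
  rw [Finset.sum_congr rfl fun j _ => h j, Finset.sum_comm]
  refine Finset.sum_congr rfl fun i _ => ?_
  rw [← Finset.sum_filter, Finset.sum_const, smul_eq_mul, mul_comm, expMult]

theorem pow_mul_pow_sum_eq_one {N : ℕ} {a P : GL (Fin m) k} {σ ζ : kˣ} {e : Fin m → Fin N}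
    (h : a.1 * P.1 = P.1 * diagonal (fun i => (σ * ζ ^ (e i).1).1)) (ha : a.1.det = 1) :
    σ ^ m * ζ ^ (∑ i, i.1 * expMult e i) = 1 := by
  have h1 := congrArg Matrix.det h
  have hP : P.1.det ≠ 0 := (P.isUnit.map (Matrix.detMonoidHom)).ne_zero
  rw [det_mul, det_mul, ha, mul_comm, det_diagonal] at h1
  have h2 := mul_left_cancel₀ hP h1
  rw [← sum_val_eq, ← Finset.prod_pow_eq_pow_sum]
  have h3 : σ ^ m = ∏ _i : Fin m, σ := by simp
  rw [h3, ← Finset.prod_mul_distrib]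
  refine Units.ext ?_
  rw [Units.coe_prod]
  exact h2.symm

/-- The number of pairs of equal eigenvalues of two matrices with the same multiplicities. -/
theorem crossPairs_eq {N : ℕ} {σ ζ : kˣ} (hζ : IsPrimitiveRoot ζ N) {e e' : Fin m → Fin N}
    {μ : Fin N → ℕ} (he : ∀ i, expMult e i = μ i) (he' : ∀ i, expMult e' i = μ i) :
    crossPairs (fun i => (σ * ζ ^ (e' i).1).1) (fun i => (σ * ζ ^ (e i).1).1) = ∑ i, μ i ^ 2 := by
  obtain ⟨τ, hτ⟩ := exists_perm_of_card_eq (d := e) (d' := e') fun i => by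
    have h1 := (he i).trans (he' i).symm
    rwa [Nat.card_eq_fintype_card, Nat.card_eq_fintype_card, Fintype.card_subtype,
      Fintype.card_subtype]
  have hinj : Function.Injective fun i : Fin N => (σ * ζ ^ i.1).1 := fun i j h =>
    hζ.units_pow_injective (by
      have h1 : σ * ζ ^ i.1 = σ * ζ ^ j.1 := Units.ext h
      exact congrArg Units.val (mul_left_cancel h1))
  have h2 : ∑ i, μ i ^ 2 = eqPairs e := by
    rw [eqPairs_eq_sum]
    simp only [he]
  rw [h2, crossPairs, eqPairs]
  refine Nat.card_congr (Equiv.subtypeEquiv ((τ.symm).prodCongr (Equiv.refl _)) fun p => ?_)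
  rw [hinj.eq_iff]
  simp only [Equiv.prodCongr_apply, Prod.map_fst, Prod.map_snd, Equiv.refl_apply]
  rw [← hτ, ← hτ, Equiv.apply_symm_apply]

theorem isPrimitiveRoot_neg_one_units (h2 : (2 : k) ≠ 0) : IsPrimitiveRoot (-1 : kˣ) 2 := by
  have h : orderOf (-1 : kˣ) = 2 := orderOf_eq_prime (by simp) fun h => h2 (by
    have h1 := congrArg Units.val h
    rw [Units.val_neg, Units.val_one] at h1
    linear_combination -h1)
  exact h ▸ IsPrimitiveRoot.orderOf (-1 : kˣ)

/-- The multiplicities at most `c + 1` with sum `m`, square sum `q` and weighted sum divisible by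
`r` belong to the list `L`. -/
def MultIn (m N c q r : ℕ) (L : List (Fin N → ℕ)) : Prop :=
  ∀ a : Fin N → Fin (c + 2), ∑ i, (a i).1 = m → ∑ i, (a i).1 ^ 2 = q → r ∣ ∑ i, i.1 * (a i).1 →
    ∃ μ ∈ L, ∀ i, (a i).1 = μ i

instance (m N c q r : ℕ) (L : List (Fin N → ℕ)) : Decidable (MultIn m N c q r L) := by
  unfold MultIn
  infer_instance

theorem MultIn.exists_mem {N c q r : ℕ} {L : List (Fin N → ℕ)} (h : MultIn m N c q r L)
    (hq : q + N * (c * (c + 1)) = (2 * c + 1) * m) {e : Fin m → Fin N} (he : eqPairs e = q)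
    (hr : r ∣ ∑ i, i.1 * expMult e i) : ∃ μ ∈ L, ∀ i, expMult e i = μ i :=
  h (fun i => ⟨expMult e i, expMult_le_of_eqPairs_eq (c := c) (by rw [he, hq]) i⟩) (sum_expMult e)
    (by simpa only [eqPairs_eq_sum] using he) hr

/-- The multiplicities of the eigenvalues `σ`, `-σ` of `x₂` in an irreducible representation of
dimension `m`. -/
def multTwo : ℕ → Fin 2 → ℕ
  | 2 => ![1, 1]
  | 3 => ![1, 2]
  | 4 => ![2, 2]
  | 5 => ![3, 2]
  | 6 => ![3, 3]
  | _ => 0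

/-- The multiplicities of the eigenvalues `ε ζ₃ⁱ` of `x₃` in an irreducible representation of
dimension `m` in which `z` acts as `ε`. -/
def multThree : ℕ → Fin 3 → ℕ
  | 2 => ![0, 1, 1]
  | 3 => ![1, 1, 1]
  | 4 => ![2, 1, 1]
  | 5 => ![1, 2, 2]
  | 6 => ![2, 2, 2]
  | _ => 0

/-- The possible multiplicities of the eigenvalues `ε ζ₅ⁱ` of `x₅` in an irreducible representation
of dimension `m` in which `z` acts as `ε`. -/
def multFive : ℕ → List (Fin 5 → ℕ)
  | 2 => [![0, 1, 0, 0, 1], ![0, 0, 1, 1, 0]]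
  | 3 => [![1, 1, 0, 0, 1], ![1, 0, 1, 1, 0]]
  | 4 => [![0, 1, 1, 1, 1]]
  | 5 => [![1, 1, 1, 1, 1]]
  | 6 => [![2, 1, 1, 1, 1]]
  | _ => []

variable {ζ₃ ζ₅ : kˣ} {ρ ρ' : BinIcos →* GL (Fin m) k} {ε σ : kˣ}

theorem det_eq_one (ρ : BinIcos →* GL (Fin m) k) (x : BinIcos) : (ρ x).1.det = 1 :=
  congrArg Units.val (BinIcos.hom_eq_one (GeneralLinearGroup.det.comp ρ) x)

theorem commute_z (hz : ρ BinIcos.z = GeneralLinearGroup.scalar (Fin m) ε)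
    (hz' : ρ' BinIcos.z = GeneralLinearGroup.scalar (Fin m) ε) (X : Matrix (Fin m) (Fin m) k) :
    X * (ρ BinIcos.z).1 = (ρ' BinIcos.z).1 * X := by
  rw [hz, hz', scalar_val, mul_smul_comm, smul_mul_assoc, mul_one, one_mul]

variable [IsAlgClosed k]

/-- Scott's inequality for an irreducible representation with `z` acting as `ε = ±1`: the
multiplicities are nearly balanced. Since the determinant is `1`, the exponents sum to zero. -/
theorem exists_exponents_of_isIrreducible (h2 : (2 : k) ≠ 0) (h3 : (3 : k) ≠ 0) (h5 : (5 : k) ≠ 0)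
    (hζ₃ : IsPrimitiveRoot ζ₃ 3) (hζ₅ : IsPrimitiveRoot ζ₅ 5) (hε : ε = 1 ∨ ε = -1)
    (hσ : σ ^ 2 = ε) (hρ : (matRep ρ).IsIrreducible)
    (hz : ρ BinIcos.z = GeneralLinearGroup.scalar (Fin m) ε) :
    ∃ (P₂ P₃ P₅ : GL (Fin m) k) (e₂ : Fin m → Fin 2) (e₃ : Fin m → Fin 3) (e₅ : Fin m → Fin 5),
      (ρ BinIcos.x2).1 * P₂.1 = P₂.1 * diagonal (fun i => (σ * (-1) ^ (e₂ i).1).1) ∧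
      (ρ BinIcos.x3).1 * P₃.1 = P₃.1 * diagonal (fun i => (ε * ζ₃ ^ (e₃ i).1).1) ∧
      (ρ BinIcos.x5).1 * P₅.1 = P₅.1 * diagonal (fun i => (ε * ζ₅ ^ (e₅ i).1).1) ∧
      eqPairs e₂ + eqPairs e₃ + eqPairs e₅ ≤ m ^ 2 + 2 ∧ ε ^ m = 1 ∧
      σ ^ m * (-1) ^ (∑ i, i.1 * expMult e₂ i) = 1 ∧ 3 ∣ ∑ i, i.1 * expMult e₃ i ∧
      5 ∣ ∑ i, i.1 * expMult e₅ i := by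
  have hζ₂ := isPrimitiveRoot_neg_one_units h2
  have hεodd : ∀ n, Odd n → ε ^ n = ε := fun n hn => by
    rcases hε with rfl | rfl
    · exact one_pow n
    · exact hn.neg_one_pow
  obtain ⟨P₂, e₂, k2⟩ := exists_exponents (a := ρ BinIcos.x2) (σ := σ) (by exact_mod_cast h2) hζ₂
    (by rw [← map_pow, BinIcos.x2_sq, hz, hσ])
  obtain ⟨P₃, e₃, k3⟩ := exists_exponents (a := ρ BinIcos.x3) (σ := ε) (by exact_mod_cast h3) hζ₃
    (by rw [← map_pow, BinIcos.x3_pow, hz, hεodd 3 (by decide)])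
  obtain ⟨P₅, e₅, k5⟩ := exists_exponents (a := ρ BinIcos.x5) (σ := ε) (by exact_mod_cast h5) hζ₅
    (by rw [← map_pow, BinIcos.x5_pow, hz, hεodd 5 (by decide)])
  have hεm : ε ^ m = 1 := by
    have h1 := det_eq_one ρ BinIcos.z
    rw [hz, scalar_val, det_smul, det_one, mul_one, Fintype.card_fin] at h1
    exact Units.ext (by simpa using h1)
  refine ⟨P₂, P₃, P₅, e₂, e₃, e₅, k2, k3, k5, ?_, hεm,
    pow_mul_pow_sum_eq_one k2 (det_eq_one ρ _), ?_, ?_⟩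
  · have hs := crossPairs_sum_le (commute_z hz hz) k2 k2 k3 k3 k5 k5
    have h1 := finrank_intertwiners_self hρ
    rw [crossPairs_eq hζ₂ (fun _ => rfl) (fun _ => rfl),
      crossPairs_eq hζ₃ (fun _ => rfl) (fun _ => rfl),
      crossPairs_eq hζ₅ (fun _ => rfl) (fun _ => rfl), ← eqPairs_eq_sum, ← eqPairs_eq_sum,
      ← eqPairs_eq_sum] at hs
    omega
  · have h1 := pow_mul_pow_sum_eq_one k3 (det_eq_one ρ _)
    rw [hεm, one_mul] at h1
    exact hζ₃.dvd_of_pow_eq_one _ h1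
  · have h1 := pow_mul_pow_sum_eq_one k5 (det_eq_one ρ _)
    rw [hεm, one_mul] at h1
    exact hζ₅.dvd_of_pow_eq_one _ h1

theorem dim_lt_seven (h2 : (2 : k) ≠ 0) (h3 : (3 : k) ≠ 0) (h5 : (5 : k) ≠ 0)
    (hζ₃ : IsPrimitiveRoot ζ₃ 3) (hζ₅ : IsPrimitiveRoot ζ₅ 5) (hε : ε = 1 ∨ ε = -1)
    (hσ : σ ^ 2 = ε) (hρ : (matRep ρ).IsIrreducible)
    (hz : ρ BinIcos.z = GeneralLinearGroup.scalar (Fin m) ε) : m < 7 := by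
  obtain ⟨_, _, _, e₂, e₃, e₅, -, -, -, h, -⟩ :=
    exists_exponents_of_isIrreducible h2 h3 h5 hζ₃ hζ₅ hε hσ hρ hz
  by_contra! hm7
  exact absurd (eqPairs_sum_gt hm7 e₂ e₃ e₅) (by omega)

set_option maxRecDepth 20000 in
/-- The multiplicities of the eigenvalues of the generators in an irreducible representation. -/
theorem hasExponents_of_isIrreducible (h2 : (2 : k) ≠ 0) (h3 : (3 : k) ≠ 0) (h5 : (5 : k) ≠ 0)
    (hζ₃ : IsPrimitiveRoot ζ₃ 3) (hζ₅ : IsPrimitiveRoot ζ₅ 5) (hε : ε = 1 ∨ ε = -1)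
    (hσ : σ ^ 2 = ε) (hσ1 : ε = 1 → σ = 1) (hm : m = 2 ∨ m = 3 ∨ m = 4 ∨ m = 5 ∨ m = 6)
    (hρ : (matRep ρ).IsIrreducible) (hz : ρ BinIcos.z = GeneralLinearGroup.scalar (Fin m) ε) :
    (ε = 1 → m ≠ 2 ∧ m ≠ 6) ∧ (ε = -1 → m ≠ 3 ∧ m ≠ 5) ∧
      HasExponents (ρ BinIcos.x2) σ (-1) (multTwo m) ∧
      HasExponents (ρ BinIcos.x3) ε ζ₃ (multThree m) ∧
      ∃ μ ∈ multFive m, HasExponents (ρ BinIcos.x5) ε ζ₅ μ := by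
  have hne : (-1 : kˣ) ≠ 1 := (isPrimitiveRoot_neg_one_units h2).ne_one (by norm_num)
  obtain ⟨P₂, P₃, P₅, e₂, e₃, e₅, k2, k3, k5, hs, hεm, d2, d3, d5⟩ :=
    exists_exponents_of_isIrreducible h2 h3 h5 hζ₃ hζ₅ hε hσ hρ hz
  have heven : ε = 1 → 2 ∣ ∑ i, i.1 * expMult e₂ i := fun h => by
    rw [hσ1 h, one_pow, one_mul] at d2
    exact (isPrimitiveRoot_neg_one_units h2).dvd_of_pow_eq_one _ d2
  have hodd : ε = -1 → Even m := fun h => by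
    rw [h] at hεm
    rcases Nat.even_or_odd m with he | ho
    · exact he
    · rw [ho.neg_one_pow] at hεm
      exact absurd hεm hne
  -- it remains to determine the multiplicities, which have the least possible square sums
  suffices key : ∀ c₂ q₂ c₃ q₃ c₅ q₅ : ℕ, q₂ + 2 * (c₂ * (c₂ + 1)) = (2 * c₂ + 1) * m →
      q₃ + 3 * (c₃ * (c₃ + 1)) = (2 * c₃ + 1) * m → q₅ + 5 * (c₅ * (c₅ + 1)) = (2 * c₅ + 1) * m →
      q₂ + q₃ + q₅ = m ^ 2 + 2 →
      MultIn m 2 c₂ q₂ 2 (if m = 2 ∨ m = 6 then [] else [multTwo m]) →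
      (Even m → MultIn m 2 c₂ q₂ 1 [multTwo m]) →
      MultIn m 3 c₃ q₃ 3 [multThree m] → MultIn m 5 c₅ q₅ 5 (multFive m) →
      (ε = 1 → m ≠ 2 ∧ m ≠ 6) ∧ (ε = -1 → m ≠ 3 ∧ m ≠ 5) ∧
      HasExponents (ρ BinIcos.x2) σ (-1) (multTwo m) ∧
      HasExponents (ρ BinIcos.x3) ε ζ₃ (multThree m) ∧
      ∃ μ ∈ multFive m, HasExponents (ρ BinIcos.x5) ε ζ₅ μ by
    rcases hm with rfl | rfl | rfl | rfl | rfl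
    · exact key 0 2 0 2 0 2 (by decide) (by decide) (by decide) (by decide) (by decide) (by decide)
        (by decide) (by decide)
    · exact key 1 5 0 3 0 3 (by decide) (by decide) (by decide) (by decide) (by decide) (by decide)
        (by decide) (by decide)
    · exact key 1 8 1 6 0 4 (by decide) (by decide) (by decide) (by decide) (by decide) (by decide)
        (by decide) (by decide)
    · exact key 2 13 1 9 0 5 (by decide) (by decide) (by decide) (by decide) (by decide)
        (by decide) (by decide) (by decide)
    · exact key 2 18 1 12 1 8 (by decide) (by decide) (by decide) (by decide) (by decide)
        (by decide) (by decide) (by decide)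
  intro c₂ q₂ c₃ q₃ c₅ q₅ hc₂ hc₃ hc₅ hq b2 b2' b3 b5
  have g₂ := eqPairs_ge e₂ c₂
  have g₃ := eqPairs_ge e₃ c₃
  have g₅ := eqPairs_ge e₅ c₅
  obtain ⟨μ₃, hμ₃, hμ₃'⟩ := b3.exists_mem hc₃ (e := e₃) (by omega) d3
  obtain ⟨μ₅, hμ₅, hμ₅'⟩ := b5.exists_mem hc₅ (e := e₅) (by omega) d5
  obtain rfl := List.mem_singleton.1 hμ₃
  have hone : ε = 1 → (m ≠ 2 ∧ m ≠ 6) ∧ ∀ i, expMult e₂ i = multTwo m i := fun h => by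
    obtain ⟨μ₂, hμ₂, hμ₂'⟩ := b2.exists_mem hc₂ (e := e₂) (by omega) (heven h)
    split_ifs at hμ₂ with h26
    · simp at hμ₂
    · obtain rfl := List.mem_singleton.1 hμ₂
      exact ⟨not_or.1 h26, hμ₂'⟩
  have hneg : ε = -1 → (m ≠ 3 ∧ m ≠ 5) ∧ ∀ i, expMult e₂ i = multTwo m i := fun h => by
    obtain ⟨μ₂, hμ₂, hμ₂'⟩ := (b2' (hodd h)).exists_mem hc₂ (e := e₂) (by omega) (one_dvd _)
    obtain rfl := List.mem_singleton.1 hμ₂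
    refine ⟨⟨?_, ?_⟩, hμ₂'⟩ <;> rintro rfl <;> exact absurd (hodd h) (by decide)
  refine ⟨fun h => (hone h).1, fun h => (hneg h).1, ⟨P₂, e₂, k2, ?_⟩, ⟨P₃, e₃, k3, hμ₃'⟩, μ₅, hμ₅,
    P₅, e₅, k5, hμ₅'⟩
  exact hε.elim (fun h => (hone h).2) fun h => (hneg h).2

/-- Irreducible representations of the same dimension and central character are isomorphic if the
eigenvalues of `x₅` have the same multiplicities: by Scott's inequality there is a nonzero
intertwining matrix in one of the two directions. -/
theorem exists_conj_of_hasExponents (h2 : (2 : k) ≠ 0) (h3 : (3 : k) ≠ 0) (h5 : (5 : k) ≠ 0)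
    (hζ₃ : IsPrimitiveRoot ζ₃ 3) (hζ₅ : IsPrimitiveRoot ζ₅ 5) (hε : ε = 1 ∨ ε = -1)
    (hσ : σ ^ 2 = ε) (hσ1 : ε = 1 → σ = 1) (hm : m = 2 ∨ m = 3 ∨ m = 4 ∨ m = 5 ∨ m = 6)
    (hρ : (matRep ρ).IsIrreducible) (hz : ρ BinIcos.z = GeneralLinearGroup.scalar (Fin m) ε)
    (hρ' : (matRep ρ').IsIrreducible) (hz' : ρ' BinIcos.z = GeneralLinearGroup.scalar (Fin m) ε)
    {μ : Fin 5 → ℕ} (hμ : μ ∈ multFive m) (k5 : HasExponents (ρ BinIcos.x5) ε ζ₅ μ)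
    (k5' : HasExponents (ρ' BinIcos.x5) ε ζ₅ μ) :
    ∃ P : GL (Fin m) k, ∀ g, ρ' g = P * ρ g * P⁻¹ := by
  obtain ⟨-, -, ⟨P₂, e₂, k2, m2⟩, ⟨P₃, e₃, k3, m3⟩, -⟩ :=
    hasExponents_of_isIrreducible h2 h3 h5 hζ₃ hζ₅ hε hσ hσ1 hm hρ hz
  obtain ⟨-, -, ⟨P₂', e₂', k2', m2'⟩, ⟨P₃', e₃', k3', m3'⟩, -⟩ :=
    hasExponents_of_isIrreducible h2 h3 h5 hζ₃ hζ₅ hε hσ hσ1 hm hρ' hz'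
  obtain ⟨P₅, e₅, k5, m5⟩ := k5
  obtain ⟨P₅', e₅', k5', m5'⟩ := k5'
  by_contra hc
  have hs := crossPairs_sum_le (commute_z hz hz') k2 k2' k3 k3' k5 k5'
  have hc' : ¬ ∃ P : GL (Fin m) k, ∀ g, ρ g = P * ρ' g * P⁻¹ := by
    rintro ⟨P, hP⟩
    exact hc ⟨P⁻¹, fun g => by rw [hP]; group⟩
  rw [crossPairs_eq (isPrimitiveRoot_neg_one_units h2) m2 m2', crossPairs_eq hζ₃ m3 m3',
    crossPairs_eq hζ₅ m5 m5', intertwiners_eq_bot hρ hc, intertwiners_eq_bot hρ' hc',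
    finrank_bot] at hs
  have key : ∀ μ ∈ multFive m, ∑ i, multTwo m i ^ 2 + ∑ i, multThree m i ^ 2 + ∑ i, μ i ^ 2 =
      m ^ 2 + 2 := by
    rcases hm with rfl | rfl | rfl | rfl | rfl <;> decide
  have := key μ hμ
  omega

end Rigidity

/-! ### Irreducible constituents of representations of the binary icosahedral group -/

section Constituents

open Matrix

variable {m : ℕ} {k : Type*} [Field k]

theorem exists_isCompl_of_not_isIrreducible {Γ : Type*} [Group Γ] [Finite Γ]
    (hΓ : (Nat.card Γ : k) ≠ 0) {ρ : Γ →* GL (Fin m) k} (hm : Nontrivial (Fin m → k))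
    (hρ : ¬ (matRep ρ).IsIrreducible) :
    ∃ W W' : Submodule k (Fin m → k), (∀ g, ∀ v ∈ W, matRep ρ g v ∈ W) ∧
      (∀ g, ∀ v ∈ W', matRep ρ g v ∈ W') ∧ IsCompl W W' ∧ W ≠ ⊥ ∧ W ≠ ⊤ := by
  obtain ⟨W, hW, hW0, hW1⟩ : ∃ W : Submodule k (Fin m → k), (∀ g, ∀ v ∈ W, matRep ρ g v ∈ W) ∧
      W ≠ ⊥ ∧ W ≠ ⊤ := by
    by_contra! hc
    exact hρ ((isIrreducible_iff_submodule _).2 ⟨hm, fun W hW =>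
      or_iff_not_imp_left.2 (hc W hW)⟩)
  obtain ⟨W', hW', hc⟩ := exists_isCompl_invariant hΓ _ hW
  exact ⟨W, W', hW, hW', hc, hW0, hW1⟩

/-- A matrix representation that is not irreducible contains one of at most half its dimension. -/
theorem exists_sub_of_not_isIrreducible {Γ : Type*} [Group Γ] [Finite Γ]
    (hΓ : (Nat.card Γ : k) ≠ 0) {ρ : Γ →* GL (Fin m) k} (hm : 0 < m)
    (hρ : ¬ (matRep ρ).IsIrreducible) :
    ∃ (n : ℕ) (ρ' : Γ →* GL (Fin n) k) (e : (Fin n → k) →ₗ[k] (Fin m → k)), 0 < n ∧ 2 * n ≤ m ∧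
      Function.Injective e ∧ ∀ g v, e ((ρ' g).1 *ᵥ v) = (ρ g).1 *ᵥ e v := by
  have hm₀ : Nonempty (Fin m) := ⟨⟨0, hm⟩⟩
  have hm' : Nontrivial (Fin m → k) := inferInstance
  obtain ⟨W, W', hW, hW', hc, hW0, hW1⟩ := exists_isCompl_of_not_isIrreducible hΓ hm' hρ
  have hsum := Submodule.finrank_add_eq_of_isCompl hc
  rw [Module.finrank_fin_fun] at hsum
  have hW'0 : W' ≠ ⊥ := fun h => hW1 (by simpa [h] using hc.sup_eq_top)
  have key : ∀ U : Submodule k (Fin m → k), (∀ g, ∀ v ∈ U, matRep ρ g v ∈ U) → U ≠ ⊥ →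
      2 * Module.finrank k U ≤ m → ∃ (n : ℕ) (ρ' : Γ →* GL (Fin n) k)
      (e : (Fin n → k) →ₗ[k] (Fin m → k)), 0 < n ∧ 2 * n ≤ m ∧
      Function.Injective e ∧ ∀ g v, e ((ρ' g).1 *ᵥ v) = (ρ g).1 *ᵥ e v := fun U hU hU0 hle => by
    obtain ⟨ρ', e, he, -, h⟩ := exists_matRep_of_invariant (matRep ρ) hU rfl
    exact ⟨_, ρ', e, Nat.pos_of_ne_zero fun h => hU0 (Submodule.finrank_eq_zero.1 h), hle, he, h⟩
  rcases le_total (Module.finrank k W) (Module.finrank k W') with h | h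
  · exact key W hW hW0 (by omega)
  · exact key W' hW' hW'0 (by omega)

theorem z_eq_of_intertwining {n : ℕ} {Γ : Type*} [Group Γ] {ρ : Γ →* GL (Fin m) k}
    {ρ' : Γ →* GL (Fin n) k} {e : (Fin n → k) →ₗ[k] (Fin m → k)} (he : Function.Injective e)
    (h : ∀ g v, e ((ρ' g).1 *ᵥ v) = (ρ g).1 *ᵥ e v) {x : Γ} {ε : kˣ}
    (hz : ρ x = GeneralLinearGroup.scalar (Fin m) ε) :
    ρ' x = GeneralLinearGroup.scalar (Fin n) ε := by
  refine Units.ext (Matrix.toLin'.injective (LinearMap.ext fun v => he ?_))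
  rw [Matrix.toLin'_apply, Matrix.toLin'_apply, h, hz, scalar_val, scalar_val, smul_mulVec,
    smul_mulVec, one_mulVec, one_mulVec, map_smul]

theorem eq_one_of_dim_one (ρ : BinIcos →* GL (Fin 1) k) (x : BinIcos) : ρ x = 1 := by
  refine Units.ext (Matrix.ext fun i j => ?_)
  have h := det_eq_one ρ x
  rw [Matrix.det_fin_one] at h
  rw [Subsingleton.elim i 0, Subsingleton.elim j 0, h]
  rfl

/-- The irreducible constituent containing a given eigenvector, or rather a projection of it. -/
theorem exists_isIrreducible_of_eigenvector {Γ : Type*} [Group Γ] [Finite Γ]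
    (hΓ : (Nat.card Γ : k) ≠ 0) {m : ℕ} (ρ : Γ →* GL (Fin m) k) {x y : Γ} {c : k} {ε : kˣ}
    (hy : ρ y = GeneralLinearGroup.scalar (Fin m) ε) {v : Fin m → k} (hv : v ≠ 0)
    (hx : (ρ x).1 *ᵥ v = c • v) :
    (matRep ρ).IsIrreducible ∨ ∃ (n : ℕ) (ρ' : Γ →* GL (Fin n) k), n < m ∧
      (matRep ρ').IsIrreducible ∧ ρ' y = GeneralLinearGroup.scalar (Fin n) ε ∧
      ∃ v, v ≠ 0 ∧ (ρ' x).1 *ᵥ v = c • v := by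
  induction m using Nat.strong_induction_on with
  | _ m ih =>
  refine or_iff_not_imp_left.2 fun hρ => ?_
  have hm' : Nontrivial (Fin m → k) := ⟨v, 0, hv⟩
  obtain ⟨W, W', hW, hW', hc, hW0, hW1⟩ := exists_isCompl_of_not_isIrreducible hΓ hm' hρ
  have hW'1 : W' ≠ ⊤ := fun h => hW0 (by simpa [h] using hc.inf_eq_bot)
  have key : ∀ U : Submodule k (Fin m → k), (∀ g, ∀ v ∈ U, matRep ρ g v ∈ U) → U ≠ ⊤ →
      (∃ w ∈ U, w ≠ 0 ∧ matRep ρ x w = c • w) → ∃ (n : ℕ) (ρ' : Γ →* GL (Fin n) k), n < m ∧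
      (matRep ρ').IsIrreducible ∧ ρ' y = GeneralLinearGroup.scalar (Fin n) ε ∧
      ∃ v, v ≠ 0 ∧ (ρ' x).1 *ᵥ v = c • v := by
    rintro U hU hU1 ⟨w, hwU, hw0, hw⟩
    obtain ⟨ρ', e, he, hr, h⟩ := exists_matRep_of_invariant (matRep ρ) hU rfl
    obtain ⟨u, rfl⟩ : w ∈ e.range := hr.symm ▸ hwU
    have hlt : Module.finrank k U < m := by
      have := Submodule.finrank_lt hU1
      rwa [Module.finrank_fin_fun] at this
    have hu0 : u ≠ 0 := by rintro rfl; exact hw0 (map_zero e)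
    have hu : (ρ' x).1 *ᵥ u = c • u := he (by rw [h, hw, map_smul])
    have hy' := z_eq_of_intertwining he h hy
    rcases ih _ hlt ρ' hy' hu0 hu with hi | ⟨n, ρ'', hn, h3⟩
    · exact ⟨_, ρ', hlt, hi, hy', u, hu0, hu⟩
    · exact ⟨n, ρ'', hn.trans hlt, h3⟩
  -- the components of `v` are eigenvectors as well
  obtain ⟨w, hw, w', hw', rfl⟩ : ∃ w ∈ W, ∃ w' ∈ W', w + w' = v :=
    Submodule.mem_sup.1 (hc.sup_eq_top ▸ Submodule.mem_top)
  have hx' : matRep ρ x w + matRep ρ x w' = c • w + c • w' := by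
    rw [← map_add, ← smul_add]
    exact hx
  have hdiff : matRep ρ x w - c • w = c • w' - matRep ρ x w' := by
    rw [sub_eq_sub_iff_add_eq_add, hx', add_comm]
  have h0 : matRep ρ x w - c • w = 0 := (Submodule.disjoint_def.1 hc.disjoint) _
    (W.sub_mem (hW x w hw) (W.smul_mem c hw))
    (hdiff ▸ W'.sub_mem (W'.smul_mem c hw') (hW' x w' hw'))
  rcases eq_or_ne w 0 with rfl | hw0
  · refine key W' hW' hW'1 ⟨w', hw', by simpa using hv, ?_⟩
    rw [h0] at hdiff
    exact (sub_eq_zero.1 hdiff.symm).symm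
  · exact key W hW hW1 ⟨w, hw, hw0, sub_eq_zero.1 h0⟩

theorem HasExponents.mult_pos {N : ℕ} {a : GL (Fin m) k} {σ ζ : kˣ} {μ : Fin N → ℕ}
    (h : HasExponents a σ ζ μ) {v : Fin m → k} (hv : v ≠ 0) {c : k} (hc : a.1 *ᵥ v = c • v) :
    ∃ i, 0 < μ i ∧ c = (σ * ζ ^ i.1).1 := by
  obtain ⟨P, e, hP, hμ⟩ := h
  set w := (P⁻¹).1 *ᵥ v with hw
  have hPw : P.1 *ᵥ w = v := by
    rw [hw, mulVec_mulVec, ← Units.val_mul, mul_inv_cancel, Units.val_one, one_mulVec]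
  have hw0 : w ≠ 0 := fun h => hv (by rw [← hPw, h, mulVec_zero])
  obtain ⟨j, hj⟩ := Function.ne_iff.1 hw0
  refine ⟨e j, ?_, ?_⟩
  · rw [← hμ]
    exact Finset.card_pos.2 ⟨j, by simp⟩
  · have h1 : diagonal (fun i => (σ * ζ ^ (e i).1).1) *ᵥ w = c • w := by
      have h2 : P.1 *ᵥ (diagonal (fun i => (σ * ζ ^ (e i).1).1) *ᵥ w) = P.1 *ᵥ (c • w) := by
        rw [mulVec_mulVec, ← hP, ← mulVec_mulVec, hPw, mulVec_smul, hPw, hc]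
      have hP' : ∀ u, (P⁻¹).1 *ᵥ (P.1 *ᵥ u) = u := fun u => by
        rw [mulVec_mulVec, ← Units.val_mul, inv_mul_cancel, Units.val_one, one_mulVec]
      rw [← hP' (diagonal _ *ᵥ w), h2, hP']
    have h4 := congrFun h1 j
    rw [mulVec_diagonal, Pi.smul_apply, smul_eq_mul] at h4
    exact (mul_right_cancel₀ hj h4).symm

theorem dim_ne_one_of_z_eq_neg_one {n : ℕ} (h2 : (2 : k) ≠ 0) {ρ : BinIcos →* GL (Fin n) k}
    (hz : ρ BinIcos.z = GeneralLinearGroup.scalar (Fin n) (-1)) : n ≠ 1 := by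
  rintro rfl
  have h := scalar_injective one_pos
    ((hz.symm.trans (eq_one_of_dim_one ρ _)).trans (map_one _).symm)
  exact (isPrimitiveRoot_neg_one_units h2).ne_one (by norm_num) h

theorem isIrreducible_of_neg_two (h2 : (2 : k) ≠ 0) (h3 : (3 : k) ≠ 0) (h5 : (5 : k) ≠ 0)
    {ρ : BinIcos →* GL (Fin 2) k} (hz : ρ BinIcos.z = GeneralLinearGroup.scalar (Fin 2) (-1)) :
    (matRep ρ).IsIrreducible := by
  by_contra hρ
  obtain ⟨n, ρ₁, e₁, hn0, hn, he₁, h₁⟩ :=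
    exists_sub_of_not_isIrreducible (BinIcos.card_ne_zero h2 h3 h5) two_pos hρ
  exact dim_ne_one_of_z_eq_neg_one h2 (z_eq_of_intertwining he₁ h₁ hz) (by omega)

variable [IsAlgClosed k]

/-- A representation of `𝒜₅` of dimension at most `5` without invariant vectors is irreducible:
otherwise it contains an irreducible representation of dimension `1` or `2`, but the only one is
the trivial representation. -/
theorem isIrreducible_of_no_invariants (h2 : (2 : k) ≠ 0) (h3 : (3 : k) ≠ 0) (h5 : (5 : k) ≠ 0)
    {ρ : BinIcos →* GL (Fin m) k} (hm0 : 0 < m) (hm : m ≤ 5)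
    (hz : ρ BinIcos.z = GeneralLinearGroup.scalar (Fin m) 1)
    (hinv : ∀ v, (∀ g, (ρ g).1 *ᵥ v = v) → v = 0) : (matRep ρ).IsIrreducible := by
  have hΓ := BinIcos.card_ne_zero h2 h3 h5
  by_contra hρ
  have key : ∀ (ρ' : BinIcos →* GL (Fin 1) k) (e : (Fin 1 → k) →ₗ[k] (Fin m → k)),
      Function.Injective e → (∀ g v, e ((ρ' g).1 *ᵥ v) = (ρ g).1 *ᵥ e v) → False :=
    fun ρ' e he h => by
      have h1 := hinv (e 1) fun g => by rw [← h, eq_one_of_dim_one, Units.val_one, one_mulVec]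
      have h2 := congrFun (he (h1.trans (map_zero e).symm)) 0
      exact one_ne_zero h2
  obtain ⟨n, ρ₁, e₁, hn0, hn, he₁, h₁⟩ := exists_sub_of_not_isIrreducible hΓ hm0 hρ
  obtain rfl | rfl : n = 1 ∨ n = 2 := by omega
  · exact key ρ₁ e₁ he₁ h₁
  obtain ⟨ζ₃, hζ₃⟩ := exists_units_isPrimitiveRoot (k := k) (n := 3) (by exact_mod_cast h3)
  obtain ⟨ζ₅, hζ₅⟩ := exists_units_isPrimitiveRoot (k := k) (n := 5) (by exact_mod_cast h5)
  by_cases hρ₁ : (matRep ρ₁).IsIrreducible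
  · exact ((hasExponents_of_isIrreducible h2 h3 h5 hζ₃ hζ₅ (Or.inl rfl) (one_pow 2) (fun _ => rfl)
      (by omega) hρ₁ (z_eq_of_intertwining he₁ h₁ hz)).1 rfl).1 rfl
  · obtain ⟨n, ρ₂, e₂, hn0, hn, he₂, h₂⟩ := exists_sub_of_not_isIrreducible hΓ two_pos hρ₁
    obtain rfl : n = 1 := by omega
    exact key ρ₂ (e₁ ∘ₗ e₂) (he₁.comp he₂) fun g v => by
      rw [LinearMap.comp_apply, LinearMap.comp_apply, h₂, h₁]

/-- In a representation of dimension `4` with `z = -1`, a constituent containing an eigenvector of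
`x₃` with eigenvalue `-1` does not have dimension `2`. -/
theorem isIrreducible_of_neg_four (h2 : (2 : k) ≠ 0) (h3 : (3 : k) ≠ 0) (h5 : (5 : k) ≠ 0)
    {ρ : BinIcos →* GL (Fin 4) k} (hz : ρ BinIcos.z = GeneralLinearGroup.scalar (Fin 4) (-1))
    {v : Fin 4 → k} (hv : v ≠ 0) (hx : (ρ BinIcos.x3).1 *ᵥ v = (-1 : k) • v) :
    (matRep ρ).IsIrreducible := by
  obtain ⟨ζ₃, hζ₃⟩ := exists_units_isPrimitiveRoot (k := k) (n := 3) (by exact_mod_cast h3)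
  obtain ⟨ζ₅, hζ₅⟩ := exists_units_isPrimitiveRoot (k := k) (n := 5) (by exact_mod_cast h5)
  obtain ⟨σ, hσ⟩ := exists_units_pow_eq (-1 : kˣ) (n := 2) (by norm_num)
  have hne : (-1 : kˣ) ≠ 1 := (isPrimitiveRoot_neg_one_units h2).ne_one (by norm_num)
  refine (exists_isIrreducible_of_eigenvector (BinIcos.card_ne_zero h2 h3 h5) ρ hz hv
    hx).resolve_right ?_
  rintro ⟨n, ρ', hn, hρ', hz', w, hw, hxw⟩
  have hn1 := dim_ne_one_of_z_eq_neg_one h2 hz'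
  have hn0 : n ≠ 0 := by rintro rfl; exact hw (Subsingleton.elim _ _)
  obtain ⟨-, hodd, -, h3', -⟩ := hasExponents_of_isIrreducible h2 h3 h5 hζ₃ hζ₅ (Or.inr rfl) hσ
    (fun h => absurd h hne) (by omega) hρ' hz'
  obtain rfl : n = 2 := by have := hodd rfl; omega
  obtain ⟨i, hi, hc⟩ := h3'.mult_pos hw hxw
  have h0 : ζ₃ ^ i.1 = 1 := by
    have h1 : (-1 : kˣ) = -1 * ζ₃ ^ i.1 := Units.ext (by simpa using hc)
    simpa using h1.symm
  have hi0 : i = 0 := Fin.ext (Nat.eq_zero_of_dvd_of_lt (hζ₃.dvd_of_pow_eq_one _ h0) i.2)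
  subst hi0
  exact absurd hi (by decide)

/-- In a representation of dimension `6` with `z = -1`, a constituent containing an eigenvector of
`x₅` with eigenvalue `-1` does not have dimension `2` or `4`. -/
theorem isIrreducible_of_neg_six (h2 : (2 : k) ≠ 0) (h3 : (3 : k) ≠ 0) (h5 : (5 : k) ≠ 0)
    {ρ : BinIcos →* GL (Fin 6) k} (hz : ρ BinIcos.z = GeneralLinearGroup.scalar (Fin 6) (-1))
    {v : Fin 6 → k} (hv : v ≠ 0) (hx : (ρ BinIcos.x5).1 *ᵥ v = (-1 : k) • v) :
    (matRep ρ).IsIrreducible := by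
  obtain ⟨ζ₃, hζ₃⟩ := exists_units_isPrimitiveRoot (k := k) (n := 3) (by exact_mod_cast h3)
  obtain ⟨ζ₅, hζ₅⟩ := exists_units_isPrimitiveRoot (k := k) (n := 5) (by exact_mod_cast h5)
  obtain ⟨σ, hσ⟩ := exists_units_pow_eq (-1 : kˣ) (n := 2) (by norm_num)
  have hne : (-1 : kˣ) ≠ 1 := (isPrimitiveRoot_neg_one_units h2).ne_one (by norm_num)
  refine (exists_isIrreducible_of_eigenvector (BinIcos.card_ne_zero h2 h3 h5) ρ hz hv
    hx).resolve_right ?_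
  rintro ⟨n, ρ', hn, hρ', hz', w, hw, hxw⟩
  have hn1 := dim_ne_one_of_z_eq_neg_one h2 hz'
  have hn0 : n ≠ 0 := by rintro rfl; exact hw (Subsingleton.elim _ _)
  obtain ⟨-, hodd, -, -, μ, hμ, h5'⟩ := hasExponents_of_isIrreducible h2 h3 h5 hζ₃ hζ₅ (Or.inr rfl)
    hσ (fun h => absurd h hne) (by omega) hρ' hz'
  obtain ⟨i, hi, hc⟩ := h5'.mult_pos hw hxw
  have h0 : ζ₅ ^ i.1 = 1 := by
    have h1 : (-1 : kˣ) = -1 * ζ₅ ^ i.1 := Units.ext (by simpa using hc)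
    simpa using h1.symm
  have hi0 : i = 0 := Fin.ext (Nat.eq_zero_of_dvd_of_lt (hζ₅.dvd_of_pow_eq_one _ h0) i.2)
  subst hi0
  have hμ0 : ∀ μ ∈ multFive n, μ 0 = 0 := by
    obtain rfl | rfl : n = 2 ∨ n = 4 := by have := hodd rfl; omega
    all_goals decide
  exact hi.ne' (hμ0 μ hμ)

end Constituents

/-! ### Binary forms -/

section BinaryForms

open Matrix

variable {k : Type*} [Field k]

/-- The binary form `∑ aᵢ xⁱ yⁿ⁻ⁱ` with coefficients `a`, as a function on row vectors `(x, y)`. -/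
def formMap (k : Type*) [Field k] (n : ℕ) : (Fin (n + 1) → k) →ₗ[k] ((Fin 2 → k) → k) where
  toFun a v := ∑ i, a i * (v 0 ^ i.1 * v 1 ^ (n - i.1))
  map_add' a b := by
    funext v
    simp only [Pi.add_apply, add_mul, Finset.sum_add_distrib]
  map_smul' c a := by
    funext v
    simp only [Pi.smul_apply, smul_eq_mul, mul_assoc, Finset.mul_sum, RingHom.id_apply]

theorem formMap_apply {n : ℕ} (a : Fin (n + 1) → k) (v : Fin 2 → k) :
    formMap k n a v = ∑ i, a i * (v 0 ^ i.1 * v 1 ^ (n - i.1)) := rfl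

theorem formMap_single (n : ℕ) (i : Fin (n + 1)) (v : Fin 2 → k) :
    formMap k n (Pi.single i 1) v = v 0 ^ i.1 * v 1 ^ (n - i.1) := by
  rw [formMap_apply, Finset.sum_eq_single i (fun j _ hj => by rw [Pi.single_eq_of_ne hj, zero_mul])
    (by simp), Pi.single_eq_same, one_mul]

theorem formMap_injective [Infinite k] (n : ℕ) : Function.Injective (formMap k n) := by
  refine (injective_iff_map_eq_zero _).2 fun a ha => ?_
  refine eq_zero_of_forall_index_sum_mul_pow_eq_zero
    (f := fun i : Fin (n + 1) => Infinite.natEmbedding k i.1)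
    ((Infinite.natEmbedding k).injective.comp Fin.val_injective) fun j => ?_
  have := congrFun ha ![Infinite.natEmbedding k j.1, 1]
  simpa [formMap_apply] using this

/-- The space of binary forms of degree `n`. -/
def binaryForms (k : Type*) [Field k] (n : ℕ) : Submodule k ((Fin 2 → k) → k) := (formMap k n).range

instance (n : ℕ) : FiniteDimensional k (binaryForms k n) :=
  inferInstanceAs (FiniteDimensional k (formMap k n).range)

theorem finrank_binaryForms [Infinite k] (n : ℕ) : Module.finrank k (binaryForms k n) = n + 1 := by
  rw [binaryForms, LinearMap.finrank_range_of_inj (formMap_injective n), Module.finrank_fin_fun]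

theorem monomial_mem_binaryForms (i j : ℕ) :
    (fun v : Fin 2 → k => v 0 ^ i * v 1 ^ j) ∈ binaryForms k (i + j) :=
  ⟨Pi.single ⟨i, by omega⟩ 1, by
    funext v
    rw [formMap_single, Nat.add_sub_cancel_left]⟩

theorem binaryForms_le {n : ℕ} {U : Submodule k ((Fin 2 → k) → k)}
    (h : ∀ i j, i + j = n → (fun v : Fin 2 → k => v 0 ^ i * v 1 ^ j) ∈ U) :
    binaryForms k n ≤ U := by
  rintro _ ⟨a, rfl⟩
  have h1 : formMap k n a = ∑ i : Fin (n + 1), a i • fun v : Fin 2 → k =>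
      v 0 ^ i.1 * v 1 ^ (n - i.1) := by
    funext v
    simp [formMap_apply]
  rw [h1]
  exact U.sum_mem fun i _ => U.smul_mem _ (h _ _ (by omega))

theorem linear_mul_mem_binaryForms (α β : k) {n : ℕ} {f : (Fin 2 → k) → k}
    (hf : f ∈ binaryForms k n) : (fun v => (v 0 * α + v 1 * β) * f v) ∈ binaryForms k (n + 1) := by
  let M : ((Fin 2 → k) → k) →ₗ[k] ((Fin 2 → k) → k) :=
    LinearMap.mulLeft k (fun v : Fin 2 → k => v 0 * α + v 1 * β)
  suffices binaryForms k n ≤ (binaryForms k (n + 1)).comap M from this hf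
  refine binaryForms_le fun i j hij => ?_
  have h1 : M (fun v : Fin 2 → k => v 0 ^ i * v 1 ^ j) =
      α • (fun v : Fin 2 → k => v 0 ^ (i + 1) * v 1 ^ j) +
        β • (fun v : Fin 2 → k => v 0 ^ i * v 1 ^ (j + 1)) := by
    funext v
    simp only [M, LinearMap.mulLeft_apply, Pi.mul_apply, Pi.add_apply, Pi.smul_apply, smul_eq_mul]
    ring
  rw [Submodule.mem_comap, h1]
  refine Submodule.add_mem _ (Submodule.smul_mem _ _ ?_) (Submodule.smul_mem _ _ ?_)
  · have := monomial_mem_binaryForms (k := k) (i + 1) j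
    rwa [show i + 1 + j = n + 1 by omega] at this
  · have := monomial_mem_binaryForms (k := k) i (j + 1)
    rwa [show i + (j + 1) = n + 1 by omega] at this

theorem linear_pow_mul_mem_binaryForms (α β : k) (i : ℕ) {n : ℕ} {f : (Fin 2 → k) → k}
    (hf : f ∈ binaryForms k n) :
    (fun v => (v 0 * α + v 1 * β) ^ i * f v) ∈ binaryForms k (i + n) := by
  induction i with
  | zero => simpa using hf
  | succ i ih =>
    have h := linear_mul_mem_binaryForms α β ih
    rw [show i + n + 1 = i + 1 + n by omega] at h
    refine (congrArg (· ∈ binaryForms k (i + 1 + n)) (funext fun v => ?_)).mp h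
    rw [pow_succ', mul_assoc]

theorem linear_pow_mem_binaryForms (α β : k) (n : ℕ) :
    (fun v => (v 0 * α + v 1 * β) ^ n) ∈ binaryForms k n := by
  have h1 : (fun v : Fin 2 → k => v 0 ^ 0 * v 1 ^ 0) ∈ binaryForms k 0 :=
    monomial_mem_binaryForms 0 0
  simpa using linear_pow_mul_mem_binaryForms α β n h1

/-- The action of a group on functions on row vectors, induced by a two-dimensional
representation. -/
def funRep {Γ : Type*} [Group Γ] (ρ : Γ →* GL (Fin 2) k) :
    Representation k Γ ((Fin 2 → k) → k) where
  toFun g :=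
    { toFun := fun f v => f (v ᵥ* (ρ g).1)
      map_add' := fun _ _ => rfl
      map_smul' := fun _ _ => rfl }
  map_one' := by
    refine LinearMap.ext fun f => funext fun v => ?_
    simp
  map_mul' g h := by
    refine LinearMap.ext fun f => funext fun v => ?_
    simp [vecMul_vecMul]

theorem funRep_apply {Γ : Type*} [Group Γ] (ρ : Γ →* GL (Fin 2) k) (g : Γ) (f : (Fin 2 → k) → k)
    (v : Fin 2 → k) : funRep ρ g f v = f (v ᵥ* (ρ g).1) := rfl

theorem funRep_mem_binaryForms {Γ : Type*} [Group Γ] (ρ : Γ →* GL (Fin 2) k) (n : ℕ) (g : Γ)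
    (f : (Fin 2 → k) → k) (hf : f ∈ binaryForms k n) : funRep ρ g f ∈ binaryForms k n := by
  suffices binaryForms k n ≤ (binaryForms k n).comap (funRep ρ g) from this hf
  refine binaryForms_le fun i j hij => ?_
  rw [Submodule.mem_comap, ← hij]
  refine (congrArg (· ∈ binaryForms k (i + j)) (funext fun v => ?_)).mp
    (linear_pow_mul_mem_binaryForms ((ρ g).1 0 0) ((ρ g).1 1 0) i
      (linear_pow_mem_binaryForms ((ρ g).1 0 1) ((ρ g).1 1 1) j))
  simp [funRep_apply, vecMul, dotProduct, Fin.sum_univ_two]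

end BinaryForms

/-! ### Existence of irreducible representations -/

section Existence

open Matrix

theorem matrix_fin_two_congr {R : Type*} {a b c d a' b' c' d' : R} (ha : a = a') (hb : b = b')
    (hc : c = c') (hd : d = d') : !![a, b; c, d] = !![a', b'; c', d'] := by
  rw [ha, hb, hc, hd]

variable {k : Type*} [Field k]

/-- A two-dimensional representation: `x₅` is the diagonal matrix with entries `c`, `c⁻¹`, and `x₂`
is a matrix of determinant `1` and trace `0` whose upper left entry `a = (c⁻¹ - c)⁻¹` is such that
`x₃ = x₂ x₅⁻¹` has trace `1`. -/
theorem exists_rep_two {c : kˣ} (hc : c ^ 5 = -1) (hc2 : c ^ 2 ≠ 1) :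
    ∃ ρ : BinIcos →* GL (Fin 2) k, ρ BinIcos.z = GeneralLinearGroup.scalar (Fin 2) (-1) ∧
      (ρ BinIcos.x5).1 = !![c.1, 0; 0, (c⁻¹).1] ∧ (ρ BinIcos.x2).1 0 0 * (ρ BinIcos.x2).1 0 1 ≠ 0 ∧
      (ρ BinIcos.x3).1.det = 1 ∧ (ρ BinIcos.x3).1.trace = 1 := by
  have hd : (c⁻¹).1 - c.1 ≠ 0 := by
    rw [sub_ne_zero, Units.val_injective.ne_iff, ne_eq, inv_eq_iff_mul_eq_one, ← pow_two]
    exact hc2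
  obtain ⟨a, ha⟩ : ∃ a, a * ((c⁻¹).1 - c.1) = 1 := ⟨_, inv_mul_cancel₀ hd⟩
  have hcc : c.1 * (c⁻¹).1 = 1 := by rw [← Units.val_mul, mul_inv_cancel, Units.val_one]
  let A : GL (Fin 2) k := ⟨!![a, 1; -1 - a ^ 2, -a], !![-a, -1; 1 + a ^ 2, a],
    by rw [Matrix.mul_fin_two, Matrix.one_fin_two]; apply matrix_fin_two_congr <;> ring,
    by rw [Matrix.mul_fin_two, Matrix.one_fin_two]; apply matrix_fin_two_congr <;> ring⟩
  let C : GL (Fin 2) k := ⟨!![c.1, 0; 0, (c⁻¹).1], !![(c⁻¹).1, 0; 0, c.1],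
    by rw [Matrix.mul_fin_two, Matrix.one_fin_two]; apply matrix_fin_two_congr <;> simp,
    by rw [Matrix.mul_fin_two, Matrix.one_fin_two]; apply matrix_fin_two_congr <;> simp⟩
  have hneg : (GeneralLinearGroup.scalar (Fin 2) (-1 : kˣ)).1 = !![-1, 0; 0, -1] := by
    rw [scalar_val, Matrix.one_fin_two]
    simp
  have hA : A ^ 2 = GeneralLinearGroup.scalar (Fin 2) (-1) := by
    refine Units.ext ?_
    rw [hneg, pow_two, Units.val_mul]
    change !![a, 1; -1 - a ^ 2, -a] * !![a, 1; -1 - a ^ 2, -a] = _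
    rw [Matrix.mul_fin_two]
    apply matrix_fin_two_congr <;> ring
  have hB1 : (A * C⁻¹).1 = !![a * (c⁻¹).1, c.1; (-1 - a ^ 2) * (c⁻¹).1, -a * c.1] := by
    change !![a, 1; -1 - a ^ 2, -a] * !![(c⁻¹).1, 0; 0, c.1] = _
    rw [Matrix.mul_fin_two]
    apply matrix_fin_two_congr <;> ring
  have hdet : (A * C⁻¹).1.det = 1 := by
    rw [hB1, Matrix.det_fin_two_of]
    linear_combination hcc
  have htr : (A * C⁻¹).1.trace = 1 := by
    rw [hB1, Matrix.trace_fin_two_of]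
    linear_combination ha
  have hB2 : (A * C⁻¹).1 * (A * C⁻¹).1 = (A * C⁻¹).1 - 1 := by
    have h1 : (A * C⁻¹).1 - 1 =
        !![a * (c⁻¹).1 - 1, c.1 - 0; (-1 - a ^ 2) * (c⁻¹).1 - 0, -a * c.1 - 1] := by
      rw [hB1, Matrix.one_fin_two]
      exact Matrix.eta_fin_two _
    rw [h1, hB1, Matrix.mul_fin_two]
    apply matrix_fin_two_congr
    · linear_combination a * (c⁻¹).1 * ha - hcc
    · linear_combination c.1 * ha
    · linear_combination (-1 - a ^ 2) * (c⁻¹).1 * ha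
    · linear_combination -a * c.1 * ha - hcc
  have hB : (A * C⁻¹) ^ 3 = GeneralLinearGroup.scalar (Fin 2) (-1) := by
    refine Units.ext ?_
    rw [scalar_val, Units.val_pow_eq_pow_val, pow_succ, pow_two, hB2, sub_mul, hB2]
    simp
  have hC : C ^ 5 = GeneralLinearGroup.scalar (Fin 2) (-1) := by
    have hCp : ∀ n : ℕ, (C ^ n).1 = !![(c ^ n).1, 0; 0, ((c⁻¹) ^ n).1] := fun n => by
      induction n with
      | zero => simp [Matrix.one_fin_two]
      | succ n ih =>
        rw [pow_succ, Units.val_mul, ih]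
        change _ * !![c.1, 0; 0, (c⁻¹).1] = _
        rw [Matrix.mul_fin_two]
        simp [pow_succ]
    refine Units.ext ?_
    rw [hneg, hCp, inv_pow, hc]
    simp
  have hABC : A * (A * C⁻¹) * C = GeneralLinearGroup.scalar (Fin 2) (-1) := by
    rw [← hA, pow_two, ← mul_assoc, inv_mul_cancel_right]
  let ρ : BinIcos →* GL (Fin 2) k := BinIcos.lift A (A * C⁻¹) C (hA.trans hABC.symm)
    (hB.trans hABC.symm) (hC.trans hABC.symm)
  refine ⟨ρ, (BinIcos.lift_z).trans hABC, ?_, ?_, ?_, ?_⟩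
  · rw [show ρ BinIcos.x5 = C from BinIcos.lift_x5]
  · rw [show ρ BinIcos.x2 = A from BinIcos.lift_x2]
    change a * 1 ≠ 0
    rintro h
    rw [← mul_one a, h, zero_mul] at ha
    exact zero_ne_one ha
  · rw [show ρ BinIcos.x3 = A * C⁻¹ from BinIcos.lift_x3, hdet]
  · rw [show ρ BinIcos.x3 = A * C⁻¹ from BinIcos.lift_x3, htr]

/-- The symmetric powers of a two-dimensional representation, realized on binary forms. -/
theorem exists_symPow [Infinite k] {ρ : BinIcos →* GL (Fin 2) k}
    (hz : ρ BinIcos.z = GeneralLinearGroup.scalar (Fin 2) (-1)) (n : ℕ) :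
    ∃ (ρ' : BinIcos →* GL (Fin (n + 1)) k) (e : (Fin (n + 1) → k) →ₗ[k] ((Fin 2 → k) → k)),
      ρ' BinIcos.z = GeneralLinearGroup.scalar (Fin (n + 1)) ((-1) ^ n) ∧
      Function.Injective e ∧ e.range = binaryForms k n ∧
      ∀ g v, e ((ρ' g).1 *ᵥ v) = funRep ρ g (e v) := by
  obtain ⟨ρ', e, he, hr, h⟩ := exists_matRep_of_invariant (funRep ρ)
    (funRep_mem_binaryForms ρ n) (finrank_binaryForms n)
  refine ⟨ρ', e, ?_, he, hr, h⟩
  refine Units.ext (Matrix.toLin'.injective (LinearMap.ext fun v => he ?_))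
  rw [Matrix.toLin'_apply, Matrix.toLin'_apply, h, scalar_val, smul_mulVec, one_mulVec, map_smul]
  obtain ⟨a, ha⟩ : e v ∈ binaryForms k n := hr ▸ LinearMap.mem_range_self e v
  funext w
  rw [funRep_apply, hz, scalar_val, vecMul_smul, vecMul_one, ← ha, Pi.smul_apply, formMap_apply,
    formMap_apply, smul_eq_mul, Finset.mul_sum]
  refine Finset.sum_congr rfl fun i _ => ?_
  have h1 : (-1 : k) ^ i.1 * (-1) ^ (n - i.1) = (-1) ^ n := by
    rw [← pow_add, Nat.add_sub_cancel' (by omega)]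
  simp only [Pi.smul_apply, smul_eq_mul, Units.val_neg, Units.val_one, mul_pow,
    Units.val_pow_eq_pow_val]
  linear_combination a i * w 0 ^ i.1 * w 1 ^ (n - i.1) * h1

theorem exists_sq_pow_eq_neg_one {ζ : kˣ} (hζ : IsPrimitiveRoot ζ 5) :
    ∃ c : kˣ, c ^ 5 = -1 ∧ c ^ 2 = ζ ^ 2 ∧ c ^ 2 ≠ 1 := by
  have h2 : (-ζ) ^ 2 = ζ ^ 2 := by rw [neg_sq]
  refine ⟨-ζ, by rw [Odd.neg_pow (by decide), hζ.pow_eq_one], h2, ?_⟩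
  rw [h2]
  exact hζ.pow_ne_one_of_pos_of_lt (by norm_num) (by norm_num)

/-- The permutation representation of `𝒜₅` on five points. -/
def permRep (k : Type*) [Field k] : Representation k BinIcos (Fin 5 → k) where
  toFun g :=
    { toFun := fun f i => f ((A5.toPerm (BinIcos.toA5 g))⁻¹ i)
      map_add' := fun _ _ => rfl
      map_smul' := fun _ _ => rfl }
  map_one' := by
    refine LinearMap.ext fun f => funext fun i => ?_
    simp
  map_mul' g h := by
    refine LinearMap.ext fun f => funext fun i => ?_
    simp

theorem permRep_apply (g : BinIcos) (f : Fin 5 → k) (i : Fin 5) :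
    permRep k g f i = f ((A5.toPerm (BinIcos.toA5 g))⁻¹ i) := rfl

variable [IsAlgClosed k]

/-- The irreducible representations with `z = -1` are symmetric powers of a two-dimensional one. -/
theorem exists_isIrreducible_neg (h2 : (2 : k) ≠ 0) (h3 : (3 : k) ≠ 0) (h5 : (5 : k) ≠ 0) {m : ℕ}
    (hm : m = 2 ∨ m = 4 ∨ m = 6) : ∃ ρ : BinIcos →* GL (Fin m) k, (matRep ρ).IsIrreducible ∧
      ρ BinIcos.z = GeneralLinearGroup.scalar (Fin m) (-1) := by
  have : Infinite k := IsAlgClosed.instInfinite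
  obtain ⟨ζ₅, hζ₅⟩ := exists_units_isPrimitiveRoot (k := k) (n := 5) (by exact_mod_cast h5)
  obtain ⟨c, hc, -, hc2⟩ := exists_sq_pow_eq_neg_one hζ₅
  obtain ⟨ρ, hz, hx5, -, hdet, htr⟩ := exists_rep_two hc hc2
  -- powers of a linear form which is an eigenvector are eigenvectors
  have key : ∀ (x : BinIcos) (b : k) (u : Fin 2 → k), u ≠ 0 → (ρ x).1 *ᵥ u = b • u → ∀ n : ℕ,
      Odd n → ∃ ρ' : BinIcos →* GL (Fin (n + 1)) k,
        ρ' BinIcos.z = GeneralLinearGroup.scalar (Fin (n + 1)) (-1) ∧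
        ∃ v, v ≠ 0 ∧ (ρ' x).1 *ᵥ v = b ^ n • v := fun x b u hu hb n hn => by
    obtain ⟨ρ', e, hz', he, hr, h⟩ := exists_symPow hz n
    obtain ⟨v, hv⟩ : (fun w : Fin 2 → k => (w ⬝ᵥ u) ^ n) ∈ e.range := by
      rw [hr]
      have := linear_pow_mem_binaryForms (u 0) (u 1) n
      simpa only [dotProduct, Fin.sum_univ_two] using this
    refine ⟨ρ', by rw [hz', hn.neg_one_pow], v, ?_, he ?_⟩
    · rintro rfl
      rw [map_zero] at hv
      refine hu (funext fun i => ?_)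
      have h1 := congrFun hv (Pi.single i 1)
      rw [Pi.zero_apply, single_one_dotProduct] at h1
      exact eq_zero_of_pow_eq_zero h1.symm
    · rw [h, map_smul, hv]
      funext w
      rw [funRep_apply, Pi.smul_apply, smul_eq_mul, ← dotProduct_mulVec, hb, dotProduct_smul,
        smul_eq_mul, mul_pow]
  rcases hm with rfl | rfl | rfl
  · exact ⟨ρ, isIrreducible_of_neg_two h2 h3 h5 hz, hz⟩
  · obtain ⟨b, hb⟩ : ∃ b : k, b ^ 2 - b + 1 = 0 := by
      obtain ⟨s, hs⟩ := IsAlgClosed.exists_pow_nat_eq (-3 : k) (n := 2) two_pos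
      refine ⟨(1 + s) / 2, ?_⟩
      field_simp
      linear_combination hs
    have hdet0 : ((ρ BinIcos.x3).1 - b • 1).det = 0 := by
      rw [Matrix.det_fin_two] at hdet ⊢
      rw [Matrix.trace_fin_two] at htr
      simp only [Matrix.sub_apply, Matrix.smul_apply, smul_eq_mul, Matrix.one_apply_eq, ne_eq,
        zero_ne_one, one_ne_zero, not_false_eq_true, Matrix.one_apply_ne, mul_one, mul_zero,
        sub_zero]
      linear_combination hdet - b * htr + hb
    obtain ⟨u, hu, hu'⟩ := Matrix.exists_mulVec_eq_zero_iff.2 hdet0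
    rw [sub_mulVec, smul_mulVec, one_mulVec, sub_eq_zero] at hu'
    obtain ⟨ρ', hz', v, hv, hx⟩ := key _ b u hu hu' 3 (by decide)
    rw [show b ^ 3 = -1 by linear_combination (b + 1) * hb] at hx
    exact ⟨ρ', isIrreducible_of_neg_four h2 h3 h5 hz' hv hx, hz'⟩
  · have hu : (ρ BinIcos.x5).1 *ᵥ ![1, 0] = c.1 • ![1, 0] := by
      rw [hx5]
      ext i
      fin_cases i <;> simp
    obtain ⟨ρ', hz', v, hv, hx⟩ := key _ c.1 ![1, 0] (fun h => one_ne_zero (congrFun h 0)) hu 5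
      (by decide)
    rw [← Units.val_pow_eq_pow_val, hc, Units.val_neg, Units.val_one] at hx
    exact ⟨ρ', isIrreducible_of_neg_six h2 h3 h5 hz' hv hx, hz'⟩

/-- The symmetric square and the symmetric fourth power of a two-dimensional representation have no
invariants: the forms of degree `2 l` invariant under `x₅` are the multiples of `(x y)ˡ`, which
vanishes at `(1, 0)`, whereas its image under `x₂` does not. -/
theorem exists_isIrreducible_symPow (h2 : (2 : k) ≠ 0) (h3 : (3 : k) ≠ 0) (h5 : (5 : k) ≠ 0) {l : ℕ}
    (hl0 : 0 < l) (hl : l ≤ 2) :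
    ∃ ρ : BinIcos →* GL (Fin (2 * l + 1)) k, (matRep ρ).IsIrreducible ∧
      ρ BinIcos.z = GeneralLinearGroup.scalar (Fin (2 * l + 1)) 1 := by
  have : Infinite k := IsAlgClosed.instInfinite
  obtain ⟨ζ₅, hζ₅⟩ := exists_units_isPrimitiveRoot (k := k) (n := 5) (by exact_mod_cast h5)
  obtain ⟨c, hc, hcζ, hc2⟩ := exists_sq_pow_eq_neg_one hζ₅
  obtain ⟨ρ, hz, hx5, ha, -⟩ := exists_rep_two hc hc2
  obtain ⟨ρ', e, hz', he, hr, h⟩ := exists_symPow hz (2 * l)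
  rw [pow_mul, neg_one_sq, one_pow] at hz'
  refine ⟨ρ', isIrreducible_of_no_invariants h2 h3 h5 (by omega) (by omega) hz' fun v hv => ?_, hz'⟩
  obtain ⟨a, hav⟩ : e v ∈ binaryForms k (2 * l) := hr ▸ LinearMap.mem_range_self e v
  have hinv : ∀ g w, formMap k (2 * l) a (w ᵥ* (ρ g).1) = formMap k (2 * l) a w := fun g w => by
    rw [hav, ← funRep_apply ρ g (e v) w, ← h, hv]
  have hsupp : ∀ i : Fin (2 * l + 1), i.1 ≠ l → a i = 0 := by
    have h1 : formMap k (2 * l) (fun i => a i * (c.1 ^ i.1 * (c⁻¹).1 ^ (2 * l - i.1))) =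
        formMap k (2 * l) a := by
      funext w
      rw [← hinv BinIcos.x5 w, hx5, formMap_apply, formMap_apply]
      refine Finset.sum_congr rfl fun i _ => ?_
      simp [vecMul, dotProduct, Fin.sum_univ_two, mul_pow]
      ring
    intro i hi
    have h2 : a i * _ = a i := congrFun (formMap_injective _ h1) i
    by_contra h0
    have h3 : c ^ i.1 * (c⁻¹) ^ (2 * l - i.1) = 1 := Units.ext (by
      simpa using mul_left_cancel₀ h0 (h2.trans (mul_one _).symm))
    rw [inv_pow, mul_inv_eq_one] at h3
    have h4 : (ζ₅ ^ 2) ^ i.1 = (ζ₅ ^ 2) ^ l := by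
      rw [← hcζ, ← pow_mul, ← pow_mul, two_mul i.1, pow_add]
      nth_rw 2 [h3]
      rw [← pow_add, Nat.add_sub_cancel' (by omega)]
    exact hi ((hζ₅.pow_of_coprime 2 (by decide)).pow_inj (by omega) (by omega) h4)
  have hl1 : a ⟨l, by omega⟩ = 0 := by
    have hval : ∀ w, formMap k (2 * l) a w = a ⟨l, by omega⟩ * (w 0 * w 1) ^ l := fun w => by
      rw [formMap_apply, Finset.sum_eq_single ⟨l, by omega⟩ (fun j _ hj => by
        rw [hsupp j fun h => hj (Fin.ext h), zero_mul]) (by simp), mul_pow,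
        show 2 * l - l = l by omega]
    have h1 := hinv BinIcos.x2 ![1, 0]
    rw [hval, hval] at h1
    have h2 : ![(1 : k), 0] ᵥ* (ρ BinIcos.x2).1 = (ρ BinIcos.x2).1 0 := by
      funext i
      simp [vecMul, dotProduct, Fin.sum_univ_two]
    rw [h2, show (![1, 0] : Fin 2 → k) 1 = 0 from rfl, mul_zero, zero_pow hl0.ne', mul_zero] at h1
    exact (mul_eq_zero.1 h1).resolve_right (pow_ne_zero l ha)
  have ha0 : a = 0 := funext fun i => by
    by_cases hi : i.1 = l
    · rw [show i = ⟨l, by omega⟩ from Fin.ext hi, hl1, Pi.zero_apply]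
    · exact hsupp i hi
  refine he ?_
  rw [← hav, ha0, map_zero, map_zero]

/-- The permutation representation on the vectors with coordinate sum `0` has no invariants, since
the five points form one orbit under `x₅` and `5 ≠ 0`. -/
theorem exists_isIrreducible_perm (h2 : (2 : k) ≠ 0) (h3 : (3 : k) ≠ 0) (h5 : (5 : k) ≠ 0) :
    ∃ ρ : BinIcos →* GL (Fin 4) k, (matRep ρ).IsIrreducible ∧
      ρ BinIcos.z = GeneralLinearGroup.scalar (Fin 4) 1 := by
  let s : (Fin 5 → k) →ₗ[k] k := ∑ i, LinearMap.proj i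
  have hs : ∀ f, s f = ∑ i, f i := fun f => by simp [s]
  have hs0 : s ≠ 0 := fun h => one_ne_zero (α := k) (by
    have h1 := hs (Pi.single 0 1)
    rw [h, Finset.sum_pi_single' ] at h1
    simpa using h1.symm)
  have hW : ∀ g, ∀ f ∈ s.ker, permRep k g f ∈ s.ker := fun g f hf => by
    rw [LinearMap.mem_ker, hs] at hf ⊢
    rw [← hf]
    exact Equiv.sum_comp (A5.toPerm (BinIcos.toA5 g))⁻¹ f
  have hfin : Module.finrank k s.ker = 4 := by
    have := Module.Dual.finrank_ker_add_one_of_ne_zero (f := s) hs0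
    rw [Module.finrank_fin_fun] at this
    omega
  obtain ⟨ρ, e, he, hr, h⟩ := exists_matRep_of_invariant (permRep k) hW hfin
  have hz : ρ BinIcos.z = GeneralLinearGroup.scalar (Fin 4) 1 := by
    rw [map_one]
    refine Units.ext (Matrix.toLin'.injective (LinearMap.ext fun v => he ?_))
    rw [Matrix.toLin'_apply, Matrix.toLin'_apply, h, Units.val_one, one_mulVec]
    funext i
    rw [permRep_apply, BinIcos.toA5_z, map_one, inv_one, Equiv.Perm.one_apply]
  refine ⟨ρ, isIrreducible_of_no_invariants h2 h3 h5 (by norm_num) (by norm_num) hz fun v hv => ?_,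
    hz⟩
  set f := e v with hf
  have hshift : ∀ i, f (i + 1) = f i := fun i => by
    have h1 : permRep k BinIcos.x5 f = f := by rw [hf, ← h, hv]
    have h2 := congrFun h1 (i + 1)
    rw [permRep_apply, BinIcos.toA5_x5, A5.toPerm_x5] at h2
    simpa using h2.symm
  have hconst : ∀ i, f i = f 0 := fun i => by
    have h1 := hshift 0
    have h2 := hshift 1
    have h3 := hshift 2
    have h4 := hshift 3
    fin_cases i
    · rfl
    · exact h1
    · exact h2.trans h1
    · exact h3.trans (h2.trans h1)
    · exact h4.trans (h3.trans (h2.trans h1))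
  have hsum : s f = 0 := by
    have : f ∈ s.ker := hr ▸ LinearMap.mem_range_self e v
    exact this
  rw [hs, Finset.sum_congr rfl fun i _ => hconst i, Finset.sum_const, Finset.card_univ,
    Fintype.card_fin, nsmul_eq_mul] at hsum
  have h0 : f 0 = 0 := (mul_eq_zero.1 hsum).resolve_left (by exact_mod_cast h5)
  refine he ?_
  rw [map_zero, ← hf]
  exact funext fun i => (hconst i).trans h0

theorem exists_isIrreducible_one (h2 : (2 : k) ≠ 0) (h3 : (3 : k) ≠ 0) (h5 : (5 : k) ≠ 0) {m : ℕ}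
    (hm : m = 3 ∨ m = 4 ∨ m = 5) : ∃ ρ : BinIcos →* GL (Fin m) k, (matRep ρ).IsIrreducible ∧
      ρ BinIcos.z = GeneralLinearGroup.scalar (Fin m) 1 := by
  rcases hm with rfl | rfl | rfl
  · exact exists_isIrreducible_symPow h2 h3 h5 (l := 1) (by norm_num) (by norm_num)
  · exact exists_isIrreducible_perm h2 h3 h5
  · exact exists_isIrreducible_symPow h2 h3 h5 (l := 2) (by norm_num) (by norm_num)

end Existence

/-! ### Classification of the regular homomorphisms -/

section Classification

open Matrix

variable {m : ℕ} {k : Type*} [Field k]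

theorem isConj_rootDiag_of_mul_eq {N : ℕ} {ζ σ : kˣ} {a P : GL (Fin m) k} {e : Fin m → Fin N}
    (h : a.1 * P.1 = P.1 * diagonal (fun i => (σ * ζ ^ (e i).1).1)) :
    IsConj (rootDiag ζ e) (ProjGenLinGroup.mk a : PGL(m, k)) := by
  refine isConj_iff.2 ⟨ProjGenLinGroup.mk P, ?_⟩
  rw [mul_inv_eq_iff_eq_mul, rootDiag, ← map_mul, ← map_mul, pgl_mk_eq_mk]
  refine ⟨σ, ?_⟩
  rw [Units.val_mul, Units.val_mul, h, diagGL_val, ← mul_smul_comm, ← diagonal_smul]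
  rfl

theorem expMult_add_self (e : Fin m → Fin 5) (i : Fin 5) :
    expMult (fun j => e j + e j) i = expMult e (3 * i) := by
  have h : ∀ a i : Fin 5, a + a = i ↔ a = 3 * i := by decide
  simp only [expMult, h]

/-- If `m = 2` or `m = 3`, the image of `x₅` in `PGL_m` is not conjugate to its square. -/
theorem not_isConj_sq_of_hasExponents (hm : m = 2 ∨ m = 3) {ζ σ : kˣ} (hζ : IsPrimitiveRoot ζ 5)
    {a : GL (Fin m) k} {μ : Fin 5 → ℕ} (hμ : μ ∈ multFive m) (ha : HasExponents a σ ζ μ) :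
    ¬ IsConj (ProjGenLinGroup.mk a : PGL(m, k)) (ProjGenLinGroup.mk a ^ 2) := fun hc => by
  obtain ⟨P, e, hP, he⟩ := ha
  have h1 : IsConj (rootDiag ζ e) (ProjGenLinGroup.mk a : PGL(m, k)) := isConj_rootDiag_of_mul_eq hP
  have h2 := (h1.trans hc).trans (h1.pow 2).symm
  rw [rootDiag_sq hζ.pow_eq_one] at h2
  obtain ⟨s, hs⟩ := exists_shift_of_isConj hζ (by omega) h2
  simp only [expMult_add_self, he] at hs
  have key : ∀ μ ∈ multFive m, ¬ ∃ s : Fin 5, ∀ i, μ i = μ (3 * (i + s)) := by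
    rcases hm with rfl | rfl <;> decide
  exact key μ hμ ⟨s, hs⟩

theorem IsRegularHom.comp_iota {Γ G : Type*} [Group Γ] [Group G] {ψ : Γ →* G}
    (h : IsRegularHom ψ) (ι : MulAut Γ) : IsRegularHom (ψ.comp ι.toMonoidHom) := by
  have hr : (ψ.comp ι.toMonoidHom).range = ψ.range := by
    rw [MonoidHom.range_comp, MonoidHom.range_eq_top.2 ι.surjective, MonoidHom.range_eq_map]
  rw [IsRegularHom, hr]
  exact h

/-- The linear lift `ρ` of the regular homomorphism `ψ`, with `z` acting as `ε = ±1`, and the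
multiplicities `μ` of the eigenvalues of `x₅`. -/
structure RegularLift (ζ : kˣ) (ψ : A5 →* PGL(m, k)) (ε : kˣ) (μ : Fin 5 → ℕ)
    (ρ : BinIcos →* GL (Fin m) k) : Prop where
  isLift : IsLift ψ ρ
  isIrreducible : (matRep ρ).IsIrreducible
  z_eq : ρ BinIcos.z = GeneralLinearGroup.scalar (Fin m) ε
  mem : μ ∈ multFive m
  hasExponents : HasExponents (ρ BinIcos.x5) ε ζ μ

/-- The central element acts with the same sign on the lifts of conjugate homomorphisms. -/
theorem sign_eq_of_homConj (hm : 0 < m) {ψ ψ' : A5 →* PGL(m, k)} {ε ε' : kˣ}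
    {ρ ρ' : BinIcos →* GL (Fin m) k} (h : IsLift ψ ρ) (h' : IsLift ψ' ρ')
    (hz : ρ BinIcos.z = GeneralLinearGroup.scalar (Fin m) ε)
    (hz' : ρ' BinIcos.z = GeneralLinearGroup.scalar (Fin m) ε') (hc : HomConj ψ ψ') : ε' = ε := by
  obtain ⟨P, hP⟩ := (homConj_iff_of_isLift hm h h').1 hc
  have h1 := hP BinIcos.z
  rw [hz, hz', ← (commute_scalar ε P).eq, mul_inv_cancel_right] at h1
  exact scalar_injective hm h1

theorem natCast_ne_zero_of_charP (p : ℕ) [CharP k p] (hp : p = 0 ∨ 7 ≤ p) {n : ℕ} (hn0 : 0 < n)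
    (hn : n < 7) : (n : k) ≠ 0 := fun h => by
  rcases hp with rfl | hp
  · exact hn0.ne' (zero_dvd_iff.1 ((CharP.cast_eq_zero_iff k 0 n).1 h))
  · have := Nat.le_of_dvd hn0 ((CharP.cast_eq_zero_iff k p n).1 h)
    omega

variable [IsAlgClosed k] {ζ₅ : kˣ}

theorem exists_sq_eq_of_sign (ε : kˣ) : ∃ σ : kˣ, σ ^ 2 = ε ∧ (ε = 1 → σ = 1) := by
  by_cases h : ε = 1
  · exact ⟨1, by rw [h, one_pow], fun _ => rfl⟩
  · obtain ⟨σ, hσ⟩ := exists_units_pow_eq ε (n := 2) (by norm_num)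
    exact ⟨σ, hσ, fun h' => absurd h' h⟩

theorem exists_lift_of_isRegularHom (h2 : (2 : k) ≠ 0) (h3 : (3 : k) ≠ 0) (h5 : (5 : k) ≠ 0)
    (hm : 0 < m) {ψ : A5 →* PGL(m, k)} (hψ : IsRegularHom ψ) :
    ∃ ρ ε, (ε = 1 ∨ ε = -1) ∧ IsLift ψ ρ ∧ (matRep ρ).IsIrreducible ∧
      ρ BinIcos.z = GeneralLinearGroup.scalar (Fin m) ε := by
  obtain ⟨ρ, hρ⟩ := exists_isLift ψ
  have hirr := (isRegularHom_iff (BinIcos.card_ne_zero h2 h3 h5) hm hρ).1 hψ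
  rcases hρ.z_eq hm with hz | hz
  · exact ⟨ρ, 1, Or.inl rfl, hρ, hirr, by rw [hz, map_one]⟩
  · refine ⟨ρ, -1, Or.inr rfl, hρ, hirr, hz.trans (Units.ext ?_)⟩
    rw [scalar_val]
    simp

/-- Scott's inequality leaves no room for regular homomorphisms if `m ≥ 7`. -/
theorem not_isRegularHom_of_seven_le (h2 : (2 : k) ≠ 0) (h3 : (3 : k) ≠ 0) (h5 : (5 : k) ≠ 0)
    (hm : 7 ≤ m) (ψ : A5 →* PGL(m, k)) : ¬ IsRegularHom ψ := fun hψ => by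
  obtain ⟨ρ, ε, hε, -, hirr, hz⟩ := exists_lift_of_isRegularHom h2 h3 h5 (by omega) hψ
  obtain ⟨ζ₃, hζ₃⟩ := exists_units_isPrimitiveRoot (k := k) (n := 3) (by exact_mod_cast h3)
  obtain ⟨ζ₅, hζ₅⟩ := exists_units_isPrimitiveRoot (k := k) (n := 5) (by exact_mod_cast h5)
  obtain ⟨σ, hσ, -⟩ := exists_sq_eq_of_sign ε
  have := dim_lt_seven h2 h3 h5 hζ₃ hζ₅ hε hσ hirr hz
  omega

theorem exists_regularLift (h2 : (2 : k) ≠ 0) (h3 : (3 : k) ≠ 0) (h5 : (5 : k) ≠ 0)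
    (hζ₅ : IsPrimitiveRoot ζ₅ 5) (hm : m = 2 ∨ m = 3 ∨ m = 4 ∨ m = 5 ∨ m = 6)
    {ψ : A5 →* PGL(m, k)} (hψ : IsRegularHom ψ) :
    ∃ ε μ ρ, (ε = 1 ∧ m ≠ 2 ∧ m ≠ 6 ∨ ε = -1 ∧ m ≠ 3 ∧ m ≠ 5) ∧ RegularLift ζ₅ ψ ε μ ρ := by
  obtain ⟨ρ, ε, hε, hρ, hirr, hz⟩ := exists_lift_of_isRegularHom h2 h3 h5 (by omega) hψ
  obtain ⟨ζ₃, hζ₃⟩ := exists_units_isPrimitiveRoot (k := k) (n := 3) (by exact_mod_cast h3)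
  obtain ⟨σ, hσ, hσ1⟩ := exists_sq_eq_of_sign ε
  obtain ⟨hp, hn, -, -, μ, hμ, he⟩ :=
    hasExponents_of_isIrreducible h2 h3 h5 hζ₃ hζ₅ hε hσ hσ1 hm hirr hz
  exact ⟨ε, μ, ρ, hε.imp (fun h => ⟨h, hp h⟩) fun h => ⟨h, hn h⟩, hρ, hirr, hz, hμ, he⟩

theorem RegularLift.homConj (h2 : (2 : k) ≠ 0) (h3 : (3 : k) ≠ 0) (h5 : (5 : k) ≠ 0)
    (hζ₅ : IsPrimitiveRoot ζ₅ 5) (hm : m = 2 ∨ m = 3 ∨ m = 4 ∨ m = 5 ∨ m = 6)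
    {ψ ψ' : A5 →* PGL(m, k)} {ε : kˣ} (hε : ε = 1 ∨ ε = -1) {μ : Fin 5 → ℕ}
    {ρ ρ' : BinIcos →* GL (Fin m) k} (h : RegularLift ζ₅ ψ ε μ ρ) (h' : RegularLift ζ₅ ψ' ε μ ρ') :
    HomConj ψ ψ' := by
  obtain ⟨ζ₃, hζ₃⟩ := exists_units_isPrimitiveRoot (k := k) (n := 3) (by exact_mod_cast h3)
  obtain ⟨σ, hσ, hσ1⟩ := exists_sq_eq_of_sign ε
  exact (homConj_iff_of_isLift (by omega) h.isLift h'.isLift).2 (exists_conj_of_hasExponents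
    h2 h3 h5 hζ₃ hζ₅ hε hσ hσ1 hm h.isIrreducible h.z_eq h'.isIrreducible h'.z_eq h.mem
    h.hasExponents h'.hasExponents)

theorem exists_isRegularHom (h2 : (2 : k) ≠ 0) (h3 : (3 : k) ≠ 0) (h5 : (5 : k) ≠ 0) {ε : kˣ}
    (hm : ε = 1 ∧ (m = 3 ∨ m = 4 ∨ m = 5) ∨ ε = -1 ∧ (m = 2 ∨ m = 4 ∨ m = 6)) :
    ∃ (ψ : A5 →* PGL(m, k)) (ρ : BinIcos →* GL (Fin m) k), IsRegularHom ψ ∧ IsLift ψ ρ ∧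
      (matRep ρ).IsIrreducible ∧ ρ BinIcos.z = GeneralLinearGroup.scalar (Fin m) ε := by
  obtain ⟨ρ, hirr, hz⟩ : ∃ ρ : BinIcos →* GL (Fin m) k, (matRep ρ).IsIrreducible ∧
      ρ BinIcos.z = GeneralLinearGroup.scalar (Fin m) ε := by
    rcases hm with ⟨rfl, hm⟩ | ⟨rfl, hm⟩
    · exact exists_isIrreducible_one h2 h3 h5 hm
    · exact exists_isIrreducible_neg h2 h3 h5 hm
  obtain ⟨ψ, hψ⟩ := exists_isLift_of_scalar (ρ := ρ) (by
    rw [hz, ProjGenLinGroup.mk_eq_one, GeneralLinearGroup.center_eq_range_scalar]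
    exact ⟨ε, rfl⟩)
  exact ⟨ψ, ρ, (isRegularHom_iff (BinIcos.card_ne_zero h2 h3 h5) (by omega) hψ).2 hirr, hψ, hirr, hz⟩

theorem not_homConj_comp_iota (h2 : (2 : k) ≠ 0) (h3 : (3 : k) ≠ 0) (h5 : (5 : k) ≠ 0)
    (hm : m = 2 ∨ m = 3) {ι : MulAut A5} (hι : A5.IsIota ι) {ψ : A5 →* PGL(m, k)}
    (hψ : IsRegularHom ψ) : ¬ HomConj ψ (ψ.comp ι.toMonoidHom) := by
  rintro ⟨g, hg⟩
  obtain ⟨ζ₅, hζ₅⟩ := exists_units_isPrimitiveRoot (k := k) (n := 5) (by exact_mod_cast h5)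
  obtain ⟨ε, μ, ρ, -, hL⟩ := exists_regularLift h2 h3 h5 hζ₅ (by omega) hψ
  refine not_isConj_sq_of_hasExponents hm hζ₅ hL.mem hL.hasExponents ?_
  rw [hL.isLift, BinIcos.toA5_x5]
  have h1 : IsConj (ψ A5.x5) (ψ (ι A5.x5)) := isConj_iff.2 ⟨g, (hg A5.x5).symm⟩
  have h2 := ψ.map_isConj hι.2.2.2
  rw [map_pow] at h2
  exact h1.trans h2

section Counting

variable {Γ G : Type*} [Group Γ] [Group G]

theorem ncard_regularHomClasses_eq_one {ψ : Γ →* G} (h : IsRegularHom ψ)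
    (hall : ∀ φ : Γ →* G, IsRegularHom φ → HomConj ψ φ) : (regularHomClasses Γ G).ncard = 1 := by
  refine Set.ncard_eq_one.2 ⟨Quotient.mk (homConjSetoid Γ G) ψ, Set.eq_singleton_iff_unique_mem.2
    ⟨⟨ψ, h, rfl⟩, ?_⟩⟩
  rintro _ ⟨φ, hφ, rfl⟩
  exact (Quotient.sound (hall φ hφ)).symm

theorem ncard_regularHomClasses_eq_two {ψ ψ' : Γ →* G} (h : IsRegularHom ψ) (h' : IsRegularHom ψ')
    (hne : ¬ HomConj ψ ψ') (hall : ∀ φ : Γ →* G, IsRegularHom φ → HomConj ψ φ ∨ HomConj ψ' φ) :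
    (regularHomClasses Γ G).ncard = 2 := by
  refine Set.ncard_eq_two.2 ⟨Quotient.mk (homConjSetoid Γ G) ψ, Quotient.mk (homConjSetoid Γ G) ψ',
    fun e => hne (Quotient.exact e), Set.ext fun c => ⟨?_, ?_⟩⟩
  · rintro ⟨φ, hφ, rfl⟩
    exact (hall φ hφ).imp (fun e => (Quotient.sound e).symm) fun e => (Quotient.sound e).symm
  · rintro (rfl | rfl)
    · exact ⟨ψ, h, rfl⟩
    · exact ⟨ψ', h', rfl⟩

end Counting

/-- For `m = 2, 3` the two possible multiplicities of the eigenvalues of `x₅` are interchanged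
by `ι`. -/
theorem ncard_regularHomClasses_two_three (h2 : (2 : k) ≠ 0) (h3 : (3 : k) ≠ 0) (h5 : (5 : k) ≠ 0)
    (hm : m = 2 ∨ m = 3) : (regularHomClasses A5 (PGL(m, k))).ncard = 2 := by
  obtain ⟨ζ₅, hζ₅⟩ := exists_units_isPrimitiveRoot (k := k) (n := 5) (by exact_mod_cast h5)
  obtain ⟨ι, hι⟩ := A5.exists_isIota
  have hm' : m = 2 ∨ m = 3 ∨ m = 4 ∨ m = 5 ∨ m = 6 := by omega
  obtain ⟨ε, hε, hεm, huniq⟩ : ∃ ε : kˣ, (ε = 1 ∨ ε = -1) ∧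
      (ε = 1 ∧ (m = 3 ∨ m = 4 ∨ m = 5) ∨ ε = -1 ∧ (m = 2 ∨ m = 4 ∨ m = 6)) ∧
      ∀ ε' : kˣ, (ε' = 1 ∧ m ≠ 2 ∧ m ≠ 6 ∨ ε' = -1 ∧ m ≠ 3 ∧ m ≠ 5) → ε' = ε := by
    rcases hm with rfl | rfl
    · exact ⟨-1, Or.inr rfl, by simp, by simp⟩
    · exact ⟨1, Or.inl rfl, by simp, by simp⟩
  obtain ⟨ψ, -, hψ, -⟩ := exists_isRegularHom h2 h3 h5 hεm
  have hψ' := hψ.comp_iota ι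
  have hne := not_homConj_comp_iota h2 h3 h5 hm hι hψ
  refine ncard_regularHomClasses_eq_two hψ hψ' hne fun φ hφ => ?_
  obtain ⟨ε₁, μ₁, ρ₁, h₁, L₁⟩ := exists_regularLift h2 h3 h5 hζ₅ hm' hψ
  obtain ⟨ε₂, μ₂, ρ₂, h₂, L₂⟩ := exists_regularLift h2 h3 h5 hζ₅ hm' hψ'
  obtain ⟨ε₃, μ₃, ρ₃, h₃, L₃⟩ := exists_regularLift h2 h3 h5 hζ₅ hm' hφ
  obtain rfl := huniq _ h₁
  obtain rfl := huniq _ h₂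
  obtain rfl := huniq _ h₃
  have key : ∀ a ∈ multFive m, ∀ b ∈ multFive m, ∀ c ∈ multFive m, a ≠ b → c = a ∨ c = b := by
    rcases hm with rfl | rfl <;> decide
  rcases key _ L₁.mem _ L₂.mem _ L₃.mem fun h => hne (by
      subst h
      exact L₁.homConj h2 h3 h5 hζ₅ hm' hε L₂) with rfl | rfl
  · exact Or.inl (L₁.homConj h2 h3 h5 hζ₅ hm' hε L₃)
  · exact Or.inr (L₂.homConj h2 h3 h5 hζ₅ hm' hε L₃)

/-- For `m ≥ 4` a regular homomorphism is determined by the sign with which `z` acts. -/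
theorem homConj_of_sign_eq (h2 : (2 : k) ≠ 0) (h3 : (3 : k) ≠ 0) (h5 : (5 : k) ≠ 0)
    (hm : m = 4 ∨ m = 5 ∨ m = 6) (hζ₅ : IsPrimitiveRoot ζ₅ 5) {ψ ψ' : A5 →* PGL(m, k)} {ε : kˣ}
    (hε : ε = 1 ∨ ε = -1) {μ μ' : Fin 5 → ℕ} {ρ ρ' : BinIcos →* GL (Fin m) k}
    (h : RegularLift ζ₅ ψ ε μ ρ) (h' : RegularLift ζ₅ ψ' ε μ' ρ') : HomConj ψ ψ' := by
  have key : ∀ a ∈ multFive m, ∀ b ∈ multFive m, a = b := by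
    rcases hm with rfl | rfl | rfl <;> decide
  obtain rfl := key _ h.mem _ h'.mem
  exact h.homConj h2 h3 h5 hζ₅ (by omega) hε h'

theorem ncard_regularHomClasses_five_six (h2 : (2 : k) ≠ 0) (h3 : (3 : k) ≠ 0) (h5 : (5 : k) ≠ 0)
    (hm : m = 5 ∨ m = 6) : (regularHomClasses A5 (PGL(m, k))).ncard = 1 := by
  obtain ⟨ζ₅, hζ₅⟩ := exists_units_isPrimitiveRoot (k := k) (n := 5) (by exact_mod_cast h5)
  have hm' : m = 2 ∨ m = 3 ∨ m = 4 ∨ m = 5 ∨ m = 6 := by omega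
  obtain ⟨ε, hε, hεm, huniq⟩ : ∃ ε : kˣ, (ε = 1 ∨ ε = -1) ∧
      (ε = 1 ∧ (m = 3 ∨ m = 4 ∨ m = 5) ∨ ε = -1 ∧ (m = 2 ∨ m = 4 ∨ m = 6)) ∧
      ∀ ε' : kˣ, (ε' = 1 ∧ m ≠ 2 ∧ m ≠ 6 ∨ ε' = -1 ∧ m ≠ 3 ∧ m ≠ 5) → ε' = ε := by
    rcases hm with rfl | rfl
    · exact ⟨1, Or.inl rfl, by simp, by simp⟩
    · exact ⟨-1, Or.inr rfl, by simp, by simp⟩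
  obtain ⟨ψ, -, hψ, -⟩ := exists_isRegularHom h2 h3 h5 hεm
  refine ncard_regularHomClasses_eq_one hψ fun φ hφ => ?_
  obtain ⟨ε₁, μ₁, ρ₁, h₁, L₁⟩ := exists_regularLift h2 h3 h5 hζ₅ hm' hψ
  obtain ⟨ε₂, μ₂, ρ₂, h₂, L₂⟩ := exists_regularLift h2 h3 h5 hζ₅ hm' hφ
  obtain rfl := huniq _ h₁
  obtain rfl := huniq _ h₂
  exact homConj_of_sign_eq h2 h3 h5 (by omega) hζ₅ hε L₁ L₂

/-- For `m = 4` both signs occur. -/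
theorem exists_regularHoms_four (h2 : (2 : k) ≠ 0) (h3 : (3 : k) ≠ 0) (h5 : (5 : k) ≠ 0) :
    ∃ ψ₁ ψ₂ : A5 →* PGL(4, k), IsRegularHom ψ₁ ∧ IsRegularHom ψ₂ ∧ ¬ HomConj ψ₁ ψ₂ ∧
      (∀ ψ : A5 →* PGL(4, k), IsRegularHom ψ → HomConj ψ₁ ψ ∨ HomConj ψ₂ ψ) ∧ ComesFromA5 ψ₁ ∧
      ∀ pr, A5.IsDoubleCover pr → ComesFromSL2 pr ψ₂ := by
  obtain ⟨ζ₅, hζ₅⟩ := exists_units_isPrimitiveRoot (k := k) (n := 5) (by exact_mod_cast h5)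
  have hne : (-1 : kˣ) ≠ 1 := (isPrimitiveRoot_neg_one_units h2).ne_one (by norm_num)
  obtain ⟨ψ₁, ρ₁, hψ₁, hl₁, hi₁, hz₁⟩ := exists_isRegularHom (m := 4) (ε := 1) h2 h3 h5 (by simp)
  obtain ⟨ψ₂, ρ₂, hψ₂, hl₂, hi₂, hz₂⟩ := exists_isRegularHom (m := 4) (ε := -1) h2 h3 h5 (by simp)
  refine ⟨ψ₁, ψ₂, hψ₁, hψ₂, fun h => hne (sign_eq_of_homConj (by norm_num) hl₁ hl₂ hz₁ hz₂ h),
    fun ψ hψ => ?_, comesFromA5_of_isLift hl₁ hi₁ (by rw [hz₁, map_one]), fun pr hpr =>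
    comesFromSL2_of_isLift hl₂ hi₂ (fun h => hne (scalar_injective (m := 4) (by norm_num)
      (hz₂.symm.trans (h.trans (map_one _).symm)))) hpr⟩
  obtain ⟨ε, μ, ρ, hε, L⟩ := exists_regularLift h2 h3 h5 hζ₅ (by norm_num) hψ
  have key : ∀ {φ : A5 →* PGL(4, k)} {τ : BinIcos →* GL (Fin 4) k}, (ε = 1 ∨ ε = -1) →
      IsRegularHom φ → IsLift φ τ → τ BinIcos.z = GeneralLinearGroup.scalar (Fin 4) ε →
      HomConj φ ψ := fun {φ τ} hε hφ hl hz => by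
    obtain ⟨ε', μ', ρ', -, L'⟩ := exists_regularLift h2 h3 h5 hζ₅ (by norm_num) hφ
    obtain rfl := hl.unique (by norm_num) L'.isLift
    obtain rfl := scalar_injective (m := 4) (by norm_num) (hz.symm.trans L'.z_eq)
    exact homConj_of_sign_eq h2 h3 h5 (by norm_num) hζ₅ hε L' L
  rcases hε with ⟨rfl, -⟩ | ⟨rfl, -⟩
  · exact Or.inl (key (Or.inl rfl) hψ₁ hl₁ hz₁)
  · exact Or.inr (key (Or.inr rfl) hψ₂ hl₂ hz₂)

theorem comesFromA5_of_isRegularHom (h2 : (2 : k) ≠ 0) (h3 : (3 : k) ≠ 0) (h5 : (5 : k) ≠ 0)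
    (hm : m = 3 ∨ m = 5) {ψ : A5 →* PGL(m, k)} (hψ : IsRegularHom ψ) : ComesFromA5 ψ := by
  obtain ⟨ζ₅, hζ₅⟩ := exists_units_isPrimitiveRoot (k := k) (n := 5) (by exact_mod_cast h5)
  obtain ⟨ε, μ, ρ, hε, L⟩ := exists_regularLift h2 h3 h5 hζ₅ (by omega) hψ
  obtain rfl : ε = 1 := hε.elim (fun h => h.1) fun h => by omega
  exact comesFromA5_of_isLift L.isLift L.isIrreducible (by rw [L.z_eq, map_one])

theorem comesFromSL2_of_isRegularHom (h2 : (2 : k) ≠ 0) (h3 : (3 : k) ≠ 0) (h5 : (5 : k) ≠ 0)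
    {pr : SL(2, ZMod 5) →* A5} (hpr : A5.IsDoubleCover pr) (hm : m = 2 ∨ m = 6)
    {ψ : A5 →* PGL(m, k)} (hψ : IsRegularHom ψ) : ComesFromSL2 pr ψ := by
  obtain ⟨ζ₅, hζ₅⟩ := exists_units_isPrimitiveRoot (k := k) (n := 5) (by exact_mod_cast h5)
  obtain ⟨ε, μ, ρ, hε, L⟩ := exists_regularLift h2 h3 h5 hζ₅ (by omega) hψ
  obtain rfl : ε = -1 := hε.elim (fun h => by omega) fun h => h.1
  have hne : (-1 : kˣ) ≠ 1 := (isPrimitiveRoot_neg_one_units h2).ne_one (by norm_num)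
  refine comesFromSL2_of_isLift L.isLift L.isIrreducible (fun h => hne ?_) hpr
  exact scalar_injective (m := m) (by omega) (L.z_eq.symm.trans (h.trans (map_one _).symm))

end Classification

theorem mainTheorem8 {k : Type*} [Field k] [IsAlgClosed k] (p : ℕ) [CharP k p]
    (hp : p = 0 ∨ 7 ≤ p) :
    -- the automorphism `ι` and the double cover exist
    (∃ ι, A5.IsIota ι) ∧ (∃ pr, A5.IsDoubleCover pr) ∧
    -- `m = 2, 3`: two regular triples and two regular homomorphisms, interchanged by `ι`
    (∀ m : ℕ, m = 2 ∨ m = 3 →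
      (regularTriples m k).ncard = 2 ∧
      (∀ C ∈ regularTriples m k, iotaTriple C ∈ regularTriples m k ∧ iotaTriple C ≠ C) ∧
      (regularHomClasses A5 (PGL(m, k))).ncard = 2 ∧
      ∀ ι, A5.IsIota ι → ∀ ψ : A5 →* PGL(m, k), IsRegularHom ψ →
        IsRegularHom (ψ.comp ι.toMonoidHom) ∧ ¬ HomConj ψ (ψ.comp ι.toMonoidHom)) ∧
    -- `m = 4`: one regular triple, two regular homomorphisms
    ((regularTriples 4 k).ncard = 1 ∧ (regularHomClasses A5 (PGL(4, k))).ncard = 2) ∧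
    -- `m = 5, 6`: one regular triple, one regular homomorphism
    (∀ m : ℕ, m = 5 ∨ m = 6 →
      (regularTriples m k).ncard = 1 ∧ (regularHomClasses A5 (PGL(m, k))).ncard = 1) ∧
    -- `m ≥ 7`: none
    (∀ m : ℕ, 7 ≤ m →
      regularTriples m k = ∅ ∧ ∀ ψ : A5 →* PGL(m, k), ¬ IsRegularHom ψ) ∧
    -- the types of the regular triples
    (∀ C ∈ regularTriples 2 k, TripleHasType C [] [] []) ∧
    (∀ C ∈ regularTriples 3 k, TripleHasType C [1] [] []) ∧
    (∀ C ∈ regularTriples 4 k, TripleHasType C [1, 1] [1] []) ∧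
    (∀ C ∈ regularTriples 5 k, TripleHasType C [2, 1] [1, 1] []) ∧
    (∀ C ∈ regularTriples 6 k, TripleHasType C [2, 2] [1, 1, 1] [1]) ∧
    -- the representations from which the regular homomorphisms come
    (∀ m : ℕ, m = 3 ∨ m = 5 → ∀ ψ : A5 →* PGL(m, k), IsRegularHom ψ → ComesFromA5 ψ) ∧
    (∀ pr, A5.IsDoubleCover pr →
      (∀ m : ℕ, m = 2 ∨ m = 6 → ∀ ψ : A5 →* PGL(m, k), IsRegularHom ψ → ComesFromSL2 pr ψ) ∧
      ∃ ψ₁ ψ₂ : A5 →* PGL(4, k), IsRegularHom ψ₁ ∧ IsRegularHom ψ₂ ∧ ¬ HomConj ψ₁ ψ₂ ∧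
        (∀ ψ : A5 →* PGL(4, k), IsRegularHom ψ → HomConj ψ₁ ψ ∨ HomConj ψ₂ ψ) ∧
        ComesFromA5 ψ₁ ∧ ComesFromSL2 pr ψ₂) := by
  have h2 : (2 : k) ≠ 0 := by
    exact_mod_cast natCast_ne_zero_of_charP p hp (n := 2) (by norm_num) (by norm_num)
  have h3 : (3 : k) ≠ 0 := by
    exact_mod_cast natCast_ne_zero_of_charP p hp (n := 3) (by norm_num) (by norm_num)
  have h5 : (5 : k) ≠ 0 := by
    exact_mod_cast natCast_ne_zero_of_charP p hp (n := 5) (by norm_num) (by norm_num)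
  obtain ⟨ψ₁, ψ₂, hψ₁, hψ₂, hne, hall, hA, hS⟩ := exists_regularHoms_four (k := k) h2 h3 h5
  obtain ⟨t2, t3, t4, t5, t6⟩ := tripleHasType_of_mem_regularTriples (k := k) h2 h3 h5
  refine ⟨A5.exists_isIota, A5.exists_isDoubleCover, fun m hm => ?_, ⟨?_, ?_⟩, fun m hm => ⟨?_, ?_⟩,
    fun m hm => ⟨?_, ?_⟩, t2, t3, t4, t5, t6, ?_, fun pr hpr => ⟨?_, ?_⟩⟩
  · obtain ⟨hcard, hι⟩ := ncard_regularTriples_eq_two (k := k) h2 h3 h5 hm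
    exact ⟨hcard, hι, ncard_regularHomClasses_two_three h2 h3 h5 hm, fun ι hι ψ hψ =>
      ⟨hψ.comp_iota ι, not_homConj_comp_iota h2 h3 h5 hm hι hψ⟩⟩
  · exact ncard_regularTriples_eq_one h2 h3 h5 (Or.inl rfl)
  · exact ncard_regularHomClasses_eq_two hψ₁ hψ₂ hne hall
  · exact ncard_regularTriples_eq_one h2 h3 h5 (Or.inr hm)
  · exact ncard_regularHomClasses_five_six h2 h3 h5 hm
  · exact regularTriples_eq_empty h2 h3 h5 hm
  · exact not_isRegularHom_of_seven_le h2 h3 h5 hm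
  · exact fun m hm ψ hψ => comesFromA5_of_isRegularHom h2 h3 h5 hm hψ
  · exact fun m hm ψ hψ => comesFromSL2_of_isRegularHom h2 h3 h5 hpr hm hψ
  · exact ⟨ψ₁, ψ₂, hψ₁, hψ₂, hne, hall, hA, hS pr hpr⟩
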